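/- **Model.** Algorithms are programs of a unit-cost word RAM: a finite program (instructions: constants, arithmetic and bitwise operations on registers, indirect load and store, comparison and branch, reading an entry of a tape of independent uniform random words of $\lfloor\log_2 n\rfloor+1$ bits, halt), independent of $n$, that starts with blank memory and is given $n$ and the numbers $k(n)$ and $T(n)$. It first does some preprocessing (for the empty graph on $n$ vertices) and then receives edge insertions and deletions one by one; the time of an update is the number of instructions executed for it. A matching is output as a mate array in memory (given by base address and stride). A program is deterministic if it never reads a random word. For a graph $G$ on $n$ vertices with maximum matching size $\mu(G)$, a matching $M$ of $G$ is $(\alpha,\delta)$-approximate if $\alpha|M|+\delta n\ge\mu(G)$, and $\alpha$-approximate if it is $(\alpha,0)$-approximate. Update sequences are legal (only missing edges are inserted, only present edges are deleted), start with the empty graph, are fixed in advance, and have length at most $n^d$ for an arbitrary constant $d$ and $n$ large enough in terms of $d$; for each $d$ all numbers that occur are at most $(n+T(n)+P(n)+2)^{c}$ for some $c=c(d)$. **Statement.** Let $k,T,P:\mathbb N\to\mathbb N$ with $k(n)=\Theta(\log n)$ and $T,P\ge 1$, let $\alpha,\delta$ be real (possibly depending on $n$) and let $p(n)\in[0,\infty]$.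 Let $Alg$ be an $(\alpha,\delta)$-approximate dynamic matching algorithm that is $k(n)$ batch-dynamic with update time $O(T(n))$ and has preprocessing time $O(P(n))$; that is, for every update sequence $I$ and every partition of $I$ into at most $k(n)$ consecutive batches $I_1,I_2,\dots$ (the algorithm being told, with each update, whether a new batch begins), with probability at least $1-p(n)$ its output is an $(\alpha,\delta)$-approximate matching of the current graph at all times, its preprocessing takes $O(P(n))$ time, and each batch $I_i$ is processed in total time $O(T(n)\cdot|I_i|)$. Then there is an algorithm $Alg'$ such that for every update sequence of length $N$, with probability at least $1-O\big((N+1)\,p(n)\log n\big)$: $Alg'$ maintains $O(\log n)$ matchings of the current graph, at all times at least one of them is $(\alpha,\delta)$-approximate, each single update takes worst-case time $O(T(n)\log^3 n)$, and the preprocessing takes time $O(P(n)\log^3 n)$. All hidden constants in the time bounds and in the number of matchings, and $Alg'$ itself, are independent of $d$. If $Alg$ is deterministic, then so is $Alg'$. (For $\delta=0$ this is the statement on $\alpha$-approximate matchings; $p=0$ is the case of guarantees that hold with certainty.) -/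

import Mathlib

open Filter Asymptotics MeasureTheory
open scoped ENNReal NNReal

namespace DynMatching

/-! ### Graphs, updates, matchings -/

/-- One edge update of a graph on `n` vertices: the insertion or the deletion of the edge `uv`. -/
structure Update (n : ℕ) where
  isInsert : Bool
  u : Fin n
  v : Fin n

/-- The graph after an update. -/
def Update.apply {n : ℕ} (e : Update n) (G : SimpleGraph (Fin n)) : SimpleGraph (Fin n) :=
  if e.isInsert then G ⊔ SimpleGraph.edge e.u e.v else G.deleteEdges {s(e.u, e.v)}

/-- The graph obtained from `G` by a sequence of updates. -/
def applyAll {n : ℕ} (G : SimpleGraph (Fin n)) (I : List (Update n)) : SimpleGraph (Fin n) :=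
  I.foldl (fun H e => e.apply H) G

/-- The graph after processing `I`, starting with the empty graph. -/
def graphAfter {n : ℕ} (I : List (Update n)) : SimpleGraph (Fin n) :=
  applyAll ⊥ I

/-- An update is legal if it inserts a missing edge or deletes a present one. -/
def Update.Legal {n : ℕ} (e : Update n) (G : SimpleGraph (Fin n)) : Prop :=
  e.u ≠ e.v ∧ (G.Adj e.u e.v ↔ e.isInsert = false)

/-- Every update of `I` is legal at the time when it arrives. -/
def LegalSeq {n : ℕ} (I : List (Update n)) : Prop :=
  ∀ i (h : i < I.length), (I[i]).Legal (graphAfter (I.take i))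

/-- `μ(G)`, the size of a maximum cardinality matching. -/
noncomputable def matchingNumber {n : ℕ} (G : SimpleGraph (Fin n)) : ℕ :=
  sSup {m | ∃ M : G.Subgraph, M.IsMatching ∧ M.edgeSet.ncard = m}

/-- `M` is `(α, δ)`-approximate: `α |M| + δ n ≥ μ(G)`. For `δ = 0` this says that `M` is
`α`-approximate. -/
def IsApprox {n : ℕ} (α δ : ℝ) {G : SimpleGraph (Fin n)} (M : G.Subgraph) : Prop :=
  (matchingNumber G : ℝ) ≤ α * (M.edgeSet.ncard : ℝ) + δ * (n : ℝ)

/-! ### The random access machine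

Registers and memory cells hold natural numbers; every instruction costs one time step. The
magnitude of all numbers is controlled separately (`RunsTo` below), which gives the word RAM
model. -/

/-- The arithmetic and bitwise operations of the machine. -/
inductive BinOp
  | add | sub | mul | div | mod | land | lor | xor | shl | shr

/-- The value of an operation (subtraction is truncated). -/
def BinOp.eval : BinOp → ℕ → ℕ → ℕ
  | .add, a, b => a + b
  | .sub, a, b => a - b
  | .mul, a, b => a * b
  | .div, a, b => a / b
  | .mod, a, b => a % b
  | .land, a, b => a &&& b
  | .lor, a, b => a ||| b
  | .xor, a, b => a ^^^ b
  | .shl, a, b => a <<< b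
  | .shr, a, b => a >>> b

/-- Instructions; `σ` is the set of program locations, `r s t` are register numbers and `q q'` are
the locations where the program continues. -/
inductive Instr (σ : Type)
  /-- `R r := c` -/
  | const (r c : ℕ) (q : σ)
  /-- `R r := f (R s) (R t)` -/
  | op (f : BinOp) (r s t : ℕ) (q : σ)
  /-- `R r := mem (R s)` -/
  | load (r s : ℕ) (q : σ)
  /-- `mem (R r) := R s` -/
  | store (r s : ℕ) (q : σ)
  /-- `R r := ` the random word number `R s` -/
  | rand (r s : ℕ) (q : σ)
  /-- continue at `q` if `R r < R s`, otherwise at `q'` -/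
  | branch (r s : ℕ) (q q' : σ)
  /-- wait for the next update -/
  | halt

/-- A program: finitely many locations, each with an instruction. The preprocessing starts at
`init`, the processing of each update at `entry`. -/
structure Program where
  Loc : Type
  finite_loc : Finite Loc
  init : Loc
  entry : Loc
  code : Loc → Instr Loc

/-- A program is deterministic if it never reads a random word. -/
def Program.Deterministic (A : Program) : Prop :=
  ∀ (q : A.Loc) (r s : ℕ) (q' : A.Loc), A.code q ≠ .rand r s q'

/-- A configuration of the machine. -/
structure Program.Cfg (A : Program) where
  loc : A.Loc
  reg : ℕ → ℕ
  mem : ℕ → ℕ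

/-- The configuration has come to a halt. -/
def Program.Cfg.Halted {A : Program} (c : A.Cfg) : Prop :=
  A.code c.loc = .halt

/-- All numbers in the configuration are at most `W`. -/
def Program.Cfg.Bounded {A : Program} (W : ℕ) (c : A.Cfg) : Prop :=
  (∀ r, c.reg r ≤ W) ∧ ∀ a, c.mem a ≤ W

/-- One step of the machine; `ω` is the tape of random words. -/
def Program.step (A : Program) (ω : ℕ → ℕ) (c : A.Cfg) : A.Cfg :=
  match A.code c.loc with
  | .const r x q => ⟨q, Function.update c.reg r x, c.mem⟩
  | .op f r s t q => ⟨q, Function.update c.reg r (f.eval (c.reg s) (c.reg t)), c.mem⟩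
  | .load r s q => ⟨q, Function.update c.reg r (c.mem (c.reg s)), c.mem⟩
  | .store r s q => ⟨q, c.reg, Function.update c.mem (c.reg r) (c.reg s)⟩
  | .rand r s q => ⟨q, Function.update c.reg r (ω (c.reg s)), c.mem⟩
  | .branch r s q q' => ⟨if c.reg r < c.reg s then q else q', c.reg, c.mem⟩
  | .halt => c

/-- Started in `c`, the machine halts after exactly `t` steps, in the configuration `c'`, and all
numbers that occur are at most `W`. -/
def Program.RunsTo (A : Program) (ω : ℕ → ℕ) (W : ℕ) (c : A.Cfg) (t : ℕ) (c' : A.Cfg) : Prop :=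
  (A.step ω)^[t] c = c' ∧ c'.Halted ∧
    (∀ s < t, ¬ ((A.step ω)^[s] c).Halted) ∧ ∀ s ≤ t, ((A.step ω)^[s] c).Bounded W

/-- The initial configuration: blank memory, and the parameters `n`, `k`, `T` in the first three
registers. -/
def Program.start (A : Program) (n k T : ℕ) : A.Cfg where
  loc := A.init
  reg := fun r => match r with
    | 0 => n
    | 1 => k
    | 2 => T
    | _ => 0
  mem := fun _ => 0

/-- The update `e.1` is written into the first registers and the machine is woken up. The flag
`e.2` tells whether a new batch begins with this update. -/
def Program.Cfg.feed {A : Program} {n : ℕ} (c : A.Cfg) (e : Update n × Bool) : A.Cfg where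
  loc := A.entry
  reg := fun r => match r with
    | 0 => e.1.isInsert.toNat
    | 1 => e.1.u
    | 2 => e.1.v
    | 3 => e.2.toNat
    | r => c.reg r
  mem := c.mem

/-- The machine preprocesses (in `time 0` steps) and then processes the sequence `evs`: the update
number `i` takes `time (i + 1)` steps, and `cfg i` is the configuration after `i` updates. All
numbers that occur are at most `W`. -/
structure Program.IsExecution (A : Program) (ω : ℕ → ℕ) (W n k T : ℕ)
    (evs : List (Update n × Bool)) (cfg : ℕ → A.Cfg) (time : ℕ → ℕ) : Prop where
  preprocess : A.RunsTo ω W (A.start n k T) (time 0) (cfg 0)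
  process : ∀ i (h : i < evs.length),
    A.RunsTo ω W ((cfg i).feed evs[i]) (time (i + 1)) (cfg (i + 1))

/-! ### The output -/

/-- The `j`-th output in memory is the matching `M`. The output `j` is a mate array, given by its
base address and its stride in the cells `2 j` and `2 j + 1`; the entry of the vertex `u` is `0` if
`u` is unmatched, and `v + 1` if `u` is matched to `v`. -/
def Outputs {n : ℕ} (mem : ℕ → ℕ) (j : ℕ) {G : SimpleGraph (Fin n)} (M : G.Subgraph) : Prop :=
  ∀ u : Fin n,
    (mem (mem (2 * j) + mem (2 * j + 1) * (u : ℕ)) = 0 ↔ u ∉ M.verts) ∧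
    ∀ v : Fin n, mem (mem (2 * j) + mem (2 * j + 1) * (u : ℕ)) = (v : ℕ) + 1 ↔ M.Adj u v

/-- The outputs `0, …, K - 1` in memory are matchings of `G`, and one of them is
`(α, δ)`-approximate. -/
def HoldsMatchings {n : ℕ} (K : ℕ) (α δ : ℝ) (G : SimpleGraph (Fin n)) (mem : ℕ → ℕ) : Prop :=
  (∀ j < K, ∃ M : G.Subgraph, M.IsMatching ∧ Outputs mem j M) ∧
    ∃ j < K, ∃ M : G.Subgraph, M.IsMatching ∧ Outputs mem j M ∧ IsApprox α δ M

/-! ### Randomness -/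

/-- The random words on `n` vertices have `⌊log₂ n⌋ + 1` bits. -/
abbrev RandomWord (n : ℕ) : Type := Fin (2 ^ (Nat.log 2 n + 1))

/-- The law of the random tape: independent uniform random words. -/
noncomputable def tapeLaw (n : ℕ) : Measure (ℕ → RandomWord n) :=
  Measure.infinitePi fun _ => (PMF.uniformOfFintype (RandomWord n)).toMeasure

/-! ### Batch-dynamic and worst-case algorithms -/

/-- A batch, with its first update marked. -/
def tagBatch {n : ℕ} : List (Update n) → List (Update n × Bool)
  | [] => []
  | e :: es => (e, true) :: es.map fun e' => (e', false)

/-- The number of updates in the first `j` batches. -/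
def offset {n : ℕ} (B : List (List (Update n))) (j : ℕ) : ℕ :=
  (B.take j).flatten.length

/-- With the random tape `ω`, the algorithm behaves well on the batches `B`: the preprocessing
takes at most `C P` steps, the output is an `(α, δ)`-approximate matching at all times, and each
batch is processed within `C T` steps times its size. -/
def Program.GoodOnBatches (A : Program) (ω : ℕ → ℕ) (W : ℕ) (C : ℝ) (n k T P : ℕ) (α δ : ℝ)
    (B : List (List (Update n))) : Prop :=
  ∃ (cfg : ℕ → A.Cfg) (time : ℕ → ℕ),
    A.IsExecution ω W n k T (B.flatMap tagBatch) cfg time ∧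
    (time 0 : ℝ) ≤ C * P ∧
    (∀ i ≤ B.flatten.length, HoldsMatchings 1 α δ (graphAfter (B.flatten.take i)) (cfg i).mem) ∧
    ∀ j (h : j < B.length),
      ((∑ i ∈ Finset.Ico (offset B j) (offset B (j + 1)), time (i + 1) : ℕ) : ℝ) ≤
        C * T * (B[j]).length

/-- With the random tape `ω`, the algorithm behaves well on the update sequence `I`: the
preprocessing takes at most `Q` steps, each update at most `U` steps, and at all times the `K`
outputs are matchings of which one is `(α, δ)`-approximate. -/
def Program.GoodWorstCase (A : Program) (ω : ℕ → ℕ) (W : ℕ) (n k T : ℕ) (K : ℕ) (U Q : ℝ)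
    (α δ : ℝ) (I : List (Update n)) : Prop :=
  ∃ (cfg : ℕ → A.Cfg) (time : ℕ → ℕ),
    A.IsExecution ω W n k T (I.map fun e => (e, false)) cfg time ∧
    (time 0 : ℝ) ≤ Q ∧
    (∀ i ≤ I.length, HoldsMatchings K α δ (graphAfter (I.take i)) (cfg i).mem) ∧
    ∀ i < I.length, (time (i + 1) : ℝ) ≤ U

/-- `A` is an `(α, δ)`-approximate dynamic matching algorithm that is `k` batch-dynamic with update
time `O(T)` and preprocessing time `O(P)`, on update sequences of arbitrary polynomial length and
with words of `O(log (n + T + P))` bits. For each sequence and each partition into batches these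
guarantees fail with probability at most `p`. -/
def Program.IsBatchDynamic (A : Program) (k T P : ℕ → ℕ) (α δ : ℕ → ℝ) (p : ℕ → ℝ≥0∞) : Prop :=
  ∃ C : ℝ, ∀ d : ℕ, ∃ c : ℕ, ∀ᶠ n : ℕ in atTop, ∀ B : List (List (Update n)),
    B.length ≤ k n → LegalSeq B.flatten → B.flatten.length ≤ n ^ d →
    tapeLaw n {ω | ¬ A.GoodOnBatches (fun i => (ω i : ℕ)) ((n + T n + P n + 2) ^ c) C
      n (k n) (T n) (P n) (α n) (δ n) B} ≤ p n

/-- `A`, which is given the numbers `n`, `k n` and `T n`, maintains `K` matchings one of which is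
`(α, δ)`-approximate, with worst-case update time `O(U)` and preprocessing time `O(Q)`, on update
sequences of arbitrary polynomial length and with words of `O(log (n + T + P))` bits. For each
sequence of length `N` these guarantees fail with probability at most `p n N`. -/
def Program.IsWorstCaseDynamic (A : Program) (k T P K : ℕ → ℕ) (U Q : ℕ → ℝ) (α δ : ℕ → ℝ)
    (p : ℕ → ℕ → ℝ≥0∞) : Prop :=
  ∃ C : ℝ, ∀ d : ℕ, ∃ c : ℕ, ∀ᶠ n : ℕ in atTop, ∀ I : List (Update n),
    LegalSeq I → I.length ≤ n ^ d →
    tapeLaw n {ω | ¬ A.GoodWorstCase (fun i => (ω i : ℕ)) ((n + T n + P n + 2) ^ c)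
      n (k n) (T n) (K n) (C * U n) (C * Q n) (α n) (δ n) I} ≤ p n I.length

end DynMatching

/-! Run `K = k n` copies of the algorithm, the slots, side by side on the same random tape. Each
slot keeps an undo log of its writes, so that it can return to its configuration before any of its
current batches. Time is counted in ticks, one per update. On each level `j` the blocks `[q b^j,
(q+1) b^j)` of ticks are handed to the slots in round-robin order as windows. A window of level `J`
is a cascade of tasks of levels `J, J-1, …, 0`. A task of level `l` below the top undoes everything
after the last task of level `l+1` and processes all updates since then, including the current one,
as one new batch. It may use `b^l - b^(l-1)` ticks, and one tick if `l = 0`.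

Windows of level `l+1` of a slot recur every `K b^(l+1)` ticks, so the batch of a task of level `l`
has at most `K b^(l+1)` updates (`le_reached_add`). Since `b` is constant, `O(T K)` units of work
per tick and slot suffice. A task of the top level `K-1` starts again from the preprocessed
algorithm: its batch inserts the edges of the graph at the beginning of the current epoch (`K
b^(K-1)` ticks) and then replays the updates of the epoch. The base `b` is chosen such that `n² ≤
b^(K-1)`, which is possible since `k = Θ(log n)`, so this batch also fits into its time. The edge
table of the next epoch is prepared at the speed of two updates per tick.

At any time the history of a slot is a list of at most `K` batches (`batches`) that depends only on
the update sequence, the slot and the time, and whose concatenation is a legal sequence of length at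
most `n² + N`. This is where the batch-dynamic guarantee is used. For a fixed tape the runs are
deterministic, so a configuration restored by undoing is the one that the guarantee for the present
list of batches speaks about (`Program.Conf.unique`).

There are only `K-1` positive levels, each occupying one slot at a time, so at each tick some slot
performs a task of level `0` (`exists_free`) and has then processed all updates. The output cells
are redirected to its mate array. Thus a single matching suffices, which is in particular `O(log n)`
matchings. Each of the `K` slots does `O(T K)` work per tick, so an update takes `O(T log² n)` time,
better than required. The failure probability is a union bound over the slots and the `N+1` times
(`measure_not_good_le`), so sharing the tape does no harm.

The core is the invariant `SlotInv` and its preservation, `SlotInv.tick`, which rests on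
`Slot.reaches_task` and the schedule. The remainder carries this out on the machine: an imperative
language with arrays is compiled by `Stm.Big.exec`, and `goodWorstCase_simProgram` puts everything
together. -/

namespace DynMatching

/-! ### Structured commands of the machine -/

/-- Registers and memory, without the program location. -/
structure Store where
  reg : ℕ → ℕ
  mem : ℕ → ℕ

/-- The configuration at the location `q` with a given store. -/
def Store.at (s : Store) {A : Program} (q : A.Loc) : A.Cfg := ⟨q, s.reg, s.mem⟩

/-- All numbers in the store are at most `W`. -/
def Store.Bounded (W : ℕ) (s : Store) : Prop :=
  (∀ r, s.reg r ≤ W) ∧ ∀ a, s.mem a ≤ W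

/-- Instructions without a jump. -/
inductive Basic
  | const (r c : ℕ)
  | op (f : BinOp) (r s t : ℕ)
  | load (r s : ℕ)
  | store (r s : ℕ)
  | rand (r s : ℕ)

/-- The instruction that continues at `q`. -/
def Basic.toInstr {σ : Type} (q : σ) : Basic → Instr σ
  | .const r c => .const r c q
  | .op f r s t => .op f r s t q
  | .load r s => .load r s q
  | .store r s => .store r s q
  | .rand r s => .rand r s q

/-- The effect of a basic instruction. -/
def Basic.run (ω : ℕ → ℕ) (s : Store) : Basic → Store
  | .const r c => ⟨Function.update s.reg r c, s.mem⟩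
  | .op f r x y => ⟨Function.update s.reg r (f.eval (s.reg x) (s.reg y)), s.mem⟩
  | .load r x => ⟨Function.update s.reg r (s.mem (s.reg x)), s.mem⟩
  | .store r x => ⟨s.reg, Function.update s.mem (s.reg r) (s.reg x)⟩
  | .rand r x => ⟨Function.update s.reg r (ω (s.reg x)), s.mem⟩

/-- The number written by a basic instruction. -/
def Basic.value (ω : ℕ → ℕ) (s : Store) : Basic → ℕ
  | .const _ c => c
  | .op f _ x y => f.eval (s.reg x) (s.reg y)
  | .load _ x => s.mem (s.reg x)
  | .store _ x => s.reg x
  | .rand _ x => ω (s.reg x)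

lemma update_le {f : ℕ → ℕ} {W : ℕ} (h : ∀ a, f a ≤ W) (r : ℕ) {v : ℕ} (hv : v ≤ W) (a : ℕ) :
    Function.update f r v a ≤ W := by
  rw [Function.update_apply]; split_ifs
  · exact hv
  · exact h a

lemma Basic.run_bounded {ω : ℕ → ℕ} {s : Store} {W : ℕ} (hs : s.Bounded W) (i : Basic)
    (hv : i.value ω s ≤ W) : (i.run ω s).Bounded W := by
  cases i <;> first
    | exact ⟨update_le hs.1 _ hv, hs.2⟩
    | exact ⟨hs.1, update_le hs.2 _ hv⟩

/-- Structured commands; the tests are of the form `R r < R s`. -/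
inductive Cmd
  | basic (i : Basic)
  | seq (a b : Cmd)
  | ite (r s : ℕ) (a b : Cmd)
  | loop (r s : ℕ) (a : Cmd)

/-- The program locations of a command. -/
def Cmd.Loc : Cmd → Type
  | .basic _ => Unit
  | .seq a b => a.Loc ⊕ b.Loc
  | .ite _ _ a b => Option (a.Loc ⊕ b.Loc)
  | .loop _ _ a => Option a.Loc

lemma Cmd.finite_loc : ∀ c : Cmd, Finite c.Loc
  | .basic _ => inferInstanceAs (Finite Unit)
  | .seq a b => by
    have := a.finite_loc
    have := b.finite_loc
    exact inferInstanceAs (Finite (a.Loc ⊕ b.Loc))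
  | .ite _ _ a b => by
    have := a.finite_loc
    have := b.finite_loc
    exact inferInstanceAs (Finite (Option (a.Loc ⊕ b.Loc)))
  | .loop _ _ a => by
    have := a.finite_loc
    exact inferInstanceAs (Finite (Option a.Loc))

/-- The location where a command starts. -/
def Cmd.entry : (c : Cmd) → c.Loc
  | .basic _ => ()
  | .seq a _ => Sum.inl a.entry
  | .ite _ _ _ _ => (none : Option _)
  | .loop _ _ _ => (none : Option _)

/-- The code of a command placed into a larger program by `emb`, continuing at `cont`. -/
def Cmd.code {σ : Type} : (c : Cmd) → (c.Loc → σ) → σ → c.Loc → Instr σ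
  | .basic i, _, cont, _ => i.toInstr cont
  | .seq a b, emb, cont, q =>
    match q with
    | Sum.inl x => a.code (fun y => emb (Sum.inl y)) (emb (Sum.inr b.entry)) x
    | Sum.inr x => b.code (fun y => emb (Sum.inr y)) cont x
  | .ite r s a b, emb, cont, q =>
    match q with
    | none => .branch r s (emb (some (Sum.inl a.entry))) (emb (some (Sum.inr b.entry)))
    | some (Sum.inl x) => a.code (fun y => emb (some (Sum.inl y))) cont x
    | some (Sum.inr x) => b.code (fun y => emb (some (Sum.inr y))) cont x
  | .loop r s a, emb, cont, q =>
    match q with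
    | none => .branch r s (emb (some a.entry)) cont
    | some x => a.code (fun y => emb (some y)) (emb none) x

/-- `c`, started in the store `s`, ends after `t` steps in `s'`; all numbers are at most `W`. -/
inductive Cmd.Exec (ω : ℕ → ℕ) (W : ℕ) : Cmd → Store → ℕ → Store → Prop
  | basic (i : Basic) (s : Store) (h : i.value ω s ≤ W) : Exec ω W (.basic i) s 1 (i.run ω s)
  | seq {a b : Cmd} {s s₁ s₂ : Store} {t₁ t₂ : ℕ} (h₁ : Exec ω W a s t₁ s₁)
      (h₂ : Exec ω W b s₁ t₂ s₂) : Exec ω W (.seq a b) s (t₁ + t₂) s₂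
  | ite_true {r x : ℕ} {a b : Cmd} {s s₁ : Store} {t : ℕ} (h : s.reg r < s.reg x)
      (h₁ : Exec ω W a s t s₁) : Exec ω W (.ite r x a b) s (1 + t) s₁
  | ite_false {r x : ℕ} {a b : Cmd} {s s₁ : Store} {t : ℕ} (h : ¬ s.reg r < s.reg x)
      (h₁ : Exec ω W b s t s₁) : Exec ω W (.ite r x a b) s (1 + t) s₁
  | loop_done {r x : ℕ} {a : Cmd} {s : Store} (h : ¬ s.reg r < s.reg x) :
      Exec ω W (.loop r x a) s 1 s
  | loop_step {r x : ℕ} {a : Cmd} {s s₁ s₂ : Store} {t t' : ℕ} (h : s.reg r < s.reg x)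
      (h₁ : Exec ω W a s t s₁) (h₂ : Exec ω W (.loop r x a) s₁ t' s₂) :
      Exec ω W (.loop r x a) s (1 + t + t') s₂

lemma Cmd.Exec.bounded {ω : ℕ → ℕ} {W : ℕ} {c : Cmd} {s s' : Store} {t : ℕ}
    (h : c.Exec ω W s t s') (hs : s.Bounded W) : s'.Bounded W := by
  induction h with
  | basic i s h => exact i.run_bounded hs h
  | seq _ _ ih₁ ih₂ => exact ih₂ (ih₁ hs)
  | ite_true _ _ ih => exact ih hs
  | ite_false _ _ ih => exact ih hs
  | loop_done _ => exact hs
  | loop_step _ _ _ ih₁ ih₂ => exact ih₂ (ih₁ hs)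

/-- The machine gets from `c` to `c'` in `t` steps without halting before, and all numbers are at
most `W`. -/
def Program.Path (A : Program) (ω : ℕ → ℕ) (W : ℕ) (c : A.Cfg) (t : ℕ) (c' : A.Cfg) : Prop :=
  (A.step ω)^[t] c = c' ∧ (∀ u < t, ¬ ((A.step ω)^[u] c).Halted) ∧
    ∀ u ≤ t, ((A.step ω)^[u] c).Bounded W

lemma Program.Path.trans {A : Program} {ω : ℕ → ℕ} {W : ℕ} {c c' c'' : A.Cfg} {t t' : ℕ}
    (h : A.Path ω W c t c') (h' : A.Path ω W c' t' c'') : A.Path ω W c (t + t') c'' := by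
  obtain ⟨h1, h2, h3⟩ := h
  obtain ⟨k1, k2, k3⟩ := h'
  have key : ∀ v, (A.step ω)^[t + v] c = (A.step ω)^[v] c' := fun v => by
    rw [add_comm, Function.iterate_add_apply, h1]
  refine ⟨by rw [key, k1], fun u hu => ?_, fun u hu => ?_⟩
  · rcases lt_or_ge u t with h | h
    · exact h2 u h
    · obtain ⟨v, rfl⟩ := Nat.exists_eq_add_of_le h
      rw [key]; exact k2 v (by omega)
  · rcases le_or_gt u t with h | h
    · exact h3 u h
    · obtain ⟨v, rfl⟩ := Nat.exists_eq_add_of_le h.le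
      rw [key]; exact k3 v (by omega)

lemma Program.Path.one {A : Program} {ω : ℕ → ℕ} {W : ℕ} {c c' : A.Cfg} (h : A.step ω c = c')
    (hc : ¬ c.Halted) (hb : c.Bounded W) (hbd : c'.Bounded W) : A.Path ω W c 1 c' := by
  refine ⟨h, fun u hu => ?_, fun u hu => ?_⟩
  · obtain rfl : u = 0 := by omega
    exact hc
  · obtain rfl | rfl : u = 0 ∨ u = 1 := by omega
    · exact hb
    · simpa [h] using hbd

/-- The code of a command does what the command says. -/
theorem Cmd.Exec.path {A : Program} {ω : ℕ → ℕ} {W : ℕ} {c : Cmd} {s s' : Store} {t : ℕ}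
    (h : c.Exec ω W s t s') (hs : s.Bounded W) (emb : c.Loc → A.Loc) (cont : A.Loc)
    (hcode : ∀ x, A.code (emb x) = c.code emb cont x) :
    A.Path ω W (s.at (emb c.entry)) t (s'.at cont) := by
  induction h generalizing cont with
  | basic i s h =>
    have h0 := hcode ()
    refine Program.Path.one ?_ ?_ hs (i.run_bounded hs h)
    · change A.step ω ⟨emb (), s.reg, s.mem⟩ = _
      unfold Program.step
      simp only [h0]
      cases i <;> rfl
    · change ¬ A.code (emb ()) = _
      rw [h0]
      cases i <;> simp [Cmd.code, Basic.toInstr]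
  | @seq a b s s₁ s₂ t₁ t₂ h₁ h₂ ih₁ ih₂ =>
    exact (ih₁ hs (fun y => emb (Sum.inl y)) (emb (Sum.inr b.entry))
      fun x => hcode (Sum.inl x)).trans
      (ih₂ (h₁.bounded hs) (fun y => emb (Sum.inr y)) cont fun x => hcode (Sum.inr x))
  | @ite_true r x a b s s₁ t h h₁ ih =>
    have h0 := hcode (none : Option _)
    refine Program.Path.trans (c' := s.at (emb (some (Sum.inl a.entry))))
      (Program.Path.one ?_ ?_ hs hs)
      (ih hs (fun y => emb (some (Sum.inl y))) cont fun x => hcode (some (Sum.inl x)))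
    · change A.step ω ⟨emb none, s.reg, s.mem⟩ = _
      unfold Program.step
      simp only [h0, Cmd.code, if_pos h]
      rfl
    · change ¬ A.code (emb none) = _
      rw [h0]; simp [Cmd.code]
  | @ite_false r x a b s s₁ t h h₁ ih =>
    have h0 := hcode (none : Option _)
    refine Program.Path.trans (c' := s.at (emb (some (Sum.inr b.entry))))
      (Program.Path.one ?_ ?_ hs hs)
      (ih hs (fun y => emb (some (Sum.inr y))) cont fun x => hcode (some (Sum.inr x)))
    · change A.step ω ⟨emb none, s.reg, s.mem⟩ = _
      unfold Program.step
      simp only [h0, Cmd.code, if_neg h]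
      rfl
    · change ¬ A.code (emb none) = _
      rw [h0]; simp [Cmd.code]
  | @loop_done r x a s h =>
    have h0 := hcode (none : Option _)
    refine Program.Path.one ?_ ?_ hs hs
    · change A.step ω ⟨emb none, s.reg, s.mem⟩ = _
      unfold Program.step
      simp only [h0, Cmd.code, if_neg h]
      rfl
    · change ¬ A.code (emb none) = _
      rw [h0]; simp [Cmd.code]
  | @loop_step r x a s s₁ s₂ t t' h h₁ h₂ ih₁ ih₂ =>
    have h0 := hcode (none : Option _)
    have hp : A.Path ω W (s.at (emb none)) 1 (s.at (emb (some a.entry))) := by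
      refine Program.Path.one ?_ ?_ hs hs
      · change A.step ω ⟨emb none, s.reg, s.mem⟩ = _
        unfold Program.step
        simp only [h0, Cmd.code, if_pos h]
        rfl
      · change ¬ A.code (emb none) = _
        rw [h0]; simp [Cmd.code]
    exact (hp.trans (ih₁ hs (fun y => emb (some y)) (emb none) fun x => hcode (some x))).trans
      -- The body continues at the head of the loop itself, so the remaining iterations use the same
      -- placement of the code.
      (ih₂ (h₁.bounded hs) emb cont hcode)

/-- The command contains no reading of random words. -/
def Cmd.NoRand : Cmd → Prop
  | .basic i => ∀ r s, i ≠ .rand r s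
  | .seq a b => a.NoRand ∧ b.NoRand
  | .ite _ _ a b => a.NoRand ∧ b.NoRand
  | .loop _ _ a => a.NoRand

lemma Cmd.NoRand.code_ne {σ : Type} : ∀ {c : Cmd}, c.NoRand → ∀ (emb : c.Loc → σ) (cont : σ)
    (x : c.Loc) (r s : ℕ) (q : σ), c.code emb cont x ≠ .rand r s q
  | .basic i, h, emb, cont, x, r, s, q => by
    cases i <;> simp_all [Cmd.NoRand, Cmd.code, Basic.toInstr]
  | .seq a b, h, emb, cont, x, r, s, q => by
    rcases x with x | x
    · exact h.1.code_ne _ _ x r s q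
    · exact h.2.code_ne _ _ x r s q
  | .ite _ _ a b, h, emb, cont, x, r, s, q => by
    rcases x with _ | x | x
    · simp [Cmd.code]
    · exact h.1.code_ne _ _ x r s q
    · exact h.2.code_ne _ _ x r s q
  | .loop _ _ a, h, emb, cont, x, r, s, q => by
    rcases x with _ | x
    · simp [Cmd.code]
    · exact Cmd.NoRand.code_ne (c := a) h _ _ x r s q

/-- The program with preprocessing `a` that processes each update by `b`. -/
def Cmd.program (a b : Cmd) : Program where
  Loc := Option (a.Loc ⊕ b.Loc)
  finite_loc := by
    have := a.finite_loc
    have := b.finite_loc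
    infer_instance
  init := some (Sum.inl a.entry)
  entry := some (Sum.inr b.entry)
  code q := match q with
    | none => .halt
    | some (Sum.inl x) => a.code (fun y => some (Sum.inl y)) none x
    | some (Sum.inr x) => b.code (fun y => some (Sum.inr y)) none x

lemma Cmd.program_deterministic {a b : Cmd} (ha : a.NoRand) (hb : b.NoRand) :
    (Cmd.program a b).Deterministic := by
  rintro (_ | x | x) r s q'
  · simp [Cmd.program]
  · exact ha.code_ne _ _ x r s q'
  · exact hb.code_ne _ _ x r s q'

lemma Program.Path.runsTo {A : Program} {ω : ℕ → ℕ} {W : ℕ} {c c' : A.Cfg} {t : ℕ}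
    (h : A.Path ω W c t c') (hc : c'.Halted) : A.RunsTo ω W c t c' :=
  ⟨h.1, hc, h.2.1, h.2.2⟩

lemma Cmd.Exec.runsTo_init {a b : Cmd} {ω : ℕ → ℕ} {W : ℕ} {s s' : Store} {t : ℕ}
    (h : a.Exec ω W s t s') (hs : s.Bounded W) :
    (Cmd.program a b).RunsTo ω W (s.at (Cmd.program a b).init) t
      (s'.at (A := Cmd.program a b) none) :=
  (h.path (A := Cmd.program a b) hs (fun y => some (Sum.inl y)) none fun _ => rfl).runsTo rfl

lemma Cmd.Exec.runsTo_entry {a b : Cmd} {ω : ℕ → ℕ} {W : ℕ} {s s' : Store} {t : ℕ}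
    (h : b.Exec ω W s t s') (hs : s.Bounded W) :
    (Cmd.program a b).RunsTo ω W (s.at (Cmd.program a b).entry) t
      (s'.at (A := Cmd.program a b) none) :=
  (h.path (A := Cmd.program a b) hs (fun y => some (Sum.inr y)) none fun _ => rfl).runsTo rfl

end DynMatching

namespace DynMatching

/-! ### A small imperative language with arrays -/

/-- The state of the imperative language: variables, arrays and the two output cells. -/
structure HS where
  reg : ℕ → ℕ
  arr : ℕ → ℕ → ℕ
  out : ℕ → ℕ

/-- Assign to a variable. -/
def HS.setReg (σ : HS) (r v : ℕ) : HS := { σ with reg := Function.update σ.reg r v }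

/-- Assign to an array entry. -/
def HS.setArr (σ : HS) (ρ a v : ℕ) : HS :=
  { σ with arr := Function.update σ.arr ρ (Function.update (σ.arr ρ) a v) }

/-- Assign to an output cell. -/
def HS.setOut (σ : HS) (j v : ℕ) : HS := { σ with out := Function.update σ.out j v }

@[simp] lemma HS.setReg_reg (σ : HS) (r v x : ℕ) :
    (σ.setReg r v).reg x = if x = r then v else σ.reg x := by
  simp [HS.setReg, Function.update_apply]
@[simp] lemma HS.setReg_arr (σ : HS) (r v : ℕ) : (σ.setReg r v).arr = σ.arr := rfl
@[simp] lemma HS.setReg_out (σ : HS) (r v : ℕ) : (σ.setReg r v).out = σ.out := rfl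
@[simp] lemma HS.setArr_reg (σ : HS) (ρ a v : ℕ) : (σ.setArr ρ a v).reg = σ.reg := rfl
@[simp] lemma HS.setArr_arr (σ : HS) (ρ a v : ℕ) : (σ.setArr ρ a v).arr =
    Function.update σ.arr ρ (Function.update (σ.arr ρ) a v) := rfl
@[simp] lemma HS.setArr_out (σ : HS) (ρ a v : ℕ) : (σ.setArr ρ a v).out = σ.out := rfl
@[simp] lemma HS.setOut_reg (σ : HS) (j v : ℕ) : (σ.setOut j v).reg = σ.reg := rfl
@[simp] lemma HS.setOut_arr (σ : HS) (j v : ℕ) : (σ.setOut j v).arr = σ.arr := rfl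
@[simp] lemma HS.setOut_out (σ : HS) (j v : ℕ) :
    (σ.setOut j v).out = Function.update σ.out j v := rfl

/-- Operations that occur in expressions. -/
inductive AOp
  | add | sub | mul | div | mod

/-- The corresponding operation of the machine. -/
def AOp.toBin : AOp → BinOp
  | .add => .add
  | .sub => .sub
  | .mul => .mul
  | .div => .div
  | .mod => .mod

/-- Expressions. -/
inductive Ex
  | var (r : ℕ)
  | lit (c : ℕ)
  | bin (f : AOp) (a b : Ex)
  | get (ρ i : Ex)

/-- The value of an expression. -/
def Ex.eval (σ : HS) : Ex → ℕ
  | .var r => σ.reg r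
  | .lit c => c
  | .bin f a b => f.toBin.eval (a.eval σ) (b.eval σ)
  | .get ρ i => σ.arr (ρ.eval σ) (i.eval σ)

/-- The expression uses variables and arrays that exist; `M` is the number of arrays. -/
def Ex.Ok (M : ℕ) (σ : HS) : Ex → Prop
  | .var r => r < 40
  | .lit _ => True
  | .bin _ a b => a.Ok M σ ∧ b.Ok M σ
  | .get ρ i => ρ.Ok M σ ∧ i.Ok M σ ∧ ρ.eval σ < M

/-- An exponent that bounds the values occurring in the evaluation. -/
def Ex.size : Ex → ℕ
  | .var _ => 1
  | .lit c => c + 1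
  | .bin _ a b => a.size + b.size
  | .get ρ i => ρ.size + i.size + 2

/-- The number of instructions for evaluating an expression. -/
def Ex.cost : Ex → ℕ
  | .var _ => 1
  | .lit _ => 1
  | .bin _ a b => a.cost + (b.cost + 1)
  | .get ρ i => ρ.cost + (i.cost + (1 + (1 + (1 + (1 + 1)))))

/-- The code that evaluates an expression into the register `40 + d`. The register `4` holds the
number of arrays. -/
def Ex.cmd : Ex → ℕ → Cmd
  | .var r, d => .basic (.op .lor (40 + d) r r)
  | .lit c, d => .basic (.const (40 + d) c)
  | .bin f a b, d => .seq (a.cmd d) (.seq (b.cmd (d + 1))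
      (.basic (.op f.toBin (40 + d) (40 + d) (40 + (d + 1)))))
  | .get ρ i, d => .seq (ρ.cmd d) (.seq (i.cmd (d + 1))
      (.seq (.basic (.op .mul (40 + (d + 1)) (40 + (d + 1)) 4))
      (.seq (.basic (.op .add (40 + d) (40 + d) (40 + (d + 1))))
      (.seq (.basic (.const (40 + (d + 1)) 2))
      (.seq (.basic (.op .add (40 + d) (40 + d) (40 + (d + 1))))
      (.basic (.load (40 + d) (40 + d))))))))

/-- Variables and array entries are at most `Y`. -/
def HS.Bdd (M Y : ℕ) (σ : HS) : Prop :=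
  (∀ r < 40, σ.reg r ≤ Y) ∧ ∀ ρ < M, ∀ a, σ.arr ρ a ≤ Y

/-- The store represents the state; variables and array entries are at most `Y`. -/
structure Sim (M Y : ℕ) (σ : HS) (s : Store) : Prop where
  reg : ∀ r < 40, s.reg r = σ.reg r
  arrays : σ.reg 4 = M
  arr : ∀ ρ < M, ∀ a, s.mem (2 + a * M + ρ) = σ.arr ρ a
  out : ∀ j < 2, s.mem j = σ.out j
  reg_le : ∀ r < 40, σ.reg r ≤ Y
  arr_le : ∀ ρ < M, ∀ a, σ.arr ρ a ≤ Y

lemma Ex.one_le_size : ∀ e : Ex, 1 ≤ e.size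
  | .var _ => le_rfl
  | .lit c => by simp [Ex.size]
  | .bin _ a b => by have := a.one_le_size; simp only [Ex.size]; omega
  | .get ρ i => by simp only [Ex.size]; omega

/-- For numbers at least `2` a sum is at most the product. Hence exponents add under addition just
as under multiplication, and one exponent per expression bounds all intermediate values. -/
lemma add_le_pow {Z x y a b : ℕ} (hZ : 2 ≤ Z) (ha : 1 ≤ a) (hb : 1 ≤ b) (hx : x ≤ Z ^ a)
    (hy : y ≤ Z ^ b) : x + y ≤ Z ^ (a + b) := by
  have h1 : 2 ≤ Z ^ a := hZ.trans (Nat.le_self_pow (by omega) Z)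
  have h2 : 2 ≤ Z ^ b := hZ.trans (Nat.le_self_pow (by omega) Z)
  rw [pow_add]
  calc x + y ≤ Z ^ a + Z ^ b := by omega
    _ ≤ Z ^ a * Z ^ b := Nat.add_le_mul h1 h2

lemma AOp.eval_le {Z x y a b : ℕ} (hZ : 2 ≤ Z) (ha : 1 ≤ a) (hb : 1 ≤ b) (hx : x ≤ Z ^ a)
    (hy : y ≤ Z ^ b) (f : AOp) : f.toBin.eval x y ≤ Z ^ (a + b) := by
  have h0 := add_le_pow hZ ha hb hx hy
  cases f
  · exact h0
  · exact (Nat.sub_le x y).trans (by omega)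
  · rw [pow_add]; exact Nat.mul_le_mul hx hy
  · exact (Nat.div_le_self x y).trans (by omega)
  · exact (Nat.mod_le x y).trans (by omega)

lemma Ex.eval_le {M Y : ℕ} {σ : HS} (h1 : ∀ r < 40, σ.reg r ≤ Y)
    (h2 : ∀ ρ < M, ∀ a, σ.arr ρ a ≤ Y) : ∀ {e : Ex}, e.Ok M σ → e.eval σ ≤ (Y + 2) ^ e.size
  | .var r, h => by simpa [Ex.eval, Ex.size] using (h1 r h).trans (by omega)
  | .lit c, _ => by
    have : c < 2 ^ c := Nat.lt_two_pow_self
    calc c ≤ 2 ^ (c + 1) := by rw [pow_succ]; omega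
      _ ≤ (Y + 2) ^ (c + 1) := Nat.pow_le_pow_left (by omega) _
  | .bin f a b, h =>
    f.eval_le (by omega) a.one_le_size b.one_le_size (Ex.eval_le h1 h2 h.1) (Ex.eval_le h1 h2 h.2)
  | .get ρ i, h => (h2 _ h.2.2 _).trans
      ((by omega : Y ≤ Y + 2).trans (Nat.le_self_pow (by simp [Ex.size]) _))

/-- The registers from `40` on are scratch space for evaluating expressions and are invisible to the
represented state. -/
lemma Sim.congr {M Y : ℕ} {σ : HS} {s s' : Store} (h : Sim M Y σ s) (hm : s'.mem = s.mem)
    (hr : ∀ r < 40, s'.reg r = s.reg r) : Sim M Y σ s' :=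
  ⟨fun r hr' => (hr r hr').trans (h.reg r hr'), h.arrays, fun ρ hρ a => by rw [hm, h.arr ρ hρ],
    fun j hj => by rw [hm, h.out j hj], h.reg_le, h.arr_le⟩

lemma pow_le_of_le {Z W a b : ℕ} (hZ : 1 ≤ Z) (h : Z ^ b ≤ W) (hab : a ≤ b) : Z ^ a ≤ W :=
  (Nat.pow_le_pow_right hZ hab).trans h

/-- The number of arrays is itself the value of a variable, so it costs one factor `Y + 2`, and the
offset `2` of the array area costs another. This explains the summand `2` in the exponent of an
array access. -/
lemma address_le {Y W ρ i M a b : ℕ} (ha : 1 ≤ a) (hρ : ρ ≤ (Y + 2) ^ a)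
    (hi : i ≤ (Y + 2) ^ b) (hM : M ≤ Y) (hW : (Y + 2) ^ (a + b + 2) ≤ W) :
    i * M ≤ W ∧ ρ + i * M ≤ W ∧ ρ + i * M + 2 ≤ W := by
  have h1 : i * M ≤ (Y + 2) ^ (b + 1) := by
    rw [pow_succ]; exact Nat.mul_le_mul hi (by omega)
  have h2 := add_le_pow (by omega : 2 ≤ Y + 2) ha (by omega : 1 ≤ b + 1) hρ h1
  have h3 := add_le_pow (by omega : 2 ≤ Y + 2) (by omega : 1 ≤ a + (b + 1)) le_rfl h2
    (by simp : 2 ≤ (Y + 2) ^ 1)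
  have h4 : (Y + 2) ^ (a + (b + 1) + 1) ≤ W := pow_le_of_le (by omega) hW (by omega)
  omega

/-- The code of an expression evaluates it. -/
theorem Ex.exec_cmd {ω : ℕ → ℕ} {M Y W : ℕ} {σ : HS} : ∀ {e : Ex} (d : ℕ) {s : Store},
    Sim M Y σ s → e.Ok M σ → (Y + 2) ^ e.size ≤ W →
    ∃ s', (e.cmd d).Exec ω W s e.cost s' ∧ s'.reg (40 + d) = e.eval σ ∧ s'.mem = s.mem ∧
      ∀ r < 40 + d, s'.reg r = s.reg r
  | .var r, d, s, hs, hok, hW => by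
    have hv := Ex.eval_le hs.reg_le hs.arr_le hok
    -- The machine has no move instruction; the bitwise or of a register with itself copies it.
    have e1 : (BinOp.lor).eval (s.reg r) (s.reg r) = σ.reg r := by
      rw [hs.reg r hok]; exact Nat.or_self _
    refine ⟨_, Cmd.Exec.basic _ s ?_, ?_, rfl, ?_⟩
    · simp only [Basic.value, e1]; exact hv.trans hW
    · simp [Basic.run, e1, Ex.eval]
    · intro x hx
      simp [Basic.run, hx.ne]
  | .lit c, d, s, hs, hok, hW => by
    have hv := Ex.eval_le hs.reg_le hs.arr_le hok
    refine ⟨_, Cmd.Exec.basic _ s (hv.trans hW), ?_, rfl, ?_⟩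
    · simp [Basic.run, Ex.eval]
    · intro x hx
      simp [Basic.run, hx.ne]
  | .bin f a b, d, s, hs, hok, hW => by
    have hv := Ex.eval_le hs.reg_le hs.arr_le hok
    obtain ⟨s1, x1, v1, m1, r1⟩ := Ex.exec_cmd (ω := ω) (e := a) d hs hok.1
      (pow_le_of_le (by omega) hW (by simp [Ex.size]))
    obtain ⟨s2, x2, v2, m2, r2⟩ := Ex.exec_cmd (ω := ω) (e := b) (d + 1)
      (hs.congr m1 fun r hr => r1 r (by omega)) hok.2
      (pow_le_of_le (by omega) hW (by simp [Ex.size]))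
    have v1' : s2.reg (40 + d) = a.eval σ := by rw [r2 _ (by omega), v1]
    refine ⟨_, x1.seq (x2.seq (Cmd.Exec.basic _ s2 ?_)), ?_, ?_, ?_⟩
    · simp only [Basic.value, v1', v2]; exact hv.trans hW
    · simp [Basic.run, Ex.eval, v1', v2]
    · exact m2.trans m1
    · intro x hx
      simp only [Basic.run, Function.update_apply, hx.ne, if_false]
      rw [r2 x (by omega), r1 x hx]
  | .get ρ i, d, s, hs, hok, hW => by
    have hv := Ex.eval_le hs.reg_le hs.arr_le hok
    obtain ⟨s1, x1, v1, m1, r1⟩ := Ex.exec_cmd (ω := ω) (e := ρ) d hs hok.1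
      (pow_le_of_le (by omega) hW (by simp only [Ex.size]; omega))
    obtain ⟨s2, x2, v2, m2, r2⟩ := Ex.exec_cmd (ω := ω) (e := i) (d + 1)
      (hs.congr m1 fun r hr => r1 r (by omega)) hok.2.1
      (pow_le_of_le (by omega) hW (by simp only [Ex.size]; omega))
    have v1' : s2.reg (40 + d) = ρ.eval σ := by rw [r2 _ (by omega), v1]
    have v4 : s2.reg 4 = M := by
      rw [r2 _ (by omega), r1 _ (by omega), hs.reg _ (by omega), hs.arrays]
    have hM : M ≤ Y := hs.arrays ▸ hs.reg_le 4 (by omega)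
    have hb := address_le ρ.one_le_size (Ex.eval_le hs.reg_le hs.arr_le hok.1)
      (Ex.eval_le hs.reg_le hs.arr_le hok.2.1) hM hW
    have n1 : (4 : ℕ) ≠ 40 + (d + 1) := by omega
    have n2 : 40 + d ≠ 40 + (d + 1) := by omega
    have hmem : s2.mem (ρ.eval σ + i.eval σ * M + 2) = σ.arr (ρ.eval σ) (i.eval σ) := by
      rw [m2, m1, ← hs.arr _ hok.2.2]; congr 1; ring
    refine ⟨_, x1.seq (x2.seq (.seq (.basic _ _ ?_) (.seq (.basic _ _ ?_) (.seq (.basic _ _ ?_)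
      (.seq (.basic _ _ ?_) (.basic _ _ ?_)))))), ?_, ?_, ?_⟩
    · simpa [Basic.value, v2, v4, BinOp.eval] using hb.1
    · simpa [Basic.value, Basic.run, v2, v4, v1', BinOp.eval, n2] using hb.2.1
    · exact (le_add_left le_rfl).trans hb.2.2
    · simpa [Basic.value, Basic.run, v2, v4, v1', BinOp.eval, n2] using hb.2.2
    · simp only [Basic.value, Basic.run, v2, v4, v1', BinOp.eval, n2, Function.update_self, ne_eq,
        not_false_eq_true, Function.update_of_ne, hmem]
      exact hv.trans hW
    · simp only [Basic.run, v2, v4, v1', BinOp.eval, n2, Function.update_self, ne_eq,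
        not_false_eq_true, Function.update_of_ne, hmem]
      rfl
    · exact m2.trans m1
    · intro x hx
      have n3 : x ≠ 40 + d := hx.ne
      have n4 : x ≠ 40 + (d + 1) := by omega
      simp only [Basic.run, ne_eq, n3, n4, not_false_eq_true, Function.update_of_ne]
      rw [r2 x (by omega), r1 x hx]

/-- Statements; the tests are of the form `a < b`. -/
inductive Stm
  | assign (r : ℕ) (e : Ex)
  | set (ρ i v : Ex)
  | out (j : ℕ) (e : Ex)
  | opr (f : BinOp) (r s t : ℕ)
  | rand (r s : ℕ)
  | seq (c c' : Stm)
  | ite (a b : Ex) (c c' : Stm)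
  | loop (a b : Ex) (c : Stm)

/-- The code of a statement. -/
def Stm.cmd : Stm → Cmd
  | .assign r e => .seq (e.cmd 0) (.basic (.op .lor r 40 40))
  | .set ρ i v => .seq (ρ.cmd 0) (.seq (i.cmd 1) (.seq (v.cmd 2)
      (.seq (.basic (.op .mul 41 41 4)) (.seq (.basic (.op .add 40 40 41))
      (.seq (.basic (.const 41 2)) (.seq (.basic (.op .add 40 40 41))
      (.basic (.store 40 42))))))))
  | .out j e => .seq (e.cmd 0) (.seq (.basic (.const 41 j)) (.basic (.store 41 40)))
  | .opr f r s t => .basic (.op f r s t)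
  | .rand r s => .basic (.rand r s)
  | .seq c c' => .seq c.cmd c'.cmd
  | .ite a b c c' => .seq (a.cmd 0) (.seq (b.cmd 1) (.ite 40 41 c.cmd c'.cmd))
  | .loop a b c => .seq (.seq (a.cmd 0) (b.cmd 1))
      (.loop 40 41 (.seq c.cmd (.seq (a.cmd 0) (b.cmd 1))))

/-- An exponent that bounds all values occurring in the evaluation of expressions. -/
def Stm.size : Stm → ℕ
  | .assign _ e => e.size
  | .set ρ i v => ρ.size + i.size + v.size + 2
  | .out _ e => e.size
  | .opr .. => 1
  | .rand .. => 1
  | .seq c c' => c.size + c'.size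
  | .ite a b c c' => a.size + b.size + c.size + c'.size
  | .loop a b c => a.size + b.size + c.size

/-- Execution of statements; variables and array entries stay at most `Y`. -/
inductive Stm.Big (ω : ℕ → ℕ) (M Y : ℕ) : Stm → HS → ℕ → HS → Prop
  | assign {r : ℕ} {e : Ex} {σ : HS} (hr : r < 40) (h4 : r ≠ 4) (he : e.Ok M σ)
      (hv : σ.Bdd M Y → e.eval σ ≤ Y) : Big ω M Y (.assign r e) σ (e.cost + 1) (σ.setReg r (e.eval σ))
  | set {ρ i v : Ex} {σ : HS} (hρ : ρ.Ok M σ) (hi : i.Ok M σ) (hv : v.Ok M σ)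
      (hM : ρ.eval σ < M) (hY : σ.Bdd M Y → v.eval σ ≤ Y) :
      Big ω M Y (.set ρ i v) σ (ρ.cost + (i.cost + (v.cost + 5)))
        (σ.setArr (ρ.eval σ) (i.eval σ) (v.eval σ))
  | out {j : ℕ} {e : Ex} {σ : HS} (hj : j < 2) (he : e.Ok M σ) :
      Big ω M Y (.out j e) σ (e.cost + 2) (σ.setOut j (e.eval σ))
  | opr {f : BinOp} {r s t : ℕ} {σ : HS} (hr : r < 40) (h4 : r ≠ 4) (hs : s < 40) (ht : t < 40)
      (hv : σ.Bdd M Y → f.eval (σ.reg s) (σ.reg t) ≤ Y) :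
      Big ω M Y (.opr f r s t) σ 1 (σ.setReg r (f.eval (σ.reg s) (σ.reg t)))
  | rand {r s : ℕ} {σ : HS} (hr : r < 40) (h4 : r ≠ 4) (hs : s < 40) (hv : σ.Bdd M Y → ω (σ.reg s) ≤ Y) :
      Big ω M Y (.rand r s) σ 1 (σ.setReg r (ω (σ.reg s)))
  | seq {c c' : Stm} {σ σ₁ σ₂ : HS} {t₁ t₂ : ℕ} (h₁ : Big ω M Y c σ t₁ σ₁)
      (h₂ : Big ω M Y c' σ₁ t₂ σ₂) : Big ω M Y (.seq c c') σ (t₁ + t₂) σ₂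
  | ite_true {a b : Ex} {c c' : Stm} {σ σ₁ : HS} {t : ℕ} (ha : a.Ok M σ) (hb : b.Ok M σ)
      (h : a.eval σ < b.eval σ) (h₁ : Big ω M Y c σ t σ₁) :
      Big ω M Y (.ite a b c c') σ (a.cost + (b.cost + (1 + t))) σ₁
  | ite_false {a b : Ex} {c c' : Stm} {σ σ₁ : HS} {t : ℕ} (ha : a.Ok M σ) (hb : b.Ok M σ)
      (h : ¬ a.eval σ < b.eval σ) (h₁ : Big ω M Y c' σ t σ₁) :
      Big ω M Y (.ite a b c c') σ (a.cost + (b.cost + (1 + t))) σ₁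
  | loop_done {a b : Ex} {c : Stm} {σ : HS} (ha : a.Ok M σ) (hb : b.Ok M σ)
      (h : ¬ a.eval σ < b.eval σ) : Big ω M Y (.loop a b c) σ (a.cost + b.cost + 1) σ
  | loop_step {a b : Ex} {c : Stm} {σ σ₁ σ₂ : HS} {t t' : ℕ} (ha : a.Ok M σ) (hb : b.Ok M σ)
      (h : a.eval σ < b.eval σ) (h₁ : Big ω M Y c σ t σ₁) (h₂ : Big ω M Y (.loop a b c) σ₁ t' σ₂) :
      Big ω M Y (.loop a b c) σ (a.cost + b.cost + 1 + t + t') σ₂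

lemma Sim.setReg {M Y : ℕ} {σ : HS} {s s' : Store} (h : Sim M Y σ s) {r v : ℕ} (h4 : r ≠ 4)
    (hv : v ≤ Y) (hm : s'.mem = s.mem) (hr' : s'.reg r = v)
    (hx : ∀ x < 40, x ≠ r → s'.reg x = s.reg x) : Sim M Y (σ.setReg r v) s' := by
  refine ⟨fun x hx' => ?_, ?_, fun ρ hρ a => by rw [hm, h.arr ρ hρ]; rfl,
    fun j hj => by rw [hm, h.out j hj]; rfl, fun x hx' => ?_, h.arr_le⟩
  · rw [HS.setReg_reg]; split_ifs with h'
    · rw [h', hr']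
    · rw [hx x hx' h', h.reg x hx']
  · simp [h4.symm, h.arrays]
  · rw [HS.setReg_reg]; split_ifs with h'
    · exact hv
    · exact h.reg_le x hx'

/-- Arrays are interleaved: each one occupies a residue class modulo `M`. So arrays need no length
bound, although their number depends on `n`. -/
lemma address_inj {M ρ a ρ' a' : ℕ} (hρ : ρ < M) (hρ' : ρ' < M)
    (h : 2 + a * M + ρ = 2 + a' * M + ρ') : ρ = ρ' ∧ a = a' := by
  have h1 : ρ + M * a = ρ' + M * a' := by linarith [mul_comm a M, mul_comm a' M]
  have h2 := congrArg (· % M) h1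
  simp only [Nat.add_mul_mod_self_left, Nat.mod_eq_of_lt hρ, Nat.mod_eq_of_lt hρ'] at h2
  subst h2
  exact ⟨rfl, Nat.eq_of_mul_eq_mul_left (Nat.zero_lt_of_lt hρ) (Nat.add_left_cancel h1)⟩

lemma Sim.setArr {M Y : ℕ} {σ : HS} {s s' : Store} (h : Sim M Y σ s) {ρ a v : ℕ} (hρ : ρ < M)
    (hv : v ≤ Y) (hm : s'.mem = Function.update s.mem (2 + a * M + ρ) v)
    (hr : ∀ x < 40, s'.reg x = s.reg x) : Sim M Y (σ.setArr ρ a v) s' := by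
  refine ⟨fun x hx => (hr x hx).trans (h.reg x hx), h.arrays, fun ρ' hρ' a' => ?_,
    fun j hj => ?_, h.reg_le, fun ρ' hρ' a' => ?_⟩
  · rw [hm]
    by_cases h1 : 2 + a' * M + ρ' = 2 + a * M + ρ
    · obtain ⟨rfl, rfl⟩ := address_inj hρ' hρ h1
      simp
    · rw [Function.update_of_ne h1, h.arr ρ' hρ']
      by_cases h2 : ρ' = ρ
      · subst h2
        have : a' ≠ a := by rintro rfl; exact h1 rfl
        simp [this]
      · simp [h2]
  · rw [hm, Function.update_of_ne (by omega), h.out j hj]; rfl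
  · simp only [HS.setArr_arr, Function.update_apply]
    split_ifs with h1
    · rw [Function.update_apply]; split_ifs
      · exact hv
      · exact h.arr_le _ hρ _
    · exact h.arr_le _ hρ' _

/-- The code of a statement executes it. -/
theorem Stm.Big.exec {ω : ℕ → ℕ} {M Y W : ℕ} {c : Stm} {σ σ' : HS} {t : ℕ}
    (h : c.Big ω M Y σ t σ') {s : Store} (hs : Sim M Y σ s) (hW : (Y + 2) ^ c.size ≤ W)  :
    ∃ s', c.cmd.Exec ω W s t s' ∧ Sim M Y σ' s' := by
  have hYW : ∀ {m : ℕ}, 1 ≤ m → (Y + 2) ^ m ≤ W → Y + 2 ≤ W := fun hm h =>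
    (Nat.le_self_pow (by omega) _).trans h
  induction h generalizing s with
  | @assign r e σ hr h4 he hv =>
    -- The side condition on the new value may assume that the current state is bounded, and `Sim`
    -- supplies this. Copying a variable or an array entry therefore needs no bound of its own.
    replace hv := hv ⟨hs.reg_le, hs.arr_le⟩
    obtain ⟨s1, x1, v1, m1, r1⟩ := Ex.exec_cmd (ω := ω) 0 hs he hW
    refine ⟨_, x1.seq (.basic _ _ ?_), hs.setReg h4 hv (m1 ▸ rfl) ?_ ?_⟩
    · simp only [Basic.value, v1, BinOp.eval, Nat.or_self]
      exact hv.trans (by have := hYW e.one_le_size hW; omega)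
    · simp [Basic.run, v1, BinOp.eval]
    · intro x hx hxr
      simp only [Basic.run, ne_eq, hxr, not_false_eq_true, Function.update_of_ne]
      exact r1 x (by omega)
  | @set ρ i v σ hρ hi hv hM hY =>
    replace hY := hY ⟨hs.reg_le, hs.arr_le⟩
    simp only [Stm.size] at hW
    obtain ⟨s1, x1, v1, m1, r1⟩ := Ex.exec_cmd (ω := ω) 0 hs hρ
      (pow_le_of_le (by omega) hW (by omega))
    obtain ⟨s2, x2, v2, m2, r2⟩ := Ex.exec_cmd (ω := ω) (e := i) 1
      (hs.congr m1 fun r hr => r1 r (by omega)) hi (pow_le_of_le (by omega) hW (by omega))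
    obtain ⟨s3, x3, v3, m3, r3⟩ := Ex.exec_cmd (ω := ω) (e := v) 2
      (hs.congr (m2.trans m1) fun r hr => by rw [r2 r (by omega), r1 r (by omega)]) hv
      (pow_le_of_le (by omega) hW (by omega))
    simp only [Nat.add_zero, Nat.reduceAdd] at v1 v2 v3 r1 r2 r3
    have w1 : s3.reg 40 = ρ.eval σ := by rw [r3 _ (by omega), r2 _ (by omega), v1]
    have w2 : s3.reg 41 = i.eval σ := by rw [r3 _ (by omega), v2]
    have w4 : s3.reg 4 = M := by
      rw [r3 _ (by omega), r2 _ (by omega), r1 _ (by omega), hs.reg _ (by omega), hs.arrays]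
    have hMY : M ≤ Y := hs.arrays ▸ hs.reg_le 4 (by omega)
    have hb := address_le ρ.one_le_size (Ex.eval_le hs.reg_le hs.arr_le hρ)
      (Ex.eval_le hs.reg_le hs.arr_le hi) hMY (pow_le_of_le (by omega) hW (by omega))
    refine ⟨_, x1.seq (x2.seq (x3.seq (.seq (.basic _ _ ?_) (.seq (.basic _ _ ?_)
      (.seq (.basic _ _ ?_) (.seq (.basic _ _ ?_) (.basic _ _ ?_))))))), ?_⟩
    · simpa [Basic.value, w2, w4, BinOp.eval] using hb.1
    · simpa [Basic.value, Basic.run, w1, w2, w4, BinOp.eval] using hb.2.1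
    · exact (le_add_left le_rfl).trans hb.2.2
    · simpa [Basic.value, Basic.run, w1, w2, w4, BinOp.eval] using hb.2.2
    · simp only [Basic.value, Basic.run, ne_eq, Nat.reduceEqDiff,
        not_false_eq_true, Function.update_of_ne, v3]
      exact hY.trans (by have := hYW (by omega) hW; omega)
    · refine hs.setArr hM hY ?_ ?_
      · simp only [Basic.run, ne_eq, Nat.reduceEqDiff, not_false_eq_true,
          Function.update_of_ne, Function.update_self, v3, w1, w2, w4, BinOp.eval, m3, m2, m1]
        congr 1; ring
      · intro x hx
        have n1 : x ≠ 40 := by omega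
        have n2 : x ≠ 41 := by omega
        simp only [Basic.run, ne_eq, n1, n2, not_false_eq_true, Function.update_of_ne]
        rw [r3 x (by omega), r2 x (by omega), r1 x (by omega)]
  | @out j e σ hj he =>
    obtain ⟨s1, x1, v1, m1, r1⟩ := Ex.exec_cmd (ω := ω) 0 hs he hW
    have hv := Ex.eval_le hs.reg_le hs.arr_le he
    refine ⟨_, x1.seq (.seq (.basic _ _ ?_) (.basic _ _ ?_)), ?_⟩
    · exact le_trans (by change j ≤ 2; omega) (le_trans (by omega) (hYW e.one_le_size hW))
    · simp only [Basic.value, Basic.run, ne_eq, Nat.reduceEqDiff,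
        not_false_eq_true, Function.update_of_ne]
      rw [show s1.reg 40 = _ from v1]; exact hv.trans hW
    · simp only [Nat.add_zero] at v1 r1
      refine ⟨fun x hx => ?_, hs.arrays, fun ρ' hρ' a' => ?_, fun x hx => ?_, hs.reg_le,
        hs.arr_le⟩
      · have n2 : x ≠ 41 := by omega
        simp only [Basic.run, ne_eq, n2, not_false_eq_true, Function.update_of_ne]
        rw [r1 x hx, hs.reg x hx]; rfl
      · simp only [Basic.run, Function.update_self]
        rw [Function.update_of_ne (by omega), m1, hs.arr ρ' hρ']; rfl
      · simp only [Basic.run, Function.update_self, ne_eq, Nat.reduceEqDiff, not_false_eq_true, Function.update_of_ne, v1, HS.setOut_out,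
          Function.update_apply]
        rw [m1, hs.out x hx]
  | @opr f r x y σ hr h4 hx hy hv =>
    replace hv := hv ⟨hs.reg_le, hs.arr_le⟩
    have e1 : f.eval (s.reg x) (s.reg y) = f.eval (σ.reg x) (σ.reg y) := by
      rw [hs.reg x hx, hs.reg y hy]
    refine ⟨_, .basic _ _ ?_, hs.setReg h4 hv rfl ?_ ?_⟩
    · change BinOp.eval _ _ _ ≤ W
      rw [e1]; exact hv.trans (by have := hYW le_rfl hW; omega)
    · simp [Basic.run, e1]
    · intro z _ hz; simp [Basic.run, hz]
  | @rand r x σ hr h4 hx hv =>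
    replace hv := hv ⟨hs.reg_le, hs.arr_le⟩
    have e1 : ω (s.reg x) = ω (σ.reg x) := by rw [hs.reg x hx]
    refine ⟨_, .basic _ _ ?_, hs.setReg h4 hv rfl ?_ ?_⟩
    · change ω _ ≤ W
      rw [e1]; exact hv.trans (by have := hYW le_rfl hW; omega)
    · simp [Basic.run, e1]
    · intro z _ hz; simp [Basic.run, hz]
  | seq _ _ ih₁ ih₂ =>
    simp only [Stm.size] at hW
    obtain ⟨s1, x1, h1⟩ := ih₁ hs (pow_le_of_le (by omega) hW (by omega))
    obtain ⟨s2, x2, h2⟩ := ih₂ h1 (pow_le_of_le (by omega) hW (by omega))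
    exact ⟨s2, x1.seq x2, h2⟩
  | @ite_true a b c c' σ σ₁ t ha hb h h₁ ih =>
    simp only [Stm.size] at hW
    obtain ⟨s1, x1, v1, m1, r1⟩ := Ex.exec_cmd (ω := ω) 0 hs ha
      (pow_le_of_le (by omega) hW (by omega))
    obtain ⟨s2, x2, v2, m2, r2⟩ := Ex.exec_cmd (ω := ω) (e := b) 1
      (hs.congr m1 fun r hr => r1 r (by omega)) hb (pow_le_of_le (by omega) hW (by omega))
    obtain ⟨s3, x3, h3⟩ := ih (hs.congr (m2.trans m1)
      fun r hr => by rw [r2 r (by omega), r1 r (by omega)]) (pow_le_of_le (by omega) hW (by omega))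
    refine ⟨s3, x1.seq (x2.seq (.ite_true ?_ x3)), h3⟩
    rw [r2 40 (by omega), show s1.reg 40 = _ from v1, show s2.reg 41 = _ from v2]; exact h
  | @ite_false a b c c' σ σ₁ t ha hb h h₁ ih =>
    simp only [Stm.size] at hW
    obtain ⟨s1, x1, v1, m1, r1⟩ := Ex.exec_cmd (ω := ω) 0 hs ha
      (pow_le_of_le (by omega) hW (by omega))
    obtain ⟨s2, x2, v2, m2, r2⟩ := Ex.exec_cmd (ω := ω) (e := b) 1
      (hs.congr m1 fun r hr => r1 r (by omega)) hb (pow_le_of_le (by omega) hW (by omega))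
    obtain ⟨s3, x3, h3⟩ := ih (hs.congr (m2.trans m1)
      fun r hr => by rw [r2 r (by omega), r1 r (by omega)]) (pow_le_of_le (by omega) hW (by omega))
    refine ⟨s3, x1.seq (x2.seq (.ite_false ?_ x3)), h3⟩
    rw [r2 40 (by omega), show s1.reg 40 = _ from v1, show s2.reg 41 = _ from v2]; exact h
  | @loop_done a b c σ ha hb h =>
    simp only [Stm.size] at hW
    obtain ⟨s1, x1, v1, m1, r1⟩ := Ex.exec_cmd (ω := ω) 0 hs ha
      (pow_le_of_le (by omega) hW (by omega))
    obtain ⟨s2, x2, v2, m2, r2⟩ := Ex.exec_cmd (ω := ω) (e := b) 1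
      (hs.congr m1 fun r hr => r1 r (by omega)) hb (pow_le_of_le (by omega) hW (by omega))
    refine ⟨s2, (x1.seq x2).seq (.loop_done ?_), hs.congr (m2.trans m1)
      fun r hr => by rw [r2 r (by omega), r1 r (by omega)]⟩
    rw [r2 40 (by omega), show s1.reg 40 = _ from v1, show s2.reg 41 = _ from v2]; exact h
  | @loop_step a b c σ σ₁ σ₂ t t' ha hb h h₁ h₂ ih₁ ih₂ =>
    have hW' := hW
    simp only [Stm.size] at hW
    obtain ⟨s1, x1, v1, m1, r1⟩ := Ex.exec_cmd (ω := ω) 0 hs ha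
      (pow_le_of_le (by omega) hW (by omega))
    obtain ⟨s2, x2, v2, m2, r2⟩ := Ex.exec_cmd (ω := ω) (e := b) 1
      (hs.congr m1 fun r hr => r1 r (by omega)) hb (pow_le_of_le (by omega) hW (by omega))
    obtain ⟨s3, x3, h3⟩ := ih₁ (hs.congr (m2.trans m1)
      fun r hr => by rw [r2 r (by omega), r1 r (by omega)]) (pow_le_of_le (by omega) hW (by omega))
    obtain ⟨s4, x4, h4⟩ := ih₂ h3 hW'
    -- The compiled loop evaluates its test once before the loop and again at the end of the body.
    -- The evaluation that starts the remaining run is split off and becomes the end of the present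
    -- body.
    cases x4 with
    | @seq _ _ _ s5 _ t₁ t₂ y1 y2 =>
    have hlt : s2.reg 40 < s2.reg 41 := by
      rw [r2 40 (by omega), show s1.reg 40 = _ from v1, show s2.reg 41 = _ from v2]; exact h
    have := (x1.seq x2).seq (.loop_step hlt (x3.seq y1) y2)
    refine ⟨s4, ?_, h4⟩
    have e : a.cost + b.cost + 1 + t + (t₁ + t₂) = a.cost + b.cost + (1 + (t + t₁) + t₂) := by ring
    rw [e]; exact this

/-- The statement contains no reading of random words. -/
def Stm.NoRand : Stm → Prop
  | .rand .. => False
  | .seq c c' => c.NoRand ∧ c'.NoRand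
  | .ite _ _ c c' => c.NoRand ∧ c'.NoRand
  | .loop _ _ c => c.NoRand
  | _ => True

lemma Ex.noRand_cmd : ∀ (e : Ex) (d : ℕ), (e.cmd d).NoRand
  | .var r, d => by simp [Ex.cmd, Cmd.NoRand]
  | .lit c, d => by simp [Ex.cmd, Cmd.NoRand]
  | .bin f a b, d => ⟨a.noRand_cmd d, b.noRand_cmd _, by simp [Cmd.NoRand]⟩
  | .get ρ i, d => ⟨ρ.noRand_cmd d, i.noRand_cmd _, by simp [Cmd.NoRand]⟩

lemma Stm.noRand_cmd : ∀ {c : Stm}, c.NoRand → c.cmd.NoRand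
  | .assign r e, _ => ⟨e.noRand_cmd 0, by simp [Cmd.NoRand]⟩
  | .set ρ i v, _ => ⟨ρ.noRand_cmd _, i.noRand_cmd _, v.noRand_cmd _, by simp [Cmd.NoRand]⟩
  | .out j e, _ => ⟨e.noRand_cmd _, by simp [Cmd.NoRand]⟩
  | .opr .., _ => by simp [Stm.cmd, Cmd.NoRand]
  | .rand .., h => h.elim
  | .seq c c', h => ⟨Stm.noRand_cmd h.1, Stm.noRand_cmd h.2⟩
  | .ite a b c c', h => ⟨a.noRand_cmd _, b.noRand_cmd _, Stm.noRand_cmd h.1, Stm.noRand_cmd h.2⟩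
  | .loop a b c, h => ⟨⟨a.noRand_cmd _, b.noRand_cmd _⟩, Stm.noRand_cmd (c := c) h,
      a.noRand_cmd _, b.noRand_cmd _⟩

/-- Started in `σ`, the statement ends within `t` steps in a state that satisfies `Q`. -/
def Stm.Tr (ω : ℕ → ℕ) (M Y : ℕ) (c : Stm) (σ : HS) (t : ℕ) (Q : HS → Prop) : Prop :=
  ∃ t' ≤ t, ∃ σ', c.Big ω M Y σ t' σ' ∧ Q σ'

/-! ### Hoare-style rules with time bounds -/

section Rules

variable {ω : ℕ → ℕ} {M Y : ℕ}

lemma Stm.Tr.mono {c : Stm} {σ : HS} {t t' : ℕ} {Q Q' : HS → Prop} (h : c.Tr ω M Y σ t Q)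
    (ht : t ≤ t') (hQ : ∀ σ, Q σ → Q' σ) : c.Tr ω M Y σ t' Q' := by
  obtain ⟨t₁, h1, σ', h2, h3⟩ := h
  exact ⟨t₁, h1.trans ht, σ', h2, hQ _ h3⟩

lemma Stm.Tr.seq {c c' : Stm} {σ : HS} {t t' : ℕ} {Q : HS → Prop}
    (h : c.Tr ω M Y σ t fun σ' => c'.Tr ω M Y σ' t' Q) : (c.seq c').Tr ω M Y σ (t + t') Q := by
  obtain ⟨t₁, h1, σ', h2, t₂, h3, σ'', h4, h5⟩ := h
  exact ⟨t₁ + t₂, by omega, σ'', h2.seq h4, h5⟩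

lemma Stm.Tr.ite {a b : Ex} {c c' : Stm} {σ : HS} {t : ℕ} {Q : HS → Prop} (ha : a.Ok M σ)
    (hb : b.Ok M σ) (h : a.eval σ < b.eval σ → c.Tr ω M Y σ t Q)
    (h' : ¬ a.eval σ < b.eval σ → c'.Tr ω M Y σ t Q) :
    (Stm.ite a b c c').Tr ω M Y σ (a.cost + (b.cost + (1 + t))) Q := by
  by_cases hab : a.eval σ < b.eval σ
  · obtain ⟨t₁, h1, σ', h2, h3⟩ := h hab
    exact ⟨_, by omega, σ', .ite_true ha hb hab h2, h3⟩
  · obtain ⟨t₁, h1, σ', h2, h3⟩ := h' hab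
    exact ⟨_, by omega, σ', .ite_false ha hb hab h2, h3⟩

/-- A loop whose body is executed `m` times. -/
lemma Stm.Tr.loop {a b : Ex} {c : Stm} {t : ℕ} {Q : HS → Prop} (Inv : ℕ → HS → Prop)
    (m : ℕ) (hok : ∀ j ≤ m, ∀ σ, Inv j σ → a.Ok M σ ∧ b.Ok M σ ∧ (a.eval σ < b.eval σ ↔ j < m))
    (hstep : ∀ j < m, ∀ σ, Inv j σ → c.Tr ω M Y σ t (Inv (j + 1)))
    (hQ : ∀ σ, Inv m σ → Q σ) {σ : HS} (h0 : Inv 0 σ) :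
    (Stm.loop a b c).Tr ω M Y σ ((m + 1) * (a.cost + b.cost + 1 + t)) Q := by
  -- Induction on the number of iterations that remain.
  suffices H : ∀ i ≤ m, ∀ σ, Inv (m - i) σ →
      (Stm.loop a b c).Tr ω M Y σ ((i + 1) * (a.cost + b.cost + 1 + t)) Q by
    exact H m le_rfl σ (by simpa using h0)
  intro i
  induction i with
  | zero =>
    intro _ σ h
    obtain ⟨ha, hb, hab⟩ := hok _ (Nat.sub_le _ _) σ h
    exact ⟨a.cost + b.cost + 1, by nlinarith, σ, .loop_done ha hb (by simpa using hab),
      hQ _ (by simpa using h)⟩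
  | succ i ih =>
    intro hi σ h
    obtain ⟨ha, hb, hab⟩ := hok _ (Nat.sub_le _ _) σ h
    obtain ⟨t₁, h1, σ', h2, h3⟩ := hstep _ (by omega) σ h
    rw [show m - (i + 1) + 1 = m - i by omega] at h3
    obtain ⟨t₂, k1, σ'', k2, k3⟩ := ih (by omega) σ' h3
    refine ⟨a.cost + b.cost + 1 + t₁ + t₂, ?_, σ'', .loop_step ha hb (hab.2 (by omega)) h2 k2, k3⟩
    calc a.cost + b.cost + 1 + t₁ + t₂
        ≤ (a.cost + b.cost + 1 + t) + (i + 1) * (a.cost + b.cost + 1 + t) := by omega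
      _ = _ := by ring

/-- An upper bound for the running time of a statement without loops. -/
def Stm.cost : Stm → ℕ
  | .assign _ e => e.cost + 1
  | .set ρ i v => ρ.cost + (i.cost + (v.cost + 5))
  | .out _ e => e.cost + 2
  | .opr .. => 1
  | .rand .. => 1
  | .seq c c' => c.cost + c'.cost
  | .ite a b c c' => a.cost + (b.cost + (1 + (c.cost + c'.cost)))
  | .loop .. => 0

/-- Weakest precondition of a statement without loops. -/
def Stm.wp (ω : ℕ → ℕ) (M Y : ℕ) : Stm → HS → (HS → Prop) → Prop
  | .assign r e, σ, Q => r < 40 ∧ r ≠ 4 ∧ e.Ok M σ ∧ (σ.Bdd M Y → e.eval σ ≤ Y) ∧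
      Q (σ.setReg r (e.eval σ))
  | .set ρ i v, σ, Q => (ρ.Ok M σ ∧ i.Ok M σ ∧ v.Ok M σ ∧ ρ.eval σ < M) ∧
      (σ.Bdd M Y → v.eval σ ≤ Y) ∧ Q (σ.setArr (ρ.eval σ) (i.eval σ) (v.eval σ))
  | .out j e, σ, Q => j < 2 ∧ e.Ok M σ ∧ Q (σ.setOut j (e.eval σ))
  | .opr f r s t, σ, Q => (r < 40 ∧ r ≠ 4 ∧ s < 40 ∧ t < 40) ∧
      (σ.Bdd M Y → f.eval (σ.reg s) (σ.reg t) ≤ Y) ∧ Q (σ.setReg r (f.eval (σ.reg s) (σ.reg t)))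
  | .rand r s, σ, Q => (r < 40 ∧ r ≠ 4 ∧ s < 40) ∧ (σ.Bdd M Y → ω (σ.reg s) ≤ Y) ∧
      Q (σ.setReg r (ω (σ.reg s)))
  | .seq c c', σ, Q => c.wp ω M Y σ fun σ' => c'.wp ω M Y σ' Q
  | .ite a b c c', σ, Q => a.Ok M σ ∧ b.Ok M σ ∧ (a.eval σ < b.eval σ → c.wp ω M Y σ Q) ∧
      (¬ a.eval σ < b.eval σ → c'.wp ω M Y σ Q)
  | .loop .., _, _ => False

lemma Stm.wp_mono : ∀ {c : Stm} {σ : HS} {Q Q' : HS → Prop}, c.wp ω M Y σ Q →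
    (∀ σ, Q σ → Q' σ) → c.wp ω M Y σ Q'
  | .assign .., _, _, _, h, hQ => ⟨h.1, h.2.1, h.2.2.1, h.2.2.2.1, hQ _ h.2.2.2.2⟩
  | .set .., _, _, _, h, hQ => ⟨h.1, h.2.1, hQ _ h.2.2⟩
  | .out .., _, _, _, h, hQ => ⟨h.1, h.2.1, hQ _ h.2.2⟩
  | .opr .., _, _, _, h, hQ => ⟨h.1, h.2.1, hQ _ h.2.2⟩
  | .rand .., _, _, _, h, hQ => ⟨h.1, h.2.1, hQ _ h.2.2⟩
  | .seq c c', _, Q, _, h, hQ =>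
      Stm.wp_mono (c := c) (Q := fun σ' => c'.wp ω M Y σ' Q) h fun _ h' => Stm.wp_mono h' hQ
  | .ite .., _, _, _, h, hQ => ⟨h.1, h.2.1, fun h' => Stm.wp_mono (h.2.2.1 h') hQ,
      fun h' => Stm.wp_mono (h.2.2.2 h') hQ⟩
  | .loop .., _, _, _, h, _ => h.elim

/-- The time bound is read off the syntax, both branches of a test being counted. Code without loops
thus only needs a proof of its effect. -/
lemma Stm.Tr.of_wp : ∀ {c : Stm} {σ : HS} {Q : HS → Prop}, c.wp ω M Y σ Q →
    c.Tr ω M Y σ c.cost Q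
  | .assign .., _, _, h => ⟨_, le_rfl, _, .assign h.1 h.2.1 h.2.2.1 h.2.2.2.1, h.2.2.2.2⟩
  | .set .., _, _, h => ⟨_, le_rfl, _, .set h.1.1 h.1.2.1 h.1.2.2.1 h.1.2.2.2 h.2.1, h.2.2⟩
  | .out .., _, _, h => ⟨_, le_rfl, _, .out h.1 h.2.1, h.2.2⟩
  | .opr .., _, _, h => ⟨_, le_rfl, _, .opr h.1.1 h.1.2.1 h.1.2.2.1 h.1.2.2.2 h.2.1, h.2.2⟩
  | .rand .., _, _, h => ⟨_, le_rfl, _, .rand h.1.1 h.1.2.1 h.1.2.2 h.2.1, h.2.2⟩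
  | .seq c c', _, Q, h => ((Stm.Tr.of_wp (c := c) (Q := fun σ' => c'.wp ω M Y σ' Q) h).mono le_rfl
      fun _ h' => Stm.Tr.of_wp h').seq
  | .ite .., _, _, h => .ite h.1 h.2.1
      (fun h' => (Stm.Tr.of_wp (h.2.2.1 h')).mono (by omega) fun _ h => h)
      (fun h' => (Stm.Tr.of_wp (h.2.2.2 h')).mono (by omega) fun _ h => h)
  | .loop .., _, _, h => h.elim

end Rules

end DynMatching

namespace DynMatching

/-! ### Simulating an algorithm with an undo log -/

/-- The configuration with the location `q` whose register `r` is in the cell `2 r` and whose memory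
cell `a` is in the cell `2 a + 1`. -/
def Program.ofCells (A : Program) (q : A.Loc) (S : ℕ → ℕ) : A.Cfg :=
  ⟨q, fun r => S (2 * r), fun a => S (2 * a + 1)⟩

/-- The cells that represent a configuration. -/
def Program.Cfg.cells {A : Program} (c : A.Cfg) : ℕ → ℕ :=
  fun x => if x % 2 = 0 then c.reg (x / 2) else c.mem (x / 2)

lemma Program.ofCells_cells {A : Program} (c : A.Cfg) : A.ofCells c.loc c.cells = c := by
  have h1 : ∀ r, c.cells (2 * r) = c.reg r := fun r => by simp [Program.Cfg.cells]
  have h2 : ∀ r, c.cells (2 * r + 1) = c.mem r := fun r => by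
    simp [Program.Cfg.cells, Nat.add_mod, show (2 * r + 1) / 2 = r by omega]
  simp [Program.ofCells, h1, h2]

lemma Program.cells_ofCells {A : Program} (q : A.Loc) (S : ℕ → ℕ) : (A.ofCells q S).cells = S := by
  funext x
  rcases Nat.even_or_odd' x with ⟨y, rfl | rfl⟩
  · simp [Program.Cfg.cells, Program.ofCells]
  · simp [Program.Cfg.cells, Program.ofCells, Nat.add_mod, show (2 * y + 1) / 2 = y by omega]

lemma Program.Cfg.cells_le {A : Program} {c : A.Cfg} {W : ℕ} (h : c.Bounded W) (x : ℕ) :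
    c.cells x ≤ W := by
  unfold Program.Cfg.cells
  split_ifs
  · exact h.1 _
  · exact h.2 _

/-- The address and the value of the write that an instruction performs. -/
def Instr.write {τ : Type} (ω S : ℕ → ℕ) : Instr τ → Option (ℕ × ℕ)
  | .const r c _ => some (2 * r, c)
  | .op f r s t _ => some (2 * r, f.eval (S (2 * s)) (S (2 * t)))
  | .load r s _ => some (2 * r, S (2 * S (2 * s) + 1))
  | .store r s _ => some (2 * S (2 * r) + 1, S (2 * s))
  | .rand r s _ => some (2 * r, ω (S (2 * s)))
  | .branch .. => none
  | .halt => none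

/-- The location after an instruction; `q₀` is the present one. -/
def Instr.next {τ : Type} (S : ℕ → ℕ) (q₀ : τ) : Instr τ → τ
  | .const _ _ q => q
  | .op _ _ _ _ q => q
  | .load _ _ q => q
  | .store _ _ q => q
  | .rand _ _ q => q
  | .branch r s q q' => if S (2 * r) < S (2 * s) then q else q'
  | .halt => q₀

lemma update_even (S : ℕ → ℕ) (r v : ℕ) :
    (fun x => Function.update S (2 * r) v (2 * x)) = Function.update (fun x => S (2 * x)) r v ∧
    (fun x => Function.update S (2 * r) v (2 * x + 1)) = fun x => S (2 * x + 1) := by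
  constructor <;> funext x
  · simp [Function.update_apply]
  · exact Function.update_of_ne (by omega) _ _

lemma update_odd (S : ℕ → ℕ) (r v : ℕ) :
    (fun x => Function.update S (2 * r + 1) v (2 * x)) = (fun x => S (2 * x)) ∧
    (fun x => Function.update S (2 * r + 1) v (2 * x + 1)) =
      Function.update (fun x => S (2 * x + 1)) r v := by
  constructor <;> funext x
  · exact Function.update_of_ne (by omega) _ _
  · simp [Function.update_apply]

/-- With registers in even cells and memory in odd cells, every instruction is a change of location
together with at most one write to one array. One log entry per step is therefore enough to undo it.
-/
lemma Program.step_ofCells (A : Program) (ω : ℕ → ℕ) (q : A.Loc) (S : ℕ → ℕ) :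
    A.step ω (A.ofCells q S) = A.ofCells ((A.code q).next S q)
      (match (A.code q).write ω S with
        | none => S
        | some (a, v) => Function.update S a v) := by
  unfold Program.step
  change (match A.code q with | _ => _) = _
  cases h : A.code q <;>
    simp only [Program.ofCells, Instr.next, Instr.write, update_even, update_odd, h]
  all_goals rfl

/-- Handing over an update amounts to four writes, into the registers `0` to `3`. They are logged
too, which is the source of the `4` in the bounds on the log. -/
lemma Program.feed_ofCells {A : Program} {n : ℕ} (q : A.Loc) (S : ℕ → ℕ) (e : Update n × Bool) :
    (A.ofCells q S).feed e = A.ofCells A.entry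
      (Function.update (Function.update (Function.update (Function.update S 0 e.1.isInsert.toNat)
        2 e.1.u) 4 e.1.v) 6 e.2.toNat) := by
  have h1 : ∀ a v, (fun x => Function.update S (2 * a) v (2 * x + 1)) = fun x => S (2 * x + 1) :=
    fun a v => (update_even S a v).2
  simp only [Program.Cfg.feed, Program.ofCells, Program.Cfg.mk.injEq, true_and]
  constructor
  · funext r
    rcases r with _ | _ | _ | _ | r
    · simp
    · simp
    · simp
    · simp
    · simp only [Function.update_apply]
      rw [if_neg (by omega), if_neg (by omega), if_neg (by omega), if_neg (by omega)]
  · funext x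
    simp only [Function.update_apply]
    rw [if_neg (by omega), if_neg (by omega), if_neg (by omega), if_neg (by omega)]

/-- A copy of the algorithm together with an undo log of its writes (latest first) and a list of
updates to be processed. The mode is `0` for fetching the next update, `1` for running, and `2` for
undoing the writes until the log has length `low`. -/
structure Slot (A : Program) where
  cells : ℕ → ℕ
  loc : A.Loc
  log : List (ℕ × ℕ)
  low : ℕ
  mode : ℕ
  first : ℕ
  todo : List (Option (ℕ × ℕ × ℕ))

/-! ### The undo log and units of work -/

namespace Slot

variable {A : Program} {ω : ℕ → ℕ}

/-- A write that is recorded in the log. -/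
def write (σ : Slot A) (a v : ℕ) : Slot A :=
  { σ with cells := Function.update σ.cells a v, log := (a, σ.cells a) :: σ.log }

/-- Fetching the next update. -/
def fetch (σ : Slot A) : Slot A :=
  match σ.todo with
  | [] => σ
  | none :: l => { σ with todo := l }
  | some e :: l => { ((((σ.write 0 e.1).write 2 e.2.1).write 4 e.2.2).write 6 σ.first) with
      todo := l, loc := A.entry, mode := 1, first := 0 }

/-- One step of the algorithm. -/
def run (ω : ℕ → ℕ) (σ : Slot A) : Slot A :=
  match A.code σ.loc with
  | .halt => { σ with mode := 0 }
  | i => match i.write ω σ.cells with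
    | none => { σ with loc := i.next σ.cells σ.loc }
    | some (a, v) => { σ.write a v with loc := i.next σ.cells σ.loc }

/-- Undoing one write. -/
def undo (σ : Slot A) : Slot A :=
  if σ.low < σ.log.length then
    match σ.log with
    | [] => σ
    | (a, v) :: l => { σ with cells := Function.update σ.cells a v, log := l }
  else { σ with mode := 0 }

/-- One unit of work. -/
def micro (ω : ℕ → ℕ) (σ : Slot A) : Slot A :=
  if σ.mode = 0 then σ.fetch else if σ.mode = 1 then σ.run ω else σ.undo

/-- The cells after undoing writes until the log has length `m`. -/
def rewind (m : ℕ) : List (ℕ × ℕ) → (ℕ → ℕ) → ℕ → ℕ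
  | [], S => S
  | (a, v) :: l, S => if m ≤ l.length then rewind m l (Function.update S a v) else S

/-- When the log is cut down to length `m`, the cells are `F`. -/
def Track (F : ℕ → ℕ) (m : ℕ) (σ : Slot A) : Prop :=
  m ≤ σ.log.length ∧ rewind m σ.log σ.cells = F

/-- The old value is logged, so undoing the newest entry gives back the cells before the write. -/
lemma Track.write {F : ℕ → ℕ} {m : ℕ} {σ : Slot A} (h : Track F m σ) (a v : ℕ) :
    Track F m (σ.write a v) := by
  refine ⟨h.1.trans (Nat.le_succ _), ?_⟩
  simp only [Slot.write, rewind, if_pos h.1, Function.update_idem, Function.update_eq_self]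
  exact h.2

lemma Track.of_length {σ : Slot A} : Track σ.cells σ.log.length σ := by
  refine ⟨le_rfl, ?_⟩
  rcases h : σ.log with _ | ⟨⟨a, v⟩, l⟩
  · rfl
  · simp [rewind]

/-- Once the log has been cut down to the recorded length there is nothing left to undo, so the slot
is in the recorded configuration. -/
lemma Track.eq_cells {F : ℕ → ℕ} {σ : Slot A} (h : Track F σ.log.length σ) : σ.cells = F := by
  rw [← h.2]
  exact (Track.of_length (σ := σ)).2.symm

lemma Track.congr {F : ℕ → ℕ} {m : ℕ} {σ σ' : Slot A} (h : Track F m σ) (h1 : σ'.cells = σ.cells)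
    (h2 : σ'.log = σ.log) : Track F m σ' := by
  unfold Track; rw [h1, h2]; exact h

@[simp] lemma micro_low (σ : Slot A) : (σ.micro ω).low = σ.low := by
  unfold micro fetch run undo
  split_ifs
  · split <;> rfl
  · split
    · rfl
    · split <;> rfl
  · split <;> rfl
  · rfl

/-- Forward work only pushes entries onto the log, and undoing stops at `low`. A checkpoint at or
below `low` survives. -/
lemma Track.micro {F : ℕ → ℕ} {m : ℕ} {σ : Slot A} (h : Track F m σ) (hm : m ≤ σ.low) :
    Track F m (σ.micro ω) := by
  unfold Slot.micro fetch run undo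
  split_ifs with h1 h2 h3
  · split
    · exact h
    · exact h.congr rfl rfl
    · exact ((((h.write _ _).write _ _).write _ _).write _ _).congr rfl rfl
  · split
    · exact h.congr rfl rfl
    · split
      · exact h.congr rfl rfl
      · exact (h.write _ _).congr rfl rfl
  · split
    · exact h
    · next a v l hl =>
      rw [hl, List.length_cons] at h3
      have hml : m ≤ l.length := by omega
      refine ⟨hml, ?_⟩
      have := h.2
      rw [hl] at this
      simpa [rewind, hml] using this
  · exact h.congr rfl rfl

lemma iterate_low (σ : Slot A) (y : ℕ) : ((Slot.micro ω)^[y] σ).low = σ.low := by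
  induction y generalizing σ with
  | zero => rfl
  | succ y ih => rw [Function.iterate_succ_apply, ih, micro_low]

lemma Track.iterate {F : ℕ → ℕ} {m : ℕ} {σ : Slot A} (h : Track F m σ) (hm : m ≤ σ.low) (y : ℕ) :
    Track F m ((Slot.micro ω)^[y] σ) := by
  induction y generalizing σ with
  | zero => exact h
  | succ y ih =>
    rw [Function.iterate_succ_apply]
    exact ih (h.micro hm) (by simpa using hm)

/-- The cells and the logged values are at most `W`, the log has length at most `D`. -/
def Ok (W D : ℕ) (σ : Slot A) : Prop :=
  (∀ x, σ.cells x ≤ W) ∧ (∀ p ∈ σ.log, p.2 ≤ W) ∧ σ.log.length ≤ D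

lemma Ok.write {W D : ℕ} {σ : Slot A} (h : σ.Ok W D) {a v : ℕ} (hv : v ≤ W)
    (hD : σ.log.length + 1 ≤ D) : (σ.write a v).Ok W D := by
  refine ⟨update_le h.1 _ hv, fun p hp => ?_, hD⟩
  rcases List.mem_cons.1 hp with rfl | hp
  · exact h.1 _
  · exact h.2.1 _ hp

/-- `σ` becomes `σ'` by `N` units of work, and all states in between are `Ok`. -/
def Reaches (ω : ℕ → ℕ) (W D : ℕ) (σ : Slot A) (N : ℕ) (σ' : Slot A) : Prop :=
  (Slot.micro ω)^[N] σ = σ' ∧ ∀ y ≤ N, ((Slot.micro ω)^[y] σ).Ok W D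

lemma Reaches.refl {W D : ℕ} {σ : Slot A} (h : σ.Ok W D) : Reaches ω W D σ 0 σ :=
  ⟨rfl, fun y hy => by obtain rfl : y = 0 := by omega
                       exact h⟩

lemma Reaches.trans {W D N N' : ℕ} {σ σ' σ'' : Slot A} (h : Reaches ω W D σ N σ')
    (h' : Reaches ω W D σ' N' σ'') : Reaches ω W D σ (N + N') σ'' := by
  have key : ∀ v, (Slot.micro ω)^[N + v] σ = (Slot.micro ω)^[v] σ' := fun v => by
    rw [add_comm, Function.iterate_add_apply, h.1]
  refine ⟨by rw [key, h'.1], fun y hy => ?_⟩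
  rcases le_or_gt y N with h1 | h1
  · exact h.2 y h1
  · obtain ⟨v, rfl⟩ := Nat.exists_eq_add_of_le h1.le
    rw [key]; exact h'.2 v (by omega)

lemma Reaches.step {W D N : ℕ} {σ σ' : Slot A} (h0 : σ.Ok W D)
    (h : Reaches ω W D (σ.micro ω) N σ') : Reaches ω W D σ (1 + N) σ' :=
  Reaches.trans ⟨rfl, fun y hy => by
    obtain rfl | rfl : y = 0 ∨ y = 1 := by omega
    · exact h0
    · exact h.2 0 (Nat.zero_le _)⟩ h

lemma Reaches.ok_right {W D N : ℕ} {σ σ' : Slot A} (h : Reaches ω W D σ N σ') : σ'.Ok W D :=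
  h.1 ▸ h.2 N le_rfl

/-- Undoing the writes. -/
lemma reaches_undo {W D : ℕ} (σ : Slot A) (h : σ.Ok W D) (hmode : σ.mode = 2)
    (hl : σ.low ≤ σ.log.length) : ∃ σ', Reaches ω W D σ (σ.log.length - σ.low + 1) σ' ∧
      σ'.mode = 0 ∧ σ'.log.length = σ.low ∧ σ'.first = σ.first ∧ σ'.todo = σ.todo ∧
      σ'.low = σ.low := by
  obtain ⟨m, hm⟩ := Nat.exists_eq_add_of_le hl
  induction m generalizing σ with
  -- The extra unit of work is the one that finds the log cut down and changes the mode.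
  | zero =>
    have e : σ.micro ω = { σ with mode := 0 } := by
      simp [micro, hmode, undo, hm]
    have hr : Reaches ω W D (σ.micro ω) 0 { σ with mode := 0 } := by
      rw [e]; exact Reaches.refl h
    refine ⟨{ σ with mode := 0 }, ?_, rfl, hm, rfl, rfl, rfl⟩
    rw [show σ.log.length - σ.low + 1 = 1 + 0 by omega]
    exact Reaches.step h hr
  | succ m ih =>
    rcases hlog : σ.log with _ | ⟨⟨a, v⟩, l⟩
    · rw [hlog] at hm; simp at hm
    · have e : σ.micro ω = { σ with cells := Function.update σ.cells a v, log := l } := by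
        simp only [micro, hmode, undo]
        rw [if_neg (by omega), if_neg (by omega), if_pos (by omega)]
        simp [hlog]
      rw [hlog, List.length_cons] at hm
      have hok := h
      unfold Ok at h
      rw [hlog] at h
      obtain ⟨σ', k1, k2⟩ := ih { σ with cells := Function.update σ.cells a v, log := l }
        ⟨update_le h.1 _ (h.2.1 _ List.mem_cons_self),
          fun p hp => h.2.1 p (List.mem_cons_of_mem _ hp), by
          have := h.2.2
          simp only [List.length_cons] at this ⊢
          omega⟩
        hmode (by simp; omega) (by simp; omega)
      refine ⟨σ', ?_, k2⟩
      rw [← e] at k1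
      have := Reaches.step hok k1
      simp only [List.length_cons]
      convert this using 1
      rw [e]; simp only; omega

/-- Running the algorithm until it halts. -/
lemma reaches_run {W D : ℕ} {c c' : A.Cfg} {t : ℕ} (hrun : A.RunsTo ω W c t c') (σ : Slot A)
    (h : σ.Ok W D) (hc : A.ofCells σ.loc σ.cells = c) (hmode : σ.mode = 1)
    (hD : σ.log.length + t ≤ D) : ∃ σ', Reaches ω W D σ (t + 1) σ' ∧
      σ'.mode = 0 ∧ σ'.log.length ≤ σ.log.length + t ∧ σ'.first = σ.first ∧ σ'.todo = σ.todo ∧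
      σ'.low = σ.low ∧ σ'.cells = c'.cells := by
  induction t generalizing σ c with
  -- The extra unit of work is the one that finds the algorithm halted.
  | zero =>
    have h1 : A.ofCells σ.loc σ.cells = c' := hc.trans hrun.1
    have h2 : A.code σ.loc = .halt := by
      have := hrun.2.1
      rw [← h1] at this; exact this
    have e : σ.micro ω = { σ with mode := 0 } := by simp [micro, hmode, run, h2]
    have hr : Reaches ω W D (σ.micro ω) 0 { σ with mode := 0 } := by
      rw [e]; exact Reaches.refl h
    refine ⟨{ σ with mode := 0 }, ?_, rfl, le_rfl, rfl, rfl, rfl, ?_⟩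
    · rw [add_comm]; exact Reaches.step h hr
    · rw [← h1, Program.cells_ofCells]
  | succ t ih =>
    have h2 : A.code σ.loc ≠ .halt := by
      have := hrun.2.2.1 0 (by omega)
      rw [Function.iterate_zero_apply, ← hc] at this; exact this
    have hst := A.step_ofCells ω σ.loc σ.cells
    rw [hc] at hst
    have hrun' : A.RunsTo ω W (A.step ω c) t c' := by
      refine ⟨?_, hrun.2.1, fun s hs => ?_, fun s hs => ?_⟩
      · rw [← Function.iterate_succ_apply]; exact hrun.1
      · rw [← Function.iterate_succ_apply]; exact hrun.2.2.1 _ (by omega)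
      · rw [← Function.iterate_succ_apply]; exact hrun.2.2.2 _ (by omega)
    have e : σ.micro ω = match (A.code σ.loc).write ω σ.cells with
        | none => { σ with loc := (A.code σ.loc).next σ.cells σ.loc }
        | some (a, v) => { σ.write a v with loc := (A.code σ.loc).next σ.cells σ.loc } := by
      unfold micro run
      rw [if_neg (by omega), if_pos hmode]
      cases hcode : A.code σ.loc <;> first | rfl | exact absurd hcode h2
    have hbd : (A.step ω c).Bounded W := hrun'.2.2.2 0 (by omega)
    have key : (σ.micro ω).Ok W D ∧ A.ofCells (σ.micro ω).loc (σ.micro ω).cells = A.step ω c ∧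
        (σ.micro ω).mode = 1 ∧ (σ.micro ω).log.length ≤ σ.log.length + 1 ∧
        (σ.micro ω).first = σ.first ∧ (σ.micro ω).todo = σ.todo := by
      rw [e]
      rcases hw : (A.code σ.loc).write ω σ.cells with _ | ⟨a, v⟩
      · rw [hw] at hst
        exact ⟨h, hst.symm, hmode, Nat.le_succ _, rfl, rfl⟩
      · rw [hw] at hst
        refine ⟨?_, hst.symm, hmode, le_rfl, rfl, rfl⟩
        -- The written value is a cell of the next configuration of the algorithm, which is bounded
        -- by the hypothesis on the run.
        have hv : v ≤ W := by
          have := Program.Cfg.cells_le hbd a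
          rw [hst, Program.cells_ofCells] at this
          simpa using this
        exact h.write hv (by omega)
    obtain ⟨k1, k2, k3, k4, k5, k6⟩ := key
    obtain ⟨σ', j1, j2, j3, j4, j5, j6, j7⟩ := ih hrun' (σ.micro ω) k1 k2 k3 (by omega)
    refine ⟨σ', ?_, j2, by omega, by rw [j4, k5], by rw [j5, k6], by rw [j6, micro_low], j7⟩
    have := Reaches.step h j1
    convert this using 1
    omega

end Slot

/-- An update as a triple of numbers. -/
def Update.code {n : ℕ} (e : Update n) : ℕ × ℕ × ℕ := (e.isInsert.toNat, e.u, e.v)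

/-- The events `es`, starting in the configuration `c`, are processed in total time `t`, ending in
`c'`. -/
inductive Program.Chain (A : Program) (ω : ℕ → ℕ) (W : ℕ) {n : ℕ} :
    A.Cfg → List (Update n × Bool) → ℕ → A.Cfg → Prop
  | nil (c : A.Cfg) : Chain A ω W c [] 0 c
  | cons {c c₁ c₂ : A.Cfg} {e : Update n × Bool} {es : List (Update n × Bool)} {t t' : ℕ}
      (h : A.RunsTo ω W (c.feed e) t c₁) (h' : Chain A ω W c₁ es t' c₂) :
      Chain A ω W c (e :: es) (t + t') c₂

/-- A list of updates of which the first carries the mark `f` and the others carry none. -/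
def tagFrom {n : ℕ} (f : Bool) : List (Update n) → List (Update n × Bool)
  | [] => []
  | e :: es => (e, f) :: tagFrom false es

lemma tagFrom_false {n : ℕ} (l : List (Update n)) : tagFrom false l = l.map fun e => (e, false) := by
  induction l with
  | nil => rfl
  | cons e es ih => simp [tagFrom, ih]

lemma tagBatch_eq {n : ℕ} (l : List (Update n)) : tagBatch l = tagFrom true l := by
  cases l with
  | nil => rfl
  | cons e es => simp [tagBatch, tagFrom, tagFrom_false]

/-! ### Processing a batch within a slot -/

namespace Slot

variable {A : Program} {ω : ℕ → ℕ}

/-- Processing the list of updates. -/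
lemma reaches_todo {n W D : ℕ} (l : List (Option (ℕ × ℕ × ℕ))) :
    ∀ (X : List (Update n)) (f : Bool) {c c' : A.Cfg} {t : ℕ} (σ : Slot A),
    A.Chain ω W c (tagFrom f X) t c' → l.filterMap id = X.map Update.code →
    σ.todo = l → σ.Ok W D → σ.cells = c.cells → σ.mode = 0 → σ.first = f.toNat →
    σ.log.length + t + 4 * X.length ≤ D →
    ∃ σ' : Slot A, Reaches ω W D σ (l.length + (t + X.length)) σ' ∧ σ'.mode = 0 ∧ σ'.todo = [] ∧
      σ'.low = σ.low ∧ σ'.cells = c'.cells ∧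
      σ'.log.length ≤ σ.log.length + t + 4 * X.length := by
  induction l with
  | nil =>
    intro X f c c' t σ hch hX htodo hok hcells hmode _ _
    obtain rfl : X = [] := by simpa using hX.symm
    cases hch
    exact ⟨σ, Reaches.refl hok, hmode, htodo, rfl, hcells, by simp⟩
  | cons o l ih =>
    intro X f c c' t σ hch hX htodo hok hcells hmode hfirst hD
    rcases o with _ | e
    -- An entry `none` is a pair of vertices that is not an edge. Skipping it costs a unit of work,
    -- so the length of the whole list enters the bound besides the number of updates.
    · have e1 : σ.micro ω = { σ with todo := l } := by simp [micro, hmode, fetch, htodo]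
      obtain ⟨σ', k1, k2⟩ := ih X f { σ with todo := l } hch (by simpa using hX) rfl hok hcells
        hmode hfirst hD
      refine ⟨σ', ?_, k2⟩
      have := Reaches.step hok (e1 ▸ k1)
      convert this using 1
      simp only [List.length_cons]; omega
    · rcases X with _ | ⟨x, X⟩
      · simp at hX
      simp only [List.filterMap_cons_some (f := id) (show id (some e) = some e from rfl),
        List.map_cons, List.cons.injEq] at hX
      obtain ⟨hx, hX⟩ := hX
      simp only [List.length_cons] at hD
      cases hch with
      | @cons _ c₁ _ _ _ t₁ t₂ hrun hch' =>
      set σ₁ := σ.micro ω with hσ₁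
      have e1 : σ₁ = { ((((σ.write 0 e.1).write 2 e.2.1).write 4 e.2.2).write 6 σ.first) with
          todo := l, loc := A.entry, mode := 1, first := 0 } := by
        simp [hσ₁, micro, hmode, fetch, htodo]
      have hfeed : c.feed (x, f) = A.ofCells σ₁.loc σ₁.cells := by
        rw [← Program.ofCells_cells c, Program.feed_ofCells, ← hcells, e1]
        simp only [write, hfirst, hx, Update.code]
      have hb : (A.ofCells σ₁.loc σ₁.cells).Bounded W := hfeed ▸ hrun.2.2.2 0 (Nat.zero_le _)
      have hb' : ∀ x, σ₁.cells x ≤ W := fun x => by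
        have := Program.Cfg.cells_le hb x
        rwa [Program.cells_ofCells] at this
      have hlen : σ₁.log.length = σ.log.length + 4 := by rw [e1]; simp [write]
      -- The four cells are distinct, so each written value can be read off the configuration that
      -- results from all four writes, and this one is bounded.
      have v6 : σ.first ≤ W := by have := hb' 6; rw [e1] at this; simpa [write] using this
      have v4 : e.2.2 ≤ W := by
        have := hb' 4; rw [e1] at this; simpa [write, Function.update_apply] using this
      have v2 : e.2.1 ≤ W := by
        have := hb' 2; rw [e1] at this; simpa [write, Function.update_apply] using this
      have v0 : e.1 ≤ W := by
        have := hb' 0; rw [e1] at this; simpa [write, Function.update_apply] using this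
      have hok₁ : σ₁.Ok W D := by
        have : ((((σ.write 0 e.1).write 2 e.2.1).write 4 e.2.2).write 6 σ.first).Ok W D :=
          (((hok.write v0 (by omega)).write v2 (by simp only [write, List.length_cons]; omega)).write
            v4 (by simp only [write, List.length_cons]; omega)).write v6
            (by simp only [write, List.length_cons]; omega)
        rw [e1]; exact this
      obtain ⟨σ₂, k1, k2, k3, k4, k5, k6, k7⟩ := reaches_run hrun σ₁ hok₁ hfeed.symm
        (by rw [e1]) (by omega)
      have f1 : σ₁.first = 0 := by rw [e1]
      have f2 : σ₁.todo = l := by rw [e1]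
      have f3 : σ₁.low = σ.low := by rw [hσ₁, micro_low]
      obtain ⟨σ₃, j1, j2, j3, j4, j5, j6⟩ := ih X false σ₂ hch' hX (k5.trans f2) k1.ok_right k7 k2
        (by rw [k4, f1]; rfl) (by omega)
      refine ⟨σ₃, ?_, j2, j3, by rw [j4, k6, f3], j5, by simp only [List.length_cons]; omega⟩
      have := (Reaches.step hok k1).trans j1
      convert this using 1
      simp only [List.length_cons]; omega

/-- A task: undo the log down to the length `low` and process a batch. -/
lemma reaches_task {n W D : ℕ} (X : List (Update n)) {c c' : A.Cfg} {t : ℕ} (σ : Slot A)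
    (hch : A.Chain ω W c (tagBatch X) t c') (hX : σ.todo.filterMap id = X.map Update.code)
    (hok : σ.Ok W D) (hmode : σ.mode = 2) (htr : Track c.cells σ.low σ) (hfirst : σ.first = 1)
    (hD : σ.low + t + 4 * X.length ≤ D) :
    ∃ σ' : Slot A, Reaches ω W D σ
        (σ.log.length - σ.low + 1 + (σ.todo.length + (t + X.length))) σ' ∧
      σ'.mode = 0 ∧ σ'.todo = [] ∧ σ'.cells = c'.cells ∧
      σ'.log.length ≤ σ.low + t + 4 * X.length := by
  obtain ⟨σ₁, k1, k2, k3, k4, k5, k6⟩ := reaches_undo (ω := ω) σ hok hmode htr.1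
  have htr1 : Track c.cells σ.low σ₁ := k1.1 ▸ htr.iterate le_rfl _
  -- The log now has exactly the length of the checkpoint, which determines the cells.
  have hc : σ₁.cells = c.cells := by
    rw [← k3] at htr1; exact htr1.eq_cells
  obtain ⟨σ₂, j1, j2, j3, j4, j5, j6⟩ := reaches_todo σ.todo X true σ₁ (tagBatch_eq X ▸ hch) hX k5
    k1.ok_right hc k2 (k4.trans hfirst) (by omega)
  exact ⟨σ₂, k1.trans j1, j2, j3, j5, by omega⟩

/-- A slot that has finished is a fixed point of the work. It may be given its fixed amount of work
in every tick, whether needed or not. -/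
lemma micro_idle {σ : Slot A} (h1 : σ.mode = 0) (h2 : σ.todo = []) (y : ℕ) :
    (Slot.micro ω)^[y] σ = σ :=
  Function.iterate_fixed (by simp [micro, h1, fetch, h2]) y

/-- After enough work the task is done. -/
lemma Reaches.idle {W D N : ℕ} {σ σ' : Slot A} (h : Reaches ω W D σ N σ') (h1 : σ'.mode = 0)
    (h2 : σ'.todo = []) : (∀ y, N ≤ y → (Slot.micro ω)^[y] σ = σ') ∧
      ∀ y, ((Slot.micro ω)^[y] σ).Ok W D := by
  have key : ∀ y, N ≤ y → (Slot.micro ω)^[y] σ = σ' := by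
    intro y hy
    obtain ⟨v, rfl⟩ := Nat.exists_eq_add_of_le hy
    rw [add_comm, Function.iterate_add_apply, h.1, micro_idle h1 h2]
  refine ⟨key, fun y => ?_⟩
  rcases le_or_gt y N with hy | hy
  · exact h.2 y hy
  · rw [key y hy.le]; exact h.ok_right

end Slot

end DynMatching

namespace DynMatching

/-! ### The schedule -/

/-- The largest level `j ≤ L` such that the slot `i` is in its window of level `j`. -/
def lev (b m L i t : ℕ) : ℕ := Nat.findGreatest (fun j => t / b ^ j % m = i) L

/-- The number of ticks until the end of the present window. -/
def remTicks (b m L i t : ℕ) : ℕ := b ^ lev b m L i t - t % b ^ lev b m L i t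

/-- The level of the task on which the slot works. -/
def curLevel (b m L i t : ℕ) : ℕ := Nat.clog b (remTicks b m L i t)

/-- The time until which the last task of level `l` reached, after `t` ticks. -/
def reached (b m L i l : ℕ) : ℕ → ℕ
  | 0 => 0
  | t + 1 => if remTicks b m L i t = b ^ l then t + 1 else reached b m L i l t

/-- The epoch in which the slot has been restarted, after `t` ticks. -/
def epochOf (b m L i : ℕ) : ℕ → ℕ
  | 0 => 0
  | t + 1 => if remTicks b m L i t = b ^ L then t / (m * b ^ L) else epochOf b m L i t

section

variable {b m L i : ℕ}

lemma lev_le (t : ℕ) : lev b m L i t ≤ L := Nat.findGreatest_le _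

lemma remTicks_pos (hb : 2 ≤ b) (t : ℕ) : 1 ≤ remTicks b m L i t := by
  have : t % b ^ lev b m L i t < b ^ lev b m L i t := Nat.mod_lt _ (by positivity)
  unfold remTicks; omega

lemma remTicks_le (hb : 2 ≤ b) (t : ℕ) : remTicks b m L i t ≤ b ^ L :=
  (Nat.sub_le _ _).trans (Nat.pow_le_pow_right (by omega) (lev_le t))

/-- The value `0` also results when no level qualifies. This ambiguity is harmless: a block of level
`0` is a single tick, and being in no window is treated in the same way. -/
lemma lev_win {t : ℕ} (h : lev b m L i t ≠ 0) : t / b ^ lev b m L i t % m = i :=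
  Nat.findGreatest_of_ne_zero (P := fun j => t / b ^ j % m = i) rfl h

lemma le_lev {t j : ℕ} (hj : j ≤ L) (h : t / b ^ j % m = i) : j ≤ lev b m L i t :=
  Nat.le_findGreatest hj h

lemma not_win_of_lev_lt {t j : ℕ} (hj : j ≤ L) (h : lev b m L i t < j) : t / b ^ j % m ≠ i :=
  Nat.findGreatest_is_greatest (P := fun j => t / b ^ j % m = i) h hj

lemma succ_div_of_not_dvd {t d : ℕ} (h : ¬ d ∣ t + 1) : (t + 1) / d = t / d := by
  rw [Nat.succ_div, if_neg h, add_zero]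

/-- Windows of level `j` are aligned to multiples of `b ^ j`, so the last tick is the one before
such a multiple. -/
lemma dvd_succ_of_remTicks {t : ℕ} (hb : 2 ≤ b) :
    remTicks b m L i t = 1 ↔ b ^ lev b m L i t ∣ t + 1 := by
  have hpos : 0 < b ^ lev b m L i t := by positivity
  have hlt : t % b ^ lev b m L i t < b ^ lev b m L i t := Nat.mod_lt _ hpos
  unfold remTicks
  generalize b ^ lev b m L i t = d at *
  rw [Nat.dvd_iff_mod_eq_zero, Nat.add_mod]
  rcases Nat.eq_or_lt_of_le (show 1 ≤ d from hpos) with rfl | h1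
  · simp [Nat.mod_one]
  · rw [Nat.mod_eq_of_lt h1]
    constructor
    · intro h
      rw [show t % d + 1 = d by omega, Nat.mod_self]
    · intro h
      by_contra h2
      rw [Nat.mod_eq_of_lt (by omega)] at h
      omega

/-- Blocks of different levels are nested. A window of a higher level can only begin at a multiple
of a higher power of `b`, hence not in the interior of the present window, so the countdown is not
interrupted. -/
lemma remTicks_succ_of_gt (hb : 2 ≤ b) {t : ℕ} (h : 1 < remTicks b m L i t) :
    remTicks b m L i (t + 1) = remTicks b m L i t - 1 := by
  have hnd : ¬ b ^ lev b m L i t ∣ t + 1 := fun h' => by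
    rw [← dvd_succ_of_remTicks hb] at h'; omega
  set J := lev b m L i t with hJ
  have hJ0 : J ≠ 0 := by rintro h0; rw [h0, pow_zero] at hnd; exact hnd (one_dvd _)
  have hwin : t / b ^ J % m = i := lev_win hJ0
  have hlev : lev b m L i (t + 1) = J := by
    refine le_antisymm ?_ (le_lev (lev_le t) (by rw [succ_div_of_not_dvd hnd, hwin]))
    by_contra hlt
    push Not at hlt
    have h0 : lev b m L i (t + 1) ≠ 0 := by omega
    have h1 := lev_win h0
    have h2 := not_win_of_lev_lt (lev_le (t + 1)) (hJ ▸ hlt)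
    by_cases h3 : b ^ lev b m L i (t + 1) ∣ t + 1
    · exact hnd ((pow_dvd_pow b hlt.le).trans h3)
    · rw [succ_div_of_not_dvd h3] at h1; exact h2 h1
  have hmod : (t + 1) % b ^ J = t % b ^ J + 1 := by
    have hd : (t + 1) / b ^ J = t / b ^ J := succ_div_of_not_dvd hnd
    have e1 := Nat.div_add_mod (t + 1) (b ^ J)
    have e2 := Nat.div_add_mod t (b ^ J)
    rw [hd] at e1
    omega
  unfold remTicks
  rw [hlev, hmod, ← hJ]
  omega

/-- After a window has ended, the slot stands at the very beginning of its next one. If the new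
level is not larger, its alignment follows from that of the old window; if it is larger, the slot
has just entered the block, which again forces a block boundary. -/
lemma remTicks_succ_of_eq (hb : 2 ≤ b) {t : ℕ} (h : remTicks b m L i t = 1) :
    remTicks b m L i (t + 1) = b ^ lev b m L i (t + 1) := by
  rw [dvd_succ_of_remTicks hb] at h
  have hd : b ^ lev b m L i (t + 1) ∣ t + 1 := by
    rcases le_or_gt (lev b m L i (t + 1)) (lev b m L i t) with h1 | h1
    · exact (pow_dvd_pow b h1).trans h
    · have h2 := lev_win (b := b) (m := m) (L := L) (i := i) (t := t + 1) (by omega)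
      have h3 := not_win_of_lev_lt (lev_le (t + 1)) h1
      by_contra h4
      rw [succ_div_of_not_dvd h4] at h2
      exact h3 h2
  unfold remTicks
  rw [Nat.mod_eq_zero_of_dvd hd, Nat.sub_zero]

lemma remTicks_zero : remTicks b m L i 0 = b ^ lev b m L i 0 := by simp [remTicks]

lemma remTicks_add (hb : 2 ≤ b) {t x : ℕ} (h : x < remTicks b m L i t) :
    remTicks b m L i (t + x) = remTicks b m L i t - x := by
  induction x with
  | zero => rfl
  | succ x ih =>
    have h1 := ih (by omega)
    rw [← add_assoc, remTicks_succ_of_gt hb (by omega), h1]; omega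

/-- At every time some slot is in no window of positive level. -/
lemma exists_free (L t : ℕ) : ∃ i < L + 1, remTicks b (L + 1) L i t = 1 := by
  -- On each of the `L` positive levels exactly one residue modulo `L + 1` is active, so they cannot
  -- cover all `L + 1` slots.
  have hcard : ((Finset.Icc 1 L).image fun j => t / b ^ j % (L + 1)).card <
      (Finset.range (L + 1)).card := by
    refine lt_of_le_of_lt Finset.card_image_le ?_
    simp
  obtain ⟨i, hi, hni⟩ := Finset.exists_mem_notMem_of_card_lt_card hcard
  refine ⟨i, Finset.mem_range.1 hi, ?_⟩
  have h0 : lev b (L + 1) L i t = 0 := by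
    by_contra h
    exact hni (Finset.mem_image.2 ⟨_, Finset.mem_Icc.2 ⟨by omega, lev_le t⟩, lev_win h⟩)
  simp [remTicks, h0, Nat.mod_one]

lemma remTicks_le_pow_cur (hb : 2 ≤ b) (t : ℕ) :
    remTicks b m L i t ≤ b ^ curLevel b m L i t := Nat.le_pow_clog (by omega) _

lemma curLevel_le (hb : 2 ≤ b) (t : ℕ) : curLevel b m L i t ≤ L :=
  (Nat.clog_le_iff_le_pow (by omega)).2 (remTicks_le hb t)

lemma pow_lt_remTicks (hb : 2 ≤ b) {t l : ℕ} (h : l < curLevel b m L i t) :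
    b ^ l < remTicks b m L i t := (Nat.lt_clog_iff_pow_lt (by omega)).1 h

lemma curLevel_eq (hb : 2 ≤ b) {t l : ℕ} (h : remTicks b m L i t = b ^ l) :
    curLevel b m L i t = l := by rw [curLevel, h, Nat.clog_pow _ _ (by omega)]

/-- In the middle of a task the preceding tick belongs to the same window and the same task. -/
lemma prev_of_not_start (hb : 2 ≤ b) {t : ℕ}
    (h : remTicks b m L i (t + 1) ≠ b ^ curLevel b m L i (t + 1)) :
    remTicks b m L i t = remTicks b m L i (t + 1) + 1 ∧
      curLevel b m L i t = curLevel b m L i (t + 1) := by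
  have hp := remTicks_pos (m := m) (L := L) (i := i) hb t
  have h1 : 1 < remTicks b m L i t := by
    by_contra h1
    have h2 := remTicks_succ_of_eq (m := m) (L := L) (i := i) hb (t := t) (by omega)
    exact h (by rw [curLevel_eq hb h2, h2])
  have h2 := remTicks_succ_of_gt hb h1
  have h3 := remTicks_le_pow_cur (m := m) (L := L) (i := i) hb (t + 1)
  refine ⟨by omega, le_antisymm ?_ (Nat.clog_mono_right b (by omega))⟩
  exact (Nat.clog_le_iff_le_pow (by omega)).2 (by omega)

/-- A task of level `l` starts either as the first one after a finished window or directly after the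
task of level `l + 1` of the same window. -/
lemma prev_of_start (hb : 2 ≤ b) {t l : ℕ} (h : remTicks b m L i (t + 1) = b ^ l) :
    remTicks b m L i t = 1 ∨
      (remTicks b m L i t = b ^ l + 1 ∧ curLevel b m L i t = l + 1) := by
  have hp := remTicks_pos (m := m) (L := L) (i := i) hb t
  by_cases h1 : remTicks b m L i t = 1
  · exact Or.inl h1
  · have h2 := remTicks_succ_of_gt (m := m) (L := L) (i := i) hb (t := t) (by omega)
    have h3 : remTicks b m L i t = b ^ l + 1 := by omega
    refine Or.inr ⟨h3, le_antisymm ?_ ?_⟩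
    · refine (Nat.clog_le_iff_le_pow (by omega)).2 ?_
      rw [h3, pow_succ]
      have : 1 ≤ b ^ l := Nat.one_le_pow _ _ (by omega)
      nlinarith
    · exact (Nat.lt_clog_iff_pow_lt (by omega)).2 (by omega)

lemma reached_le (l t : ℕ) : reached b m L i l t ≤ t := by
  induction t with
  | zero => exact le_rfl
  | succ t ih => unfold reached; split_ifs <;> omega

lemma reached_mono (l : ℕ) {t t' : ℕ} (h : t ≤ t') :
    reached b m L i l t ≤ reached b m L i l t' := by
  induction t', h using Nat.le_induction with
  | base => exact le_rfl
  | succ t' _ ih =>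
    refine ih.trans ?_
    have := reached_le (b := b) (m := m) (L := L) (i := i) l t'
    rw [reached]; split_ifs <;> omega

/-- The last start of a window of level `l` before the time `t`. -/
lemma exists_window (hb : 2 ≤ b) (hi : i < m) (l t : ℕ) :
    t < m * b ^ l ∨ ∃ s, s ≤ t ∧ t < s + m * b ^ l ∧ b ^ l ∣ s ∧ s / b ^ l % m = i := by
  have hpos : 0 < b ^ l := by positivity
  rcases le_or_gt (i * b ^ l) t with h | h
  · right
    have hm : 0 < m * b ^ l := Nat.mul_pos (by omega) hpos
    set q := (t - i * b ^ l) / (m * b ^ l) with hq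
    have e := Nat.div_add_mod (t - i * b ^ l) (m * b ^ l)
    have hlt := Nat.mod_lt (t - i * b ^ l) hm
    rw [← hq] at e
    refine ⟨(i + m * q) * b ^ l, ?_, ?_, Dvd.intro_left _ rfl, ?_⟩
    · rw [add_mul, show m * q * b ^ l = m * b ^ l * q by ring]; omega
    · rw [add_mul, show m * q * b ^ l = m * b ^ l * q by ring]; omega
    · rw [Nat.mul_div_cancel _ hpos, Nat.add_mul_mod_self_left, Nat.mod_eq_of_lt hi]
  · left
    exact h.trans_le (Nat.mul_le_mul hi.le le_rfl)

/-- Take the last start `s ≤ t` of a block of level `l` of this slot. The window present at `s` has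
level at least `l` and its remaining length is a multiple of `b ^ l`, so its countdown passes
through `b ^ l`, where a task of level `l` starts. If this happened only after `t`, the countdown at
`t` would still exceed `b ^ l`. -/
lemma le_reached_add (hb : 2 ≤ b) (hi : i < m) {l t : ℕ} (hl : l ≤ L)
    (h : remTicks b m L i t ≤ b ^ l) : t + 1 ≤ reached b m L i l (t + 1) + m * b ^ l := by
  rcases exists_window hb hi l t with h1 | ⟨s, h1, h2, h3, h4⟩
  · omega
  have hJ : l ≤ lev b m L i s := le_lev hl h4
  have hpos : 1 ≤ remTicks b m L i s := remTicks_pos hb s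
  have hdvd : b ^ l ∣ remTicks b m L i s := by
    have hp : b ^ l ∣ b ^ lev b m L i s := pow_dvd_pow b hJ
    exact Nat.dvd_sub hp ((Nat.dvd_mod_iff hp).2 h3)
  have hge : b ^ l ≤ remTicks b m L i s := Nat.le_of_dvd hpos hdvd
  have hbl : 0 < b ^ l := by positivity
  have hle : s + (remTicks b m L i s - b ^ l) ≤ t := by
    by_contra hgt
    obtain ⟨x, rfl⟩ := Nat.exists_eq_add_of_le h1
    have := remTicks_add (m := m) (L := L) (i := i) hb (t := s) (x := x) (by omega)
    omega
  have hstart : remTicks b m L i (s + (remTicks b m L i s - b ^ l)) = b ^ l := by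
    rw [remTicks_add hb (by omega)]; omega
  have := reached_mono (b := b) (m := m) (L := L) (i := i) l (Nat.add_le_add_right hle 1)
  rw [reached, if_pos hstart] at this
  omega

/-- Going back from `t` to the last start of a task of level `l`, the countdown never exceeds `b ^
l`. So no task of level `l + 1` starts in between, and the mark of level `l` is the more recent one.
-/
lemma reached_anti (hb : 2 ≤ b) {l t : ℕ} (h : remTicks b m L i t ≤ b ^ l) :
    reached b m L i (l + 1) (t + 1) ≤ reached b m L i l (t + 1) := by
  have hlt : b ^ l < b ^ (l + 1) := Nat.pow_lt_pow_right (by omega) (by omega)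
  by_cases h1 : remTicks b m L i t = b ^ l
  · rw [reached.eq_2 _ _ _ _ l, if_pos h1]; exact reached_le _ _
  · have h2 : remTicks b m L i t ≠ b ^ (l + 1) := by omega
    rw [reached, reached, if_neg h1, if_neg h2]
    induction t with
    | zero => exact le_rfl
    | succ t ih =>
      have h3 : remTicks b m L i t ≤ b ^ l := by
        rcases Nat.eq_or_lt_of_le (remTicks_pos (m := m) (L := L) (i := i) hb t) with h4 | h4
        · have : 1 ≤ b ^ l := Nat.one_le_pow _ _ (by omega)
          omega
        · have := remTicks_succ_of_gt hb h4; omega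
      by_cases h5 : remTicks b m L i t = b ^ l
      · rw [reached.eq_2 _ _ _ _ l, if_pos h5]; exact reached_le _ _
      · have h6 : remTicks b m L i t ≠ b ^ (l + 1) := by omega
        rw [reached, reached, if_neg h5, if_neg h6]
        exact ih h3 h5 h6

lemma epochOf_le (t : ℕ) : epochOf b m L i (t + 1) ≤ t / (m * b ^ L) := by
  induction t with
  | zero => unfold epochOf; split_ifs <;> simp [epochOf]
  | succ t ih =>
    rw [epochOf]; split_ifs
    · exact le_rfl
    · exact ih.trans (Nat.div_le_div_right (Nat.le_succ _))

lemma epochOf_mono {t t' : ℕ} (h : t ≤ t') : epochOf b m L i t ≤ epochOf b m L i t' := by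
  induction t', h using Nat.le_induction with
  | base => exact le_rfl
  | succ t' _ ih =>
    refine ih.trans ?_
    rw [epochOf]; split_ifs
    · rcases t' with _ | t'
      · simp [epochOf]
      · exact (epochOf_le t').trans (Nat.div_le_div_right (Nat.le_succ _))
    · exact le_rfl

/-- The slot restarts within the epoch that it records, hence not before the beginning of that
epoch. -/
lemma epochOf_mul_le (t : ℕ) : epochOf b m L i t * (m * b ^ L) ≤ reached b m L i L t := by
  induction t with
  | zero => simp [epochOf]
  | succ t ih =>
    rw [epochOf, reached]; split_ifs
    · exact (Nat.div_mul_le_self _ _).trans (Nat.le_succ _)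
    · exact ih

/-- Every epoch contains exactly one window of level `L` of the slot, so the recorded epoch is at
most one behind the current one. -/
lemma lt_epochOf_add (hb : 2 ≤ b) (hi : i < m) (t : ℕ) :
    t < (epochOf b m L i (t + 1) + 2) * (m * b ^ L) := by
  have hm : 0 < m * b ^ L := Nat.mul_pos (by omega) (by positivity)
  rcases exists_window hb hi L t with h1 | ⟨s, h1, h2, h3, h4⟩
  · exact h1.trans_le (Nat.le_mul_of_pos_left _ (by omega))
  · have hJ : lev b m L i s = L := le_antisymm (lev_le s) (le_lev le_rfl h4)
    have hrem : remTicks b m L i s = b ^ L := by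
      rw [remTicks, hJ, Nat.mod_eq_zero_of_dvd h3, Nat.sub_zero]
    have h5 := epochOf_mono (b := b) (m := m) (L := L) (i := i) (Nat.add_le_add_right h1 1)
    rw [epochOf, if_pos hrem] at h5
    have h6 := Nat.lt_div_mul_add hm (a := s)
    have h7 := Nat.mul_le_mul_right (m * b ^ L) h5
    rw [add_mul]; omega

/-- A task of the top level runs within a window of level `L`, and such a window does not cross the
boundary of an epoch. Thus the edge table that the task reads stays the same until the task is over.
-/
lemma epochOf_eq (hb : 2 ≤ b) {t : ℕ} (h : curLevel b m L i t = L) (hL : 1 ≤ L) :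
    epochOf b m L i (t + 1) = t / (m * b ^ L) := by
  have key : ∀ t, curLevel b m L i t = L → remTicks b m L i t ≠ b ^ L → lev b m L i t = L := by
    intro t h _
    by_contra h2
    have h3 : b ^ (L - 1) < remTicks b m L i t := pow_lt_remTicks hb (by omega)
    have h4 : remTicks b m L i t ≤ b ^ lev b m L i t := Nat.sub_le _ _
    have h5 := lev_le (b := b) (m := m) (L := L) (i := i) t
    have h6 : b ^ lev b m L i t ≤ b ^ (L - 1) := Nat.pow_le_pow_right (by omega) (by omega)
    omega
  induction t with
  | zero =>
    rw [epochOf]; split_ifs with h1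
    · rfl
    · have h2 := key 0 h h1
      exact absurd (by rw [remTicks_zero, h2]) h1
  | succ t ih =>
    rw [epochOf]; split_ifs with h1
    · rfl
    · have h2 := key _ h h1
      obtain ⟨h3, h4⟩ := prev_of_not_start hb (by rw [h]; exact h1)
      rw [ih (h4.trans h)]
      have hnd : ¬ b ^ L ∣ t + 1 := by
        intro hd
        rw [remTicks, h2, Nat.mod_eq_zero_of_dvd hd, Nat.sub_zero] at h1
        exact h1 rfl
      rw [mul_comm m, ← Nat.div_div_eq_div_mul, ← Nat.div_div_eq_div_mul, succ_div_of_not_dvd hnd]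

end

end DynMatching

namespace DynMatching

/-! ### Rebuilding a graph by insertions -/

section

variable {n : ℕ}

/-- Every update is legal at the time when it arrives, starting with the graph `G`. -/
def LegalFrom (G : SimpleGraph (Fin n)) : List (Update n) → Prop
  | [] => True
  | e :: l => e.Legal G ∧ LegalFrom (e.apply G) l

lemma applyAll_append (G : SimpleGraph (Fin n)) (l l' : List (Update n)) :
    applyAll G (l ++ l') = applyAll (applyAll G l) l' := List.foldl_append ..

lemma legalFrom_append {l l' : List (Update n)} {G : SimpleGraph (Fin n)} :
    LegalFrom G (l ++ l') ↔ LegalFrom G l ∧ LegalFrom (applyAll G l) l' := by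
  induction l generalizing G with
  | nil => simp [LegalFrom, applyAll]
  | cons e l ih =>
    simp only [List.cons_append, LegalFrom, ih, and_assoc]
    rfl

lemma legalFrom_iff {G : SimpleGraph (Fin n)} {l : List (Update n)} :
    LegalFrom G l ↔ ∀ i (h : i < l.length), (l[i]).Legal (applyAll G (l.take i)) := by
  induction l generalizing G with
  | nil => simp [LegalFrom]
  | cons e l ih =>
    rw [LegalFrom, ih]
    constructor
    · rintro ⟨h1, h2⟩ (_ | i) h
      · exact h1
      · exact h2 i (by simpa using h)
    · intro h
      exact ⟨h 0 (by simp), fun i hi => h (i + 1) (by simpa using hi)⟩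

lemma legalSeq_iff {l : List (Update n)} : LegalSeq l ↔ LegalFrom ⊥ l := legalFrom_iff.symm

/-- The updates with numbers from `p` to `q - 1`. -/
def slice (I : List (Update n)) (p q : ℕ) : List (Update n) := (I.take q).drop p

lemma take_append_slice (I : List (Update n)) {p q : ℕ} (h : p ≤ q) :
    I.take p ++ slice I p q = I.take q := by
  unfold slice
  conv_rhs => rw [← List.take_append_drop p (I.take q)]
  rw [List.take_take, min_eq_left h]

lemma slice_append_slice (I : List (Update n)) {p q r : ℕ} (h : p ≤ q) (h' : q ≤ r) :
    slice I p q ++ slice I q r = slice I p r := by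
  have h1 := take_append_slice I (h.trans h')
  rw [← take_append_slice I h', ← take_append_slice I h, List.append_assoc] at h1
  exact (List.append_cancel_left h1).symm

lemma slice_length_le (I : List (Update n)) (p q : ℕ) : (slice I p q).length ≤ q - p := by
  simp only [slice, List.length_drop, List.length_take]; omega

lemma slice_length_le_length (I : List (Update n)) (p q : ℕ) :
    (slice I p q).length ≤ I.length := by
  simp only [slice, List.length_drop, List.length_take]; omega

/-- The number of the pair `uv`. -/
def pairIndex (u v : Fin n) : ℕ := if u < v then u * n + v else v * n + u

lemma pairIndex_comm (u v : Fin n) : pairIndex u v = pairIndex v u := by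
  unfold pairIndex
  rcases lt_trichotomy u v with h | rfl | h
  · rw [if_pos h, if_neg h.asymm]
  · rfl
  · rw [if_neg h.asymm, if_pos h]

open Classical in
/-- The insertion of the pair number `x` if it is an edge of `G`. -/
noncomputable def baseItem (G : SimpleGraph (Fin n)) (x : ℕ) : Option (Update n) :=
  if h : x / n < n ∧ x % n < n then
    if x / n < x % n ∧ G.Adj ⟨x / n, h.1⟩ ⟨x % n, h.2⟩ then some ⟨true, ⟨x / n, h.1⟩, ⟨x % n, h.2⟩⟩
    else none
  else none

lemma index_div_mod (u v : Fin n) : (u * n + v : ℕ) / n = u ∧ (u * n + v : ℕ) % n = v := by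
  have hn : 0 < n := Fin.pos u
  constructor
  · rw [add_comm, Nat.add_mul_div_right _ _ hn, Nat.div_eq_of_lt v.2, zero_add]
  · rw [add_comm, Nat.add_mul_mod_self_right, Nat.mod_eq_of_lt v.2]

/-- Only the orientation with the smaller endpoint first counts, so each edge is inserted once. -/
lemma baseItem_eq_some {G : SimpleGraph (Fin n)} {x : ℕ} {e : Update n} :
    baseItem G x = some e ↔ e.isInsert = true ∧ e.u < e.v ∧ G.Adj e.u e.v ∧ x = e.u * n + e.v := by
  obtain ⟨s, u, v⟩ := e
  unfold baseItem
  constructor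
  · intro h
    split_ifs at h with h1 h2
    simp only [Option.some.injEq, Update.mk.injEq] at h
    obtain ⟨rfl, rfl, rfl⟩ := h
    exact ⟨rfl, h2.1, h2.2, (Nat.div_add_mod' x n).symm⟩
  · rintro ⟨rfl, h2, h3, rfl⟩
    obtain ⟨e1, e2⟩ := index_div_mod u v
    have h4 : (u * n + v : ℕ) / n < n ∧ (u * n + v : ℕ) % n < n := by
      rw [e1, e2]; exact ⟨u.2, v.2⟩
    have f1 : (⟨(u * n + v : ℕ) / n, h4.1⟩ : Fin n) = u := Fin.ext e1
    have f2 : (⟨(u * n + v : ℕ) % n, h4.2⟩ : Fin n) = v := Fin.ext e2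
    rw [dif_pos h4, f1, f2, e1, e2, if_pos ⟨h2, h3⟩]

/-- The edges of `G` as insertions. -/
noncomputable def baseList (G : SimpleGraph (Fin n)) (x : ℕ) : List (Update n) :=
  (List.range x).filterMap (baseItem G)

lemma baseList_length (G : SimpleGraph (Fin n)) (x : ℕ) : (baseList G x).length ≤ x :=
  (List.length_filterMap_le _ _).trans (by simp)

lemma pairIndex_lt (u v : Fin n) : pairIndex u v < n * n := by
  have : ∀ u v : Fin n, (u * n + v : ℕ) < n * n := fun u v => by
    have h1 := u.2
    have h2 := v.2
    nlinarith
  unfold pairIndex; split_ifs <;> exact this _ _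

lemma pairIndex_inj {u v u' v' : Fin n} (h : pairIndex u v = pairIndex u' v') :
    (u = u' ∧ v = v') ∨ (u = v' ∧ v = u') := by
  have key : ∀ {u v u' v' : Fin n}, (u * n + v : ℕ) = u' * n + v' → u = u' ∧ v = v' := by
    intro u v u' v' h
    obtain ⟨e1, e2⟩ := index_div_mod u v
    obtain ⟨f1, f2⟩ := index_div_mod u' v'
    rw [h] at e1 e2
    exact ⟨Fin.ext (e1.symm.trans f1), Fin.ext (e2.symm.trans f2)⟩
  unfold pairIndex at h
  split_ifs at h
  · exact Or.inl (key h)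
  · exact Or.inr (key h)
  · exact Or.inr ⟨(key h).2, (key h).1⟩
  · exact Or.inl ⟨(key h).2, (key h).1⟩

lemma applyAll_baseList (G : SimpleGraph (Fin n)) (x : ℕ) (a c : Fin n) :
    ((applyAll ⊥ (baseList G x)).Adj a c ↔ G.Adj a c ∧ pairIndex a c < x) ∧
      LegalFrom ⊥ (baseList G x) := by
  induction x generalizing a c with
  | zero => simp [baseList, applyAll, LegalFrom]
  | succ x ih =>
    have hb : baseList G (x + 1) = baseList G x ++ (baseItem G x).toList := by
      unfold baseList
      rw [List.range_succ, List.filterMap_append]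
      rcases h : baseItem G x with _ | e <;> simp [h]
    rw [hb, applyAll_append, legalFrom_append]
    rcases h : baseItem G x with _ | e
    · refine ⟨?_, (ih a c).2, trivial⟩
      simp only [Option.toList, applyAll, List.foldl_nil]
      refine (ih a c).1.trans (and_congr_right fun hadj => ?_)
      constructor
      · intro h'; omega
      · intro h'
        rcases Nat.lt_succ_iff_lt_or_eq.1 h' with h1 | h1
        · exact h1
        · exfalso
          have hne := hadj.ne
          unfold pairIndex at h1
          split_ifs at h1 with h2
          · have := (baseItem_eq_some (e := ⟨true, a, c⟩)).2 ⟨rfl, h2, hadj, h1.symm⟩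
            rw [h] at this; cases this
          · have := (baseItem_eq_some (e := ⟨true, c, a⟩)).2
              ⟨rfl, lt_of_le_of_ne (not_lt.1 h2) hne.symm, hadj.symm, h1.symm⟩
            rw [h] at this; cases this
    · obtain ⟨h1, h2, h3, h4⟩ := baseItem_eq_some.1 h
      have hidx : pairIndex e.u e.v = x := by rw [pairIndex, if_pos h2, h4]
      refine ⟨?_, (ih a c).2, ⟨h2.ne, ?_⟩, trivial⟩
      · simp only [Option.toList, applyAll, List.foldl_cons, List.foldl_nil, Update.apply, h1,
          if_true]
        change (applyAll ⊥ (baseList G x) ⊔ _).Adj a c ↔ _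
        rw [SimpleGraph.sup_adj, (ih a c).1, SimpleGraph.edge_adj]
        constructor
        · rintro (⟨h5, h6⟩ | ⟨⟨rfl, rfl⟩ | ⟨rfl, rfl⟩, _⟩)
          · exact ⟨h5, by omega⟩
          · exact ⟨h3, by omega⟩
          · exact ⟨h3.symm, by rw [pairIndex_comm]; omega⟩
        · rintro ⟨h5, h6⟩
          rcases Nat.lt_succ_iff_lt_or_eq.1 h6 with h7 | h7
          · exact Or.inl ⟨h5, h7⟩
          · right
            refine ⟨?_, h5.ne⟩
            exact (pairIndex_inj (h7.trans hidx.symm))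
      -- The insertion is legal because only pairs with a number below `x` have been inserted
      -- before.
      · rw [(ih e.u e.v).1, hidx, h1]
        simp

lemma graphAfter_baseList (G : SimpleGraph (Fin n)) : graphAfter (baseList G (n * n)) = G := by
  ext a c
  exact ((applyAll_baseList G (n * n) a c).1).trans (and_iff_left (pairIndex_lt a c))

lemma legalFrom_baseList (G : SimpleGraph (Fin n)) : LegalFrom ⊥ (baseList G (n * n)) := by
  rcases n with _ | n
  · simp [baseList, LegalFrom]
  · exact (applyAll_baseList G _ 0 0).2

/-- Rebuilding the graph at time `p` and replaying the updates up to `q` replaces the true history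
before `p`, which may be far longer than `n * n`. -/
lemma graphAfter_base_slice (I : List (Update n)) {p q : ℕ} (h : p ≤ q) :
    graphAfter (baseList (graphAfter (I.take p)) (n * n) ++ slice I p q) =
      graphAfter (I.take q) := by
  rw [graphAfter, applyAll_append]
  change applyAll (graphAfter _) _ = _
  rw [graphAfter_baseList, graphAfter, ← applyAll_append, take_append_slice I h]
  rfl

lemma legalSeq_base_slice {I : List (Update n)} (hI : LegalSeq I) {p q : ℕ} (h : p ≤ q) :
    LegalSeq (baseList (graphAfter (I.take p)) (n * n) ++ slice I p q) := by
  rw [legalSeq_iff] at *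
  refine legalFrom_append.2 ⟨legalFrom_baseList _, ?_⟩
  change LegalFrom (graphAfter _) _
  rw [graphAfter_baseList]
  rw [← List.take_append_drop q I, ← take_append_slice I h] at hI
  exact (legalFrom_append.1 (legalFrom_append.1 hI).1).2

/-- The table of edges of `G`. -/
noncomputable def edgeTable (G : SimpleGraph (Fin n)) (x : ℕ) : ℕ :=
  if (baseItem G x).isSome then 1 else 0

lemma edgeTable_bot : edgeTable (⊥ : SimpleGraph (Fin n)) = fun _ => 0 := by
  funext x; simp [edgeTable, baseItem]

/-- This is the form in which a slot reads the insertions off the table, one pair at a time, without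
a list of edges in memory. -/
lemma baseItem_code (G : SimpleGraph (Fin n)) (x : ℕ) :
    (baseItem G x).map Update.code =
      if 0 < edgeTable G x then some (1, x / n, x % n) else none := by
  unfold edgeTable
  rcases h : baseItem G x with _ | e
  · simp
  · obtain ⟨h1, h2, h3, h4⟩ := baseItem_eq_some.1 h
    obtain ⟨e1, e2⟩ := index_div_mod e.u e.v
    simp [Update.code, h1, h4, e1, e2]

lemma isSome_baseItem_pairIndex (G : SimpleGraph (Fin n)) {u v : Fin n} (huv : u ≠ v) :
    (baseItem G (pairIndex u v)).isSome ↔ G.Adj u v := by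
  wlog h : u < v generalizing u v with H
  · rw [pairIndex_comm, SimpleGraph.adj_comm]
    exact H huv.symm (lt_of_le_of_ne (not_lt.1 h) huv.symm)
  · rw [pairIndex, if_pos h, Option.isSome_iff_exists]
    constructor
    · rintro ⟨e, he⟩
      obtain ⟨h1, h2, h3, h4⟩ := baseItem_eq_some.1 he
      obtain ⟨e1, e2⟩ := index_div_mod e.u e.v
      obtain ⟨f1, f2⟩ := index_div_mod u v
      rw [h4] at f1 f2
      rw [← Fin.ext (e1.symm.trans f1), ← Fin.ext (e2.symm.trans f2)]
      exact h3
    · intro h'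
      exact ⟨⟨true, u, v⟩, baseItem_eq_some.2 ⟨rfl, h, h', rfl⟩⟩

/-- One update changes one entry, so advancing a table costs constant time per update. -/
lemma edgeTable_apply (G : SimpleGraph (Fin n)) {e : Update n} (he : e.u ≠ e.v) :
    edgeTable (e.apply G) =
      Function.update (edgeTable G) (pairIndex e.u e.v) e.isInsert.toNat := by
  funext x
  rw [Function.update_apply]
  split_ifs with hx
  · subst hx
    have h1 : (e.apply G).Adj e.u e.v ↔ e.isInsert = true := by
      unfold Update.apply
      rcases e.isInsert
      · simp
      · simp [SimpleGraph.edge_adj, he]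
    simp only [edgeTable, isSome_baseItem_pairIndex _ he, h1]
    rcases e.isInsert <;> simp
  · unfold edgeTable
    congr 1
    simp only [eq_iff_iff]
    have key : ∀ a c : Fin n, a < c → x = a * n + c → ((e.apply G).Adj a c ↔ G.Adj a c) := by
      intro a c hac hxe
      have hne : pairIndex a c ≠ pairIndex e.u e.v := by
        rw [pairIndex, if_pos hac, ← hxe]; exact hx
      have h1 : ¬ ((a = e.u ∧ c = e.v) ∨ (a = e.v ∧ c = e.u)) := by
        rintro (⟨h1, h2⟩ | ⟨h1, h2⟩)
        · exact hne (by rw [h1, h2])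
        · exact hne (by rw [h1, h2, pairIndex_comm])
      unfold Update.apply
      split_ifs
      · rw [SimpleGraph.sup_adj, SimpleGraph.edge_adj]
        tauto
      · rw [SimpleGraph.deleteEdges_adj]
        simp only [Set.mem_singleton_iff, Sym2.eq_iff]
        tauto
    simp only [Option.isSome_iff_exists, baseItem_eq_some]
    exact exists_congr fun e' => and_congr_right fun _ => ⟨fun ⟨h2, h3, h4⟩ =>
      ⟨h2, (key _ _ h2 h4).1 h3, h4⟩, fun ⟨h2, h3, h4⟩ => ⟨h2, (key _ _ h2 h4).2 h3, h4⟩⟩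

lemma edgeTable_take_succ {I : List (Update n)} (hI : LegalSeq I) {x : ℕ} (hx : x < I.length) :
    edgeTable (graphAfter (I.take (x + 1))) = Function.update (edgeTable (graphAfter (I.take x)))
      (pairIndex (I[x]).u (I[x]).v) (I[x]).isInsert.toNat := by
  rw [← edgeTable_apply _ (hI x hx).1, List.take_add_one, List.getElem?_eq_getElem hx,
    graphAfter, applyAll_append]
  rfl

end

end DynMatching

namespace DynMatching

/-! ### The program: simulating a slot

Variables: `4` number of arrays, `5` `n`, `6` `k`, `7` `T`, `8` `n²`, `9` work per tick, `10` number
of ticks, `11` length of an epoch, `12` array of the table of edges in use, `13` slot, `14` first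
array of the slot, `15` length of the log, `16` its goal, `17` mode, `18` location, `19` mark of the
next update, `20` next pair to be inserted, `21` next update, `22` time to be reached, `23` depth of
the task; the others are auxiliary.

Arrays: `0`, `1`, `2` the updates, `3`, `4` tables of edges; each slot has eight arrays, for the
cells, the addresses and values of the log, the lengths of the log and the times at which tasks
start, and variables. -/

instance : Add Ex := ⟨Ex.bin .add⟩
instance : Sub Ex := ⟨Ex.bin .sub⟩
instance : Mul Ex := ⟨Ex.bin .mul⟩
instance : Div Ex := ⟨Ex.bin .div⟩
instance : Mod Ex := ⟨Ex.bin .mod⟩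

section

variable (M : ℕ) (h : HS) (a b : Ex)

@[simp] lemma Ex.eval_var (r : ℕ) : (Ex.var r).eval h = h.reg r := rfl
@[simp] lemma Ex.eval_lit (c : ℕ) : (Ex.lit c).eval h = c := rfl
@[simp] lemma Ex.eval_get : (Ex.get a b).eval h = h.arr (a.eval h) (b.eval h) := rfl
@[simp] lemma Ex.eval_add : (a + b).eval h = a.eval h + b.eval h := rfl
@[simp] lemma Ex.eval_sub : (a - b).eval h = a.eval h - b.eval h := rfl
@[simp] lemma Ex.eval_mul : (a * b).eval h = a.eval h * b.eval h := rfl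
@[simp] lemma Ex.eval_div : (a / b).eval h = a.eval h / b.eval h := rfl
@[simp] lemma Ex.eval_mod : (a % b).eval h = a.eval h % b.eval h := rfl
@[simp] lemma Ex.ok_var (r : ℕ) : (Ex.var r).Ok M h ↔ r < 40 := Iff.rfl
@[simp] lemma Ex.ok_lit (c : ℕ) : (Ex.lit c).Ok M h := trivial
@[simp] lemma Ex.ok_get : (Ex.get a b).Ok M h ↔ a.Ok M h ∧ b.Ok M h ∧ a.eval h < M := Iff.rfl
@[simp] lemma Ex.ok_add : (a + b).Ok M h ↔ a.Ok M h ∧ b.Ok M h := Iff.rfl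
@[simp] lemma Ex.ok_sub : (a - b).Ok M h ↔ a.Ok M h ∧ b.Ok M h := Iff.rfl
@[simp] lemma Ex.ok_mul : (a * b).Ok M h ↔ a.Ok M h ∧ b.Ok M h := Iff.rfl
@[simp] lemma Ex.ok_div : (a / b).Ok M h ↔ a.Ok M h ∧ b.Ok M h := Iff.rfl
@[simp] lemma Ex.ok_mod : (a % b).Ok M h ↔ a.Ok M h ∧ b.Ok M h := Iff.rfl

end

notation:60 a:61 ";;" b:60 => Stm.seq a b

open Ex (var lit get)

/-- Do nothing. -/
def skipStm : Stm := .assign 33 (lit 0)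

/-- Write the variable `25` into the cell with the address in `24` and record this in the log. -/
def logWrite : Stm :=
  .set (var 14 + lit 1) (var 15) (var 24) ;;
  .set (var 14 + lit 2) (var 15) (get (var 14) (var 24)) ;;
  .set (var 14) (var 24) (var 25) ;;
  .assign 15 (var 15 + lit 1)

/-- Hand over the update in the variables `30`, `31`, `32` to the slot. -/
def feedStm (entry : ℕ) : Stm :=
  .assign 24 (lit 0) ;; .assign 25 (var 30) ;; logWrite ;;
  .assign 24 (lit 2) ;; .assign 25 (var 31) ;; logWrite ;;
  .assign 24 (lit 4) ;; .assign 25 (var 32) ;; logWrite ;;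
  .assign 24 (lit 6) ;; .assign 25 (var 19) ;; logWrite ;;
  .assign 18 (lit entry) ;; .assign 17 (lit 1) ;; .assign 19 (lit 0)

/-- Fetch the next update. -/
def fetchStm (entry : ℕ) : Stm :=
  .ite (var 20) (var 8)
    (.assign 33 (var 20) ;; .assign 20 (var 20 + lit 1) ;;
      .ite (lit 0) (get (var 12) (var 33))
        (.assign 30 (lit 1) ;; .assign 31 (var 33 / var 5) ;; .assign 32 (var 33 % var 5) ;;
          feedStm entry)
        skipStm)
    (.ite (var 21) (var 22)
      (.assign 30 (get (lit 0) (var 21)) ;; .assign 31 (get (lit 1) (var 21)) ;;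
        .assign 32 (get (lit 2) (var 21)) ;; .assign 21 (var 21 + lit 1) ;; feedStm entry)
      skipStm)

/-- One step of the simulated algorithm, for a given instruction. -/
def instrStm {τ : Type} (enc : τ → ℕ) : Instr τ → Stm
  | .const r c q => .assign 24 (lit (2 * r)) ;; .assign 25 (lit c) ;; .assign 18 (lit (enc q)) ;;
      logWrite
  | .op f r s t q => .assign 30 (get (var 14) (lit (2 * s))) ;;
      .assign 31 (get (var 14) (lit (2 * t))) ;; .opr f 25 30 31 ;; .assign 24 (lit (2 * r)) ;;
      .assign 18 (lit (enc q)) ;; logWrite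
  | .load r s q => .assign 25 (get (var 14) (lit 2 * get (var 14) (lit (2 * s)) + lit 1)) ;;
      .assign 24 (lit (2 * r)) ;; .assign 18 (lit (enc q)) ;; logWrite
  | .store r s q => .assign 24 (lit 2 * get (var 14) (lit (2 * r)) + lit 1) ;;
      .assign 25 (get (var 14) (lit (2 * s))) ;; .assign 18 (lit (enc q)) ;; logWrite
  | .rand r s q => .assign 30 (get (var 14) (lit (2 * s))) ;; .rand 25 30 ;;
      .assign 24 (lit (2 * r)) ;; .assign 18 (lit (enc q)) ;; logWrite
  | .branch r s q q' => .ite (get (var 14) (lit (2 * r))) (get (var 14) (lit (2 * s)))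
      (.assign 18 (lit (enc q))) (.assign 18 (lit (enc q')))
  | .halt => .assign 17 (lit 0)

/-- Execute the statement whose number is in the variable `18`. -/
def dispatch (q : ℕ) : List Stm → Stm
  | [] => skipStm
  | c :: cs => .ite (var 18) (lit (q + 1)) c (dispatch (q + 1) cs)

/-- Undo one write. -/
def undoStm : Stm :=
  .ite (var 16) (var 15)
    (.assign 15 (var 15 - lit 1) ;;
      .set (var 14) (get (var 14 + lit 1) (var 15)) (get (var 14 + lit 2) (var 15)))
    (.assign 17 (lit 0))

/-- One unit of work; the locations of the simulated algorithm are numbered by `enc`. -/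
def microStm {A : Program} {Q : ℕ} (enc : A.Loc ≃ Fin Q) : Stm :=
  .ite (var 17) (lit 1) (fetchStm (enc A.entry))
    (.ite (var 17) (lit 2)
      (dispatch 0 (List.ofFn fun j => instrStm (fun q => (enc q : ℕ)) (A.code (enc.symm j))))
      undoStm)

/-- The log is in the arrays. -/
def LogRep (f g : ℕ → ℕ) : List (ℕ × ℕ) → Prop
  | [] => True
  | p :: l => f l.length = p.1 ∧ g l.length = p.2 ∧ LogRep f g l

lemma LogRep.update {f g : ℕ → ℕ} {l : List (ℕ × ℕ)} (h : LogRep f g l) {x y u v : ℕ}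
    (hx : l.length ≤ x) (hy : l.length ≤ y) :
    LogRep (Function.update f x u) (Function.update g y v) l := by
  induction l with
  | nil => trivial
  | cons p l ih =>
    simp only [List.length_cons] at hx hy
    refine ⟨?_, ?_, ih h.2.2 (by omega) (by omega)⟩
    · rw [Function.update_of_ne (by omega)]; exact h.1
    · rw [Function.update_of_ne (by omega)]; exact h.2.1

/-- The cells and the log of a slot are in its arrays. -/
structure Core (M : ℕ) (h : HS) (S : ℕ → ℕ) (log : List (ℕ × ℕ)) : Prop where
  le : 8 ≤ h.reg 14
  lt : h.reg 14 + 8 ≤ M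
  cells : h.arr (h.reg 14) = S
  logRep : LogRep (h.arr (h.reg 14 + 1)) (h.arr (h.reg 14 + 2)) log
  len : h.reg 15 = log.length

lemma Core.congr {M : ℕ} {h h' : HS} {S : ℕ → ℕ} {log : List (ℕ × ℕ)} (hc : Core M h S log)
    (h14 : h'.reg 14 = h.reg 14) (h15 : h'.reg 15 = h.reg 15)
    (harr : ∀ x < 3, h'.arr (h.reg 14 + x) = h.arr (h.reg 14 + x)) : Core M h' S log := by
  refine ⟨h14 ▸ hc.le, h14 ▸ hc.lt, ?_, ?_, h15.trans hc.len⟩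
  · rw [h14]; exact (harr 0 (by omega)).trans hc.cells
  · rw [h14, harr 1 (by omega), harr 2 (by omega)]; exact hc.logRep

section

variable {ω : ℕ → ℕ} {M Y : ℕ}

/-- The old cell value must be logged before the cell is overwritten. The rule takes an arbitrary
postcondition, so that it can be chained four times when an update is handed over. -/
lemma wp_logWrite {h : HS} {S : ℕ → ℕ} {log : List (ℕ × ℕ)} {Q : HS → Prop} (hc : Core M h S log)
    (hY : log.length + 1 ≤ Y)
    (hQ : ∀ h', Core M h' (Function.update S (h.reg 24) (h.reg 25))
        ((h.reg 24, S (h.reg 24)) :: log) → (∀ r, r ≠ 15 → h'.reg r = h.reg r) →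
      (∀ ρ, ρ < h.reg 14 ∨ h.reg 14 + 3 ≤ ρ → h'.arr ρ = h.arr ρ) → h'.out = h.out → Q h') :
    logWrite.wp ω M Y h Q := by
  obtain ⟨h1, h2, h3, h4, h5⟩ := hc
  simp only [logWrite, Stm.wp, Ex.eval_var, Ex.eval_lit, Ex.eval_get, Ex.eval_add, Ex.ok_var,
    Ex.ok_lit, Ex.ok_get, Ex.ok_add, HS.setArr_reg]
  refine ⟨⟨by norm_num, by norm_num, by norm_num, by omega⟩, fun hb => hb.1 _ (by norm_num),
    ⟨by norm_num, by norm_num, ⟨by norm_num, by norm_num, by omega⟩, by omega⟩,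
    fun hb => hb.2 _ (by omega) _, ⟨by norm_num, by norm_num, by norm_num, by omega⟩,
    fun hb => hb.1 _ (by norm_num), by norm_num, by norm_num, by norm_num, fun _ => by omega,
    hQ _ ⟨?_, ?_, ?_, ?_, ?_⟩ ?_ ?_ rfl⟩
  · simpa using h1
  · simpa using h2
  · simp [h3]
  · simp only [HS.setReg_reg, HS.setReg_arr, HS.setArr_arr, HS.setArr_reg]
    simp only [Nat.reduceEqDiff, if_false, h5]
    rw [Function.update_of_ne (show h.reg 14 + 1 ≠ h.reg 14 by omega),
      Function.update_of_ne (show h.reg 14 + 1 ≠ h.reg 14 + 2 by omega), Function.update_self,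
      Function.update_of_ne (show h.reg 14 + 2 ≠ h.reg 14 by omega), Function.update_self,
      Function.update_of_ne (show h.reg 14 + 2 ≠ h.reg 14 + 1 by omega),
      Function.update_of_ne (show h.reg 14 ≠ h.reg 14 + 1 by omega)]
    refine ⟨?_, ?_, h4.update le_rfl le_rfl⟩
    · simp
    · simp [h3]
  · simp [h5]
  · intro r hr; simp [hr]
  · intro ρ hρ
    simp only [HS.setReg_arr, HS.setArr_arr]
    rw [Function.update_of_ne (by omega), Function.update_of_ne (by omega),
      Function.update_of_ne (by omega)]

/-- The list of updates that the slot in the variables still has to process. -/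
def todoOf (h : HS) : List (Option (ℕ × ℕ × ℕ)) :=
  (List.range' (h.reg 20) (h.reg 8 - h.reg 20)).map
      (fun x => if 0 < h.arr (h.reg 12) x then some (1, x / h.reg 5, x % h.reg 5) else none) ++
    (List.range' (h.reg 21) (h.reg 22 - h.reg 21)).map
      fun x => some (h.arr 0 x, h.arr 1 x, h.arr 2 x)

/-- The state represents the slot. -/
structure Rep {A : Program} {Q : ℕ} (enc : A.Loc ≃ Fin Q) (M : ℕ) (h : HS) (σ : Slot A) :
    Prop where
  core : Core M h σ.cells σ.log
  loc : h.reg 18 = enc σ.loc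
  low : h.reg 16 = σ.low
  mode : h.reg 17 = σ.mode
  first : h.reg 19 = σ.first
  todo : σ.todo = todoOf h
  tab : h.reg 12 < 8

/-- What a unit of work leaves unchanged. -/
structure Frame (h h' : HS) : Prop where
  reg : ∀ r, r ≤ 14 ∨ r = 16 ∨ (22 ≤ r ∧ r ≤ 23) ∨ (26 ≤ r ∧ r ≤ 29) → h'.reg r = h.reg r
  arr : ∀ ρ, ρ < h.reg 14 ∨ h.reg 14 + 3 ≤ ρ → h'.arr ρ = h.arr ρ
  out : h'.out = h.out
  next : h.reg 20 ≤ h'.reg 20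

lemma Frame.refl (h : HS) : Frame h h := ⟨fun _ _ => rfl, fun _ _ => rfl, rfl, le_rfl⟩

lemma Frame.trans {h h' h'' : HS} (a : Frame h h') (b : Frame h' h'') : Frame h h'' :=
  ⟨fun r hr => (b.reg r hr).trans (a.reg r hr), fun ρ hρ => by
    rw [b.arr ρ (by rw [a.reg 14 (by omega)]; exact hρ), a.arr ρ hρ], b.out.trans a.out, a.next.trans b.next⟩

lemma todoOf_congr {h h' : HS} (hr : ∀ r ∈ [5, 8, 12, 20, 21, 22], h'.reg r = h.reg r)
    (ha : ∀ ρ < 8, h'.arr ρ = h.arr ρ) (h12 : h.reg 12 < 8) : todoOf h' = todoOf h := by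
  simp only [List.mem_cons, List.not_mem_nil, or_false, forall_eq_or_imp, forall_eq] at hr
  obtain ⟨h5, h8, h12', h20, h21, h22⟩ := hr
  unfold todoOf
  rw [h5, h8, h12', h20, h21, h22, ha _ h12, ha 0 (by omega), ha 1 (by omega), ha 2 (by omega)]

/-- The remaining list `l` is separate from `σ.todo`, because the code advances its counters before
it hands over the update. -/
lemma wp_feedStm {A : Program} {Q : ℕ} (enc : A.Loc ≃ Fin Q) {h : HS} {σ : Slot A} {l}
    (hc : Core M h σ.cells σ.log) (hlow : h.reg 16 = σ.low) (hfirst : h.reg 19 = σ.first)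
    (htab : h.reg 12 < 8) (htodo : l = todoOf h) {e : ℕ × ℕ × ℕ} (h30 : h.reg 30 = e.1)
    (h31 : h.reg 31 = e.2.1) (h32 : h.reg 32 = e.2.2) (hY : σ.log.length + 4 ≤ Y) (h8 : 8 ≤ Y)
    (hQ : Q ≤ Y) :
    (feedStm (enc A.entry)).wp ω M Y h fun h' => Rep enc M h'
      { ((((σ.write 0 e.1).write 2 e.2.1).write 4 e.2.2).write 6 σ.first) with
        todo := l, loc := A.entry, mode := 1, first := 0 } ∧
      (∀ r, r ≤ 14 ∨ r = 16 ∨ (20 ≤ r ∧ r ≤ 23) ∨ (26 ≤ r ∧ r ≤ 29) → h'.reg r = h.reg r) ∧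
      (∀ ρ, ρ < h.reg 14 ∨ h.reg 14 + 3 ≤ ρ → h'.arr ρ = h.arr ρ) ∧ h'.out = h.out := by
  have henc : ((enc A.entry : Fin Q) : ℕ) ≤ Y := (enc A.entry).2.le.trans hQ
  simp only [feedStm, Stm.wp, Ex.eval_var, Ex.eval_lit, Ex.ok_var, Ex.ok_lit]
  refine ⟨by norm_num, by norm_num, trivial, fun _ => by omega, by norm_num, by norm_num,
    by norm_num, fun hb => hb.1 _ (by norm_num), ?_⟩
  refine wp_logWrite (hc.congr (by simp) (by simp) (by simp)) (by omega) ?_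
  intro h₁ c₁ r₁ a₁ o₁
  simp only [HS.setReg_reg, HS.setReg_arr, HS.setReg_out, Nat.reduceEqDiff, if_true, if_false,
    h30] at c₁ r₁ a₁ o₁
  refine ⟨by norm_num, by norm_num, trivial, fun _ => by omega, by norm_num, by norm_num,
    by norm_num, fun hb => hb.1 _ (by norm_num), ?_⟩
  refine wp_logWrite (c₁.congr (by simp) (by simp) (by simp)) (by simp; omega) ?_
  intro h₂ c₂ r₂ a₂ o₂
  simp only [HS.setReg_reg, HS.setReg_arr, HS.setReg_out, Nat.reduceEqDiff, if_true, if_false,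
    h31, r₁ 31 (by norm_num), r₁ 14 (by norm_num)] at c₂ r₂ a₂ o₂
  refine ⟨by norm_num, by norm_num, trivial, fun _ => by omega, by norm_num, by norm_num,
    by norm_num, fun hb => hb.1 _ (by norm_num), ?_⟩
  refine wp_logWrite (c₂.congr (by simp) (by simp) (by simp)) (by simp; omega) ?_
  intro h₃ c₃ r₃ a₃ o₃
  simp only [HS.setReg_reg, HS.setReg_arr, HS.setReg_out, Nat.reduceEqDiff, if_true, if_false,
    h32, r₂ 32 (by norm_num), r₁ 32 (by norm_num), r₂ 14 (by norm_num), r₁ 14 (by norm_num)]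
    at c₃ r₃ a₃ o₃
  refine ⟨by norm_num, by norm_num, trivial, fun _ => by omega, by norm_num, by norm_num,
    by norm_num, fun hb => hb.1 _ (by norm_num), ?_⟩
  refine wp_logWrite (c₃.congr (by simp) (by simp) (by simp)) (by simp; omega) ?_
  intro h₄ c₄ r₄ a₄ o₄
  simp only [HS.setReg_reg, HS.setReg_arr, HS.setReg_out, Nat.reduceEqDiff, if_true, if_false,
    hfirst, r₃ 19 (by norm_num), r₂ 19 (by norm_num), r₁ 19 (by norm_num), r₃ 14 (by norm_num),
    r₂ 14 (by norm_num), r₁ 14 (by norm_num)] at c₄ r₄ a₄ o₄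
  have hreg : ∀ r, r ≤ 14 ∨ r = 16 ∨ (20 ≤ r ∧ r ≤ 23) ∨ (26 ≤ r ∧ r ≤ 29) →
      h₄.reg r = h.reg r := by
    intro r hr
    rw [r₄ r (by omega), if_neg (by omega), if_neg (by omega), r₃ r (by omega),
      if_neg (by omega), if_neg (by omega), r₂ r (by omega), if_neg (by omega), if_neg (by omega),
      r₁ r (by omega), if_neg (by omega), if_neg (by omega)]
  have harr : ∀ ρ, ρ < h.reg 14 ∨ h.reg 14 + 3 ≤ ρ → h₄.arr ρ = h.arr ρ := fun ρ hρ => by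
    rw [a₄ ρ hρ, a₃ ρ hρ, a₂ ρ hρ, a₁ ρ hρ]
  refine ⟨by norm_num, by norm_num, trivial, fun _ => henc, by norm_num, by norm_num, trivial,
    fun _ => by omega, by norm_num, by norm_num, trivial, fun _ => by omega,
    ⟨c₄.congr (by simp) (by simp) (by simp), by simp, ?_, by simp, by simp, ?_, ?_⟩, ?_, ?_, ?_⟩
  · simp [hreg 16 (by omega), hlow, Slot.write]
  · rw [htodo]
    refine (todoOf_congr ?_ ?_ htab).symm
    · intro r hr
      simp only [List.mem_cons, List.not_mem_nil, or_false] at hr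
      rw [HS.setReg_reg, HS.setReg_reg, HS.setReg_reg, if_neg (by omega), if_neg (by omega),
        if_neg (by omega)]
      exact hreg r (by omega)
    · intro ρ hρ
      exact harr ρ (by have := hc.le; omega)
  · simpa [hreg 12 (by omega)] using htab
  · intro r hr
    rw [HS.setReg_reg, HS.setReg_reg, HS.setReg_reg, if_neg (by omega), if_neg (by omega),
      if_neg (by omega)]
    exact hreg r hr
  · exact harr
  · simp [o₄, o₃, o₂, o₁]

lemma wp_skipStm {h : HS} {Q : HS → Prop} (hQ : Q (h.setReg 33 0)) : skipStm.wp ω M Y h Q :=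
  ⟨by norm_num, by norm_num, trivial, fun _ => Nat.zero_le _, hQ⟩

end

end DynMatching

/-! ### Correctness of the code for a unit of work -/

namespace DynMatching

section

open Ex (var lit get)

variable {ω : ℕ → ℕ} {M Y : ℕ} {A : Program} {Q : ℕ} {enc : A.Loc ≃ Fin Q}

lemma range'_cons {a b : ℕ} (h : a < b) :
    List.range' a (b - a) = a :: List.range' (a + 1) (b - (a + 1)) := by
  rw [show b - a = (b - (a + 1)) + 1 by omega, List.range'_succ]

lemma wp_fetchStm {h : HS} {σ : Slot A} (hr : Rep enc M h σ) (hY : σ.log.length + 4 ≤ Y)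
    (h8 : 8 ≤ Y) (hQ : Q ≤ Y) :
    (fetchStm (enc A.entry)).wp ω M Y h fun h' => Rep enc M h' σ.fetch ∧ Frame h h' := by
  have h12 := hr.tab
  have hM := hr.core.lt
  have hM8 := hr.core.le
  simp only [fetchStm, Stm.wp, Ex.eval_var, Ex.eval_lit, Ex.ok_var, Ex.ok_lit]
  refine ⟨by norm_num, by norm_num, fun hlt => ?_, fun hge => ⟨by norm_num, by norm_num,
    fun hlt => ?_, fun hge' => ?_⟩⟩
  · refine ⟨by norm_num, by norm_num, by norm_num, fun hb => hb.1 _ (by norm_num), ?_⟩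
    refine ⟨by norm_num, by norm_num, by simp, fun hb => ?_, ?_⟩
    -- The incremented counter is still at most the variable `8`, so no separate bound is needed.
    · have := hb.1 8 (by norm_num)
      simp only [HS.setReg_reg, Nat.reduceEqDiff, if_false, Ex.eval_add, Ex.eval_var,
        Ex.eval_lit] at this ⊢
      omega
    simp only [Ex.eval_add, Ex.eval_var, Ex.eval_lit, Ex.eval_get, Ex.ok_get, Ex.ok_var,
      HS.setReg_reg, HS.setReg_arr, Nat.reduceEqDiff, if_true, if_false]
    set h₁ := (h.setReg 33 (h.reg 20)).setReg 20 (h.reg 20 + 1) with hh₁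
    have htodo : σ.todo = (if 0 < h.arr (h.reg 12) (h.reg 20) then
        some (1, h.reg 20 / h.reg 5, h.reg 20 % h.reg 5) else none) :: todoOf h₁ := by
      rw [hr.todo]
      unfold todoOf
      rw [range'_cons hlt]
      simp [hh₁]
    refine ⟨trivial, ⟨by norm_num, by norm_num, by omega⟩, fun hpos => ?_, fun hpos => ?_⟩
    · rw [if_pos hpos] at htodo
      refine ⟨by norm_num, by norm_num, trivial, fun _ => by omega, by norm_num, by norm_num,
        by simp, fun hb => ?_, by norm_num, by norm_num, by simp, fun hb => ?_, ?_⟩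
      · have := hb.1 33 (by norm_num)
        simp only [Ex.eval_div, Ex.eval_var]
        exact (Nat.div_le_self _ _).trans this
      · have := hb.1 33 (by norm_num)
        simp only [Ex.eval_mod, Ex.eval_var]
        exact (Nat.mod_le _ _).trans this
      set h₂ := ((h₁.setReg 30 1).setReg 31 _).setReg 32 _ with hh₂
      have htodo₂ : todoOf h₁ = todoOf h₂ := by simp [todoOf, hh₂]
      refine Stm.wp_mono (wp_feedStm enc (σ := σ)
        (e := (1, h.reg 20 / h.reg 5, h.reg 20 % h.reg 5))
        (hr.core.congr (by simp [hh₂, hh₁]) (by simp [hh₂, hh₁]) (by simp [hh₂, hh₁]))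
        (by simpa [hh₂, hh₁] using hr.low) (by simpa [hh₂, hh₁] using hr.first)
        (by simpa [hh₂, hh₁] using h12) htodo₂ (by simp [hh₂]) (by simp [hh₂, hh₁])
        (by simp [hh₂, hh₁]) hY h8 hQ) ?_
      rintro h' ⟨k1, k2, k3, k4⟩
      refine ⟨by simpa only [Slot.fetch, htodo] using k1, ⟨fun r hr' => ?_, fun ρ hρ => ?_, ?_, ?_⟩⟩
      · rw [k2 r (by omega)]
        simp only [hh₂, hh₁, HS.setReg_reg]
        rw [if_neg (by omega), if_neg (by omega), if_neg (by omega), if_neg (by omega),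
          if_neg (by omega)]
      · rw [k3 ρ (by simpa [hh₂, hh₁] using hρ)]; rfl
      · rw [k4]; rfl
      · rw [k2 20 (by omega)]; simp [hh₂, hh₁]
    · rw [if_neg hpos] at htodo
      refine wp_skipStm ⟨?_, ⟨fun r hr' => ?_, fun ρ hρ => rfl, rfl,
        by simp [hh₁]⟩⟩
      · simp only [Slot.fetch, htodo]
        exact ⟨hr.core.congr (by simp [hh₁]) (by simp [hh₁]) (by simp [hh₁]),
          by simpa [hh₁] using hr.loc, by simpa [hh₁] using hr.low, by simpa [hh₁] using hr.mode,
          by simpa [hh₁] using hr.first, by simp [todoOf], by simpa [hh₁] using h12⟩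
      · simp only [hh₁, HS.setReg_reg]
        rw [if_neg (by omega), if_neg (by omega), if_neg (by omega)]
  · have htodo : σ.todo = some (h.arr 0 (h.reg 21), h.arr 1 (h.reg 21), h.arr 2 (h.reg 21)) ::
        todoOf (h.setReg 21 (h.reg 21 + 1)) := by
      rw [hr.todo]
      unfold todoOf
      rw [range'_cons hlt, show h.reg 8 - h.reg 20 = 0 by omega]
      simp [show h.reg 8 - h.reg 20 = 0 by omega]
    refine ⟨by norm_num, by norm_num, ⟨trivial, by norm_num, by simp; omega⟩,
      fun hb => hb.2 _ (by simp; omega) _,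
      by norm_num, by norm_num, ⟨trivial, by norm_num, by simp; omega⟩,
      fun hb => hb.2 _ (by simp; omega) _,
      by norm_num, by norm_num, ⟨trivial, by norm_num, by simp; omega⟩,
      fun hb => hb.2 _ (by simp; omega) _,
      by norm_num, by norm_num, by simp, fun hb => ?_, ?_⟩
    · have := hb.1 22 (by norm_num)
      simp only [HS.setReg_reg, Nat.reduceEqDiff, if_false, Ex.eval_add, Ex.eval_var,
        Ex.eval_lit] at this ⊢
      omega
    simp only [Ex.eval_add, Ex.eval_var, Ex.eval_lit, Ex.eval_get,
      HS.setReg_reg, HS.setReg_arr, Nat.reduceEqDiff, if_false]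
    set h₂ := (((h.setReg 30 _).setReg 31 _).setReg 32 _).setReg 21 _ with hh₂
    have htodo₂ : todoOf (h.setReg 21 (h.reg 21 + 1)) = todoOf h₂ := by simp [todoOf, hh₂]
    refine Stm.wp_mono (wp_feedStm enc (σ := σ)
      (e := (h.arr 0 (h.reg 21), h.arr 1 (h.reg 21), h.arr 2 (h.reg 21)))
      (hr.core.congr (by simp [hh₂]) (by simp [hh₂]) (by simp [hh₂]))
      (by simpa [hh₂] using hr.low) (by simpa [hh₂] using hr.first)
      (by simpa [hh₂] using h12) htodo₂ (by simp [hh₂]) (by simp [hh₂])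
      (by simp [hh₂]) hY h8 hQ) ?_
    rintro h' ⟨k1, k2, k3, k4⟩
    refine ⟨by simpa only [Slot.fetch, htodo] using k1, ⟨fun r hr' => ?_, fun ρ hρ => ?_, ?_, ?_⟩⟩
    · rw [k2 r (by omega)]
      simp only [hh₂, HS.setReg_reg]
      rw [if_neg (by omega), if_neg (by omega), if_neg (by omega), if_neg (by omega)]
    · rw [k3 ρ (by simpa [hh₂] using hρ)]; rfl
    · rw [k4]; rfl
    · rw [k2 20 (by omega)]; simp [hh₂]
  · have htodo : σ.todo = [] := by
      rw [hr.todo]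
      unfold todoOf
      rw [show h.reg 8 - h.reg 20 = 0 by omega, show h.reg 22 - h.reg 21 = 0 by omega]
      simp
    refine wp_skipStm ⟨?_, ⟨fun r hr' => ?_, fun ρ hρ => rfl, rfl, by simp⟩⟩
    · simp only [Slot.fetch, htodo]
      exact ⟨hr.core.congr (by simp) (by simp) (by simp),
        by simpa using hr.loc, by simpa using hr.low, by simpa using hr.mode,
        by simpa using hr.first, by simpa [todoOf] using hr.todo, by simpa using h12⟩
    · rw [HS.setReg_reg, if_neg (by omega)]

/-- The register numbers that an instruction writes to are at most `Y`. -/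
def Instr.RegsLe {τ : Type} (Y : ℕ) : Instr τ → Prop
  | .const r _ _ => 2 * r ≤ Y
  | .op _ r _ _ _ => 2 * r ≤ Y
  | .load r _ _ => 2 * r ≤ Y
  | .rand r _ _ => 2 * r ≤ Y
  | _ => True

/-- The final part of a simulated instruction that writes. -/
lemma rep_write {h h' : HS} {σ : Slot A} (hr : Rep enc M h σ) {q : A.Loc} {a v : ℕ}
    (hc : Core M h' (Function.update σ.cells a v) ((a, σ.cells a) :: σ.log))
    (h18 : h'.reg 18 = enc q)
    (hreg : ∀ r, r ≠ 15 ∧ r ≠ 18 ∧ r ≠ 24 ∧ r ≠ 25 ∧ r ≠ 30 ∧ r ≠ 31 → h'.reg r = h.reg r)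
    (harr : ∀ ρ, ρ < h.reg 14 ∨ h.reg 14 + 3 ≤ ρ → h'.arr ρ = h.arr ρ) (hout : h'.out = h.out) :
    Rep enc M h' { σ.write a v with loc := q } ∧ Frame h h' := by
  have h8 := hr.core.le
  refine ⟨⟨hc, h18, ?_, ?_, ?_, ?_, ?_⟩, ⟨fun r hr' => hreg r (by omega), harr, hout,
    (hreg 20 (by omega)).ge⟩⟩
  · rw [hreg 16 (by omega)]; exact hr.low
  · rw [hreg 17 (by omega)]; exact hr.mode
  · rw [hreg 19 (by omega)]; exact hr.first
  · refine hr.todo.trans (todoOf_congr ?_ (fun ρ hρ => harr ρ (by omega)) hr.tab).symm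
    intro r hr'
    simp only [List.mem_cons, List.not_mem_nil, or_false] at hr'
    exact hreg r (by omega)
  · rw [hreg 12 (by omega)]; exact hr.tab

/-- The bound on the value that the instruction writes comes from `hok'`, the state after the unit
of work; the bound on the address of a store comes from `hok`. -/
lemma wp_instrStm {h : HS} {σ : Slot A} (hr : Rep enc M h σ) (hmode : σ.mode = 1)
    (hregs : (A.code σ.loc).RegsLe Y) (hlen : σ.log.length + 1 ≤ Y) (hQ : Q ≤ Y) {W D : ℕ}
    (hW : 2 * W + 1 ≤ Y) (hok : σ.Ok W D) (hok' : (σ.micro ω).Ok W D) :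
    (instrStm (fun q => (enc q : ℕ)) (A.code σ.loc)).wp ω M Y h
      fun h' => Rep enc M h' (σ.run ω) ∧ Frame h h' := by
  have henc : ∀ q, ((enc q : Fin Q) : ℕ) ≤ Y := fun q => (enc q).2.le.trans hQ
  have hM := hr.core.lt
  have hcells := hr.core.cells
  have hm : σ.micro ω = σ.run ω := by rw [Slot.micro, if_neg (by omega), if_pos hmode]
  rw [hm] at hok'
  have hval : ∀ {a v}, (A.code σ.loc).write ω σ.cells = some (a, v) →
      σ.run ω = { σ.write a v with loc := (A.code σ.loc).next σ.cells σ.loc } ∧ v ≤ W := by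
    intro a v hw
    have e : σ.run ω = { σ.write a v with loc := (A.code σ.loc).next σ.cells σ.loc } := by
      unfold Slot.run
      cases hcode : A.code σ.loc <;> rw [hcode] at hw <;> cases hw <;> rfl
    refine ⟨e, ?_⟩
    have := hok'.1 a
    rw [e] at this
    simpa [Slot.write] using this
  cases hcode : A.code σ.loc with
  | const r c q =>
    rw [hcode] at hval hregs
    obtain ⟨e, hv⟩ := hval rfl
    simp only [instrStm, Stm.wp, Ex.eval_lit, Ex.ok_lit]
    refine ⟨by norm_num, by norm_num, trivial, fun _ => hregs, by norm_num, by norm_num, trivial,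
      fun _ => by omega, by norm_num, by norm_num, trivial, fun _ => henc q, ?_⟩
    refine wp_logWrite (hr.core.congr (by simp) (by simp) (by simp)) hlen ?_
    intro h' c₁ r₁ a₁ o₁
    simp only [HS.setReg_reg, HS.setReg_arr, HS.setReg_out, Nat.reduceEqDiff, if_true,
      if_false] at c₁ r₁ a₁ o₁
    rw [e]
    refine rep_write hr c₁ (by rw [r₁ 18 (by omega), if_pos rfl]; rfl) (fun x hx => ?_) a₁ o₁
    rw [r₁ x (by omega), if_neg (by omega), if_neg (by omega), if_neg (by omega)]
  | op f r s t q =>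
    rw [hcode] at hval hregs
    obtain ⟨e, hv⟩ := hval rfl
    simp only [instrStm, Stm.wp, Ex.eval_lit, Ex.ok_lit, Ex.eval_get, Ex.ok_get, Ex.eval_var,
      Ex.ok_var]
    refine ⟨by norm_num, by norm_num, ⟨by norm_num, trivial, by omega⟩,
      fun hb => hb.2 _ (by omega) _, by norm_num, by norm_num,
      ⟨by norm_num, trivial, by simp; omega⟩, fun hb => hb.2 _ (by simp; omega) _,
      by norm_num, ?_, by norm_num, by norm_num, trivial, fun _ => hregs,
      by norm_num, by norm_num, trivial, fun _ => henc q, ?_⟩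
    · intro _
      simp only [HS.setReg_reg, HS.setReg_arr, Nat.reduceEqDiff, if_true, if_false, hcells]
      omega
    refine wp_logWrite (hr.core.congr (by simp) (by simp) (by simp)) hlen ?_
    intro h' c₁ r₁ a₁ o₁
    simp only [HS.setReg_reg, HS.setReg_arr, HS.setReg_out, Nat.reduceEqDiff, if_true,
      if_false, hcells] at c₁ r₁ a₁ o₁
    rw [e]
    refine rep_write hr c₁ (by rw [r₁ 18 (by omega), if_pos rfl]; rfl) (fun x hx => ?_) a₁ o₁
    rw [r₁ x (by omega), if_neg (by omega), if_neg (by omega), if_neg (by omega),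
      if_neg (by omega), if_neg (by omega)]
  | load r s q =>
    rw [hcode] at hval hregs
    obtain ⟨e, hv⟩ := hval rfl
    simp only [instrStm, Stm.wp, Ex.eval_lit, Ex.ok_lit, Ex.eval_get, Ex.ok_get, Ex.eval_var,
      Ex.ok_var, Ex.eval_add, Ex.eval_mul, Ex.ok_add, Ex.ok_mul]
    refine ⟨by norm_num, by norm_num, ⟨by norm_num, ⟨⟨trivial, by norm_num, trivial, by omega⟩,
      trivial⟩, by omega⟩,
      fun hb => hb.2 _ (by omega) _, by norm_num, by norm_num, trivial, fun _ => hregs,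
      by norm_num, by norm_num, trivial, fun _ => henc q, ?_⟩
    refine wp_logWrite (hr.core.congr (by simp) (by simp) (by simp)) hlen ?_
    intro h' c₁ r₁ a₁ o₁
    simp only [HS.setReg_reg, HS.setReg_arr, HS.setReg_out, Nat.reduceEqDiff, if_true,
      if_false, hcells] at c₁ r₁ a₁ o₁
    rw [e]
    refine rep_write hr c₁ (by rw [r₁ 18 (by omega), if_pos rfl]; rfl) (fun x hx => ?_) a₁ o₁
    rw [r₁ x (by omega), if_neg (by omega), if_neg (by omega), if_neg (by omega)]
  | store r s q =>
    rw [hcode] at hval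
    obtain ⟨e, hv⟩ := hval rfl
    simp only [instrStm, Stm.wp, Ex.eval_lit, Ex.ok_lit, Ex.eval_get, Ex.ok_get, Ex.eval_var,
      Ex.ok_var, Ex.eval_add, Ex.eval_mul, Ex.ok_add, Ex.ok_mul]
    refine ⟨by norm_num, by norm_num, ⟨⟨trivial, by norm_num, trivial, by omega⟩, trivial⟩,
      fun _ => ?_, by norm_num, by norm_num, ⟨by norm_num, trivial, by simp; omega⟩,
      fun hb => hb.2 _ (by simp; omega) _,
      by norm_num, by norm_num, trivial, fun _ => henc q, ?_⟩
    · have := hok.1 (2 * r)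
      rw [hcells]; omega
    refine wp_logWrite (hr.core.congr (by simp) (by simp) (by simp)) hlen ?_
    intro h' c₁ r₁ a₁ o₁
    simp only [HS.setReg_reg, HS.setReg_arr, HS.setReg_out, Nat.reduceEqDiff, if_true,
      if_false, hcells] at c₁ r₁ a₁ o₁
    rw [e]
    refine rep_write hr c₁ (by rw [r₁ 18 (by omega), if_pos rfl]; rfl) (fun x hx => ?_) a₁ o₁
    rw [r₁ x (by omega), if_neg (by omega), if_neg (by omega), if_neg (by omega)]
  | rand r s q =>
    rw [hcode] at hval hregs
    obtain ⟨e, hv⟩ := hval rfl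
    simp only [instrStm, Stm.wp, Ex.eval_lit, Ex.ok_lit, Ex.eval_get, Ex.ok_get, Ex.eval_var,
      Ex.ok_var]
    refine ⟨by norm_num, by norm_num, ⟨by norm_num, trivial, by omega⟩,
      fun hb => hb.2 _ (by omega) _, by norm_num, ?_, by norm_num, by norm_num, trivial,
      fun _ => hregs, by norm_num, by norm_num, trivial, fun _ => henc q, ?_⟩
    · intro _
      simp only [HS.setReg_reg, if_true, hcells]
      omega
    refine wp_logWrite (hr.core.congr (by simp) (by simp) (by simp)) hlen ?_
    intro h' c₁ r₁ a₁ o₁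
    simp only [HS.setReg_reg, HS.setReg_arr, HS.setReg_out, Nat.reduceEqDiff, if_true,
      if_false, hcells] at c₁ r₁ a₁ o₁
    rw [e]
    refine rep_write hr c₁ (by rw [r₁ 18 (by omega), if_pos rfl]; rfl) (fun x hx => ?_) a₁ o₁
    rw [r₁ x (by omega), if_neg (by omega), if_neg (by omega), if_neg (by omega),
      if_neg (by omega)]
  | branch r s q q' =>
    have e : σ.run ω = { σ with loc := if σ.cells (2 * r) < σ.cells (2 * s) then q else q' } := by
      unfold Slot.run; rw [hcode]; rfl
    have key : ∀ q'' : A.Loc, Rep enc M (h.setReg 18 (enc q'')) { σ with loc := q'' } ∧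
        Frame h (h.setReg 18 (enc q'')) := fun q'' =>
      ⟨⟨hr.core.congr (by simp) (by simp) (by simp), by simp, by simpa using hr.low,
        by simpa using hr.mode, by simpa using hr.first, by simpa [todoOf] using hr.todo,
        by simpa using hr.tab⟩,
        ⟨fun x hx => by rw [HS.setReg_reg, if_neg (by omega)], fun _ _ => rfl, rfl, by simp⟩⟩
    rw [e]
    simp only [instrStm, Stm.wp, Ex.eval_lit, Ex.ok_lit, Ex.eval_get, Ex.ok_get, Ex.eval_var,
      Ex.ok_var, hcells]
    refine ⟨⟨by norm_num, trivial, by omega⟩, ⟨by norm_num, trivial, by omega⟩, fun hlt => ?_,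
      fun hge => ?_⟩
    · rw [if_pos hlt]
      exact ⟨by norm_num, by norm_num, trivial, fun _ => henc q, key q⟩
    · rw [if_neg hge]
      exact ⟨by norm_num, by norm_num, trivial, fun _ => henc q', key q'⟩
  | halt =>
    have e : σ.run ω = { σ with mode := 0 } := by unfold Slot.run; rw [hcode]
    rw [e]
    exact ⟨by norm_num, by norm_num, trivial, fun _ => Nat.zero_le _,
      ⟨hr.core.congr (by simp) (by simp) (by simp), by simpa using hr.loc, by simpa using hr.low,
        by simp, by simpa using hr.first, by simpa [todoOf] using hr.todo, by simpa using hr.tab⟩,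
      ⟨fun x hx => by rw [HS.setReg_reg, if_neg (by omega)], fun _ _ => rfl, rfl, by simp⟩⟩

/-- The failure of the earlier tests gives a lower bound for the location, so the first successful
strict test identifies it. The chain has constant length because the simulated program is fixed. -/
lemma wp_dispatch {h : HS} {P : HS → Prop} (cs : List Stm) : ∀ (q j : ℕ) (hj : j < cs.length),
    h.reg 18 = q + j → (cs[j]).wp ω M Y h P → (dispatch q cs).wp ω M Y h P := by
  induction cs with
  | nil => intro q j hj; exact absurd hj (by simp)
  | cons c cs ih =>
    intro q j hj h18 hwp
    simp only [dispatch, Stm.wp, Ex.eval_var, Ex.eval_lit, Ex.ok_var, Ex.ok_lit]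
    rcases j with _ | j
    · exact ⟨by norm_num, trivial, fun _ => hwp, fun h' => by omega⟩
    · exact ⟨by norm_num, trivial, fun h' => by omega, fun _ =>
        ih (q + 1) j (by simpa using hj) (by omega) hwp⟩

/-- A unit of work is carried out correctly. -/
theorem wp_microStm {h : HS} {σ : Slot A} (hr : Rep enc M h σ)
    (hregs : ∀ q, (A.code q).RegsLe Y) {W D : ℕ} (hD : D + 4 ≤ Y) (h8 : 8 ≤ Y) (hQ : Q ≤ Y)
    (hW : 2 * W + 1 ≤ Y) (hok : σ.Ok W D) (hok' : (σ.micro ω).Ok W D) :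
    (microStm enc).wp ω M Y h fun h' => Rep enc M h' (σ.micro ω) ∧ Frame h h' := by
  have hlen := hok.2.2
  have hM := hr.core.lt
  have hm := hr.mode
  simp only [microStm, Stm.wp, Ex.eval_var, Ex.eval_lit, Ex.ok_var, Ex.ok_lit]
  refine ⟨by norm_num, trivial, fun h0 => ?_, fun h0 => ⟨by norm_num, trivial, fun h1 => ?_,
    fun h1 => ?_⟩⟩
  · rw [Slot.micro, if_pos (by omega)]
    exact wp_fetchStm hr (by omega) h8 hQ
  · rw [show σ.micro ω = σ.run ω by rw [Slot.micro, if_neg (by omega), if_pos (by omega)]]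
    refine wp_dispatch _ 0 (enc σ.loc) (by simp) (by simpa using hr.loc) ?_
    rw [List.getElem_ofFn]
    simpa using wp_instrStm hr (by omega) (hregs _) (by omega) hQ hW hok hok'
  · rw [show σ.micro ω = σ.undo by rw [Slot.micro, if_neg (by omega), if_neg (by omega)]]
    have hl := hr.core.len
    have hlow := hr.low
    simp only [undoStm, Stm.wp, Ex.eval_var, Ex.eval_lit, Ex.ok_var, Ex.ok_lit]
    refine ⟨by norm_num, by norm_num, fun h2 => ?_, fun h2 => ?_⟩
    · rcases hlog : σ.log with _ | ⟨⟨a, v⟩, l⟩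
      · rw [hlog] at hl; simp at hl; omega
      have hlr := hr.core.logRep
      rw [hlog] at hl hlr
      simp only [List.length_cons] at hl
      have hu : σ.undo = { σ with cells := Function.update σ.cells a v, log := l } := by
        unfold Slot.undo
        rw [if_pos (by rw [hlog, List.length_cons]; omega), hlog]
      rw [hu]
      have e1 : h.arr (h.reg 14 + 1) (h.reg 15 - 1) = a := by rw [hl]; exact hlr.1
      have e2 : h.arr (h.reg 14 + 2) (h.reg 15 - 1) = v := by rw [hl]; exact hlr.2.1
      simp only [Ex.eval_sub, Ex.ok_sub, Ex.eval_add, Ex.ok_add, Ex.eval_get, Ex.ok_get,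
        Ex.eval_var, Ex.eval_lit, Ex.ok_var, Ex.ok_lit, HS.setReg_reg, HS.setReg_arr,
        Nat.reduceEqDiff, if_true, if_false, e1, e2]
      refine ⟨by norm_num, by norm_num, by norm_num, fun hb => (Nat.sub_le _ _).trans
        (hb.1 15 (by norm_num)), ⟨by norm_num, ⟨by norm_num, by norm_num, by omega⟩,
        ⟨by norm_num, by norm_num, by omega⟩, by omega⟩, fun hb => ?_,
        ⟨⟨?_, ?_, ?_, ?_, ?_⟩, ?_, ?_, ?_, ?_, ?_, ?_⟩, ⟨?_, ?_, ?_, ?_⟩⟩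
      · rw [← e2]; exact hb.2 _ (by omega) _
      · simpa using hr.core.le
      · simpa using hM
      · simp [hr.core.cells]
      · simp only [HS.setArr_reg, HS.setReg_reg, HS.setArr_arr, HS.setReg_arr, Nat.reduceEqDiff,
          if_false]
        rw [Function.update_of_ne (by omega), Function.update_of_ne (by omega)]
        exact hlr.2.2
      · simp [hl]
      · simpa using hr.loc
      · simpa using hlow
      · simpa using hm
      · simpa using hr.first
      · refine hr.todo.trans (todoOf_congr ?_ ?_ hr.tab).symm
        · intro r hr'
          simp only [List.mem_cons, List.not_mem_nil, or_false] at hr'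
          rw [HS.setArr_reg, HS.setReg_reg, if_neg (by omega)]
        · intro ρ hρ
          have := hr.core.le
          simp only [HS.setArr_arr, HS.setReg_arr]
          rw [Function.update_of_ne (by omega)]
      · simpa using hr.tab
      · intro r hr'
        rw [HS.setArr_reg, HS.setReg_reg, if_neg (by omega)]
      · intro ρ hρ
        simp only [HS.setArr_arr, HS.setReg_arr]
        rw [Function.update_of_ne (by omega)]
      · rfl
      · simp
    · have hu : σ.undo = { σ with mode := 0 } := by
        unfold Slot.undo
        rw [if_neg (by omega)]
      rw [hu]
      exact ⟨by norm_num, by norm_num, trivial, fun _ => Nat.zero_le _,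
        ⟨hr.core.congr (by simp) (by simp) (by simp), by simpa using hr.loc, by simpa using hr.low,
          by simp, by simpa using hr.first, by simpa [todoOf] using hr.todo, by simpa using hr.tab⟩,
        ⟨fun x hx => by rw [HS.setReg_reg, if_neg (by omega)], fun _ _ => rfl, rfl, by simp⟩⟩

end

end DynMatching

namespace DynMatching

/-! ### The program: one tick of a slot -/

section

open Ex (var lit get)

/-- Compute `remTicks` in `28`, `curLevel` in `29` and the corresponding power of `b` in `27`. -/
def schedStm (b : ℕ) : Stm :=
  .assign 27 (lit 1) ;; .assign 28 (lit 1) ;; .assign 26 (lit 0) ;;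
  .loop (var 26) (var 6)
    (.ite (var 10 / var 27 % var 6) (var 13 + lit 1)
      (.ite (var 10 / var 27 % var 6) (var 13) skipStm
        (.assign 28 (var 27 - var 10 % var 27)))
      skipStm ;;
    .assign 27 (var 27 * lit b) ;; .assign 26 (var 26 + lit 1)) ;;
  .assign 27 (lit 1) ;; .assign 29 (lit 0) ;;
  .loop (var 27) (var 28) (.assign 27 (var 27 * lit b) ;; .assign 29 (var 29 + lit 1))

/-- Load the variables of the slot. -/
def loadStm : Stm :=
  .assign 14 (var 13 * lit 8 + lit 8) ;;
  .assign 15 (get (var 14 + lit 5) (lit 0)) ;; .assign 16 (get (var 14 + lit 5) (lit 1)) ;;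
  .assign 17 (get (var 14 + lit 5) (lit 2)) ;; .assign 18 (get (var 14 + lit 5) (lit 3)) ;;
  .assign 19 (get (var 14 + lit 5) (lit 4)) ;; .assign 20 (get (var 14 + lit 5) (lit 5)) ;;
  .assign 21 (get (var 14 + lit 5) (lit 6)) ;; .assign 22 (get (var 14 + lit 5) (lit 7)) ;;
  .assign 23 (get (var 14 + lit 5) (lit 8))

/-- Store the variables of the slot. -/
def saveStm : Stm :=
  .set (var 14 + lit 5) (lit 0) (var 15) ;; .set (var 14 + lit 5) (lit 1) (var 16) ;;
  .set (var 14 + lit 5) (lit 2) (var 17) ;; .set (var 14 + lit 5) (lit 3) (var 18) ;;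
  .set (var 14 + lit 5) (lit 4) (var 19) ;; .set (var 14 + lit 5) (lit 5) (var 20) ;;
  .set (var 14 + lit 5) (lit 6) (var 21) ;; .set (var 14 + lit 5) (lit 7) (var 22) ;;
  .set (var 14 + lit 5) (lit 8) (var 23)

/-- Start a new task. -/
def startStm : Stm :=
  .set (var 14 + lit 3) (var 23 + lit 1) (var 15) ;;
  .set (var 14 + lit 4) (var 23 + lit 1) (var 22) ;;
  .assign 23 (var 6 - lit 1 - var 29) ;;
  .assign 16 (get (var 14 + lit 3) (var 23)) ;;
  .ite (var 23) (lit 1) (.assign 21 (var 10 / var 11 * var 11) ;; .assign 20 (lit 0))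
    (.assign 21 (get (var 14 + lit 4) (var 23))) ;;
  .assign 22 (var 10 + lit 1) ;; .assign 19 (lit 1) ;; .assign 17 (lit 2)

/-- Let the output be the matching of the slot. -/
def outStm : Stm :=
  .out 0 (lit 2 + var 4 + var 14 + get (var 14) (lit 1) * (lit 2 * var 4)) ;;
  .out 1 (get (var 14) (lit 3) * (lit 2 * var 4))

/-- Do the units of work of a tick. -/
def workStm {A : Program} {Q : ℕ} (enc : A.Loc ≃ Fin Q) : Stm :=
  .assign 26 (lit 0) ;; .loop (var 26) (var 9) (microStm enc ;; .assign 26 (var 26 + lit 1))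

/-- One tick of a slot. -/
def tickStm {A : Program} {Q : ℕ} (enc : A.Loc ≃ Fin Q) (b : ℕ) : Stm :=
  loadStm ;; schedStm b ;; .ite (var 28) (var 27) skipStm startStm ;; workStm enc ;; saveStm ;;
  .ite (var 28) (lit 2) outStm skipStm ;; .assign 13 (var 13 + lit 1)

variable {ω : ℕ → ℕ} {M Y : ℕ}

lemma Stm.Tr.bind {c c' : Stm} {h : HS} {t t' : ℕ} {P P' : HS → Prop} (h₁ : c.Tr ω M Y h t P)
    (h₂ : ∀ h', P h' → c'.Tr ω M Y h' t' P') : (c ;; c').Tr ω M Y h (t + t') P' :=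
  Stm.Tr.seq (h₁.mono le_rfl h₂)

/-- `h'` differs from `h` only in auxiliary variables. -/
structure AuxEq (h h' : HS) : Prop where
  reg : ∀ r, r ≤ 25 → h'.reg r = h.reg r
  arr : h'.arr = h.arr
  out : h'.out = h.out

lemma tr_schedStm {h : HS} {b K i t : ℕ} (hb : 2 ≤ b) (hK : 1 ≤ K) (h6 : h.reg 6 = K)
    (h10 : h.reg 10 = t) (h13 : h.reg 13 = i) (hY : b ^ K ≤ Y) (hKY : K ≤ Y) :
    (schedStm b).Tr ω M Y h ((K + 1) * 100) fun h' => AuxEq h h' ∧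
      h'.reg 28 = remTicks b K (K - 1) i t ∧ h'.reg 29 = curLevel b K (K - 1) i t ∧
      h'.reg 27 = b ^ curLevel b K (K - 1) i t := by
  have hpow : ∀ j ≤ K, b ^ j ≤ Y := fun j hj => (Nat.pow_le_pow_right (by omega) hj).trans hY
  have h1Y : 1 ≤ Y := by omega
  have key : (schedStm b).Tr ω M Y h (2 + (2 + (2 + ((K + 1) * (1 + 1 + 1 + 55) +
      (2 + (2 + (K - 1 + 1) * (1 + 1 + 1 + 8))))))) fun h' => AuxEq h h' ∧
      h'.reg 28 = remTicks b K (K - 1) i t ∧ h'.reg 29 = curLevel b K (K - 1) i t ∧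
      h'.reg 27 = b ^ curLevel b K (K - 1) i t := by
    unfold schedStm
    -- The first loop runs through the levels upwards and keeps the remaining time of the largest
    -- window found so far, as in the recursion of `Nat.findGreatest`.
    set g : ℕ → ℕ := fun j => b ^ (Nat.findGreatest (fun j => t / b ^ j % K = i) j) -
      t % b ^ (Nat.findGreatest (fun j => t / b ^ j % K = i) j) with hg
    refine Stm.Tr.bind (P := fun h' => AuxEq h h' ∧ h'.reg 27 = 1)
      (Stm.Tr.of_wp ⟨by norm_num, by norm_num, trivial, fun _ => h1Y, ⟨fun r hr => ?_, rfl, rfl⟩,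
        by simp⟩) ?_
    · rw [HS.setReg_reg, if_neg (by omega)]
    rintro h₁ ⟨x₁, y₁⟩
    refine Stm.Tr.bind (P := fun h' => AuxEq h h' ∧ h'.reg 27 = 1 ∧ h'.reg 28 = 1)
      (Stm.Tr.of_wp ⟨by norm_num, by norm_num, trivial, fun _ => h1Y, ⟨fun r hr => ?_, x₁.arr, x₁.out⟩,
        by simpa using y₁, by simp⟩) ?_
    · rw [HS.setReg_reg, if_neg (by omega), x₁.reg r hr]
    rintro h₂ ⟨x₂, y₂, z₂⟩
    refine Stm.Tr.bind (P := fun h' => AuxEq h h' ∧ h'.reg 27 = 1 ∧ h'.reg 28 = 1 ∧ h'.reg 26 = 0)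
      (Stm.Tr.of_wp ⟨by norm_num, by norm_num, trivial, fun _ => Nat.zero_le _,
        ⟨fun r hr => ?_, x₂.arr, x₂.out⟩, by simpa using y₂, by simpa using z₂, by simp⟩) ?_
    · rw [HS.setReg_reg, if_neg (by omega), x₂.reg r hr]
    rintro h₃ ⟨x₃, y₃, z₃, w₃⟩
    refine Stm.Tr.bind (P := fun h' => AuxEq h h' ∧ h'.reg 28 = remTicks b K (K - 1) i t)
      (Stm.Tr.loop (fun j h' => AuxEq h h' ∧ h'.reg 27 = b ^ j ∧ h'.reg 26 = j ∧
        h'.reg 28 = g (j - 1)) K ?_ ?_ ?_ ?_) ?_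
    · rintro j hj h' ⟨x, y, z, w⟩
      refine ⟨by simp, by simp, ?_⟩
      rw [Ex.eval_var, Ex.eval_var, z, x.reg 6 (by norm_num), h6]
    · rintro j hj h' ⟨x, y, z, w⟩
      have e6 : h'.reg 6 = K := by rw [x.reg 6 (by norm_num), h6]
      have e10 : h'.reg 10 = t := by rw [x.reg 10 (by norm_num), h10]
      have e13 : h'.reg 13 = i := by rw [x.reg 13 (by norm_num), h13]
      -- On level `0` the value is `1` whether or not the slot is in its window, so the truncated
      -- index `j - 1` in the invariant does no harm at `j = 0`.
      have hgs : g j = if t / b ^ j % K = i then b ^ j - t % b ^ j else g (j - 1) := by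
        rcases j with _ | j
        · simp [hg, Nat.mod_one]
        · simp only [hg, Nat.findGreatest_succ, Nat.add_sub_cancel]
          split_ifs <;> rfl
      refine Stm.Tr.mono (Stm.Tr.of_wp (?_ : Stm.wp ω M Y _ h' _)) (Nat.le_of_ble_eq_true rfl) fun _ h => h
      have fin : ∀ h'' : HS, AuxEq h h'' → h''.reg 27 = b ^ j → h''.reg 26 = j →
          h''.reg 28 = g j → Stm.wp ω M Y (.assign 27 (var 27 * lit b) ;;
            .assign 26 (var 26 + lit 1)) h'' fun h' => AuxEq h h' ∧ h'.reg 27 = b ^ (j + 1) ∧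
            h'.reg 26 = j + 1 ∧ h'.reg 28 = g (j + 1 - 1) := by
        intro h'' x' y' z' w'
        simp only [Stm.wp, Ex.eval_var, Ex.eval_lit, Ex.eval_add, Ex.eval_mul, Ex.ok_add,
          Ex.ok_mul, Ex.ok_var, Ex.ok_lit, HS.setReg_reg, Nat.reduceEqDiff, if_true, if_false,
          y', z', w', ← pow_succ]
        refine ⟨by norm_num, by norm_num, by norm_num, fun _ => hpow _ (by omega), by norm_num,
          by norm_num, by norm_num, fun _ => by omega, ⟨fun r hr => ?_, x'.arr, x'.out⟩, trivial,
          trivial, rfl⟩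
        rw [HS.setReg_reg, HS.setReg_reg, if_neg (by omega), if_neg (by omega), x'.reg r hr]
      have hskip : t / b ^ j % K ≠ i → Stm.wp ω M Y skipStm h' fun σ' =>
          Stm.wp ω M Y (.assign 27 (var 27 * lit b) ;; .assign 26 (var 26 + lit 1)) σ'
            fun h' => AuxEq h h' ∧ h'.reg 27 = b ^ (j + 1) ∧ h'.reg 26 = j + 1 ∧
              h'.reg 28 = g (j + 1 - 1) := by
        intro hne
        refine wp_skipStm (fin _ ⟨fun r hr => ?_, x.arr, x.out⟩ (by simpa using y)
          (by simpa using z) ?_)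
        · rw [HS.setReg_reg, if_neg (by omega), x.reg r hr]
        · rw [hgs, if_neg hne]; simpa using w
      rw [Stm.wp]
      simp only [Stm.wp.eq_7, Ex.eval_var, Ex.eval_lit, Ex.eval_add, Ex.eval_div, Ex.eval_mod,
        Ex.ok_div, Ex.ok_mod, Ex.ok_add, Ex.ok_var, Ex.ok_lit, e6, e10, e13, y]
      refine ⟨by norm_num, by norm_num, fun hlt => ⟨by norm_num, by norm_num,
        fun hlt' => hskip (by omega), fun hge => ?_⟩, fun hge => hskip (by omega)⟩
      refine ⟨by norm_num, by norm_num, by simp, fun _ => ?_, ?_⟩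
      · simp only [Ex.eval_sub, Ex.eval_var, Ex.eval_mod, y, e10]
        exact (Nat.sub_le _ _).trans (hpow _ hj.le)
      · refine fin _ ⟨fun r hr => ?_, x.arr, x.out⟩ (by simpa using y) (by simpa using z) ?_
        · rw [HS.setReg_reg, if_neg (by omega), x.reg r hr]
        · rw [hgs, if_pos (by omega)]
          simp [y, e10]
    · rintro h' ⟨x, -, -, w⟩
      exact ⟨x, w⟩
    · refine ⟨x₃, by simpa using y₃, w₃, ?_⟩
      simp [hg, z₃, Nat.mod_one]
    rintro h₄ ⟨x₄, y₄⟩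
    refine Stm.Tr.bind (P := fun h' => AuxEq h h' ∧ h'.reg 28 = remTicks b K (K - 1) i t ∧
        h'.reg 27 = 1) (Stm.Tr.of_wp ⟨by norm_num, by norm_num, trivial, fun _ => h1Y,
        ⟨fun r hr => ?_, x₄.arr, x₄.out⟩, by simpa using y₄, by simp⟩) ?_
    · rw [HS.setReg_reg, if_neg (by omega), x₄.reg r hr]
    rintro h₅ ⟨x₅, y₅, z₅⟩
    refine Stm.Tr.bind (P := fun h' => AuxEq h h' ∧ h'.reg 28 = remTicks b K (K - 1) i t ∧
        h'.reg 27 = 1 ∧ h'.reg 29 = 0) (Stm.Tr.of_wp ⟨by norm_num, by norm_num, trivial,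
        fun _ => Nat.zero_le _, ⟨fun r hr => ?_, x₅.arr, x₅.out⟩, by simpa using y₅,
        by simpa using z₅, by simp⟩) ?_
    · rw [HS.setReg_reg, if_neg (by omega), x₅.reg r hr]
    rintro h₆ ⟨x₆, y₆, z₆, w₆⟩
    have hcl : curLevel b K (K - 1) i t ≤ K - 1 := curLevel_le hb t
    refine Stm.Tr.mono (Stm.Tr.loop (fun j h' => AuxEq h h' ∧
        h'.reg 28 = remTicks b K (K - 1) i t ∧ h'.reg 27 = b ^ j ∧ h'.reg 29 = j)
      (curLevel b K (K - 1) i t) (t := 8) ?_ ?_ ?_ ?_) ?_ fun _ h => h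
    · rintro j hj h' ⟨x, y, z, w⟩
      refine ⟨by simp, by simp, ?_⟩
      rw [Ex.eval_var, Ex.eval_var, y, z]
      -- The second loop computes the ceiling of the logarithm by repeated multiplication.
      exact (Nat.lt_clog_iff_pow_lt (by omega)).symm
    · rintro j hj h' ⟨x, y, z, w⟩
      refine Stm.Tr.mono (Stm.Tr.of_wp (?_ : Stm.wp ω M Y _ h' _)) (Nat.le_of_ble_eq_true rfl) fun _ h => h
      simp only [Stm.wp, Ex.eval_var, Ex.eval_lit, Ex.eval_add, Ex.eval_mul, Ex.ok_add,
        Ex.ok_mul, Ex.ok_var, Ex.ok_lit, HS.setReg_reg, Nat.reduceEqDiff, if_true, if_false,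
        y, z, w, ← pow_succ]
      refine ⟨by norm_num, by norm_num, by norm_num, fun _ => hpow _ (by omega), by norm_num,
        by norm_num, by norm_num, fun _ => by omega, ⟨fun r hr => ?_, x.arr, x.out⟩, trivial,
        trivial, trivial⟩
      rw [HS.setReg_reg, HS.setReg_reg, if_neg (by omega), if_neg (by omega), x.reg r hr]
    · rintro h' ⟨x, y, z, w⟩
      exact ⟨x, y, w, z⟩
    · exact ⟨x₆, y₆, by simpa using z₆, w₆⟩
    · exact Nat.mul_le_mul (by omega) le_rfl
  exact key.mono (by omega) fun _ h => h

end

end DynMatching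

/-! ### Storing and loading slots, and the correctness of a tick -/

namespace DynMatching

section

open Ex (var lit get)

variable {ω : ℕ → ℕ} {M Y : ℕ} {A : Program} {Q : ℕ} {enc : A.Loc ≃ Fin Q}

/-- A slot with the variables that describe its tasks: the next pair to be inserted, the next
update, the time to be reached, the depth of the task, and, for each depth, the length of the log
and the time at which the task starts. -/
structure FullSlot (A : Program) where
  slot : Slot A
  bc : ℕ
  pos : ℕ
  goal : ℕ
  dv : ℕ
  mark : ℕ → ℕ
  pp : ℕ → ℕ

/-- The updates from the pair `bc` and the time `pos` up to the time `goal`. -/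
def envTodo (h : HS) (bc pos goal : ℕ) : List (Option (ℕ × ℕ × ℕ)) :=
  (List.range' bc (h.reg 8 - bc)).map
      (fun x => if 0 < h.arr (h.reg 12) x then some (1, x / h.reg 5, x % h.reg 5) else none) ++
    (List.range' pos (goal - pos)).map fun x => some (h.arr 0 x, h.arr 1 x, h.arr 2 x)

lemma todoOf_eq (h : HS) : todoOf h = envTodo h (h.reg 20) (h.reg 21) (h.reg 22) := rfl

lemma envTodo_congr {h h' : HS} (hr : ∀ r ∈ [5, 8, 12], h'.reg r = h.reg r)
    (ha : ∀ ρ < 8, h'.arr ρ = h.arr ρ) (h12 : h.reg 12 < 8) (bc pos goal : ℕ) :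
    envTodo h' bc pos goal = envTodo h bc pos goal := by
  simp only [List.mem_cons, List.not_mem_nil, or_false, forall_eq_or_imp, forall_eq] at hr
  obtain ⟨h5, h8, h12'⟩ := hr
  unfold envTodo
  rw [h5, h8, h12', ha _ h12, ha 0 (by omega), ha 1 (by omega), ha 2 (by omega)]

/-- The slot after the start of a task of depth `d` at the time `t`; `p` is the beginning of the
epoch. -/
def FullSlot.begin (F : FullSlot A) (h : HS) (d t p : ℕ) : FullSlot A where
  slot := { F.slot with
    low := Function.update F.mark (F.dv + 1) F.slot.log.length d
    mode := 2
    first := 1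
    todo := envTodo h (if d = 0 then 0 else F.bc)
      (if d = 0 then p else Function.update F.pp (F.dv + 1) F.goal d) (t + 1) }
  bc := if d = 0 then 0 else F.bc
  pos := if d = 0 then p else Function.update F.pp (F.dv + 1) F.goal d
  goal := t + 1
  dv := d
  mark := Function.update F.mark (F.dv + 1) F.slot.log.length
  pp := Function.update F.pp (F.dv + 1) F.goal

/-- The slot number `i` is stored in its arrays. -/
structure Stored (enc : A.Loc ≃ Fin Q) (h : HS) (i : ℕ) (F : FullSlot A) : Prop where
  cells : h.arr (8 * i + 8) = F.slot.cells
  logRep : LogRep (h.arr (8 * i + 8 + 1)) (h.arr (8 * i + 8 + 2)) F.slot.log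
  mark : h.arr (8 * i + 8 + 3) = F.mark
  pp : h.arr (8 * i + 8 + 4) = F.pp
  len : h.arr (8 * i + 8 + 5) 0 = F.slot.log.length
  low : h.arr (8 * i + 8 + 5) 1 = F.slot.low
  mode : h.arr (8 * i + 8 + 5) 2 = F.slot.mode
  loc : h.arr (8 * i + 8 + 5) 3 = enc F.slot.loc
  first : h.arr (8 * i + 8 + 5) 4 = F.slot.first
  bc : h.arr (8 * i + 8 + 5) 5 = F.bc
  pos : h.arr (8 * i + 8 + 5) 6 = F.pos
  goal : h.arr (8 * i + 8 + 5) 7 = F.goal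
  dv : h.arr (8 * i + 8 + 5) 8 = F.dv

lemma Stored.congr {h h' : HS} {i : ℕ} {F : FullSlot A} (hs : Stored enc h i F)
    (ha : ∀ ρ, 8 * i + 8 ≤ ρ → ρ < 8 * i + 16 → h'.arr ρ = h.arr ρ) : Stored enc h' i F := by
  obtain ⟨h1, h2, h3, h4, h5, h6, h7, h8, h9, h10, h11, h12, h13⟩ := hs
  have e5 := ha (8 * i + 8 + 5) (by omega) (by omega)
  refine ⟨?_, ?_, ?_, ?_, e5 ▸ h5, e5 ▸ h6, e5 ▸ h7, e5 ▸ h8, e5 ▸ h9, e5 ▸ h10, e5 ▸ h11,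
    e5 ▸ h12, e5 ▸ h13⟩
  · rw [ha _ (by omega) (by omega)]; exact h1
  · rw [ha _ (by omega) (by omega), ha _ (by omega) (by omega)]; exact h2
  · rw [ha _ (by omega) (by omega)]; exact h3
  · rw [ha _ (by omega) (by omega)]; exact h4

/-- The slot number `i` has been loaded into the variables. -/
structure Loaded (enc : A.Loc ≃ Fin Q) (M : ℕ) (h : HS) (i : ℕ) (F : FullSlot A) : Prop where
  sl : h.reg 14 = 8 * i + 8
  rep : Rep enc M h F.slot
  bc : h.reg 20 = F.bc
  pos : h.reg 21 = F.pos
  goal : h.reg 22 = F.goal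
  dv : h.reg 23 = F.dv
  mark : h.arr (8 * i + 8 + 3) = F.mark
  pp : h.arr (8 * i + 8 + 4) = F.pp

lemma wp_loadStm {h : HS} {i : ℕ} {F : FullSlot A} (hs : Stored enc h i F) (h13 : h.reg 13 = i)
    (hM : 8 * i + 16 ≤ M) (hMY : M ≤ Y) (h12 : h.reg 12 < 8)
    (htodo : F.slot.todo = envTodo h F.bc F.pos F.goal) :
    loadStm.wp ω M Y h fun h' => Loaded enc M h' i F ∧ (∀ r ≤ 13, h'.reg r = h.reg r) ∧
      h'.arr = h.arr ∧ h'.out = h.out := by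
  obtain ⟨k1, k2, k3, k4, k5, k6, k7, k8, k9, k10, k11, k12, k13⟩ := hs
  have hi : i * 8 + 8 = 8 * i + 8 := by ring
  simp only [loadStm, Stm.wp, Ex.eval_var, Ex.eval_lit, Ex.eval_get, Ex.eval_add, Ex.eval_mul,
    Ex.ok_var, Ex.ok_lit, Ex.ok_get, Ex.ok_add, Ex.ok_mul, HS.setReg_reg, HS.setReg_arr,
    Nat.reduceEqDiff, if_true, if_false, h13, hi, k5, k6, k7, k8, k9, k10, k11, k12, k13]
  have hr5 : 8 * i + 8 + 5 < M := by omega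
  have hget : ∀ {h' : HS}, h'.Bdd M Y → h'.arr = h.arr → ∀ x, h.arr (8 * i + 8 + 5) x ≤ Y :=
    fun {h'} hb he x => he ▸ hb.2 _ hr5 x
  refine ⟨by norm_num, by norm_num, by norm_num, fun _ => by omega,
    by norm_num, by norm_num, ⟨by norm_num, trivial, hr5⟩, fun hb => k5 ▸ hget hb rfl _,
    by norm_num, by norm_num, ⟨by norm_num, trivial, hr5⟩, fun hb => k6 ▸ hget hb rfl _,
    by norm_num, by norm_num, ⟨by norm_num, trivial, hr5⟩, fun hb => k7 ▸ hget hb rfl _,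
    by norm_num, by norm_num, ⟨by norm_num, trivial, hr5⟩, fun hb => k8 ▸ hget hb rfl _,
    by norm_num, by norm_num, ⟨by norm_num, trivial, hr5⟩, fun hb => k9 ▸ hget hb rfl _,
    by norm_num, by norm_num, ⟨by norm_num, trivial, hr5⟩, fun hb => k10 ▸ hget hb rfl _,
    by norm_num, by norm_num, ⟨by norm_num, trivial, hr5⟩, fun hb => k11 ▸ hget hb rfl _,
    by norm_num, by norm_num, ⟨by norm_num, trivial, hr5⟩, fun hb => k12 ▸ hget hb rfl _,
    by norm_num, by norm_num, ⟨by norm_num, trivial, hr5⟩, fun hb => k13 ▸ hget hb rfl _,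
    ⟨by simp, ⟨⟨by simp, by simpa using hM, by simpa using k1, by simpa using k2, by simp⟩,
      by simp, by simp, by simp, by simp, ?_, by simpa using h12⟩, by simp, by simp, by simp,
      by simp, k3, k4⟩, fun r hr => ?_, trivial, rfl⟩
  · rw [htodo, todoOf_eq]
    simp [envTodo]
  · rw [if_neg (by omega), if_neg (by omega), if_neg (by omega), if_neg (by omega),
      if_neg (by omega), if_neg (by omega), if_neg (by omega), if_neg (by omega),
      if_neg (by omega), if_neg (by omega)]

lemma wp_saveStm {h : HS} {i : ℕ} {F : FullSlot A} (hl : Loaded enc M h i F) :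
    saveStm.wp ω M Y h fun h' => Stored enc h' i F ∧ h'.reg = h.reg ∧
      (∀ ρ, ρ < 8 * i + 8 ∨ 8 * i + 16 ≤ ρ → h'.arr ρ = h.arr ρ) ∧ h'.out = h.out := by
  obtain ⟨hsl, hrep, k20, k21, k22, k23, k3, k4⟩ := hl
  have hM := hrep.core.lt
  rw [hsl] at hM
  have hr5 : 8 * i + 8 + 5 < M := by omega
  simp only [saveStm, Stm.wp, Ex.eval_var, Ex.eval_lit, Ex.eval_add,
    Ex.ok_var, Ex.ok_lit, Ex.ok_add, HS.setArr_reg, hsl]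
  have h1 := hrep.core.cells
  have h2 := hrep.core.logRep
  rw [hsl] at h1 h2
  refine ⟨⟨by norm_num, trivial, by norm_num, hr5⟩, fun hb => hb.1 _ (by norm_num),
    ⟨by norm_num, trivial, by norm_num, hr5⟩, fun hb => hb.1 _ (by norm_num),
    ⟨by norm_num, trivial, by norm_num, hr5⟩, fun hb => hb.1 _ (by norm_num),
    ⟨by norm_num, trivial, by norm_num, hr5⟩, fun hb => hb.1 _ (by norm_num),
    ⟨by norm_num, trivial, by norm_num, hr5⟩, fun hb => hb.1 _ (by norm_num),
    ⟨by norm_num, trivial, by norm_num, hr5⟩, fun hb => hb.1 _ (by norm_num),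
    ⟨by norm_num, trivial, by norm_num, hr5⟩, fun hb => hb.1 _ (by norm_num),
    ⟨by norm_num, trivial, by norm_num, hr5⟩, fun hb => hb.1 _ (by norm_num),
    ⟨by norm_num, trivial, by norm_num, hr5⟩, fun hb => hb.1 _ (by norm_num),
    ⟨?_, ?_, ?_, ?_, ?_, ?_, ?_, ?_, ?_, ?_, ?_, ?_, ?_⟩, trivial, ?_, rfl⟩
  · simpa using h1
  · simpa using h2
  · simpa using k3
  · simpa using k4
  · simpa [Function.update_apply] using hrep.core.len
  · simpa [Function.update_apply] using hrep.low
  · simpa [Function.update_apply] using hrep.mode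
  · simpa [Function.update_apply] using hrep.loc
  · simpa [Function.update_apply] using hrep.first
  · simpa [Function.update_apply] using k20
  · simpa [Function.update_apply] using k21
  · simpa [Function.update_apply] using k22
  · simpa [Function.update_apply] using k23
  · intro ρ hρ
    have hne : ρ ≠ 8 * i + 8 + 5 := by omega
    simp [hne]

/-- The end of the finished task is a possible checkpoint for a task one level deeper. It is
therefore recorded at depth `dv + 1` before the data of the new depth are looked up, which may be
this very entry. -/
lemma wp_startStm {h : HS} {i K lv t E : ℕ} {F : FullSlot A} (hl : Loaded enc M h i F)
    (h6 : h.reg 6 = K) (h29 : h.reg 29 = lv) (h10 : h.reg 10 = t) (h11 : h.reg 11 = E)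
    (htY : t + 2 ≤ Y) :
    startStm.wp ω M Y h fun h' => Loaded enc M h' i (F.begin h (K - 1 - lv) t (t / E * E)) ∧
      (∀ r, r ≤ 14 ∨ (26 ≤ r ∧ r ≤ 29) → h'.reg r = h.reg r) ∧
      (∀ ρ, ρ < 8 * i + 8 ∨ 8 * i + 16 ≤ ρ → h'.arr ρ = h.arr ρ) ∧ h'.out = h.out := by
  obtain ⟨hsl, hrep, k20, k21, k22, k23, k3, k4⟩ := hl
  have hM := hrep.core.lt
  have h12 := hrep.tab
  have hlen := hrep.core.len
  rw [hsl] at hM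
  have hr3 : 8 * i + 8 + 3 < M := by omega
  have hr4 : 8 * i + 8 + 4 < M := by omega
  have hte : t / E * E ≤ t := Nat.div_mul_le_self t E
  have h1 := hrep.core.cells
  have h2 := hrep.core.logRep
  rw [hsl] at h1 h2
  simp only [startStm, Stm.wp, Ex.eval_var, Ex.eval_lit, Ex.eval_get, Ex.eval_add, Ex.eval_sub,
    Ex.eval_mul, Ex.eval_div, Ex.ok_var, Ex.ok_lit, Ex.ok_get, Ex.ok_add, Ex.ok_sub, Ex.ok_mul,
    Ex.ok_div, HS.setArr_reg, HS.setReg_reg, HS.setReg_arr, HS.setArr_arr, Nat.reduceEqDiff,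
    if_true, if_false, hsl, h6, h29, h10, h11, k23, k22, hlen]
  have e1 : Function.update (Function.update h.arr (8 * i + 8 + 3)
      (Function.update (h.arr (8 * i + 8 + 3)) (F.dv + 1) F.slot.log.length)) (8 * i + 8 + 4)
      (Function.update (Function.update h.arr (8 * i + 8 + 3)
      (Function.update (h.arr (8 * i + 8 + 3)) (F.dv + 1) F.slot.log.length) (8 * i + 8 + 4))
        (F.dv + 1) F.goal) = Function.update (Function.update h.arr (8 * i + 8 + 3)
      (Function.update F.mark (F.dv + 1) F.slot.log.length)) (8 * i + 8 + 4)
      (Function.update F.pp (F.dv + 1) F.goal) := by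
    rw [k3, ← k4]; simp
  simp only [e1]
  set arr' := Function.update (Function.update h.arr (8 * i + 8 + 3)
      (Function.update F.mark (F.dv + 1) F.slot.log.length)) (8 * i + 8 + 4)
      (Function.update F.pp (F.dv + 1) F.goal) with harr'
  have a3 : arr' (8 * i + 8 + 3) = Function.update F.mark (F.dv + 1) F.slot.log.length := by
    simp [harr']
  have a4 : arr' (8 * i + 8 + 4) = Function.update F.pp (F.dv + 1) F.goal := by
    simp [harr']
  have aρ : ∀ ρ, ρ ≠ 8 * i + 8 + 3 → ρ ≠ 8 * i + 8 + 4 → arr' ρ = h.arr ρ := by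
    intro ρ h3 h4; simp [harr', h3, h4]
  set d := K - 1 - lv with hd
  refine ⟨⟨by norm_num, by norm_num, by norm_num, hr3⟩, fun hb => hlen ▸ hb.1 15 (by norm_num),
    ⟨by norm_num, by norm_num, by norm_num, hr4⟩,
    fun hb => by have := hb.1 22 (by norm_num); rwa [HS.setArr_reg, k22] at this,
    by norm_num, by norm_num, by norm_num,
    fun hb => by
      have := hb.1 6 (by norm_num)
      rw [HS.setArr_reg, HS.setArr_reg, h6] at this
      omega,
    by norm_num, by norm_num, ⟨by norm_num, by norm_num, hr3⟩,
    fun hb => by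
      have := hb.2 _ hr3 d
      simpa only [HS.setReg_arr, HS.setArr_arr, HS.setArr_reg, e1, hlen, k22, k23] using this,
    by norm_num, trivial, fun hd0 => ?_, fun hd0 => ?_⟩
  · have hd0' : d = 0 := by omega
    refine ⟨by norm_num, by norm_num, by norm_num, fun _ => by omega, by norm_num, by norm_num,
      trivial, fun _ => Nat.zero_le _, by norm_num, by norm_num, by norm_num, fun _ => by omega,
      by norm_num, by norm_num, trivial, fun _ => by omega, by norm_num, by norm_num, trivial,
      fun _ => by omega, ⟨?_, ⟨⟨?_, ?_, ?_, ?_, ?_⟩, ?_, ?_, ?_, ?_, ?_, ?_⟩, ?_, ?_, ?_, ?_, ?_,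
      ?_⟩, fun r hr => ?_, fun ρ hρ => ?_, ?_⟩
    all_goals try simp only [HS.setReg_reg, HS.setReg_arr, HS.setReg_out, HS.setArr_reg, HS.setArr_arr,
      HS.setArr_out, Nat.reduceEqDiff, if_true, if_false, hsl, hlen, k22, k23, e1,
      FullSlot.begin, hd0', a3, a4]
    · omega
    · omega
    · rw [aρ _ (by omega) (by omega)]; exact h1
    · rw [aρ _ (by omega) (by omega), aρ _ (by omega) (by omega)]; exact h2
    · exact hrep.loc
    · rw [todoOf_eq]
      simp only [envTodo, HS.setReg_reg, HS.setReg_arr, HS.setArr_reg, HS.setArr_arr,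
        Nat.reduceEqDiff, if_true, if_false, e1, k22]
      rw [aρ _ (by omega) (by omega), aρ 0 (by omega) (by omega), aρ 1 (by omega) (by omega),
        aρ 2 (by omega) (by omega)]
    · exact h12
    · rw [if_neg (by omega), if_neg (by omega), if_neg (by omega), if_neg (by omega),
        if_neg (by omega), if_neg (by omega), if_neg (by omega)]
    · exact aρ ρ (by omega) (by omega)
  · have hd0' : d ≠ 0 := by omega
    refine ⟨by norm_num, by norm_num, ⟨by norm_num, by norm_num, hr4⟩,
      fun hb => by
        have := hb.2 _ hr4 d
        simpa only [HS.setReg_arr, HS.setArr_arr, HS.setArr_reg, e1, hlen, k22, k23] using this,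
      by norm_num, by norm_num, by norm_num, fun _ => by omega,
      by norm_num, by norm_num, trivial, fun _ => by omega, by norm_num, by norm_num, trivial,
      fun _ => by omega, ⟨?_, ⟨⟨?_, ?_, ?_, ?_, ?_⟩, ?_, ?_, ?_, ?_, ?_, ?_⟩, ?_, ?_, ?_, ?_, ?_,
      ?_⟩, fun r hr => ?_, fun ρ hρ => ?_, ?_⟩
    all_goals try simp only [HS.setReg_reg, HS.setReg_arr, HS.setReg_out, HS.setArr_reg, HS.setArr_arr,
      HS.setArr_out, Nat.reduceEqDiff, if_true, if_false, hsl, hlen, k22, k23, e1,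
      FullSlot.begin, hd0', a3, a4]
    · omega
    · omega
    · rw [aρ _ (by omega) (by omega)]; exact h1
    · rw [aρ _ (by omega) (by omega), aρ _ (by omega) (by omega)]; exact h2
    · exact hrep.loc
    · rw [todoOf_eq]
      simp only [envTodo, HS.setReg_reg, HS.setReg_arr, HS.setArr_reg, HS.setArr_arr,
        Nat.reduceEqDiff, if_true, if_false, e1, k20, k22]
      rw [aρ _ (by omega) (by omega), aρ 0 (by omega) (by omega), aρ 1 (by omega) (by omega),
        aρ 2 (by omega) (by omega)]
    · exact h12
    · exact k20
    · rw [if_neg (by omega), if_neg (by omega), if_neg (by omega), if_neg (by omega),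
        if_neg (by omega), if_neg (by omega)]
    · exact aρ ρ (by omega) (by omega)

/-- The two counters are existential, since how far fetching gets depends on the run. Later only the
monotonicity of the pair counter is needed. -/
lemma tr_workStm {h : HS} {i R W D : ℕ} {F : FullSlot A} (hl : Loaded enc M h i F)
    (hregs : ∀ q, (A.code q).RegsLe Y) (hD : D + 4 ≤ Y) (h8 : 8 ≤ Y) (hQ : Q ≤ Y)
    (hW : 2 * W + 1 ≤ Y) (h9 : h.reg 9 = R) (hRY : R ≤ Y)
    (hok : ∀ y ≤ R, ((Slot.micro ω)^[y] F.slot).Ok W D) :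
    (workStm enc).Tr ω M Y h ((R + 1) * ((microStm enc).cost + 10)) fun h' =>
      ∃ bc pos, F.bc ≤ bc ∧
        Loaded enc M h' i { F with slot := (Slot.micro ω)^[R] F.slot, bc := bc, pos := pos } ∧
        (∀ r, r ≤ 14 ∨ (27 ≤ r ∧ r ≤ 29) → h'.reg r = h.reg r) ∧
        (∀ ρ, ρ < 8 * i + 8 ∨ 8 * i + 16 ≤ ρ → h'.arr ρ = h.arr ρ) ∧ h'.out = h.out := by
  obtain ⟨hsl, hrep, k20, k21, k22, k23, k3, k4⟩ := hl
  have key : (workStm enc).Tr ω M Y h (2 + (R + 1) * (1 + 1 + 1 + ((microStm enc).cost + 4)))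
      fun h' => Rep enc M h' ((Slot.micro ω)^[R] F.slot) ∧ h.reg 20 ≤ h'.reg 20 ∧
        (∀ r, r ≤ 14 ∨ (22 ≤ r ∧ r ≤ 23) ∨ (27 ≤ r ∧ r ≤ 29) → h'.reg r = h.reg r) ∧
        (∀ ρ, ρ < h.reg 14 ∨ h.reg 14 + 3 ≤ ρ → h'.arr ρ = h.arr ρ) ∧ h'.out = h.out := by
    unfold workStm
    refine Stm.Tr.bind (P := fun h' => h' = h.setReg 26 0)
      (Stm.Tr.of_wp ⟨by norm_num, by norm_num, trivial, fun _ => Nat.zero_le _, rfl⟩) ?_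
    rintro _ rfl
    refine Stm.Tr.loop (fun y h' => h'.reg 26 = y ∧ Rep enc M h' ((Slot.micro ω)^[y] F.slot) ∧
        h.reg 20 ≤ h'.reg 20 ∧
        (∀ r, r ≤ 14 ∨ (22 ≤ r ∧ r ≤ 23) ∨ (27 ≤ r ∧ r ≤ 29) → h'.reg r = h.reg r) ∧
        (∀ ρ, ρ < h.reg 14 ∨ h.reg 14 + 3 ≤ ρ → h'.arr ρ = h.arr ρ) ∧ h'.out = h.out) R
      ?_ ?_ ?_ ?_
    · rintro y hy h' ⟨e1, -, -, e4, -⟩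
      refine ⟨by simp, by simp, ?_⟩
      rw [Ex.eval_var, Ex.eval_var, e1, e4 9 (by omega), h9]
    · rintro y hy h' ⟨e1, e2, e3, e4, e5, e6⟩
      refine Stm.Tr.bind (Stm.Tr.of_wp (wp_microStm e2 hregs hD h8 hQ hW (hok y hy.le) ?_)) ?_
      · rw [← Function.iterate_succ_apply' (Slot.micro ω)]; exact hok _ hy
      rintro h'' ⟨f1, f2⟩
      rw [← Function.iterate_succ_apply' (Slot.micro ω)] at f1
      have h26 : h''.reg 26 = y := by rw [f2.reg 26 (by omega), e1]
      refine Stm.Tr.of_wp ⟨by norm_num, by norm_num, by simp, fun _ => ?_, ?_, ?_, ?_, ?_, ?_, ?_⟩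
      · simp only [Ex.eval_add, Ex.eval_var, Ex.eval_lit, h26]; omega
      · simp [h26]
      · refine ⟨f1.core.congr (by simp) (by simp) (by simp), ?_, ?_, ?_, ?_, ?_, ?_⟩
        · simpa using f1.loc
        · simpa using f1.low
        · simpa using f1.mode
        · simpa using f1.first
        · rw [f1.todo]
          simp [todoOf]
        · simpa using f1.tab
      · rw [HS.setReg_reg, if_neg (by omega)]; exact e3.trans f2.next
      · intro r hr
        rw [HS.setReg_reg, if_neg (by omega), f2.reg r (by omega), e4 r hr]
      · intro ρ hρ
        rw [HS.setReg_arr, f2.arr ρ (by rw [e4 14 (by omega)]; exact hρ), e5 ρ hρ]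
      · rw [HS.setReg_out, f2.out, e6]
    · rintro h' ⟨-, e⟩; exact e
    · refine ⟨by simp, ⟨hrep.core.congr (by simp) (by simp) (by simp), by simpa using hrep.loc,
        by simpa using hrep.low, by simpa using hrep.mode, by simpa using hrep.first, ?_,
        by simpa using hrep.tab⟩, by simp, fun r hr => ?_, fun _ _ => rfl, rfl⟩
      · rw [Function.iterate_zero_apply, hrep.todo]; simp [todoOf]
      · rw [HS.setReg_reg, if_neg (by omega)]
  refine key.mono ?_ ?_
  · nlinarith
  · rintro h' ⟨e1, e2, e3, e4, e5⟩
    rw [hsl] at e4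
    refine ⟨h'.reg 20, h'.reg 21, k20 ▸ e2, ⟨by rw [e3 14 (by omega), hsl], e1, rfl, rfl,
      by rw [e3 22 (by omega), k22], by rw [e3 23 (by omega), k23], ?_, ?_⟩,
      fun r hr => e3 r (by omega), fun ρ hρ => e4 ρ (by omega), e5⟩
    · rw [e4 _ (by omega), k3]
    · rw [e4 _ (by omega), k4]

/-- The slot at the beginning of the tick `t`, after the start of a new task if there is one. -/
def FullSlot.turn (F : FullSlot A) (h : HS) (b K i t E : ℕ) : FullSlot A :=
  if remTicks b K (K - 1) i t = b ^ curLevel b K (K - 1) i t then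
    F.begin h (K - 1 - curLevel b K (K - 1) i t) t (t / E * E) else F

lemma FullSlot.begin_congr (F : FullSlot A) {h h' : HS} (hr : ∀ r ∈ [5, 8, 12], h'.reg r = h.reg r)
    (ha : ∀ ρ < 8, h'.arr ρ = h.arr ρ) (h12 : h.reg 12 < 8) (d t p : ℕ) :
    F.begin h' d t p = F.begin h d t p := by
  unfold FullSlot.begin
  rw [envTodo_congr hr ha h12]

/-- The output after a tick of a slot. -/
def outAfter (M i : ℕ) (F : FullSlot A) (out : ℕ → ℕ) : ℕ → ℕ :=
  Function.update (Function.update out 0 (2 + M + (8 * i + 8) + F.slot.cells 1 * (2 * M)))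
    1 (F.slot.cells 3 * (2 * M))

lemma tr_tickStm {h : HS} {b i t E K R W D : ℕ} {F : FullSlot A} (hb : 2 ≤ b) (hK : 1 ≤ K)
    (hs : Stored enc h i F) (htodo : F.slot.todo = envTodo h F.bc F.pos F.goal)
    (h4 : h.reg 4 = M) (h6 : h.reg 6 = K) (h9 : h.reg 9 = R) (h10 : h.reg 10 = t)
    (h11 : h.reg 11 = E) (h12 : h.reg 12 < 8) (h13 : h.reg 13 = i) (hi : i < K)
    (hM : 8 * i + 16 ≤ M) (hMY : M ≤ Y) (hbY : b ^ K ≤ Y) (hKY : K ≤ Y) (htY : t + 2 ≤ Y)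
    (hregs : ∀ q, (A.code q).RegsLe Y) (hD : D + 4 ≤ Y) (h8 : 8 ≤ Y) (hQ : Q ≤ Y)
    (hW : 2 * W + 1 ≤ Y) (hRY : R ≤ Y)
    (hok : ∀ y ≤ R, ((Slot.micro ω)^[y] (F.turn h b K i t E).slot).Ok W D) :
    (tickStm enc b).Tr ω M Y h ((K + R + 2) * ((microStm enc).cost + 1000)) fun h' =>
      ∃ F' : FullSlot A, F'.slot = (Slot.micro ω)^[R] (F.turn h b K i t E).slot ∧
        (F.turn h b K i t E).bc ≤ F'.bc ∧ F'.goal = (F.turn h b K i t E).goal ∧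
        F'.dv = (F.turn h b K i t E).dv ∧ F'.mark = (F.turn h b K i t E).mark ∧
        F'.pp = (F.turn h b K i t E).pp ∧ Stored enc h' i F' ∧
        F'.slot.todo = envTodo h F'.bc F'.pos F'.goal ∧
        (∀ r ≤ 12, h'.reg r = h.reg r) ∧ h'.reg 13 = i + 1 ∧
        (∀ ρ, ρ < 8 * i + 8 ∨ 8 * i + 16 ≤ ρ → h'.arr ρ = h.arr ρ) ∧
        h'.out = if remTicks b K (K - 1) i t = 1 then outAfter M i F' h.out else h.out := by
  have hcost : startStm.cost ≤ 200 ∧ loadStm.cost ≤ 200 ∧ saveStm.cost ≤ 200 ∧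
      outStm.cost ≤ 100 ∧ skipStm.cost ≤ 100 := ⟨by decide, by decide, by decide, by decide, by decide⟩
  -- With this bound the failure of the test `28 < 27` means equality, that is, a task starts in
  -- this tick.
  have hrem := remTicks_le_pow_cur (m := K) (L := K - 1) (i := i) hb t
  have key : (tickStm enc b).Tr ω M Y h (loadStm.cost + ((K + 1) * 100 + ((1 + (1 + (1 + 200))) +
      ((R + 1) * ((microStm enc).cost + 10) + (saveStm.cost + ((1 + (1 + (1 + 100))) + 4)))))) fun h' =>
      ∃ F' : FullSlot A, F'.slot = (Slot.micro ω)^[R] (F.turn h b K i t E).slot ∧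
        (F.turn h b K i t E).bc ≤ F'.bc ∧ F'.goal = (F.turn h b K i t E).goal ∧
        F'.dv = (F.turn h b K i t E).dv ∧ F'.mark = (F.turn h b K i t E).mark ∧
        F'.pp = (F.turn h b K i t E).pp ∧ Stored enc h' i F' ∧
        F'.slot.todo = envTodo h F'.bc F'.pos F'.goal ∧
        (∀ r ≤ 12, h'.reg r = h.reg r) ∧ h'.reg 13 = i + 1 ∧
        (∀ ρ, ρ < 8 * i + 8 ∨ 8 * i + 16 ≤ ρ → h'.arr ρ = h.arr ρ) ∧
        h'.out = if remTicks b K (K - 1) i t = 1 then outAfter M i F' h.out else h.out := by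
    unfold tickStm
    refine Stm.Tr.bind (Stm.Tr.of_wp (wp_loadStm hs h13 hM hMY h12 htodo)) ?_
    rintro h₁ ⟨l₁, r₁, a₁, o₁⟩
    refine Stm.Tr.bind (tr_schedStm hb hK (by rw [r₁ 6 (by omega), h6])
      (by rw [r₁ 10 (by omega), h10]) (by rw [r₁ 13 (by omega), h13]) hbY hKY) ?_
    rintro h₂ ⟨x₂, e28, e29, e27⟩
    have l₂ : Loaded enc M h₂ i F := by
      obtain ⟨q1, q2, q3, q4, q5, q6, q7, q8⟩ := l₁
      refine ⟨by rw [x₂.reg 14 (by omega), q1], ⟨q2.core.congr (x₂.reg 14 (by omega))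
        (x₂.reg 15 (by omega)) (by simp [x₂.arr]), by rw [x₂.reg 18 (by omega), q2.loc],
        by rw [x₂.reg 16 (by omega), q2.low], by rw [x₂.reg 17 (by omega), q2.mode],
        by rw [x₂.reg 19 (by omega), q2.first], ?_, by rw [x₂.reg 12 (by omega)]; exact q2.tab⟩,
        by rw [x₂.reg 20 (by omega), q3], by rw [x₂.reg 21 (by omega), q4],
        by rw [x₂.reg 22 (by omega), q5], by rw [x₂.reg 23 (by omega), q6],
        by rw [x₂.arr, q7], by rw [x₂.arr, q8]⟩
      refine q2.todo.trans (todoOf_congr (fun r hr => x₂.reg r ?_) (by simp [x₂.arr]) q2.tab).symm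
      simp only [List.mem_cons, List.not_mem_nil, or_false] at hr
      omega
    have r₂ : ∀ r ≤ 13, h₂.reg r = h.reg r := fun r hr => by rw [x₂.reg r (by omega), r₁ r hr]
    have a₂ : h₂.arr = h.arr := x₂.arr.trans a₁
    have o₂ : h₂.out = h.out := x₂.out.trans o₁
    refine Stm.Tr.bind (P := fun h' => Loaded enc M h' i (F.turn h b K i t E) ∧
        (∀ r, r ≤ 13 ∨ (27 ≤ r ∧ r ≤ 29) → h'.reg r = h₂.reg r) ∧
        (∀ ρ, ρ < 8 * i + 8 ∨ 8 * i + 16 ≤ ρ → h'.arr ρ = h.arr ρ) ∧ h'.out = h.out)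
      (Stm.Tr.ite (by simp) (by simp) (fun hlt => ?_) fun hge => ?_) ?_
    · simp only [Ex.eval_var, e28, e27] at hlt
      refine (Stm.Tr.of_wp (wp_skipStm ?_)).mono (by omega) fun _ h => h
      rw [FullSlot.turn, if_neg (by omega)]
      obtain ⟨q1, q2, q3, q4, q5, q6, q7, q8⟩ := l₂
      refine ⟨⟨by simpa using q1, ⟨q2.core.congr (by simp) (by simp) (by simp),
        by simpa using q2.loc, by simpa using q2.low, by simpa using q2.mode,
        by simpa using q2.first, ?_, by simpa using q2.tab⟩, by simpa using q3, by simpa using q4,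
        by simpa using q5, by simpa using q6, by simpa using q7, by simpa using q8⟩,
        fun r hr => ?_, fun ρ _ => ?_, ?_⟩
      · rw [q2.todo]; simp [todoOf]
      · rw [HS.setReg_reg, if_neg (by omega)]
      · rw [HS.setReg_arr, a₂]
      · rw [HS.setReg_out, o₂]
    · simp only [Ex.eval_var, e28, e27] at hge
      refine (Stm.Tr.of_wp (wp_startStm l₂ (by rw [r₂ 6 (by omega), h6]) e29
        (by rw [r₂ 10 (by omega), h10]) (by rw [r₂ 11 (by omega), h11]) htY)).mono hcost.1 ?_
      rintro h₃ ⟨l₃, r₃, a₃, o₃⟩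
      rw [FullSlot.turn, if_pos (by omega)]
      refine ⟨?_, fun r hr => r₃ r (by omega), fun ρ hρ => by rw [a₃ ρ hρ, a₂], by rw [o₃, o₂]⟩
      rw [F.begin_congr (h := h) (fun r hr => ?_) (fun ρ _ => by rw [a₂]) h12] at l₃
      · exact l₃
      · simp only [List.mem_cons, List.not_mem_nil, or_false] at hr
        exact r₂ r (by omega)
    rintro h₃ ⟨l₃, r₃, a₃, o₃⟩
    refine Stm.Tr.bind (tr_workStm l₃ hregs hD h8 hQ hW
      (by rw [r₃ 9 (by omega), r₂ 9 (by omega), h9]) hRY hok) ?_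
    rintro h₄ ⟨bc, pos, hbc, l₄, r₄, a₄, o₄⟩
    refine Stm.Tr.bind (Stm.Tr.of_wp (wp_saveStm l₄)) ?_
    rintro h₅ ⟨s₅, r₅, a₅, o₅⟩
    have hreg : ∀ r ≤ 13, h₅.reg r = h.reg r := fun r hr => by
      rw [r₅, r₄ r (by omega), r₃ r (by omega), r₂ r hr]
    have harr : ∀ ρ, ρ < 8 * i + 8 ∨ 8 * i + 16 ≤ ρ → h₅.arr ρ = h.arr ρ := fun ρ hρ => by
      rw [a₅ ρ hρ, a₄ ρ hρ, a₃ ρ hρ]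
    have h28 : h₅.reg 28 = remTicks b K (K - 1) i t := by
      rw [r₅, r₄ 28 (by omega), r₃ 28 (by omega), e28]
    have h14 : h₅.reg 14 = 8 * i + 8 := by rw [r₅]; exact l₄.sl
    have htd := l₄.rep.todo
    rw [todoOf_eq, l₄.bc, l₄.pos, l₄.goal] at htd
    simp only at htd
    rw [envTodo_congr (h := h) (fun r hr => ?_) (fun ρ hρ => by rw [a₄ ρ (by omega), a₃ ρ (by omega)])
      h12] at htd
    rotate_left
    · simp only [List.mem_cons, List.not_mem_nil, or_false] at hr
      rw [r₄ r (by omega), r₃ r (by omega), r₂ r (by omega)]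
    have hpos := remTicks_pos (m := K) (L := K - 1) (i := i) hb t
    set F' : FullSlot A := { F.turn h b K i t E with
      slot := (Slot.micro ω)^[R] (F.turn h b K i t E).slot, bc := bc, pos := pos } with hF'
    refine Stm.Tr.bind (P := fun h' => (∀ r ≤ 14, h'.reg r = h₅.reg r) ∧ h'.arr = h₅.arr ∧
        h'.out = if remTicks b K (K - 1) i t = 1 then outAfter M i F' h.out else h.out)
      (Stm.Tr.ite (by simp) (by simp) (fun hlt => ?_) fun hge => ?_) ?_
    -- The remaining time is at least one, so the test for less than `2` singles out the last tick
    -- of a window.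
    · simp only [Ex.eval_var, Ex.eval_lit, h28] at hlt
      refine (Stm.Tr.of_wp ?_).mono hcost.2.2.2.1 fun _ h => h
      have h4' : h₅.reg 4 = M := by rw [hreg 4 (by omega), h4]
      simp only [outStm, Stm.wp, Ex.eval_var, Ex.eval_lit, Ex.eval_get, Ex.eval_add, Ex.eval_mul,
        Ex.ok_var, Ex.ok_lit, Ex.ok_get, Ex.ok_add, Ex.ok_mul, HS.setOut_reg, HS.setOut_arr, h14,
        h4', s₅.cells]
      have : 8 * i + 8 < M := by omega
      refine ⟨by norm_num, ⟨⟨by norm_num, by norm_num⟩, by simpa using this⟩, by norm_num,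
        by simpa using this, fun _ _ => trivial, trivial, ?_⟩
      rw [if_pos (by omega)]
      simp only [HS.setOut_out, outAfter, o₅, o₄, o₃]
    · simp only [Ex.eval_var, Ex.eval_lit, h28] at hge
      refine (Stm.Tr.of_wp (wp_skipStm ?_)).mono hcost.2.2.2.2 fun _ h => h
      refine ⟨fun r hr => ?_, rfl, ?_⟩
      · rw [HS.setReg_reg, if_neg (by omega)]
      · rw [if_neg (by omega), HS.setReg_out, o₅, o₄, o₃]
    rintro h₆ ⟨r₆, a₆, o₆⟩
    have h13' : h₆.reg 13 = i := by rw [r₆ 13 (by omega), hreg 13 (by omega), h13]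
    refine Stm.Tr.of_wp ⟨by norm_num, by norm_num, by simp, fun _ => ?_, F', rfl, hbc, rfl, rfl,
      rfl, rfl, s₅.congr fun ρ _ _ => by rw [HS.setReg_arr, a₆], htd, fun r hr => ?_, ?_,
      fun ρ hρ => by rw [HS.setReg_arr, a₆, harr ρ hρ], o₆⟩
    · simp only [Ex.eval_add, Ex.eval_var, Ex.eval_lit, h13']; omega
    · rw [HS.setReg_reg, if_neg (by omega), r₆ r (by omega), hreg r (by omega)]
    · simp [h13']
  refine key.mono ?_ fun _ h => h
  have h1 : (R + 1) * ((microStm enc).cost + 10) + (K + 1) * ((microStm enc).cost + 1000) +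
    (R + 1) * 990 = (K + R + 2) * ((microStm enc).cost + 1000) := by ring
  have h2 : (K + 1) * 1000 ≤ (K + 1) * ((microStm enc).cost + 1000) :=
    Nat.mul_le_mul le_rfl (by omega)
  omega

end

end DynMatching

namespace DynMatching

/-! ### The program: processing an update -/

section

open Ex (var lit get)

/-- Apply the update number `x - E`, where `x` is in the variable `24`, to the table of edges that
is not in use, provided that `E ≤ x`. -/
def tableStm : Stm :=
  .ite (var 24) (var 11) skipStm
    (.assign 25 (var 24 - var 11) ;;
      .assign 30 (get (lit 0) (var 25)) ;; .assign 31 (get (lit 1) (var 25)) ;;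
      .assign 32 (get (lit 2) (var 25)) ;;
      .ite (var 31) (var 32) (.assign 33 (var 31 * var 5 + var 32))
        (.assign 33 (var 32 * var 5 + var 31)) ;;
      .set (lit 3 + (var 10 / var 11 + lit 1) % lit 2) (var 33) (var 30))

/-- Record an update and maintain the tables of edges. -/
def recordStm : Stm :=
  .set (lit 0) (var 10) (var 0) ;; .set (lit 1) (var 10) (var 1) ;;
  .set (lit 2) (var 10) (var 2) ;;
  .assign 24 (var 10 + var 10 % var 11) ;; tableStm ;; .assign 24 (var 24 + lit 1) ;; tableStm ;;
  .assign 12 (lit 3 + var 10 / var 11 % lit 2) ;; .assign 13 (lit 0)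

/-- The processing of an update. -/
def updateStm {A : Program} {Q : ℕ} (enc : A.Loc ≃ Fin Q) (b : ℕ) : Stm :=
  recordStm ;; .loop (var 13) (var 6) (tickStm enc b) ;; .assign 10 (var 10 + lit 1)

/-- The first variables. -/
structure Params (M n K R E t : ℕ) (h : HS) : Prop where
  r4 : h.reg 4 = M
  r5 : h.reg 5 = n
  r6 : h.reg 6 = K
  r8 : h.reg 8 = n * n
  r9 : h.reg 9 = R
  r10 : h.reg 10 = t
  r11 : h.reg 11 = E

lemma Params.congr {M n K R E t : ℕ} {h h' : HS} (hp : Params M n K R E t h)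
    (hr : ∀ r, 4 ≤ r → r ≤ 11 → h'.reg r = h.reg r) : Params M n K R E t h' := by
  obtain ⟨h1, h2, h3, h4, h5, h6, h7⟩ := hp
  constructor <;> rw [hr _ (by norm_num) (by norm_num)] <;> assumption

/-- The updates before the time `t` are recorded. -/
def Recorded {n : ℕ} (I : List (Update n)) (t : ℕ) (h : HS) : Prop :=
  ∀ x (hx : x < I.length), x < t →
    h.arr 0 x = (I[x]).isInsert.toNat ∧ h.arr 1 x = (I[x]).u ∧ h.arr 2 x = (I[x]).v

/-- The state between two updates, apart from the slots. -/
structure Env {n : ℕ} (I : List (Update n)) (M K R E t : ℕ) (h : HS) : Prop where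
  params : Params M n K R E t h
  hist : Recorded I t h
  cur : h.arr (3 + t / E % 2) = edgeTable (graphAfter (I.take (t / E * E)))
  nxt : h.arr (3 + (t / E + 1) % 2) = edgeTable (graphAfter (I.take (t + t % E - E)))

/-- The state during the processing of an update, apart from the slots. -/
structure Mid {n : ℕ} (I : List (Update n)) (M K R E t : ℕ) (h : HS) : Prop where
  params : Params M n K R E t h
  table : h.reg 12 = 3 + t / E % 2
  hist : Recorded I (t + 1) h
  cur : h.arr (3 + t / E % 2) = edgeTable (graphAfter (I.take (t / E * E)))
  nxt : h.arr (3 + (t / E + 1) % 2) = edgeTable (graphAfter (I.take (t + t % E + 2 - E)))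

lemma Mid.congr {n : ℕ} {I : List (Update n)} {M K R E t : ℕ} {h h' : HS}
    (hm : Mid I M K R E t h) (hr : ∀ r ≤ 12, h'.reg r = h.reg r)
    (ha : ∀ ρ < 8, h'.arr ρ = h.arr ρ) : Mid I M K R E t h' := by
  refine ⟨hm.params.congr fun r _ hr' => hr r (by omega), by rw [hr 12 le_rfl, hm.table], ?_, ?_,
    ?_⟩
  · intro x hx hxt
    rw [ha 0 (by omega), ha 1 (by omega), ha 2 (by omega)]
    exact hm.hist x hx hxt
  · rw [ha _ (by omega), hm.cur]
  · rw [ha _ (by omega), hm.nxt]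

/-- In epoch `e` the table that is not in use has position `t + t % E - E`: it starts at `(e-1) E`,
the table of the previous epoch, advances by two updates per tick, and arrives at `(e+1) E` when the
epoch ends. Then the two tables change roles, which is the second case below. Truncated subtraction
takes care of the first epoch. -/
lemma Mid.env {n : ℕ} {I : List (Update n)} {M K R E t : ℕ} {h h' : HS} (hE : 1 ≤ E)
    (hm : Mid I M K R E t h) (hr : ∀ r, 4 ≤ r → r ≤ 11 → r ≠ 10 → h'.reg r = h.reg r)
    (h10 : h'.reg 10 = t + 1) (ha : h'.arr = h.arr) : Env I M K R E (t + 1) h' := by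
  obtain ⟨⟨p1, p2, p3, p4, p5, p6, p7⟩, -, hh, hc, hn⟩ := hm
  refine ⟨⟨?_, ?_, ?_, ?_, ?_, h10, ?_⟩, ?_, ?_, ?_⟩
  iterate 6 rw [hr _ (by norm_num) (by norm_num) (by norm_num)]; assumption
  · intro x hx hxt; rw [ha]; exact hh x hx hxt
  all_goals
    rw [ha]
    have hlt := Nat.mod_lt t (show 0 < E by omega)
    have hdm := Nat.div_add_mod' t E
    rcases Nat.lt_or_ge (t % E + 1) E with h1 | h1
    · obtain ⟨e1, e2⟩ : (t + 1) / E = t / E ∧ (t + 1) % E = t % E + 1 := by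
        rw [Nat.div_mod_unique (by omega)]
        exact ⟨by rw [mul_comm]; omega, h1⟩
      rw [e1]
      first
      | exact hc
      | rw [hn, e2]; congr 3; omega
    · obtain ⟨e1, e2⟩ : (t + 1) / E = t / E + 1 ∧ (t + 1) % E = 0 := by
        rw [Nat.div_mod_unique (by omega)]
        exact ⟨by rw [mul_add, mul_comm, mul_one]; omega, by omega⟩
      rw [e1]
      first
      | rw [hn, add_mul]; congr 3; omega
      | rw [e2, show (t / E + 1 + 1) % 2 = t / E % 2 by omega, hc]; congr 3; omega

variable {ω : ℕ → ℕ} {M Y : ℕ} {A : Program} {Q : ℕ} {enc : A.Loc ≃ Fin Q}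

lemma wp_tableStm {n K R E t : ℕ} {I : List (Update n)} (hI : LegalSeq I) {h : HS} {x : ℕ}
    (hp : Params M n K R E t h) (h24 : h.reg 24 = x) (hxt : x - E ≤ t) (ht : t < I.length)
    (hh : Recorded I (t + 1) h) (hM : 8 ≤ M) (hnY : n * n ≤ Y)
    (htab : h.arr (3 + (t / E + 1) % 2) = edgeTable (graphAfter (I.take (x - E)))) :
    tableStm.wp ω M Y h fun h' => (∀ r ≤ 24, h'.reg r = h.reg r) ∧
      (∀ ρ, ρ ≠ 3 + (t / E + 1) % 2 → h'.arr ρ = h.arr ρ) ∧ h'.out = h.out ∧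
      h'.arr (3 + (t / E + 1) % 2) = edgeTable (graphAfter (I.take (x + 1 - E))) := by
  obtain ⟨p1, p2, p3, p4, p5, p6, p7⟩ := hp
  refine ⟨by simp, by simp, fun hlt => ?_, fun hge => ?_⟩
  · simp only [Ex.eval_var, h24, p7] at hlt
    refine wp_skipStm ⟨fun r hr => ?_, fun _ _ => rfl, rfl, ?_⟩
    · rw [HS.setReg_reg, if_neg (by omega)]
    -- While `x < E`, both positions truncate to `0` and the table is that of the empty graph.
    · rw [HS.setReg_arr, htab, show x - E = x + 1 - E by omega]
  · simp only [Ex.eval_var, h24, p7] at hge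
    obtain ⟨g0, g1, g2⟩ := hh (x - E) (by omega) (by omega)
    have hu := (I[x - E]).u.2
    have hv := (I[x - E]).v.2
    have hidx := pairIndex_lt (I[x - E]).u (I[x - E]).v
    have hfin : edgeTable (graphAfter (I.take (x + 1 - E))) =
        Function.update (edgeTable (graphAfter (I.take (x - E))))
          (pairIndex (I[x - E]).u (I[x - E]).v) (I[x - E]).isInsert.toNat := by
      rw [← edgeTable_take_succ hI (by omega), show x + 1 - E = x - E + 1 by omega]
    have hb1 : (I[x - E]).isInsert.toNat ≤ 1 := by cases (I[x - E]).isInsert <;> simp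
    have hnn : n ≤ n * n := Nat.le_mul_self n
    simp only [Stm.wp, Ex.eval_var, Ex.eval_lit, Ex.eval_get, Ex.eval_add, Ex.eval_sub,
      Ex.eval_mul, Ex.eval_div, Ex.eval_mod, Ex.ok_var, Ex.ok_lit, Ex.ok_get, Ex.ok_add, Ex.ok_sub,
      Ex.ok_mul, Ex.ok_div, Ex.ok_mod, HS.setReg_reg, HS.setReg_arr, Nat.reduceEqDiff, if_true,
      if_false, h24, p7, p2, p6, g0, g1, g2]
    have hM2 : 3 + (t / E + 1) % 2 < M := by omega
    refine ⟨by norm_num, by norm_num, by norm_num, fun hb => ?_, by norm_num, by norm_num,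
      ⟨trivial, by norm_num, by omega⟩, fun _ => by omega, by norm_num, by norm_num,
      ⟨trivial, by norm_num, by omega⟩, fun _ => by omega, by norm_num, by norm_num,
      ⟨trivial, by norm_num, by omega⟩, fun _ => by omega, by norm_num, by norm_num,
      fun huv => ?_, fun huv => ?_⟩
    · have := hb.1 24 (by norm_num)
      rw [h24] at this; omega
    · have e : pairIndex (I[x - E]).u (I[x - E]).v = (I[x - E]).u * n + (I[x - E]).v := by
        rw [pairIndex, if_pos (by simpa using huv)]
      refine ⟨by norm_num, by norm_num, by norm_num, fun _ => by omega,
        ⟨⟨trivial, ⟨by norm_num, trivial⟩, trivial⟩, by norm_num, by norm_num, hM2⟩,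
        fun _ => by omega, fun r hr => ?_, fun ρ hρ => ?_, rfl, ?_⟩
      · simp only [HS.setArr_reg, HS.setReg_reg]
        rw [if_neg (by omega), if_neg (by omega), if_neg (by omega), if_neg (by omega),
          if_neg (by omega)]
      · simp [hρ]
      · simp [htab, hfin, e]
    · have e : pairIndex (I[x - E]).u (I[x - E]).v = (I[x - E]).v * n + (I[x - E]).u := by
        rw [pairIndex, if_neg (by simpa using huv)]
      refine ⟨by norm_num, by norm_num, by norm_num, fun _ => by omega,
        ⟨⟨trivial, ⟨by norm_num, trivial⟩, trivial⟩, by norm_num, by norm_num, hM2⟩,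
        fun _ => by omega, fun r hr => ?_, fun ρ hρ => ?_, rfl, ?_⟩
      · simp only [HS.setArr_reg, HS.setReg_reg]
        rw [if_neg (by omega), if_neg (by omega), if_neg (by omega), if_neg (by omega),
          if_neg (by omega)]
      · simp [hρ]
      · simp [htab, hfin, e]

/-- The new update is recorded first, since the second advance of the table may already reach it. It
never reaches further, because `t % E < E`. -/
lemma wp_recordStm {n K R E t : ℕ} {I : List (Update n)} (hI : LegalSeq I) {h : HS}
    (he : Env I M K R E t h) (hE : 1 ≤ E) (ht : t < I.length)
    (h0 : h.reg 0 = (I[t]).isInsert.toNat) (h1 : h.reg 1 = (I[t]).u) (h2 : h.reg 2 = (I[t]).v)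
    (hM : 8 ≤ M) (hnY : n * n ≤ Y) (htY : 2 * t + 2 ≤ Y) (hY : 8 ≤ Y) :
    recordStm.wp ω M Y h fun h' => Mid I M K R E t h' ∧ h'.reg 13 = 0 ∧
      (∀ ρ, 8 ≤ ρ → h'.arr ρ = h.arr ρ) ∧ h'.out = h.out := by
  obtain ⟨hp, hh, hc, hn⟩ := he
  have hlt := Nat.mod_lt t (show 0 < E by omega)
  have hdm := Nat.div_add_mod' t E
  have hle := Nat.mod_le t E
  have p10 := hp.r10
  have p11 := hp.r11
  simp only [recordStm, Stm.wp.eq_1, Stm.wp.eq_2, Stm.wp.eq_6, Ex.eval_var, Ex.eval_lit,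
    Ex.eval_add, Ex.eval_mod, Ex.eval_div, Ex.ok_var, Ex.ok_lit, Ex.ok_add, Ex.ok_mod, Ex.ok_div,
    HS.setArr_reg, p10, p11,
    h0, h1, h2]
  refine ⟨⟨trivial, by norm_num, by norm_num, by omega⟩, fun hb => h0 ▸ hb.1 _ (by norm_num),
    ⟨trivial, by norm_num, by norm_num, by omega⟩, fun hb => h1 ▸ hb.1 _ (by norm_num),
    ⟨trivial, by norm_num, by norm_num, by omega⟩, fun hb => h2 ▸ hb.1 _ (by norm_num),
    by norm_num, by norm_num, by norm_num, fun _ => by omega, ?_⟩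
  refine Stm.wp_mono (wp_tableStm (R := R) (K := K) (t := t) hI (hp.congr fun r _ _ => ?_)
    (by simp; rfl) (by omega) ht ?_ hM hnY ?_) ?_
  · rw [HS.setReg_reg, if_neg (by omega)]; rfl
  · intro x hx hxt
    have n1 : (2 : ℕ) ≠ 1 := by norm_num
    simp only [HS.setReg_arr, HS.setArr_arr, Function.update_apply, Nat.reduceEqDiff, if_true,
      if_false]
    by_cases hxe : x = t
    · subst hxe; simp
    · simpa [hxe] using hh x hx (by omega)
  · simp only [HS.setReg_arr, HS.setArr_arr]
    rw [Function.update_of_ne (by omega), Function.update_of_ne (by omega),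
      Function.update_of_ne (by omega), hn]
  rintro h₁ ⟨r₁, a₁, o₁, t₁⟩
  have hh₁ : Recorded I (t + 1) h₁ := by
    intro x hx hxt
    rw [a₁ 0 (by omega), a₁ 1 (by omega), a₁ 2 (by omega)]
    simp only [HS.setReg_arr, HS.setArr_arr, Function.update_apply, Nat.reduceEqDiff, if_true,
      if_false]
    by_cases hxe : x = t
    · subst hxe; simp
    · simpa [hxe] using hh x hx (by omega)
  have hp₁ : Params M n K R E t h₁ := hp.congr fun r _ hr => by
    rw [r₁ r (by omega), HS.setReg_reg, if_neg (by omega)]; rfl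
  have h24 : h₁.reg 24 = t + t % E := by rw [r₁ 24 le_rfl]; simp
  rw [h24]
  refine ⟨by norm_num, by norm_num, by norm_num, fun _ => by omega, ?_⟩
  refine Stm.wp_mono (wp_tableStm (R := R) (K := K) (t := t) (x := t + t % E + 1) hI
    (hp₁.congr fun r _ _ => ?_) (by simp) (by omega) ht hh₁ hM hnY t₁) ?_
  · rw [HS.setReg_reg, if_neg (by omega)]
  rintro h₂ ⟨r₂, a₂, o₂, t₂⟩
  have hp₂ : Params M n K R E t h₂ := hp₁.congr fun r _ hr => by
    rw [r₂ r (by omega), HS.setReg_reg, if_neg (by omega)]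
  rw [hp₂.r10, hp₂.r11]
  refine ⟨by norm_num, by norm_num, by norm_num, fun _ => by omega, by norm_num, by norm_num,
    trivial, fun _ => Nat.zero_le _, ⟨hp₂.congr fun r _ hr => ?_, by simp, ?_, ?_, ?_⟩, by simp, ?_,
    ?_⟩
  · rw [HS.setReg_reg, HS.setReg_reg, if_neg (by omega), if_neg (by omega)]
  · intro x hx hxt
    simp only [HS.setReg_arr]
    rw [a₂ 0 (by omega), a₂ 1 (by omega), a₂ 2 (by omega)]
    exact hh₁ x hx hxt
  · simp only [HS.setReg_arr]
    rw [a₂ _ (by omega), HS.setReg_arr, a₁ _ (by omega), ← hc]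
    simp only [HS.setReg_arr, HS.setArr_arr]
    rw [Function.update_of_ne (by omega), Function.update_of_ne (by omega),
      Function.update_of_ne (by omega)]
  · exact t₂
  · intro ρ hρ
    simp only [HS.setReg_arr]
    rw [a₂ _ (by omega), HS.setReg_arr, a₁ _ (by omega)]
    simp only [HS.setReg_arr, HS.setArr_arr]
    rw [Function.update_of_ne (by omega), Function.update_of_ne (by omega),
      Function.update_of_ne (by omega)]
  · simp only [HS.setReg_out]; rw [o₂, HS.setReg_out, o₁]; rfl

/-- The state of all slots; `J i` is the condition on the slot `i`, and `free i` says that the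
slot may be the output. -/
structure Slots (enc : A.Loc ≃ Fin Q) (M K : ℕ) (free : ℕ → Prop) (J : ℕ → FullSlot A → Prop)
    (h : HS) : Prop where
  stored : ∀ i < K, ∃ F, J i F ∧ Stored enc h i F
  output : ∃ i < K, free i ∧ ∃ F, J i F ∧ Stored enc h i F ∧ ∃ o, h.out = outAfter M i F o

/-- The slot invariants `J` and `J'` are arbitrary here; only the fact `hJ` about a single tick is
used. This separates the loop over the slots from the analysis of the schedule. -/
lemma tr_updateStm {n b K R E t W D : ℕ} {I : List (Update n)} (hI : LegalSeq I) {h : HS}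
    {J J' : ℕ → FullSlot A → Prop} {free : ℕ → Prop}
    (he : Env I M K R E t h) (hs : Slots enc M K free J h) (hE : 1 ≤ E) (ht : t < I.length)
    (h0 : h.reg 0 = (I[t]).isInsert.toNat) (h1 : h.reg 1 = (I[t]).u) (h2 : h.reg 2 = (I[t]).v)
    (hb : 2 ≤ b) (hK : 1 ≤ K) (hM : M = 8 * K + 8) (hMY : M ≤ Y) (hnY : n * n ≤ Y)
    (htY : 2 * t + 2 ≤ Y) (hbY : b ^ K ≤ Y) (hregs : ∀ q, (A.code q).RegsLe Y) (hD : D + 4 ≤ Y)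
    (hQ : Q ≤ Y) (hW : 2 * W + 1 ≤ Y) (hRY : R ≤ Y)
    (hJ : ∀ i < K, ∀ F h, Mid I M K R E t h → J i F →
      F.slot.todo = envTodo h F.bc F.pos F.goal ∧
      (∀ y ≤ R, ((Slot.micro ω)^[y] (F.turn h b K i t E).slot).Ok W D) ∧
      ∀ F' : FullSlot A, F'.slot = (Slot.micro ω)^[R] (F.turn h b K i t E).slot →
        (F.turn h b K i t E).bc ≤ F'.bc → F'.goal = (F.turn h b K i t E).goal →
        F'.dv = (F.turn h b K i t E).dv → F'.mark = (F.turn h b K i t E).mark →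
        F'.pp = (F.turn h b K i t E).pp → F'.slot.todo = envTodo h F'.bc F'.pos F'.goal →
        J' i F') :
    (updateStm enc b).Tr ω M Y h ((K + 1) * (K + R + 2) * ((microStm enc).cost + 2000)) fun h' =>
      Env I M K R E (t + 1) h' ∧
      Slots enc M K (fun i => remTicks b K (K - 1) i t = 1) J' h' := by
  have hrc : recordStm.cost ≤ 300 := by decide
  have key : (updateStm enc b).Tr ω M Y h (recordStm.cost + ((K + 1) * (1 + 1 + 1 +
      (K + R + 2) * ((microStm enc).cost + 1000)) + 4)) fun h' =>
      Env I M K R E (t + 1) h' ∧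
      Slots enc M K (fun i => remTicks b K (K - 1) i t = 1) J' h' := by
    unfold updateStm
    refine Stm.Tr.bind (Stm.Tr.of_wp (wp_recordStm hI he hE ht h0 h1 h2 (by omega) hnY htY
      (by omega))) ?_
    rintro h₁ ⟨m₁, z₁, a₁, o₁⟩
    refine Stm.Tr.bind (P := fun h' => Mid I M K R E t h' ∧
        Slots enc M K (fun i => remTicks b K (K - 1) i t = 1) J' h') (Stm.Tr.loop
      (fun i h' => Mid I M K R E t h' ∧ h'.reg 13 = i ∧
        (∀ j < K, i ≤ j → ∃ F, J j F ∧ Stored enc h' j F) ∧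
        -- The output may be overwritten by several free slots; it refers to one that has had its
        -- turn in this tick, once there is such a slot.
        (∀ j < i, ∃ F, J' j F ∧ Stored enc h' j F) ∧
        ((∃ j < i, remTicks b K (K - 1) j t = 1) → ∃ j < i, remTicks b K (K - 1) j t = 1 ∧
          ∃ F, J' j F ∧ Stored enc h' j F ∧ ∃ o, h'.out = outAfter M j F o)) K ?_ ?_ ?_ ?_) ?_
    · rintro i hi h' ⟨m, e13, -⟩
      refine ⟨by simp, by simp, ?_⟩
      rw [Ex.eval_var, Ex.eval_var, e13, m.params.r6]
    · rintro i hi h' ⟨m, e13, s1, s2, s3⟩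
      obtain ⟨F, jF, sF⟩ := s1 i hi le_rfl
      obtain ⟨q1, q2, q3⟩ := hJ i hi F h' m jF
      have hp := m.params
      have htab := m.table
      refine (tr_tickStm hb hK sF q1 hp.r4 hp.r6 hp.r9 hp.r10 hp.r11 (by omega) e13 hi
        (by omega) hMY hbY (by omega) (by omega) hregs hD (by omega) hQ hW hRY q2).mono le_rfl ?_
      rintro h'' ⟨F', f1, f2, f3, f4, f5, f6, f7, f8, f9, f10, f11, f12⟩
      have jF' := q3 F' f1 f2 f3 f4 f5 f6 f8
      have hst : ∀ {j F₀}, j ≠ i → Stored enc h' j F₀ → Stored enc h'' j F₀ := fun hj h₀ =>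
        h₀.congr fun ρ _ _ => f11 ρ (by omega)
      refine ⟨m.congr f9 fun ρ hρ => f11 ρ (by omega), f10, fun j hj hij => ?_, fun j hj => ?_, ?_⟩
      · obtain ⟨F₀, g1, g2⟩ := s1 j hj (by omega)
        exact ⟨F₀, g1, hst (by omega) g2⟩
      · rcases Nat.lt_succ_iff_lt_or_eq.1 hj with h1 | rfl
        · obtain ⟨F₀, g1, g2⟩ := s2 j h1
          exact ⟨F₀, g1, hst (by omega) g2⟩
        · exact ⟨F', jF', f7⟩
      · rintro ⟨j, hj, hjr⟩
        by_cases hir : remTicks b K (K - 1) i t = 1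
        · rw [if_pos hir] at f12
          exact ⟨i, by omega, hir, F', jF', f7, _, f12⟩
        · rw [if_neg hir] at f12
          have hji : j < i := by
            rcases Nat.lt_succ_iff_lt_or_eq.1 hj with h1 | rfl
            · exact h1
            · exact absurd hjr hir
          obtain ⟨j', g1, g2, F₀, g3, g4, o, g5⟩ := s3 ⟨j, hji, hjr⟩
          exact ⟨j', by omega, g2, F₀, g3, hst (by omega) g4, o, f12.trans g5⟩
    · rintro h' ⟨m, -, -, s2, s3⟩
      obtain ⟨j, hj, hjr⟩ := exists_free (b := b) (K - 1) t
      rw [Nat.sub_add_cancel hK] at hj hjr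
      exact ⟨m, s2, s3 ⟨j, hj, hjr⟩⟩
    · refine ⟨m₁, z₁, fun j hj _ => ?_, fun j hj => by omega, fun ⟨j, hj, _⟩ => by omega⟩
      obtain ⟨F, g1, g2⟩ := hs.stored j hj
      exact ⟨F, g1, g2.congr fun ρ h1 _ => a₁ ρ (by omega)⟩
    rintro h₂ ⟨m₂, s₂⟩
    have hp := m₂.params
    refine Stm.Tr.of_wp ⟨by norm_num, by norm_num, by simp, fun _ => ?_, m₂.env hE ?_ ?_ rfl, ?_, ?_⟩
    · simp only [Ex.eval_add, Ex.eval_var, Ex.eval_lit, hp.r10]; omega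
    · intro r _ _ hr; rw [HS.setReg_reg, if_neg hr]
    · simp [hp.r10]
    · intro i hi
      obtain ⟨F, g1, g2⟩ := s₂.stored i hi
      exact ⟨F, g1, g2.congr fun _ _ _ => rfl⟩
    · obtain ⟨i, hi, hf, F, g1, g2, o, g3⟩ := s₂.output
      exact ⟨i, hi, hf, F, g1, g2.congr fun _ _ _ => rfl, o, g3⟩
  refine key.mono ?_ fun _ h => h
  have e1 : (K + 1) * (K + R + 2) * ((microStm enc).cost + 2000) = (K + 1) *
    ((K + R + 2) * ((microStm enc).cost + 1000)) + (K + 1) * (K + R + 2) * 1000 := by ring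
  have e2 : (K + 1) * 1000 ≤ (K + 1) * (K + R + 2) * 1000 := by
    refine Nat.mul_le_mul_right _ (Nat.le_mul_of_pos_right _ (by omega))
  rw [e1, mul_add]
  omega

end

end DynMatching

namespace DynMatching

/-! ### The program: preprocessing -/

namespace Slot

variable {A : Program} {ω : ℕ → ℕ}

lemma micro_todo_nil {σ : Slot A} (h : σ.todo = []) : (σ.micro ω).todo = [] := by
  unfold micro fetch run undo
  split_ifs
  · rw [h]
    exact h
  · split
    · exact h
    · split
      · exact h
      · exact h
  · split
    · exact h
    · exact h
  · exact h

/-- Run the algorithm until it halts. -/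
lemma reaches_halt {W D : ℕ} {c c' : A.Cfg} {t : ℕ} (hrun : A.RunsTo ω W c t c') (σ : Slot A)
    (h : σ.Ok W D) (hc : A.ofCells σ.loc σ.cells = c) (hmode : σ.mode = 1) (htodo : σ.todo = [])
    (hD : σ.log.length + t ≤ D) : ∃ m ≤ t + 1, (∀ y ≤ m, ((Slot.micro ω)^[y] σ).Ok W D) ∧
      (∀ y < m, ((Slot.micro ω)^[y] σ).mode ≠ 0) ∧ ((Slot.micro ω)^[m] σ).mode = 0 ∧
      ((Slot.micro ω)^[m] σ).todo = [] ∧ ((Slot.micro ω)^[m] σ).cells = c'.cells := by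
  classical
  obtain ⟨σ', h1, h2, -, -, -, -, h7⟩ := reaches_run hrun σ h hc hmode hD
  -- The loop tests the mode, so the exact number of iterations is needed, not just a bound for it.
  have hex : ∃ m, ((Slot.micro ω)^[m] σ).mode = 0 := ⟨t + 1, by rw [h1.1, h2]⟩
  have hle : Nat.find hex ≤ t + 1 := Nat.find_min' hex (by rw [h1.1, h2])
  have htd : ∀ y, ((Slot.micro ω)^[y] σ).todo = [] := by
    intro y
    induction y with
    | zero => exact htodo
    | succ y ih => rw [Function.iterate_succ_apply']; exact micro_todo_nil ih
  refine ⟨Nat.find hex, hle, fun y hy => h1.2 y (hy.trans hle), fun y hy => Nat.find_min hex hy,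
    Nat.find_spec hex, htd _, ?_⟩
  rw [← h7, ← h1.1]
  obtain ⟨v, hv⟩ := Nat.exists_eq_add_of_le hle
  rw [hv, add_comm, Function.iterate_add_apply, micro_idle (Nat.find_spec hex) (htd _)]

end Slot

lemma Program.ofCells_start (A : Program) (n k T : ℕ) :
    A.ofCells A.init (Function.update (Function.update (Function.update (fun _ => 0) 0 n) 2 k) 4 T) =
      A.start n k T := by
  simp only [Program.ofCells, Program.start, Program.Cfg.mk.injEq, true_and]
  constructor
  · funext r
    rcases r with _ | _ | _ | r
    · simp
    · simp
    · simp
    · simp only [Function.update_apply]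
      rw [if_neg (by omega), if_neg (by omega), if_neg (by omega)]
  · funext x
    simp only [Function.update_apply]
    rw [if_neg (by omega), if_neg (by omega), if_neg (by omega)]

section

open Ex (var lit get)

/-- Set up the variables of a slot. -/
def clearStm (init : ℕ) : Stm :=
  .assign 14 (var 13 * lit 8 + lit 8) ;;
  .set (var 14) (lit 0) (var 5) ;; .set (var 14) (lit 2) (var 6) ;; .set (var 14) (lit 4) (var 7) ;;
  .assign 15 (lit 0) ;; .assign 16 (lit 0) ;; .assign 17 (lit 1) ;; .assign 18 (lit init) ;;
  .assign 19 (lit 0) ;; .assign 20 (var 8) ;; .assign 21 (lit 0) ;; .assign 22 (lit 0) ;;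
  .assign 23 (var 6 - lit 1)

/-- The preprocessing of a slot. -/
def setupStm {A : Program} {Q : ℕ} (enc : A.Loc ≃ Fin Q) : Stm :=
  clearStm (enc A.init) ;; .loop (lit 0) (var 17) (microStm enc) ;;
  (.assign 15 (lit 0) ;; saveStm ;; outStm ;; .assign 13 (var 13 + lit 1))

/-- The preprocessing. -/
def initStm {A : Program} {Q : ℕ} (enc : A.Loc ≃ Fin Q) (b ρ : ℕ) : Stm :=
  (.assign 5 (var 0) ;; .assign 6 (var 1) ;; .assign 7 (var 2) ;; .assign 8 (var 5 * var 5) ;;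
    .assign 9 (lit ρ * var 7 * var 6) ;; .assign 10 (lit 0) ;; .assign 11 (lit 1) ;;
    .assign 12 (lit 3) ;; .assign 26 (lit 1)) ;;
  .loop (var 26) (var 6) (.assign 11 (var 11 * lit b) ;; .assign 26 (var 26 + lit 1)) ;;
  (.assign 11 (var 6 * var 11) ;; .assign 13 (lit 0)) ;;
  .loop (var 13) (var 6) (setupStm enc)

variable {ω : ℕ → ℕ} {M Y : ℕ} {A : Program} {Q : ℕ} {enc : A.Loc ≃ Fin Q}

/-- A slot after preprocessing. -/
structure Fresh (c : A.Cfg) (nn K : ℕ) (F : FullSlot A) : Prop where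
  cells : F.slot.cells = c.cells
  log : F.slot.log = []
  mode : F.slot.mode = 0
  todo : F.slot.todo = []
  bc : nn ≤ F.bc
  goal : F.goal = 0
  dv : F.dv = K - 1
  mark : F.mark = fun _ => 0
  pp : F.pp = fun _ => 0

lemma tr_setupStm {h : HS} {n K T i W D t : ℕ} {c : A.Cfg} (hrun : A.RunsTo ω W (A.start n K T) t c)
    (h4 : h.reg 4 = M) (h5 : h.reg 5 = n) (h6 : h.reg 6 = K) (h7 : h.reg 7 = T)
    (h8 : h.reg 8 = n * n) (h12 : h.reg 12 < 8) (h13 : h.reg 13 = i) (hi : i < K)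
    (harr : ∀ ρ, 8 * i + 8 ≤ ρ → h.arr ρ = fun _ => 0)
    (hM : 8 * i + 16 ≤ M) (hMY : M ≤ Y) (hnY : n * n ≤ Y)
    (hregs : ∀ q, (A.code q).RegsLe Y) (hD : D + 4 ≤ Y) (hQ : Q ≤ Y)
    (hW : 2 * W + 1 ≤ Y) (ht : t ≤ D) :
    (setupStm enc).Tr ω M Y h ((t + 2) * ((microStm enc).cost + 3) + 1000) fun h' =>
      ∃ F : FullSlot A, Fresh c (n * n) K F ∧ Stored enc h' i F ∧
        (∀ r ≤ 12, h'.reg r = h.reg r) ∧ h'.reg 13 = i + 1 ∧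
        (∀ ρ, ρ < 8 * i + 8 ∨ 8 * i + 16 ≤ ρ → h'.arr ρ = h.arr ρ) ∧
        h'.out = outAfter M i F h.out := by
  have henc : ((enc A.init : Fin Q) : ℕ) ≤ Y := (enc A.init).2.le.trans hQ
  have hcost : (clearStm (enc A.init)).cost ≤ 200 := Nat.le_of_ble_eq_true rfl
  have hcost' : (Stm.assign 15 (lit 0) ;; saveStm ;; outStm ;; .assign 13 (var 13 + lit 1)).cost ≤
    500 := by decide
  set S₀ : ℕ → ℕ :=
    Function.update (Function.update (Function.update (fun _ => 0) 0 n) 2 K) 4 T with hS₀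
  set σ₀ : Slot A := ⟨S₀, A.init, [], 0, 1, 0, []⟩ with hσ₀
  have hof : A.ofCells σ₀.loc σ₀.cells = A.start n K T := A.ofCells_start n K T
  have hok : σ₀.Ok W D := by
    refine ⟨fun x => ?_, by simp [hσ₀], by simp [hσ₀]⟩
    have := Program.Cfg.cells_le (hrun.2.2.2 0 (Nat.zero_le _)) x
    rw [Function.iterate_zero_apply, ← hof, Program.cells_ofCells] at this
    exact this
  obtain ⟨m, hm, m1, m2, m3, m4, m5⟩ := Slot.reaches_halt hrun σ₀ hok hof rfl rfl
    (by simpa [hσ₀] using ht)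
  have key : (setupStm enc).Tr ω M Y h ((clearStm (enc A.init)).cost + ((m + 1) * (1 + 1 + 1 +
      (microStm enc).cost) + (Stm.assign 15 (lit 0) ;; saveStm ;; outStm ;;
        .assign 13 (var 13 + lit 1)).cost)) fun h' =>
      ∃ F : FullSlot A, Fresh c (n * n) K F ∧ Stored enc h' i F ∧
        (∀ r ≤ 12, h'.reg r = h.reg r) ∧ h'.reg 13 = i + 1 ∧
        (∀ ρ, ρ < 8 * i + 8 ∨ 8 * i + 16 ≤ ρ → h'.arr ρ = h.arr ρ) ∧
        h'.out = outAfter M i F h.out := by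
    unfold setupStm
    refine Stm.Tr.bind (P := fun h' => Rep enc M h' σ₀ ∧ (∀ r ≤ 13, h'.reg r = h.reg r) ∧
        h'.reg 14 = 8 * i + 8 ∧ h'.reg 20 = n * n ∧ h'.reg 22 = 0 ∧ h'.reg 23 = K - 1 ∧
        (∀ ρ, ρ ≠ 8 * i + 8 → h'.arr ρ = h.arr ρ) ∧ h'.out = h.out) (Stm.Tr.of_wp ?_) ?_
    · have hi8 : i * 8 + 8 = 8 * i + 8 := by ring
      simp only [clearStm, Stm.wp, Ex.eval_var, Ex.eval_lit, Ex.eval_add, Ex.eval_sub, Ex.eval_mul,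
        Ex.ok_var, Ex.ok_lit, Ex.ok_add, Ex.ok_sub, Ex.ok_mul, HS.setArr_reg, HS.setReg_reg,
        HS.setReg_arr, HS.setArr_arr, Nat.reduceEqDiff, if_true, if_false, h5, h6, h7, h8, h13, hi8]
      refine ⟨by norm_num, by norm_num, by norm_num, fun _ => by omega,
        ⟨by norm_num, trivial, by norm_num, by omega⟩,
        fun hb => by simpa [h5] using hb.1 5 (by norm_num),
        ⟨by norm_num, trivial, by norm_num, by omega⟩,
        fun hb => by simpa [h6] using hb.1 6 (by norm_num),
        ⟨by norm_num, trivial, by norm_num, by omega⟩,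
        fun hb => by simpa [h7] using hb.1 7 (by norm_num),
        by norm_num, by norm_num, trivial, fun _ => by omega,
        by norm_num, by norm_num, trivial, fun _ => by omega,
        by norm_num, by norm_num, trivial, fun _ => by omega,
        by norm_num, by norm_num, trivial, fun _ => henc,
        by norm_num, by norm_num, trivial, fun _ => by omega,
        by norm_num, by norm_num, by norm_num, fun _ => hnY,
        by norm_num, by norm_num, trivial, fun _ => by omega,
        by norm_num, by norm_num, trivial, fun _ => by omega,
        by norm_num, by norm_num, by norm_num,
        fun hb => by
          have := hb.1 6 (by norm_num)
          simp only [HS.setReg_reg, HS.setArr_reg, Nat.reduceEqDiff, if_false, h6] at this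
          omega,
        ⟨⟨by simp, by simpa using hM, ?_, trivial, by simp [hσ₀]⟩, by simp [hσ₀], by simp [hσ₀],
          by simp [hσ₀], by simp [hσ₀], by simp [hσ₀, todoOf, h8], by simpa using h12⟩,
        fun r hr => ?_, trivial, trivial, trivial, trivial, fun ρ hρ => ?_, rfl⟩
      · simp [hS₀, hσ₀, harr _ le_rfl]
      · iterate 10 rw [if_neg (by omega)]
      · simp [hρ]
    rintro h₁ ⟨p₁, r₁, s₁, b₁, g₁, d₁, a₁, o₁⟩
    refine Stm.Tr.bind (P := fun h' => Rep enc M h' ((Slot.micro ω)^[m] σ₀) ∧ Frame h₁ h')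
      (Stm.Tr.loop (fun y h' => Rep enc M h' ((Slot.micro ω)^[y] σ₀) ∧ Frame h₁ h') m ?_ ?_ ?_ ?_) ?_
    · rintro y hy h' ⟨q1, q2⟩
      refine ⟨by simp, by simp, ?_⟩
      rw [Ex.eval_lit, Ex.eval_var, q1.mode]
      constructor
      · intro h0
        rcases Nat.lt_or_eq_of_le hy with h1 | rfl
        · exact h1
        · omega
      · intro h0
        have := m2 y h0
        omega
    · rintro y hy h' ⟨q1, q2⟩
      refine (Stm.Tr.of_wp (wp_microStm q1 hregs hD (by omega) hQ hW (m1 y hy.le) ?_)).mono le_rfl ?_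
      · rw [← Function.iterate_succ_apply' (Slot.micro ω)]; exact m1 _ hy
      · rintro h'' ⟨f1, f2⟩
        rw [← Function.iterate_succ_apply' (Slot.micro ω)] at f1
        exact ⟨f1, q2.trans f2⟩
    · exact fun _ h => h
    · exact ⟨p₁, Frame.refl _⟩
    rintro h₂ ⟨p₂, f₂⟩
    have h14 : h₂.reg 14 = 8 * i + 8 := by rw [f₂.reg 14 (by omega), s₁]
    have hr₂ : ∀ r ≤ 13, h₂.reg r = h.reg r := fun r hr => by rw [f₂.reg r (by omega), r₁ r hr]
    have ha₂ : ∀ ρ, ρ < 8 * i + 8 ∨ 8 * i + 8 + 3 ≤ ρ → h₂.arr ρ = h.arr ρ := fun ρ hρ => by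
      rw [f₂.arr ρ (by rw [s₁]; exact hρ), a₁ ρ (by omega)]
    have hcell := p₂.core.cells
    rw [h14] at hcell
    -- The log is emptied: the preprocessing is never undone, and the deepest checkpoint is the
    -- preprocessed algorithm. Its mark `0` is thus correct.
    set F : FullSlot A := ⟨{ (Slot.micro ω)^[m] σ₀ with log := [] }, h₂.reg 20, h₂.reg 21,
      0, K - 1, fun _ => 0, fun _ => 0⟩ with hF
    have hlow := p₂.low
    have hnx := f₂.next
    refine Stm.Tr.of_wp ⟨by norm_num, by norm_num, trivial, fun _ => Nat.zero_le _, ?_⟩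
    beta_reduce
    rw [Stm.wp.eq_6, Ex.eval_lit]
    refine Stm.wp_mono (wp_saveStm (h := h₂.setReg 15 0) (i := i) (F := F) (enc := enc) ⟨by simpa using h14,
      ⟨⟨by simp [h14], by simpa [h14] using hM, by simpa [h14] using hcell, trivial, by simp [hF]⟩,
        by simpa using p₂.loc, by simpa using p₂.low, by simpa using p₂.mode,
        by simpa using p₂.first, ?_, by simpa using p₂.tab⟩, by simp [hF], by simp [hF], ?_, ?_,
        ?_, ?_⟩) ?_
    · have := p₂.todo
      simp only [hF]
      rw [this]
      simp [todoOf]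
    · simp [hF, f₂.reg 22 (by omega), g₁]
    · simp [hF, f₂.reg 23 (by omega), d₁]
    · rw [HS.setReg_arr, ha₂ _ (by omega), harr _ (by omega)]
    · rw [HS.setReg_arr, ha₂ _ (by omega), harr _ (by omega)]
    rintro h₃ ⟨st₃, r₃, a₃, o₃⟩
    have h14' : h₃.reg 14 = 8 * i + 8 := by rw [r₃]; simpa using h14
    have h4' : h₃.reg 4 = M := by rw [r₃]; simpa [hr₂ 4 (by omega)] using h4
    have h13' : h₃.reg 13 = i := by rw [r₃]; simpa [hr₂ 13 (by omega)] using h13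
    have hi8 : 8 * i + 8 < M := by omega
    simp only [outStm, Stm.wp, Ex.eval_var, Ex.eval_lit, Ex.eval_get, Ex.eval_add, Ex.eval_mul,
      Ex.ok_var, Ex.ok_lit, Ex.ok_get, Ex.ok_add, Ex.ok_mul, HS.setOut_reg, HS.setOut_arr, h14',
      h4', h13', st₃.cells]
    refine ⟨by norm_num, ⟨⟨by norm_num, by norm_num⟩, by simpa using hi8⟩, by norm_num,
      by simpa using hi8, by norm_num, by norm_num, by norm_num, fun _ => by omega, F,
      ⟨m5, rfl, m3, m4, by change _ ≤ h₂.reg 20; omega, rfl, rfl, rfl, rfl⟩,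
      st₃.congr fun _ _ _ => rfl, fun r hr => ?_, by simp, fun ρ hρ => ?_, ?_⟩
    · rw [HS.setReg_reg, if_neg (by omega)]
      simp only [HS.setOut_reg, r₃, HS.setReg_reg]
      rw [if_neg (by omega), hr₂ r (by omega)]
    · simp only [HS.setReg_arr, HS.setOut_arr]
      rw [a₃ ρ hρ, HS.setReg_arr, ha₂ ρ (by omega)]
    · simp only [HS.setReg_out, HS.setOut_out, outAfter, o₃]
      rw [f₂.out, o₁]
  refine key.mono ?_ fun _ h => h
  have : (m + 1) * (1 + 1 + 1 + (microStm enc).cost) ≤ (t + 2) * ((microStm enc).cost + 3) :=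
    Nat.mul_le_mul (by omega) (by omega)
  omega

lemma tr_initStm {h : HS} {b ρ n K T W D t : ℕ} {c : A.Cfg} (I : List (Update n))
    (hrun : A.RunsTo ω W (A.start n K T) t c) (hb : 2 ≤ b)
    (h0 : h.reg 0 = n) (h1 : h.reg 1 = K) (h2 : h.reg 2 = T) (h4 : h.reg 4 = M)
    (harr : ∀ r, h.arr r = fun _ => 0) (hK : 1 ≤ K) (hM : M = 8 * K + 8) (hMY : M ≤ Y)
    (hnY : n * n ≤ Y) (hTY : T ≤ Y) (hEY : K * b ^ (K - 1) ≤ Y) (hRY : ρ * T * K ≤ Y)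
    (hregs : ∀ q, (A.code q).RegsLe Y) (hD : D + 4 ≤ Y) (hQ : Q ≤ Y)
    (hW : 2 * W + 1 ≤ Y) (ht : t ≤ D) :
    (initStm enc b ρ).Tr ω M Y h ((K + 1) * ((t + 2) * ((microStm enc).cost + 3) + 2000)) fun h' =>
      Env I M K (ρ * T * K) (K * b ^ (K - 1)) 0 h' ∧
        Slots enc M K (fun _ => True) (fun _ => Fresh c (n * n) K) h' := by
  have hnn : n ≤ n * n := Nat.le_mul_self n
  have hpow : ∀ j < K, b ^ j ≤ Y := fun j hj =>
    (Nat.pow_le_pow_right (by omega) (show j ≤ K - 1 by omega)).trans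
      ((Nat.le_mul_of_pos_left _ (by omega)).trans hEY)
  have key : (initStm enc b ρ).Tr ω M Y h (100 + ((K - 1 + 1) * (1 + 1 + 1 + 8) + (20 +
      (K + 1) * (1 + 1 + 1 + ((t + 2) * ((microStm enc).cost + 3) + 1000))))) fun h' =>
      Env I M K (ρ * T * K) (K * b ^ (K - 1)) 0 h' ∧
        Slots enc M K (fun _ => True) (fun _ => Fresh c (n * n) K) h' := by
    unfold initStm
    refine Stm.Tr.bind (P := fun h' => h'.reg 4 = M ∧ h'.reg 5 = n ∧ h'.reg 6 = K ∧ h'.reg 7 = T ∧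
        h'.reg 8 = n * n ∧ h'.reg 9 = ρ * T * K ∧ h'.reg 10 = 0 ∧ h'.reg 11 = 1 ∧ h'.reg 12 = 3 ∧
        h'.reg 26 = 1 ∧ h'.arr = h.arr)
      ((Stm.Tr.of_wp ?_).mono (Nat.le_of_ble_eq_true rfl) fun _ h => h) ?_
    · simp only [Stm.wp, Ex.eval_var, Ex.eval_lit, Ex.eval_mul,
        Ex.ok_var, Ex.ok_lit, Ex.ok_mul, HS.setReg_reg,
        HS.setReg_arr, Nat.reduceEqDiff, if_true, if_false, h0, h1, h2, h4, and_true, true_and]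
      refine ⟨by norm_num, by norm_num, by norm_num, fun _ => by omega,
        by norm_num, by norm_num, by norm_num, fun _ => by omega,
        by norm_num, by norm_num, by norm_num, fun _ => by omega,
        by norm_num, by norm_num, by norm_num, fun _ => by omega,
        by norm_num, by norm_num, by norm_num, fun _ => by omega,
        by norm_num, by norm_num, fun _ => by omega,
        by norm_num, by norm_num, fun _ => by omega,
        by norm_num, by norm_num, fun _ => by omega,
        by norm_num, by norm_num, fun _ => by omega⟩
    rintro h₁ ⟨e4, e5, e6, e7, e8, e9, e10, e11, e12, e26, ea⟩
    refine Stm.Tr.bind (P := fun h' => (∀ r, 4 ≤ r → r ≤ 12 → r ≠ 11 → h'.reg r = h₁.reg r) ∧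
        h'.reg 11 = b ^ (K - 1) ∧ h'.arr = h.arr) (Stm.Tr.loop (fun j h' =>
        (∀ r, 4 ≤ r → r ≤ 12 → r ≠ 11 → h'.reg r = h₁.reg r) ∧ h'.reg 26 = j + 1 ∧
        h'.reg 11 = b ^ j ∧ h'.arr = h.arr) (K - 1) ?_ ?_ ?_ ?_) ?_
    · rintro j hj h' ⟨x, y, z, w⟩
      refine ⟨by simp, by simp, ?_⟩
      rw [Ex.eval_var, Ex.eval_var, y, x 6 (by omega) (by omega) (by omega), e6]
      omega
    · rintro j hj h' ⟨x, y, z, w⟩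
      refine (Stm.Tr.of_wp ?_).mono (Nat.le_of_ble_eq_true rfl) fun _ h => h
      simp only [Stm.wp, Ex.eval_var, Ex.eval_lit, Ex.eval_add, Ex.eval_mul, Ex.ok_add,
        Ex.ok_mul, Ex.ok_var, Ex.ok_lit, HS.setReg_reg, HS.setReg_arr, Nat.reduceEqDiff, if_true,
        if_false, y, z, ← pow_succ]
      refine ⟨by norm_num, by norm_num, by norm_num, fun _ => hpow _ (by omega), by norm_num,
        by norm_num, by norm_num, fun _ => by omega, fun r h4 h12 h11 => ?_, trivial, trivial, w⟩
      rw [if_neg (by omega), if_neg (by omega), x r h4 h12 h11]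
    · rintro h' ⟨x, -, z, w⟩; exact ⟨x, z, w⟩
    · exact ⟨fun _ _ _ _ => rfl, e26, by simpa using e11, ea⟩
    rintro h₂ ⟨r₂, p₂, a₂⟩
    refine Stm.Tr.bind (P := fun h' => (∀ r, 4 ≤ r → r ≤ 12 → r ≠ 11 → h'.reg r = h₁.reg r) ∧
        h'.reg 11 = K * b ^ (K - 1) ∧ h'.reg 13 = 0 ∧ h'.arr = h.arr)
      ((Stm.Tr.of_wp ?_).mono (Nat.le_of_ble_eq_true rfl) fun _ h => h) ?_
    · simp only [Stm.wp, Ex.eval_var, Ex.eval_lit, Ex.eval_mul,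
        Ex.ok_mul, Ex.ok_var, Ex.ok_lit, HS.setReg_reg, HS.setReg_arr, Nat.reduceEqDiff, if_true,
        if_false, p₂, r₂ 6 (by omega) (by omega) (by omega), e6]
      refine ⟨by norm_num, by norm_num, by norm_num, fun _ => hEY, by norm_num,
        by norm_num, trivial, fun _ => by omega, fun r h4 h12 h11 => ?_, trivial, trivial, a₂⟩
      rw [if_neg (by omega), if_neg (by omega), r₂ r h4 h12 h11]
    rintro h₃ ⟨r₃, p₃, z₃, a₃⟩
    refine Stm.Tr.loop (fun i h' => (∀ r, 4 ≤ r → r ≤ 12 → h'.reg r = h₃.reg r) ∧ h'.reg 13 = i ∧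
      (∀ ρ, (ρ < 8 ∨ 8 * i + 8 ≤ ρ) → h'.arr ρ = fun _ => 0) ∧
      (∀ j < i, ∃ F, Fresh c (n * n) K F ∧ Stored enc h' j F) ∧
      (0 < i → ∃ F, Fresh c (n * n) K F ∧ Stored enc h' (i - 1) F ∧
        ∃ o, h'.out = outAfter M (i - 1) F o)) K ?_ ?_ ?_ ?_
    · rintro i hi h' ⟨x, y, -⟩
      refine ⟨by simp, by simp, ?_⟩
      rw [Ex.eval_var, Ex.eval_var, y, x 6 (by omega) (by omega),
        r₃ 6 (by omega) (by omega) (by omega), e6]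
    · rintro i hi h' ⟨x, y, z, w, v⟩
      have hreg : ∀ r, 4 ≤ r → r ≤ 12 → r ≠ 11 → h'.reg r = h₁.reg r := fun r g1 g2 g3 => by
        rw [x r g1 g2, r₃ r g1 g2 g3]
      refine (tr_setupStm hrun (by rw [hreg 4 (by omega) (by omega) (by omega), e4])
        (by rw [hreg 5 (by omega) (by omega) (by omega), e5])
        (by rw [hreg 6 (by omega) (by omega) (by omega), e6])
        (by rw [hreg 7 (by omega) (by omega) (by omega), e7])
        (by rw [hreg 8 (by omega) (by omega) (by omega), e8])
        (by rw [hreg 12 (by omega) (by omega) (by omega), e12]; omega) y hi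
        (fun r hr => z r (by omega)) (by omega) hMY hnY hregs hD hQ hW ht).mono le_rfl ?_
      rintro h'' ⟨F, f1, f2, f3, f4, f5, f6⟩
      refine ⟨fun r g1 g2 => by rw [f3 r g2, x r g1 g2], f4, fun r hr => ?_, fun j hj => ?_,
        fun _ => ⟨F, f1, f2, _, f6⟩⟩
      · rw [f5 r (by omega), z r (by omega)]
      · rcases Nat.lt_succ_iff_lt_or_eq.1 hj with h1 | rfl
        · obtain ⟨F₀, g1, g2⟩ := w j h1
          exact ⟨F₀, g1, g2.congr fun r _ _ => f5 r (by omega)⟩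
        · exact ⟨F, f1, f2⟩
    · rintro h' ⟨x, -, z, w, v⟩
      have hreg : ∀ r, 4 ≤ r → r ≤ 12 → r ≠ 11 → h'.reg r = h₁.reg r := fun r g1 g2 g3 => by
        rw [x r g1 g2, r₃ r g1 g2 g3]
      refine ⟨⟨⟨by rw [hreg 4 (by omega) (by omega) (by omega), e4],
        by rw [hreg 5 (by omega) (by omega) (by omega), e5],
        by rw [hreg 6 (by omega) (by omega) (by omega), e6],
        by rw [hreg 8 (by omega) (by omega) (by omega), e8],
        by rw [hreg 9 (by omega) (by omega) (by omega), e9],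
        by rw [hreg 10 (by omega) (by omega) (by omega), e10],
        by rw [x 11 (by omega) (by omega), p₃]⟩, fun _ _ h0 => absurd h0 (Nat.not_lt_zero _),
        ?_, ?_⟩, w, ?_⟩
      · rw [z _ (by omega), Nat.zero_div, zero_mul, List.take_zero]
        exact edgeTable_bot.symm
      · rw [z _ (by omega), Nat.zero_mod, zero_add, Nat.zero_sub, List.take_zero]
        exact edgeTable_bot.symm
      · obtain ⟨F, f1, f2, o, f3⟩ := v hK
        exact ⟨K - 1, by omega, trivial, F, f1, f2, o, f3⟩
    · refine ⟨fun _ _ _ => rfl, z₃, fun r _ => by rw [a₃, harr], fun _ h0 => absurd h0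
        (Nat.not_lt_zero _), fun h0 => absurd h0 (Nat.lt_irrefl _)⟩
  refine key.mono ?_ fun _ h => h
  have e1 : (K + 1) * ((t + 2) * ((microStm enc).cost + 3) + 2000) =
    (K + 1) * ((t + 2) * ((microStm enc).cost + 3)) + (K + 1) * 2000 := by ring
  have e2 : (K + 1) * (1 + 1 + 1 + ((t + 2) * ((microStm enc).cost + 3) + 1000)) =
    (K + 1) * ((t + 2) * ((microStm enc).cost + 3)) + (K + 1) * 1003 := by ring
  omega

end

end DynMatching

namespace DynMatching

/-! ### The batches of a slot -/

section

variable {b K n i : ℕ}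

/-- The time at which the batch of depth `d` begins, for the slot `i` after `t` ticks. -/
def bnd (b K i t d : ℕ) : ℕ :=
  if d = 0 then epochOf b K (K - 1) i t * (K * b ^ (K - 1)) else reached b K (K - 1) i (K - d) t

/-- The depth of the task of the slot `i` after `t` ticks. -/
def dvOf (b K i : ℕ) : ℕ → ℕ
  | 0 => K - 1
  | t + 1 => K - 1 - curLevel b K (K - 1) i t

/-- The batch of depth `d`. -/
noncomputable def batch (b K : ℕ) (I : List (Update n)) (i t d : ℕ) : List (Update n) :=
  (if d = 0 then baseList (graphAfter (I.take (bnd b K i t 0))) (n * n) else []) ++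
    slice I (bnd b K i t d) (bnd b K i t (d + 1))

/-- The batches of depth less than `d`. -/
noncomputable def prefixBatches (b K : ℕ) (I : List (Update n)) (i t d : ℕ) :
    List (List (Update n)) := (List.range d).map (batch b K I i t)

/-- The batches that the slot `i` processes. -/
noncomputable def batches (b K : ℕ) (I : List (Update n)) (i t : ℕ) : List (List (Update n)) :=
  prefixBatches b K I i t (dvOf b K i t + 1)

lemma dvOf_lt (hK : 1 ≤ K) (t : ℕ) : dvOf b K i t < K := by
  cases t <;> simp only [dvOf] <;> omega

lemma bnd_le (t d : ℕ) : bnd b K i t d ≤ t := by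
  unfold bnd
  split_ifs
  · exact (epochOf_mul_le t).trans (reached_le _ _)
  · exact reached_le _ _

lemma bnd_zero (d : ℕ) : bnd b K i 0 d = 0 := Nat.le_zero.1 (bnd_le 0 d)

lemma bnd_le_succ (hb : 2 ≤ b) {t d : ℕ} (hd : d ≤ dvOf b K i t) :
    bnd b K i t d ≤ bnd b K i t (d + 1) := by
  rcases t with _ | t
  · simp [bnd_zero]
  rcases d with _ | d
  · simpa [bnd] using epochOf_mul_le (b := b) (m := K) (L := K - 1) (i := i) (t + 1)
  · simp only [dvOf] at hd
    have h1 : remTicks b K (K - 1) i t ≤ b ^ (K - (d + 1 + 1)) :=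
      (remTicks_le_pow_cur hb t).trans (Nat.pow_le_pow_right (by omega) (by omega))
    have := reached_anti hb h1
    rw [show K - (d + 1 + 1) + 1 = K - (d + 1) by omega] at this
    simpa [bnd] using this

lemma bnd_mono (hb : 2 ≤ b) (hK : 1 ≤ K) {t d d' : ℕ} (hdd : d ≤ d') (hd : d' ≤ dvOf b K i t + 1) :
    bnd b K i t d ≤ bnd b K i t d' := by
  induction d', hdd using Nat.le_induction with
  | base => exact le_rfl
  | succ d' _ ih => exact (ih (by omega)).trans (bnd_le_succ hb (by omega))

lemma prefixBatches_succ (I : List (Update n)) (t d : ℕ) :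
    prefixBatches b K I i t (d + 1) = prefixBatches b K I i t d ++ [batch b K I i t d] := by
  simp [prefixBatches, List.range_succ]

/-- The end of a batch is the beginning of the next deeper one, so the slices join to a single
interval of updates. -/
lemma flatten_prefixBatches (hb : 2 ≤ b) (hK : 1 ≤ K) (I : List (Update n)) {t d : ℕ}
    (hd : d ≤ dvOf b K i t) : (prefixBatches b K I i t (d + 1)).flatten =
      baseList (graphAfter (I.take (bnd b K i t 0))) (n * n) ++
        slice I (bnd b K i t 0) (bnd b K i t (d + 1)) := by
  induction d with
  | zero => simp [prefixBatches, batch]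
  | succ d ih =>
    rw [prefixBatches_succ, List.flatten_append, ih (by omega)]
    simp only [batch, List.flatten_cons, List.flatten_nil, List.append_nil, Nat.succ_ne_zero,
      if_false, List.nil_append, List.append_assoc]
    rw [slice_append_slice I (bnd_mono hb hK (Nat.zero_le _) (by omega)) (bnd_le_succ hb hd)]

lemma take_batches (I : List (Update n)) {t d : ℕ} (hd : d ≤ dvOf b K i t + 1) :
    (batches b K I i t).take d = prefixBatches b K I i t d := by
  rw [batches, prefixBatches, ← List.map_take, List.take_range, min_eq_left hd, prefixBatches]

lemma batches_length (I : List (Update n)) (t : ℕ) :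
    (batches b K I i t).length = dvOf b K i t + 1 := by simp [batches, prefixBatches]

lemma getElem_batches (I : List (Update n)) {t d : ℕ} (hd : d < (batches b K I i t).length) :
    (batches b K I i t)[d] = batch b K I i t d := by simp [batches, prefixBatches]

lemma flatten_batches (hb : 2 ≤ b) (hK : 1 ≤ K) (I : List (Update n)) (t : ℕ) :
    (batches b K I i t).flatten = baseList (graphAfter (I.take (bnd b K i t 0))) (n * n) ++
        slice I (bnd b K i t 0) (bnd b K i t (dvOf b K i t + 1)) :=
  flatten_prefixBatches hb hK I le_rfl

lemma legalSeq_batches (hb : 2 ≤ b) (hK : 1 ≤ K) {I : List (Update n)} (hI : LegalSeq I) (t : ℕ) :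
    LegalSeq (batches b K I i t).flatten := by
  rw [flatten_batches hb hK]
  exact legalSeq_base_slice hI (bnd_mono hb hK (Nat.zero_le _) le_rfl)

lemma graphAfter_batches (hb : 2 ≤ b) (hK : 1 ≤ K) (I : List (Update n)) (t : ℕ) :
    graphAfter (batches b K I i t).flatten =
      graphAfter (I.take (bnd b K i t (dvOf b K i t + 1))) := by
  rw [flatten_batches hb hK]
  exact graphAfter_base_slice I (bnd_mono hb hK (Nat.zero_le _) le_rfl)

lemma length_flatten_batches (hb : 2 ≤ b) (hK : 1 ≤ K) (I : List (Update n)) (t : ℕ) :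
    (batches b K I i t).flatten.length ≤ n * n + I.length := by
  rw [flatten_batches hb hK, List.length_append]
  exact Nat.add_le_add (baseList_length _ _) (slice_length_le_length _ _ _)

/-- The number of updates in the batches of depth less than `d`. -/
noncomputable def prefixLen (b K : ℕ) (I : List (Update n)) (i t d : ℕ) : ℕ :=
  (prefixBatches b K I i t d).flatten.length

lemma prefixLen_zero (I : List (Update n)) (t : ℕ) : prefixLen b K I i t 0 = 0 := rfl

lemma prefixLen_succ (I : List (Update n)) (t d : ℕ) :
    prefixLen b K I i t (d + 1) = prefixLen b K I i t d + (batch b K I i t d).length := by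
  simp [prefixLen, prefixBatches_succ]

lemma prefixLen_le (hb : 2 ≤ b) (hK : 1 ≤ K) (I : List (Update n)) {t d : ℕ}
    (hd : d ≤ dvOf b K i t + 1) :
    prefixLen b K I i t d ≤ n * n + (bnd b K i t d - bnd b K i t 0) := by
  rcases d with _ | d
  · simp [prefixLen_zero]
  · rw [prefixLen, flatten_prefixBatches hb hK I (by omega), List.length_append]
    exact Nat.add_le_add (baseList_length _ _) (slice_length_le _ _ _)

/-- The hypothesis `1 ≤ d` excludes the insertions of the batch of depth `0`. Everything deeper
consists of genuine updates and is bounded by elapsed time. -/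
lemma prefixLen_le_add (hb : 2 ≤ b) (hK : 1 ≤ K) (I : List (Update n)) {t d d' : ℕ} (h1 : 1 ≤ d)
    (hdd : d ≤ d') (hd : d' ≤ dvOf b K i t + 1) :
    prefixLen b K I i t d' ≤ prefixLen b K I i t d + (bnd b K i t d' - bnd b K i t d) := by
  obtain ⟨d, rfl⟩ := Nat.exists_eq_add_of_le' h1
  obtain ⟨d', rfl⟩ := Nat.exists_eq_add_of_le' (h1.trans hdd)
  rw [prefixLen, prefixLen, flatten_prefixBatches hb hK I (by omega),
    flatten_prefixBatches hb hK I (by omega), List.length_append, List.length_append,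
    ← slice_append_slice I (bnd_mono hb hK (Nat.zero_le _) (by omega)) (bnd_mono hb hK hdd hd),
    List.length_append]
  have := slice_length_le I (bnd b K i t (d + 1)) (bnd b K i t (d' + 1))
  omega

/-! ### How the batches change in a tick -/

section Start

variable {t : ℕ}

lemma reached_eq_of_ne {l : ℕ} (h : remTicks b K (K - 1) i t ≠ b ^ l) :
    reached b K (K - 1) i l (t + 1) = reached b K (K - 1) i l t := by
  rw [reached, if_neg h]

/-- A start on level `l` alters only the end of the batch of its own depth, and for the top level
also the epoch; all shallower boundaries persist. The depth grows by at most one, since the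
preceding task either has the next higher level or was the last one of its window, at maximal depth
`K - 1`. -/
lemma bnd_of_start (hb : 2 ≤ b) (hK : 1 ≤ K)
    (h : remTicks b K (K - 1) i t = b ^ curLevel b K (K - 1) i t) :
    (∀ d, 1 ≤ d → d ≤ dvOf b K i (t + 1) → bnd b K i (t + 1) d = bnd b K i t d) ∧
    (1 ≤ dvOf b K i (t + 1) → bnd b K i (t + 1) 0 = bnd b K i t 0) ∧
    (dvOf b K i (t + 1) = 0 → bnd b K i (t + 1) 0 = t / (K * b ^ (K - 1)) * (K * b ^ (K - 1))) ∧
    bnd b K i (t + 1) (dvOf b K i (t + 1) + 1) = t + 1 ∧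
    dvOf b K i (t + 1) ≤ dvOf b K i t + 1 := by
  have hcl := curLevel_le (m := K) (L := K - 1) (i := i) hb t
  have hinj : ∀ l, remTicks b K (K - 1) i t = b ^ l → l = curLevel b K (K - 1) i t := fun l hl =>
    (curLevel_eq hb hl).symm
  simp only [dvOf]
  refine ⟨fun d h1 hd => ?_, fun h1 => ?_, fun h0 => ?_, ?_, ?_⟩
  · simp only [bnd, if_neg (show d ≠ 0 by omega)]
    exact reached_eq_of_ne fun hl => by have := hinj _ hl; omega
  · simp only [bnd, if_true]
    rw [epochOf, if_neg fun hl => by have := hinj _ hl; omega]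
  · simp only [bnd, if_true]
    rw [epochOf, if_pos (by rw [h]; congr 1; omega)]
  · simp only [bnd, Nat.succ_ne_zero, if_false]
    rw [show K - (K - 1 - curLevel b K (K - 1) i t + 1) = curLevel b K (K - 1) i t by omega, reached,
      if_pos h]
  · rcases t with _ | t
    · dsimp only [dvOf]; omega
    · dsimp only [dvOf]
      rcases prev_of_start hb h with h1 | ⟨-, h1⟩
      · have : curLevel b K (K - 1) i t = 0 := curLevel_eq hb (by simpa using h1)
        omega
      · omega

lemma batch_of_start (hb : 2 ≤ b) (hK : 1 ≤ K) (I : List (Update n))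
    (h : remTicks b K (K - 1) i t = b ^ curLevel b K (K - 1) i t) {d : ℕ}
    (hd : d < dvOf b K i (t + 1)) : batch b K I i (t + 1) d = batch b K I i t d := by
  obtain ⟨h1, h2, -⟩ := bnd_of_start hb hK h
  unfold batch
  rw [h2 (by omega), h1 (d + 1) (by omega) (by omega)]
  rcases d with _ | d
  · rw [h2 (by omega)]
  · rw [h1 (d + 1) (by omega) (by omega)]

/-- The batches before the one being replaced are untouched, hence the configuration after them can
be restored from the log. -/
lemma prefixBatches_of_start (hb : 2 ≤ b) (hK : 1 ≤ K) (I : List (Update n))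
    (h : remTicks b K (K - 1) i t = b ^ curLevel b K (K - 1) i t) {d : ℕ}
    (hd : d ≤ dvOf b K i (t + 1)) :
    prefixBatches b K I i (t + 1) d = prefixBatches b K I i t d := by
  unfold prefixBatches
  refine List.map_congr_left fun x hx => batch_of_start hb hK I h ?_
  have := List.mem_range.1 hx
  omega

lemma bnd_of_not_start (hb : 2 ≤ b)
    (h : remTicks b K (K - 1) i t ≠ b ^ curLevel b K (K - 1) i t) :
    bnd b K i (t + 1) = bnd b K i t ∧ dvOf b K i (t + 1) = dvOf b K i t ∧ t ≠ 0 := by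
  have hne : ∀ l, remTicks b K (K - 1) i t ≠ b ^ l := fun l hl => h (by rw [curLevel_eq hb hl, hl])
  have ht : t ≠ 0 := by
    rintro rfl
    exact hne _ remTicks_zero
  refine ⟨?_, ?_, ht⟩
  · funext d
    unfold bnd
    rw [epochOf, if_neg (hne _), reached_eq_of_ne (hne _)]
  · obtain ⟨t, rfl⟩ := Nat.exists_eq_succ_of_ne_zero ht
    simp only [dvOf]
    rw [(prev_of_not_start hb h).2]

lemma batches_of_not_start (hb : 2 ≤ b) (I : List (Update n))
    (h : remTicks b K (K - 1) i t ≠ b ^ curLevel b K (K - 1) i t) :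
    prefixBatches b K I i (t + 1) = prefixBatches b K I i t ∧
      batches b K I i (t + 1) = batches b K I i t := by
  obtain ⟨h1, h2, -⟩ := bnd_of_not_start hb h
  have h3 : prefixBatches b K I i (t + 1) = prefixBatches b K I i t := by
    funext d
    unfold prefixBatches batch
    rw [h1]
  exact ⟨h3, by rw [batches, h3, h2, batches]⟩

/-- In the last tick of a window the task has level `0` and takes in the current update, so the slot
is up to date afterwards. -/
lemma bnd_of_free (hb : 2 ≤ b) (hK : 1 ≤ K) (h : remTicks b K (K - 1) i t = 1) :
    bnd b K i (t + 1) (dvOf b K i (t + 1) + 1) = t + 1 := by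
  have h0 : curLevel b K (K - 1) i t = 0 := curLevel_eq hb (by simpa using h)
  exact (bnd_of_start hb hK (by rw [h0, h, pow_zero])).2.2.2.1

/-- The size of a task of low level. -/
lemma size_of_start (hb : 2 ≤ b) (hK : 1 ≤ K) (hi : i < K)
    (h : remTicks b K (K - 1) i t = b ^ curLevel b K (K - 1) i t)
    (hd : 1 ≤ dvOf b K i (t + 1)) :
    t + 1 ≤ bnd b K i (t + 1) (dvOf b K i (t + 1)) + K * b ^ (curLevel b K (K - 1) i t + 1) := by
  have h1 : remTicks b K (K - 1) i t ≤ b ^ (curLevel b K (K - 1) i t + 1) := by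
    rw [h]; exact Nat.pow_le_pow_right (by omega) (by omega)
  simp only [dvOf] at hd ⊢
  have := le_reached_add hb hi (l := curLevel b K (K - 1) i t + 1) (by omega) h1
  simp only [bnd, if_neg (show K - 1 - curLevel b K (K - 1) i t ≠ 0 by omega)]
  rwa [show K - (K - 1 - curLevel b K (K - 1) i t) = curLevel b K (K - 1) i t + 1 by omega]

/-- Every slot restarts once per epoch, from the beginning of that epoch, so it replays less than
two epochs. -/
lemma le_bnd_zero (hb : 2 ≤ b) (hi : i < K) (t : ℕ) :
    t ≤ bnd b K i t 0 + 2 * (K * b ^ (K - 1)) := by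
  rcases t with _ | t
  · exact Nat.zero_le _
  · have := lt_epochOf_add (L := K - 1) hb hi t
    simp only [bnd, if_true]
    rw [add_mul] at this
    omega

end Start

end

end DynMatching

namespace DynMatching

/-! ### The runs of the given algorithm -/

section

variable {A : Program} {ω : ℕ → ℕ} {W n : ℕ}

/-- For a fixed tape the machine is deterministic. -/
lemma Program.RunsTo.unique {c c₁ c₂ : A.Cfg} {t₁ t₂ : ℕ} (h₁ : A.RunsTo ω W c t₁ c₁)
    (h₂ : A.RunsTo ω W c t₂ c₂) : t₁ = t₂ ∧ c₁ = c₂ := by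
  have h : t₁ = t₂ := by
    rcases lt_trichotomy t₁ t₂ with h | h | h
    · exact absurd (h₁.1 ▸ h₁.2.1) (h₂.2.2.1 t₁ h)
    · exact h
    · exact absurd (h₂.1 ▸ h₂.2.1) (h₁.2.2.1 t₂ h)
  exact ⟨h, by rw [← h₁.1, ← h₂.1, h]⟩

lemma Program.Chain.unique {c c₁ c₂ : A.Cfg} {X : List (Update n × Bool)} {t₁ t₂ : ℕ}
    (h₁ : A.Chain ω W c X t₁ c₁) (h₂ : A.Chain ω W c X t₂ c₂) : c₁ = c₂ := by
  induction h₁ generalizing t₂ with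
  | nil => cases h₂; rfl
  | cons h h' ih =>
    cases h₂ with
    | cons k k' =>
      obtain ⟨-, rfl⟩ := h.unique k
      exact ih k'

lemma Program.Chain.append {c c₁ c₂ : A.Cfg} {X X' : List (Update n × Bool)} {t t' : ℕ}
    (h : A.Chain ω W c X t c₁) (h' : A.Chain ω W c₁ X' t' c₂) :
    A.Chain ω W c (X ++ X') (t + t') c₂ := by
  induction h with
  | nil => simpa using h'
  | cons k _ ih => rw [add_assoc]; exact .cons k (ih h')

lemma Program.IsExecution.chain {k T : ℕ} {X Z : List (Update n × Bool)} {cfg : ℕ → A.Cfg}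
    {time : ℕ → ℕ} (V : List (Update n × Bool))
    (h : A.IsExecution ω W n k T (X ++ (V ++ Z)) cfg time) :
    A.Chain ω W (cfg X.length) V
      (∑ i ∈ Finset.Ico X.length (X.length + V.length), time (i + 1))
      (cfg (X.length + V.length)) := by
  induction V generalizing X with
  | nil => simpa using Program.Chain.nil _
  | cons e V ih =>
    have h1 := h.process X.length (by simp)
    have e1 : (X ++ (e :: V ++ Z))[X.length]'(by simp) = e := by simp
    rw [e1] at h1
    have h2 := ih (X := X ++ [e]) (by simpa using h)
    simp only [List.length_append, List.length_cons, List.length_nil, zero_add] at h2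
    have h3 := Program.Chain.cons h1 h2
    rw [List.length_cons, Finset.sum_eq_sum_Ico_succ_bot (by omega)]
    rwa [show X.length + 1 + V.length = X.length + (V.length + 1) by omega] at h3

/-- The algorithm comes to the configuration `c` by processing the batches `B`. -/
def Program.Conf (A : Program) (ω : ℕ → ℕ) (W k T : ℕ) (B : List (List (Update n))) (c : A.Cfg) :
    Prop :=
  ∃ t₀ c₀ t, A.RunsTo ω W (A.start n k T) t₀ c₀ ∧ A.Chain ω W c₀ (B.flatMap tagBatch) t c

/-- The guarantees for different lists of batches come with separate executions. Uniqueness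
identifies their configurations after a common prefix, so a slot may continue from a restored
checkpoint as if it had run the new list from the start. -/
lemma Program.Conf.unique {k T : ℕ} {B : List (List (Update n))} {c c' : A.Cfg}
    (h : A.Conf ω W k T B c) (h' : A.Conf ω W k T B c') : c = c' := by
  obtain ⟨t₀, c₀, t, h1, h2⟩ := h
  obtain ⟨t₀', c₀', t', h1', h2'⟩ := h'
  obtain ⟨-, rfl⟩ := h1.unique h1'
  exact h2.unique h2'

lemma Program.Conf.append {k T t : ℕ} {B : List (List (Update n))} {X : List (Update n)}
    {c c' : A.Cfg} (h : A.Conf ω W k T B c) (h' : A.Chain ω W c (tagBatch X) t c') :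
    A.Conf ω W k T (B ++ [X]) c' := by
  obtain ⟨t₀, c₀, t', h1, h2⟩ := h
  exact ⟨t₀, c₀, _, h1, by simpa using h2.append h'⟩

lemma tagBatch_length (l : List (Update n)) : (tagBatch l).length = l.length := by
  cases l <;> simp [tagBatch]

lemma length_flatMap_tagBatch (B : List (List (Update n))) :
    (B.flatMap tagBatch).length = B.flatten.length := by
  induction B with
  | nil => rfl
  | cons X B ih => simp [ih, tagBatch_length]

lemma Program.GoodOnBatches.preprocess {C : ℝ} {k T P : ℕ} {α δ : ℝ} {B : List (List (Update n))}
    (h : A.GoodOnBatches ω W C n k T P α δ B) {C' : ℕ} (hC : C ≤ C') :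
    ∃ t c, A.RunsTo ω W (A.start n k T) t c ∧ t ≤ C' * P := by
  obtain ⟨cfg, time, h1, h2, -⟩ := h
  refine ⟨_, _, h1.preprocess, ?_⟩
  have : (time 0 : ℝ) ≤ C' * P := h2.trans (by gcongr)
  exact_mod_cast this

lemma Program.GoodOnBatches.step {C : ℝ} {k T P : ℕ} {α δ : ℝ} {B : List (List (Update n))}
    (h : A.GoodOnBatches ω W C n k T P α δ B) {C' : ℕ} (hC : C ≤ C') {d : ℕ} (hd : d < B.length) :
    ∃ c c' t, A.Conf ω W k T (B.take d) c ∧ A.Chain ω W c (tagBatch B[d]) t c' ∧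
      t ≤ C' * T * (B[d]).length ∧ c'.Bounded W := by
  obtain ⟨cfg, time, h1, -, -, h4⟩ := h
  have hB : B.flatMap tagBatch = (B.take d).flatMap tagBatch ++
      (tagBatch B[d] ++ (B.drop (d + 1)).flatMap tagBatch) := by
    conv_lhs => rw [← List.take_append_drop d B, List.drop_eq_getElem_cons hd]
    rw [List.flatMap_append, List.flatMap_cons]
  rw [hB] at h1
  have h5 := Program.IsExecution.chain (X := []) _ h1
  have h6 := Program.IsExecution.chain _ h1
  simp only [List.length_nil, zero_add] at h5
  have hlen : ((B.take d).flatMap tagBatch).length = offset B d := length_flatMap_tagBatch _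
  have hoff : offset B (d + 1) = offset B d + (tagBatch B[d]).length := by
    rw [tagBatch_length, offset, offset, List.take_add_one, List.getElem?_eq_getElem hd,
      List.flatten_append, List.length_append]
    congr 1
    simp
  rw [hlen] at h5 h6
  refine ⟨_, _, _, ⟨_, _, _, h1.preprocess, h5⟩, h6, ?_, ?_⟩
  · have := h4 d hd
    rw [hoff] at this
    have h7 : ((∑ i ∈ Finset.Ico (offset B d) (offset B d + (tagBatch B[d]).length),
      time (i + 1) : ℕ) : ℝ) ≤ C' * T * (B[d]).length := this.trans (by gcongr)
    exact_mod_cast h7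
  -- If no update has been processed, the final configuration is the one after the preprocessing;
  -- otherwise it is the end of the run of the last update.
  · rcases Nat.eq_zero_or_pos (offset B d + (tagBatch B[d]).length) with h0 | h0
    · rw [h0]
      exact h1.preprocess.1 ▸ h1.preprocess.2.2.2 _ le_rfl
    · obtain ⟨x, hx⟩ := Nat.exists_eq_succ_of_ne_zero h0.ne'
      rw [hx]
      have h7 := h1.process x (by simp only [List.length_append, hlen]; omega)
      exact h7.1 ▸ h7.2.2.2 _ le_rfl

lemma Program.GoodOnBatches.final {C : ℝ} {k T P : ℕ} {α δ : ℝ} {B : List (List (Update n))}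
    (h : A.GoodOnBatches ω W C n k T P α δ B) :
    ∃ c, A.Conf ω W k T B c ∧ HoldsMatchings 1 α δ (graphAfter B.flatten) c.mem := by
  obtain ⟨cfg, time, h1, -, h3, -⟩ := h
  have h5 := Program.IsExecution.chain (X := []) (Z := []) (B.flatMap tagBatch) (by simpa using h1)
  simp only [List.length_nil, zero_add, length_flatMap_tagBatch] at h5
  refine ⟨_, ⟨_, _, _, h1.preprocess, h5⟩, ?_⟩
  have := h3 _ le_rfl
  rwa [List.take_length] at this

end

end DynMatching

namespace DynMatching

/-! ### The invariant of a slot -/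

section

variable {n : ℕ}

/-- The remaining part of a batch: the edges of `G` from the pair `bc` on, and the updates from
`pos` to `goal`. -/
noncomputable def itemTodo (I : List (Update n)) (G : SimpleGraph (Fin n)) (bc pos goal : ℕ) :
    List (Option (ℕ × ℕ × ℕ)) :=
  (List.range' bc (n * n - bc)).map (fun x => (baseItem G x).map Update.code) ++
    (List.range' pos (goal - pos)).map fun x => I[x]?.map Update.code

/-- The program reads the table in use, that of the beginning of the current epoch, and recorded
updates. The bound on `goal` ensures that these have arrived. -/
lemma envTodo_eq {I : List (Update n)} {M K R E t : ℕ} {h : HS} (hm : Mid I M K R E t h)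
    (ht : t < I.length) {goal : ℕ} (hg : goal ≤ t + 1) (bc pos : ℕ) :
    envTodo h bc pos goal = itemTodo I (graphAfter (I.take (t / E * E))) bc pos goal := by
  unfold envTodo itemTodo
  rw [hm.params.r8, hm.table, hm.cur, hm.params.r5]
  congr 1
  · exact List.map_congr_left fun x _ => (baseItem_code _ _).symm
  · refine List.map_congr_left fun x hx => ?_
    have hx' := List.mem_range'_1.1 hx
    have hxt : x < t + 1 := by omega
    obtain ⟨h0, h1, h2⟩ := hm.hist x (by omega) hxt
    rw [h0, h1, h2, List.getElem?_eq_getElem (by omega)]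
    rfl

/-- Once all pairs have been read, the table is irrelevant. A slot may thus keep working on deeper
batches after the epoch of its restart is over and its table has been overwritten. -/
lemma itemTodo_congr (I : List (Update n)) (G G' : SimpleGraph (Fin n)) {bc : ℕ} (h : n * n ≤ bc)
    (pos goal : ℕ) : itemTodo I G bc pos goal = itemTodo I G' bc pos goal := by
  simp [itemTodo, Nat.sub_eq_zero_of_le h]

lemma length_itemTodo (I : List (Update n)) (G : SimpleGraph (Fin n)) (bc pos goal : ℕ) :
    (itemTodo I G bc pos goal).length = n * n - bc + (goal - pos) := by simp [itemTodo]

lemma filterMap_range'_eq_slice (I : List (Update n)) (pos m : ℕ) :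
    (List.range' pos m).filterMap (fun x => I[x]?) = slice I pos (pos + m) := by
  induction m generalizing pos with
  | zero => simp [slice]
  | succ m ih =>
    rw [List.range'_succ, List.filterMap_cons, ih, show pos + (m + 1) = pos + 1 + m by omega]
    rcases Nat.lt_or_ge pos I.length with h | h
    · rw [List.getElem?_eq_getElem h]
      simp only [slice]
      rw [List.drop_eq_getElem_cons (i := pos) (by simp; omega), List.getElem_take]
    · rw [List.getElem?_eq_none h]
      simp only [slice]
      rw [List.drop_eq_nil_of_le (by simp; omega), List.drop_eq_nil_of_le (by simp; omega)]

lemma filterMap_itemTodo (I : List (Update n)) (G : SimpleGraph (Fin n)) (bc : ℕ) {pos goal : ℕ}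
    (h : pos ≤ goal) : (itemTodo I G bc pos goal).filterMap id =
      ((List.range' bc (n * n - bc)).filterMap (baseItem G) ++ slice I pos goal).map
        Update.code := by
  have key : ∀ (l : List ℕ) (f : ℕ → Option (Update n)),
      (l.map fun x => (f x).map Update.code).filterMap id = (l.filterMap f).map Update.code := by
    intro l f
    rw [List.filterMap_map, List.map_filterMap]
    rfl
  rw [itemTodo, List.filterMap_append, key, key, List.map_append, filterMap_range'_eq_slice,
    Nat.add_sub_cancel' h]

/-- The number of ticks that remain for the present task, after `t` ticks. -/
def leftTicks (b K i : ℕ) : ℕ → ℕ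
  | 0 => 0
  | t + 1 => remTicks b K (K - 1) i t - 1 -
      (if curLevel b K (K - 1) i t = 0 then 0 else b ^ (curLevel b K (K - 1) i t - 1))

variable {b K i t : ℕ}

/-- A task of level `l` hands over to the next one when `b ^ (l-1)` ticks of the window remain; a
task of level `0` ends with the window. -/
lemma leftTicks_succ (hb : 2 ≤ b) : leftTicks b K i (t + 1) + 1 = remTicks b K (K - 1) i t -
      (if curLevel b K (K - 1) i t = 0 then 0 else b ^ (curLevel b K (K - 1) i t - 1)) := by
  have h1 := remTicks_pos (m := K) (L := K - 1) (i := i) hb t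
  simp only [leftTicks]
  split_ifs with h
  · omega
  · have := pow_lt_remTicks (m := K) (L := K - 1) (i := i) (t := t)
      (l := curLevel b K (K - 1) i t - 1) hb (by omega)
    omega

lemma leftTicks_of_not_start (hb : 2 ≤ b)
    (h : remTicks b K (K - 1) i t ≠ b ^ curLevel b K (K - 1) i t) :
    leftTicks b K i t = leftTicks b K i (t + 1) + 1 := by
  obtain ⟨-, -, h0⟩ := bnd_of_not_start hb h
  obtain ⟨s, rfl⟩ := Nat.exists_eq_succ_of_ne_zero h0
  obtain ⟨h1, h2⟩ := prev_of_not_start hb h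
  rw [leftTicks_succ hb]
  simp only [leftTicks]
  rw [h1, h2, Nat.add_sub_cancel]

/-- A new task starts only when the previous one has used up all its ticks. -/
lemma leftTicks_of_start (hb : 2 ≤ b)
    (h : remTicks b K (K - 1) i t = b ^ curLevel b K (K - 1) i t) : leftTicks b K i t = 0 := by
  rcases t with _ | t
  · rfl
  simp only [leftTicks]
  rcases prev_of_start hb h with h1 | ⟨h1, h2⟩
  · omega
  · rw [h1, h2, if_neg (by omega)]
    simp

lemma leftTicks_of_free (h : remTicks b K (K - 1) i t = 1) : leftTicks b K i (t + 1) = 0 := by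
  simp only [leftTicks]; omega

lemma baseList_bot (x : ℕ) : baseList (⊥ : SimpleGraph (Fin n)) x = [] := by
  simp [baseList, baseItem]

lemma batch_zero (I : List (Update n)) (d : ℕ) : batch b K I i 0 d = [] := by
  have h : graphAfter (I.take 0) = ⊥ := rfl
  simp only [batch, bnd_zero, h, baseList_bot]
  simp [slice]

/-- If `R` exceeds `N`, the difference truncates to `0`, which is right because the slot is then
idle. -/
lemma Slot.Reaches.advance {A : Program} {ω : ℕ → ℕ} {W D N : ℕ} {σ σ' : Slot A}
    (h : Slot.Reaches ω W D σ N σ') (h1 : σ'.mode = 0) (h2 : σ'.todo = []) (R : ℕ) :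
    Slot.Reaches ω W D ((Slot.micro ω)^[R] σ) (N - R) σ' := by
  obtain ⟨h3, h4⟩ := h.idle h1 h2
  refine ⟨?_, fun y _ => ?_⟩
  · rw [← Function.iterate_add_apply]; exact h3 _ (by omega)
  · rw [← Function.iterate_add_apply]; exact h4 _

variable {A : Program} {ω : ℕ → ℕ}

/-- The state of the slot `i` when it performs the task of the tick `t - 1`, the work being done
after `β` further ticks. -/
structure SlotInv (ω : ℕ → ℕ) (b K T R W D c₁ : ℕ) (I : List (Update n)) (i t β : ℕ)
    (F : FullSlot A) : Prop where
  dv : F.dv = dvOf b K i t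
  goal : F.goal = bnd b K i t (F.dv + 1)
  pp : ∀ d, 1 ≤ d → d ≤ F.dv → F.pp d = bnd b K i t d
  todo : F.slot.todo = itemTodo I (graphAfter (I.take (bnd b K i t 0))) F.bc F.pos F.goal
  full : F.dv ≠ 0 → n * n ≤ F.bc
  mark_low : ∀ d ≤ F.dv, F.mark d ≤ F.slot.low
  track : ∀ d ≤ F.dv, ∃ c, A.Conf ω W K T (prefixBatches b K I i t d) c ∧
    F.slot.Track c.cells (F.mark d)
  mark_mono : ∀ d < F.dv, F.mark d ≤ F.mark (d + 1)
  mark_step : ∀ d < F.dv, F.mark (d + 1) + c₁ * prefixLen b K I i t d ≤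
    F.mark d + c₁ * prefixLen b K I i t (d + 1)
  mark_zero : F.mark 0 = 0
  done : ∃ N σ', Slot.Reaches ω W D F.slot N σ' ∧ σ'.mode = 0 ∧ σ'.todo = [] ∧
    (∃ c, A.Conf ω W K T (batches b K I i t) c ∧ σ'.cells = c.cells) ∧
    σ'.log.length + c₁ * prefixLen b K I i t F.dv ≤
      F.mark F.dv + c₁ * prefixLen b K I i t (F.dv + 1) ∧ N ≤ R * β

variable {T R W D c₁ β : ℕ} {I : List (Update n)} {F : FullSlot A}

/-- At time `0` all batches are empty, so the preprocessed algorithm is the correct configuration at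
every depth. -/
lemma SlotInv.of_fresh {t₀ : ℕ} {c : A.Cfg} (hrun : A.RunsTo ω W (A.start n K T) t₀ c)
    (hF : Fresh c (n * n) K F) (β : ℕ) : SlotInv ω b K T R W D c₁ I i 0 β F := by
  have hconf : ∀ d, A.Conf ω W K T (prefixBatches b K I i 0 d) c := fun d => by
    refine ⟨t₀, c, 0, hrun, ?_⟩
    have : (prefixBatches b K I i 0 d).flatMap tagBatch = [] := by
      simp [prefixBatches, batch_zero, List.flatMap_map, tagBatch]
    rw [this]
    exact .nil c
  have htr : F.slot.Track c.cells 0 := ⟨Nat.zero_le _, by rw [hF.log]; exact hF.cells⟩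
  refine ⟨hF.dv, by rw [hF.goal, bnd_zero], fun d _ _ => by rw [hF.pp, bnd_zero], ?_,
    fun _ => hF.bc, fun d _ => by simp [hF.mark], fun d _ => ⟨c, hconf d, by rw [hF.mark]; exact htr⟩,
    fun d _ => by simp [hF.mark], fun d _ => ?_, by simp [hF.mark], 0, F.slot, Slot.Reaches.refl ?_,
    hF.mode, hF.todo, ⟨c, hconf _, hF.cells⟩, ?_, Nat.zero_le _⟩
  · rw [hF.todo, hF.goal]
    refine (List.eq_nil_of_length_eq_zero ?_).symm
    rw [length_itemTodo, Nat.sub_eq_zero_of_le hF.bc]; omega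
  · rw [hF.mark, prefixLen_succ, batch_zero]; simp
  · refine ⟨fun x => ?_, by simp [hF.log], by simp [hF.log]⟩
    rw [hF.cells]
    exact Program.Cfg.cells_le (hrun.1 ▸ hrun.2.2.2 _ le_rfl) x
  · rw [hF.mark, hF.log, prefixLen_succ, batch_zero]; simp

/-- With no ticks left the remaining work is bounded by `R * 0`, so the task is finished and all
pairs have been read. -/
lemma SlotInv.idle (h : SlotInv ω b K T R W D c₁ I i t 0 F) : F.slot.mode = 0 ∧ F.slot.todo = [] ∧
    (∃ c, A.Conf ω W K T (batches b K I i t) c ∧ F.slot.cells = c.cells) ∧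
    F.slot.log.length + c₁ * prefixLen b K I i t F.dv ≤
      F.mark F.dv + c₁ * prefixLen b K I i t (F.dv + 1) ∧ F.slot.Ok W D ∧ n * n ≤ F.bc := by
  obtain ⟨N, σ', h1, h2, h3, h4, h5, h6⟩ := h.done
  obtain rfl : N = 0 := by simpa using h6
  have e : F.slot = σ' := h1.1
  refine ⟨e ▸ h2, e ▸ h3, e ▸ h4, e ▸ h5, h1.2 0 le_rfl, ?_⟩
  have h7 : (itemTodo I (graphAfter (I.take (bnd b K i t 0))) F.bc F.pos F.goal).length = 0 := by
    rw [← h.todo, e, h3]; rfl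
  rw [length_itemTodo] at h7
  omega

/-- In the turn of the slot, the work of a tick. -/
lemma SlotInv.work (h : SlotInv ω b K T R W D c₁ I i t (β + 1) F) {F' : FullSlot A}
    (hs : F'.slot = (Slot.micro ω)^[R] F.slot) (hbc : F.bc ≤ F'.bc) (hg : F'.goal = F.goal)
    (hdv : F'.dv = F.dv) (hm : F'.mark = F.mark) (hpp : F'.pp = F.pp)
    (htodo : F'.slot.todo =
      itemTodo I (graphAfter (I.take (bnd b K i t 0))) F'.bc F'.pos F'.goal) :
    SlotInv ω b K T R W D c₁ I i t β F' := by
  refine ⟨hdv ▸ h.dv, by rw [hg, hdv]; exact h.goal, by rw [hpp, hdv]; exact h.pp, htodo,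
    fun h0 => (h.full (hdv ▸ h0)).trans hbc, ?_, ?_, by rw [hm, hdv]; exact h.mark_mono,
    by rw [hm, hdv]; exact h.mark_step, hm ▸ h.mark_zero, ?_⟩
  · rw [hdv, hm, hs, Slot.iterate_low]; exact h.mark_low
  · rw [hdv, hm, hs]
    intro d hd
    obtain ⟨c, h1, h2⟩ := h.track d hd
    exact ⟨c, h1, h2.iterate (h.mark_low d hd) R⟩
  · obtain ⟨N, σ', h1, h2, h3, h4, h5, h6⟩ := h.done
    refine ⟨N - R, σ', hs ▸ h1.advance h2 h3 R, h2, h3, h4, by rw [hdv, hm]; exact h5, ?_⟩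
    rw [mul_add, mul_one] at h6
    omega

lemma SlotInv.ok (h : SlotInv ω b K T R W D c₁ I i t β F) (y : ℕ) :
    ((Slot.micro ω)^[y] F.slot).Ok W D := by
  obtain ⟨N, σ', h1, h2, h3, -⟩ := h.done
  exact (h1.idle h2 h3).2 y

/-- Without a start the batches stay the same; the current tick is merely counted as one of the
remaining ticks that the work may use. -/
lemma SlotInv.of_not_start (hb : 2 ≤ b)
    (hst : remTicks b K (K - 1) i t ≠ b ^ curLevel b K (K - 1) i t)
    (h : SlotInv ω b K T R W D c₁ I i t (leftTicks b K i t) F) :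
    SlotInv ω b K T R W D c₁ I i (t + 1) (leftTicks b K i (t + 1) + 1) F := by
  obtain ⟨e1, e2, -⟩ := bnd_of_not_start hb hst
  obtain ⟨e3, e4⟩ := batches_of_not_start hb I hst
  have e5 : prefixLen b K I i (t + 1) = prefixLen b K I i t := by
    funext d; unfold prefixLen; rw [e3]
  obtain ⟨h1, h2, h3, h4, h5, h6, h7, h8, h9, h10, h11⟩ := h
  rw [leftTicks_of_not_start hb hst] at h11
  exact ⟨by rw [h1, e2], by rw [e1]; exact h2, by rw [e1]; exact h3, by rw [e1]; exact h4, h5, h6,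
    by rw [e3]; exact h7, h8, by rw [e5]; exact h9, h10, by rw [e4, e5]; exact h11⟩

/-- The marks at the beginning of a new task. -/
lemma SlotInv.marks (h : SlotInv ω b K T R W D c₁ I i t 0 F) :
    (∀ d ≤ F.dv + 1, ∃ c, A.Conf ω W K T (prefixBatches b K I i t d) c ∧
      F.slot.Track c.cells (Function.update F.mark (F.dv + 1) F.slot.log.length d)) ∧
    (∀ d < F.dv + 1, Function.update F.mark (F.dv + 1) F.slot.log.length d ≤
      Function.update F.mark (F.dv + 1) F.slot.log.length (d + 1)) ∧
    (∀ d < F.dv + 1, Function.update F.mark (F.dv + 1) F.slot.log.length (d + 1) +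
        c₁ * prefixLen b K I i t d ≤ Function.update F.mark (F.dv + 1) F.slot.log.length d +
        c₁ * prefixLen b K I i t (d + 1)) := by
  obtain ⟨h1, h2, ⟨c, h3, h3'⟩, h4, -, -⟩ := h.idle
  have hdv := h.dv
  refine ⟨fun d hd => ?_, fun d hd => ?_, fun d hd => ?_⟩
  · rcases Nat.lt_or_eq_of_le hd with hd | rfl
    · rw [Function.update_of_ne (by omega)]
      exact h.track d (by omega)
    · rw [Function.update_self]
      refine ⟨c, ?_, h3' ▸ Slot.Track.of_length⟩
      rw [hdv]; exact h3
  · rw [Function.update_of_ne (by omega : d ≠ F.dv + 1)]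
    rcases Nat.lt_or_eq_of_le (Nat.lt_succ_iff.1 hd) with hd | rfl
    · rw [Function.update_of_ne (by omega)]
      exact h.mark_mono d hd
    · rw [Function.update_self]
      obtain ⟨_, -, h5⟩ := h.track F.dv le_rfl
      exact h5.1
  · rw [Function.update_of_ne (by omega : d ≠ F.dv + 1)]
    rcases Nat.lt_or_eq_of_le (Nat.lt_succ_iff.1 hd) with hd | rfl
    · rw [Function.update_of_ne (by omega)]
      exact h.mark_step d hd
    · rw [Function.update_self]
      exact h4

/-- The growth of `f` is bounded by `c` times that of `g` over each step, hence over any interval;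
the additive form avoids truncated differences. -/
lemma telescope {f g : ℕ → ℕ} {c m : ℕ} (h : ∀ d < m, f (d + 1) + c * g d ≤ f d + c * g (d + 1))
    {d : ℕ} (hd : d ≤ m) : f m + c * g d ≤ f d + c * g m := by
  obtain ⟨x, rfl⟩ := Nat.exists_eq_add_of_le hd
  induction x with
  | zero => exact le_rfl
  | succ x ih =>
    have h1 := ih (fun d' hd' => h d' (by omega)) (by omega)
    have h2 := h (d + x) (by omega)
    rw [← add_assoc]
    omega

end

end DynMatching

namespace DynMatching

/-! ### The start of a task -/

section

variable {n b K i t : ℕ} {A : Program} {ω : ℕ → ℕ} {T R W D C : ℕ} {I : List (Update n)}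
  {F : FullSlot A}

/-- The number of units of work per tick suffices for the tasks of all levels. -/
structure Budget (n b K T R D C : ℕ) : Prop where
  low : ∀ l < K - 1, (2 * (C * T) + 7) * (K * b ^ (l + 1)) ≤
    R * (b ^ l - if l = 0 then 0 else b ^ (l - 1))
  top : (2 * (C * T) + 7) * (n * n + 2 * (K * b ^ (K - 1))) ≤
    R * (b ^ (K - 1) - if K - 1 = 0 then 0 else b ^ (K - 1 - 1))
  log : (C * T + 4) * (n * n + 2 * (K * b ^ (K - 1))) ≤ D

/-- The previous task is finished, so every depth up to `dv + 1` has a valid checkpoint. The new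
task rewinds to the checkpoint of its own depth, where by uniqueness the configuration is the one
for which the batch-dynamic guarantee bounds the new batch. It remains to check that undoing,
fetching and running fit into the ticks of the task, which is the purpose of `Budget`. -/
lemma SlotInv.of_start (hb : 2 ≤ b) (hK : 1 ≤ K) (hi : i < K) (hbud : Budget n b K T R D C)
    {M : ℕ} {h : HS} (hm : Mid I M K R (K * b ^ (K - 1)) t h) (ht : t < I.length)
    (hst : remTicks b K (K - 1) i t = b ^ curLevel b K (K - 1) i t)
    (hgood : ∃ c c' s, A.Conf ω W K T (prefixBatches b K I i (t + 1) (dvOf b K i (t + 1))) c ∧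
      A.Chain ω W c (tagBatch (batch b K I i (t + 1) (dvOf b K i (t + 1)))) s c' ∧
      s ≤ C * T * (batch b K I i (t + 1) (dvOf b K i (t + 1))).length)
    (hF : SlotInv ω b K T R W D (C * T + 4) I i t (leftTicks b K i t) F) :
    SlotInv ω b K T R W D (C * T + 4) I i (t + 1) (leftTicks b K i (t + 1) + 1)
      (F.begin h (dvOf b K i (t + 1)) t (t / (K * b ^ (K - 1)) * (K * b ^ (K - 1)))) := by
  rw [leftTicks_of_start hb hst] at hF
  obtain ⟨i1, i2, -, i4, i5, i6⟩ := hF.idle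
  obtain ⟨m1, m2, m3⟩ := hF.marks
  obtain ⟨b1, b2, b3, b4, b5⟩ := bnd_of_start hb hK hst
  have hdv := hF.dv
  have hgoal := hF.goal
  have hE := le_bnd_zero (K := K) (i := i) hb hi
  have hleft := leftTicks_succ (K := K) (i := i) (t := t) hb
  set d := dvOf b K i (t + 1) with hd
  set E := K * b ^ (K - 1) with hEdef
  set mk := Function.update F.mark (F.dv + 1) F.slot.log.length with hmk
  have hlen : ∀ d' ≤ d, prefixLen b K I i (t + 1) d' = prefixLen b K I i t d' := fun d' hd' => by
    rw [prefixLen, prefixBatches_of_start hb hK I hst hd', prefixLen]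
  have hmk0 : mk 0 = 0 := by
    rw [hmk, Function.update_of_ne (by omega), hF.mark_zero]
  have hmono : ∀ d' ≤ d, mk d' ≤ mk d := fun d' hd' => by
    have : ∀ x, d' + x ≤ d → mk d' ≤ mk (d' + x) := by
      intro x
      induction x with
      | zero => intro _; exact le_rfl
      | succ x ih => exact fun hx => (ih (by omega)).trans (m2 (d' + x) (by omega))
    have := this (d - d') (by omega)
    rwa [Nat.add_sub_cancel' hd'] at this
  -- If the new depth is `dv + 1`, its batch begins where the finished task ended; otherwise the old
  -- entry is still valid.
  have hpp : ∀ d', 1 ≤ d' → d' ≤ d → Function.update F.pp (F.dv + 1) F.goal d' =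
      bnd b K i (t + 1) d' := fun d' h1 h2 => by
    rw [b1 d' h1 h2]
    by_cases hx : d' = F.dv + 1
    · rw [hx, Function.update_self, hgoal]
    · rw [Function.update_of_ne hx, hF.pp d' h1 (by omega)]
  have hpos : (if d = 0 then t / E * E else Function.update F.pp (F.dv + 1) F.goal d) =
      bnd b K i (t + 1) d := by
    split_ifs with h0
    · rw [h0, b3 h0]
    · exact hpp d (by omega) le_rfl
  have hple : bnd b K i (t + 1) d ≤ t + 1 := bnd_le _ _
  have htodo : envTodo h (if d = 0 then 0 else F.bc)
      (if d = 0 then t / E * E else Function.update F.pp (F.dv + 1) F.goal d) (t + 1) =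
      itemTodo I (graphAfter (I.take (bnd b K i (t + 1) 0))) (if d = 0 then 0 else F.bc)
        (bnd b K i (t + 1) d) (t + 1) := by
    -- At depth `0` the table in use belongs to the epoch of the restart; at other depths no pairs
    -- are read any more.
    rw [envTodo_eq hm ht le_rfl, hpos]
    by_cases h0 : d = 0
    · rw [b3 h0]
    · rw [if_neg h0]
      exact itemTodo_congr I _ _ i6 _ _
  have hX : (envTodo h (if d = 0 then 0 else F.bc)
      (if d = 0 then t / E * E else Function.update F.pp (F.dv + 1) F.goal d)
        (t + 1)).filterMap id = (batch b K I i (t + 1) d).map Update.code := by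
    rw [htodo, filterMap_itemTodo _ _ _ hple, batch, b4]
    by_cases h0 : d = 0
    · rw [if_pos h0, if_pos h0, baseList, List.range_eq_range', Nat.sub_zero]
    · rw [if_neg h0, if_neg h0, Nat.sub_eq_zero_of_le i6]
      rfl
  obtain ⟨c, c', s, g1, g2, g3⟩ := hgood
  have hconf : A.Conf ω W K T (prefixBatches b K I i t d) c := by
    rwa [prefixBatches_of_start hb hK I hst le_rfl] at g1
  obtain ⟨c₂, hc₂, htr⟩ := m1 d (by omega)
  -- The configuration stored in the log and the one in the guarantee coincide.
  obtain rfl := hc₂.unique hconf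
  set X := batch b K I i (t + 1) d with hXdef
  set todo := envTodo h (if d = 0 then 0 else F.bc)
      (if d = 0 then t / E * E else Function.update F.pp (F.dv + 1) F.goal d) (t + 1) with htd
  have hXlen : prefixLen b K I i (t + 1) (d + 1) = prefixLen b K I i t d + X.length := by
    rw [prefixLen_succ, hlen d le_rfl]
  have hmkd : mk d + (C * T + 4) * prefixLen b K I i t 0 ≤
      mk 0 + (C * T + 4) * prefixLen b K I i t d :=
    telescope (fun d' hd' => m3 d' (by omega)) (Nat.zero_le _)
  rw [hmk0, zero_add, prefixLen_zero, mul_zero, add_zero] at hmkd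
  have htot : prefixLen b K I i (t + 1) (d + 1) ≤ n * n + 2 * E := by
    refine (prefixLen_le hb hK I le_rfl).trans ?_
    rw [b4]
    have := hE (t + 1)
    omega
  have htele : mk (F.dv + 1) + (C * T + 4) * prefixLen b K I i t d ≤
      mk d + (C * T + 4) * prefixLen b K I i t (F.dv + 1) :=
    telescope m3 (by omega)
  have hlast : mk (F.dv + 1) = F.slot.log.length := Function.update_self ..
  rw [hlast] at htele
  -- At most `C * T * X.length` steps with one log entry each, and four entries for handing over
  -- each update.
  have hmul : (C * T + 4) * prefixLen b K I i (t + 1) (d + 1) =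
      (C * T + 4) * prefixLen b K I i t d + (C * T * X.length + 4 * X.length) := by
    rw [hXlen]; ring
  have hD : mk d + s + 4 * X.length ≤ D := by
    have := Nat.mul_le_mul_left (C * T + 4) htot
    have hlog := hbud.log
    rw [← hEdef] at hlog
    omega
  have hblen : X.length ≤ (if d = 0 then n * n else 0) + (t + 1 - bnd b K i (t + 1) d) := by
    rw [hXdef, batch, List.length_append, b4]
    refine Nat.add_le_add ?_ (slice_length_le _ _ _)
    split_ifs
    · exact baseList_length _ _
    · simp
  have htlen : todo.length = n * n - (if d = 0 then 0 else F.bc) +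
      (t + 1 - bnd b K i (t + 1) d) := by rw [htodo, length_itemTodo]
  have hcl := curLevel_le (m := K) (L := K - 1) (i := i) hb t
  have hdcl : d = K - 1 - curLevel b K (K - 1) i t := rfl
  -- One number `S` bounds the updates to be undone, the size of the batch and the list to be read.
  -- It is `n * n + 2 * E` at depth `0`, and the recurrence time of windows one level higher
  -- otherwise.
  obtain ⟨S, s1, s2, s3, s4, s5⟩ : ∃ S, prefixLen b K I i t (F.dv + 1) ≤ prefixLen b K I i t d + S ∧
      X.length ≤ S ∧ todo.length ≤ S ∧ 1 ≤ S ∧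
      (2 * (C * T) + 7) * S ≤ R * (leftTicks b K i (t + 1) + 1) := by
    have hEpos : 1 ≤ E := Nat.mul_pos (by omega) (Nat.pow_pos (by omega))
    have hle1 : prefixLen b K I i t (F.dv + 1) ≤ n * n + (bnd b K i t (F.dv + 1) - bnd b K i t 0) :=
      prefixLen_le hb hK I (by omega)
    have hle2 : bnd b K i t (F.dv + 1) ≤ t := bnd_le _ _
    by_cases h0 : d = 0
    · refine ⟨n * n + 2 * E, ?_, ?_, ?_, by omega, ?_⟩
      · have := hE t
        omega
      · have := hE (t + 1)
        rw [if_pos h0, h0] at hblen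
        omega
      · have := hE (t + 1)
        rw [if_pos h0, h0] at htlen
        omega
      · rw [hleft, hst, show curLevel b K (K - 1) i t = K - 1 by omega]
        exact hbud.top
    · have hsz := size_of_start hb hK hi hst (by omega)
      rw [← hd] at hsz
      refine ⟨K * b ^ (curLevel b K (K - 1) i t + 1), ?_, ?_, ?_,
        Nat.mul_pos (by omega) (Nat.pow_pos (by omega)), ?_⟩
      · refine (prefixLen_le_add hb hK I (d := d) (by omega) (by omega) (by omega)).trans ?_
        rw [← b1 d (by omega) le_rfl]
        omega
      · rw [if_neg h0] at hblen
        omega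
      · rw [if_neg h0] at htlen
        omega
      · rw [hleft, hst]
        exact hbud.low _ (by omega)
  obtain ⟨σ', r1, r2, r3, r4, r5⟩ := Slot.reaches_task (ω := ω) (W := W) (D := D) X
    (F.begin h d t (t / E * E)).slot g2 hX i5 rfl (htr.congr rfl rfl) rfl hD
  have hconf' : A.Conf ω W K T (batches b K I i (t + 1)) c' := by
    rw [batches, prefixBatches_succ, prefixBatches_of_start hb hK I hst le_rfl]
    exact hconf.append g2
  refine ⟨rfl, b4.symm, hpp, ?_, ?_, hmono, ?_, ?_, ?_, hmk0, _, σ', r1, r2, r3, ⟨c', hconf', r4⟩,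
    ?_, ?_⟩
  · change todo = itemTodo I _ _ (if d = 0 then t / E * E else _) (t + 1)
    rw [hpos]; exact htodo
  · intro h0
    change d ≠ 0 at h0
    change n * n ≤ if d = 0 then 0 else F.bc
    rw [if_neg h0]; exact i6
  · intro d' hd'
    change d' ≤ d at hd'
    obtain ⟨c₃, k1, k2⟩ := m1 d' (by omega)
    exact ⟨c₃, by rwa [prefixBatches_of_start hb hK I hst hd'], k2.congr rfl rfl⟩
  · intro d' hd'
    change d' < d at hd'
    exact m2 d' (by omega)
  · intro d' hd'
    change d' < d at hd'
    rw [hlen d' (by omega), hlen (d' + 1) (by omega)]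
    exact m3 d' (by omega)
  · change σ'.log.length + _ * prefixLen b K I i (t + 1) d ≤ mk d +
      _ * prefixLen b K I i (t + 1) (d + 1)
    change σ'.log.length ≤ mk d + s + 4 * X.length at r5
    rw [hmul, hlen d le_rfl]
    omega
  · change F.slot.log.length - mk d + 1 + (todo.length + (s + X.length)) ≤ _
    refine le_trans ?_ s5
    -- Undoing costs `(C T + 4) S + 1` units, reading the list `S`, running the batch `C T S` and
    -- its halts `S`. As `S ≥ 1`, the sum is at most `(2 C T + 7) S`.
    have e1 : (2 * (C * T) + 7) * S = (C * T + 4) * S + C * T * S + 3 * S := by ring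
    have e2 := Nat.mul_le_mul_left (C * T + 4) s1
    have e3 := Nat.mul_le_mul_left (C * T) s2
    rw [mul_add] at e2
    omega

/-- The invariant of a slot is preserved by a tick. -/
theorem SlotInv.tick (hb : 2 ≤ b) (hK : 2 ≤ K) (hi : i < K) (hbud : Budget n b K T R D C)
    {M : ℕ} {h : HS} (hm : Mid I M K R (K * b ^ (K - 1)) t h) (ht : t < I.length)
    (hgood : ∃ c c' s, A.Conf ω W K T (prefixBatches b K I i (t + 1) (dvOf b K i (t + 1))) c ∧
      A.Chain ω W c (tagBatch (batch b K I i (t + 1) (dvOf b K i (t + 1)))) s c' ∧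
      s ≤ C * T * (batch b K I i (t + 1) (dvOf b K i (t + 1))).length)
    (hF : SlotInv ω b K T R W D (C * T + 4) I i t (leftTicks b K i t) F) :
    F.slot.todo = envTodo h F.bc F.pos F.goal ∧
      (∀ y ≤ R, ((Slot.micro ω)^[y] (F.turn h b K i t (K * b ^ (K - 1))).slot).Ok W D) ∧
      ∀ F' : FullSlot A,
        F'.slot = (Slot.micro ω)^[R] (F.turn h b K i t (K * b ^ (K - 1))).slot →
        (F.turn h b K i t (K * b ^ (K - 1))).bc ≤ F'.bc →
        F'.goal = (F.turn h b K i t (K * b ^ (K - 1))).goal →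
        F'.dv = (F.turn h b K i t (K * b ^ (K - 1))).dv →
        F'.mark = (F.turn h b K i t (K * b ^ (K - 1))).mark →
        F'.pp = (F.turn h b K i t (K * b ^ (K - 1))).pp →
        F'.slot.todo = envTodo h F'.bc F'.pos F'.goal →
        SlotInv ω b K T R W D (C * T + 4) I i (t + 1) (leftTicks b K i (t + 1)) F' := by
  have hturn : SlotInv ω b K T R W D (C * T + 4) I i (t + 1) (leftTicks b K i (t + 1) + 1)
      (F.turn h b K i t (K * b ^ (K - 1))) := by
    unfold FullSlot.turn
    split_ifs with hst
    · exact hF.of_start hb (by omega) hi hbud hm ht hst hgood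
    · exact hF.of_not_start hb hst
  have hcl := curLevel_le (m := K) (L := K - 1) (i := i) hb t
  -- The epoch of the slot must be the current one only while pairs are being read, that is, during
  -- a task of depth `0`.
  have hcur : dvOf b K i (t + 1) = 0 → bnd b K i (t + 1) 0 =
      t / (K * b ^ (K - 1)) * (K * b ^ (K - 1)) := fun h0 => by
    simp only [dvOf] at h0
    simp only [bnd, if_true]
    rw [epochOf_eq hb (by omega) (by omega)]
  have htodo : ∀ {F' : FullSlot A}, (F'.dv = dvOf b K i (t + 1)) → (F'.dv ≠ 0 → n * n ≤ F'.bc) →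
      F'.goal ≤ t + 1 → envTodo h F'.bc F'.pos F'.goal =
        itemTodo I (graphAfter (I.take (bnd b K i (t + 1) 0))) F'.bc F'.pos F'.goal := by
    intro F' h1 h2 h3
    rw [envTodo_eq hm ht h3]
    by_cases h0 : F'.dv = 0
    · rw [hcur (h1 ▸ h0)]
    · exact itemTodo_congr I _ _ (h2 h0) _ _
  refine ⟨?_, fun y _ => hturn.ok y, fun F' f1 f2 f3 f4 f5 f6 f7 => hturn.work f1 f2 f3 f4 f5 f6 ?_⟩
  · have hgl : F.goal ≤ t := hF.goal ▸ bnd_le _ _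
    by_cases hst : remTicks b K (K - 1) i t = b ^ curLevel b K (K - 1) i t
    · have hF' := hF
      rw [leftTicks_of_start hb hst] at hF'
      rw [envTodo_eq hm ht (by omega), hF.todo]
      exact itemTodo_congr I _ _ hF'.idle.2.2.2.2.2 _ _
    · obtain ⟨e1, e2, -⟩ := bnd_of_not_start hb hst
      rw [htodo (by rw [hF.dv, e2]) hF.full (by omega), hF.todo, e1]
  · rw [f7]
    refine htodo (by rw [f4, hturn.dv]) (fun h0 => (hturn.full (f4 ▸ h0)).trans f2) ?_
    rw [f3, hturn.goal]
    exact bnd_le _ _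

end

end DynMatching

namespace DynMatching

/-! ### Executions of structured programs -/

/-- The initial store. -/
def Store.start (n k T : ℕ) : Store where
  reg := fun r => match r with
    | 0 => n
    | 1 => k
    | 2 => T
    | _ => 0
  mem := fun _ => 0

/-- The update `e` is written into the first registers. -/
def Store.feed {n : ℕ} (s : Store) (e : Update n × Bool) : Store where
  reg := fun r => match r with
    | 0 => e.1.isInsert.toNat
    | 1 => e.1.u
    | 2 => e.1.v
    | 3 => e.2.toNat
    | r => s.reg r
  mem := s.mem

lemma Store.feed_reg {n : ℕ} (s : Store) (e : Update n × Bool) {r : ℕ} (hr : 4 ≤ r) :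
    (s.feed e).reg r = s.reg r := by
  match r, hr with
  | r + 4, _ => rfl

lemma Store.feed_le {n W : ℕ} {s : Store} (e : Update n × Bool) {r : ℕ} (hs : s.reg r ≤ W)
    (hn : n ≤ W) (hW : 1 ≤ W) : (s.feed e).reg r ≤ W := by
  match r with
  | 0 => exact (Bool.toNat_le _).trans hW
  | 1 => exact e.1.u.2.le.trans hn
  | 2 => exact e.1.v.2.le.trans hn
  | 3 => exact (Bool.toNat_le _).trans hW
  | r + 4 => exact hs

/-- Finite dependent choice: an invariant that can always be continued yields a run. -/
lemma exists_seq {β : Type} {p : ℕ → β → Prop} {S : ℕ → β → β → Prop} {N : ℕ} {x : β} (h0 : p 0 x)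
    (h : ∀ i < N, ∀ x, p i x → ∃ y, p (i + 1) y ∧ S i x y) :
    ∃ f : ℕ → β, f 0 = x ∧ (∀ i ≤ N, p i (f i)) ∧ ∀ i < N, S i (f i) (f (i + 1)) := by
  classical
  choose! g hg using h
  let f : ℕ → β := fun i => Nat.rec x (fun i y => g i y) i
  have hf : ∀ i ≤ N, p i (f i) := by
    intro i
    induction i with
    | zero => exact fun _ => h0
    | succ i ih => exact fun hi => (hg i (by omega) _ (ih (by omega))).1
  exact ⟨f, rfl, hf, fun i hi => (hg i hi _ (hf i hi.le)).2⟩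

/-- An execution of a structured program is obtained from an invariant of the store. -/
lemma Cmd.exists_isExecution {a b : Cmd} {ω : ℕ → ℕ} {W n k T U V : ℕ}
    {evs : List (Update n × Bool)} {Inv : ℕ → Store → Prop} (hn : n ≤ W) (hk : k ≤ W) (hT : T ≤ W)
    (hW : 1 ≤ W)
    (hinit : ∃ t s, a.Exec ω W (Store.start n k T) t s ∧ t ≤ V ∧ Inv 0 s)
    (hstep : ∀ i (h : i < evs.length) s, Inv i s →
      ∃ t s', b.Exec ω W (s.feed evs[i]) t s' ∧ t ≤ U ∧ Inv (i + 1) s') :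
    ∃ (st : ℕ → Store) (time : ℕ → ℕ),
      (Cmd.program a b).IsExecution ω W n k T evs (fun i => (st i).at (A := Cmd.program a b) none)
        time ∧ time 0 ≤ V ∧ (∀ i ≤ evs.length, Inv i (st i)) ∧
        ∀ i < evs.length, time (i + 1) ≤ U := by
  obtain ⟨t₀, s₀, h1, h2, h3⟩ := hinit
  have hs : (Store.start n k T).Bounded W := by
    refine ⟨fun r => ?_, fun _ => Nat.zero_le _⟩
    match r with
    | 0 => exact hn
    | 1 => exact hk
    | 2 => exact hT
    | r + 3 => exact Nat.zero_le _
  have hfeed : ∀ (s : Store) (e : Update n × Bool), s.Bounded W → (s.feed e).Bounded W :=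
    fun s e h => ⟨fun r => s.feed_le e (h.1 r) hn hW, h.2⟩
  obtain ⟨f, f0, f1, f2⟩ := exists_seq (β := Store × ℕ) (N := evs.length) (x := (s₀, t₀))
    (p := fun i x => x.1.Bounded W ∧ Inv i x.1)
    (S := fun i x y => ∀ h : i < evs.length,
      b.Exec ω W (x.1.feed evs[i]) y.2 y.1 ∧ y.2 ≤ U) ⟨h1.bounded hs, h3⟩ (by
        rintro i hi ⟨s, t⟩ ⟨k1, k2⟩
        obtain ⟨t', s', k3, k4, k5⟩ := hstep i hi s k2
        exact ⟨(s', t'), ⟨k3.bounded (hfeed _ _ k1), k5⟩, fun _ => ⟨k3, k4⟩⟩)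
  refine ⟨fun i => (f i).1, fun i => (f i).2, ⟨?_, fun i hi => ?_⟩, (congrArg Prod.snd f0).le.trans h2,
    fun i hi => (f1 i hi).2, fun i hi => (f2 i hi hi).2⟩
  · change (Cmd.program a b).RunsTo ω W _ (f 0).2 ((f 0).1.at (A := Cmd.program a b) none)
    rw [f0]; exact h1.runsTo_init hs
  · exact (f2 i hi hi).1.runsTo_entry (hfeed _ _ (f1 i hi.le).1)

/-! ### The simulating program -/

/-- Compute the number of arrays. -/
def arraysCmd : Cmd :=
  .seq (.basic (.const 40 8)) (.seq (.basic (.op .mul 41 1 40)) (.basic (.op .add 4 41 40)))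

/-- The program that simulates the algorithm in all slots. -/
def simProgram {A : Program} {Q : ℕ} (enc : A.Loc ≃ Fin Q) (b ρ : ℕ) : Program :=
  Cmd.program (.seq arraysCmd (initStm enc b ρ).cmd) (updateStm enc b).cmd

section

variable {A : Program} {Q : ℕ} {enc : A.Loc ≃ Fin Q} {ω : ℕ → ℕ}

/-- The imperative language presupposes the number of arrays in the register `4`, so this register
is set by bare machine instructions before any statement is executed. -/
lemma exec_arraysCmd {M Y W n K T : ℕ} (hM : M = 8 * K + 8) (hMY : M ≤ Y) (hn : n ≤ Y) (hT : T ≤ Y)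
    (hW : Y ≤ W) : ∃ s h, arraysCmd.Exec ω W (Store.start n K T) 3 s ∧ Sim M Y h s ∧
      h.reg 0 = n ∧ h.reg 1 = K ∧ h.reg 2 = T ∧ h.reg 4 = M ∧ ∀ r, h.arr r = fun _ => 0 := by
  obtain ⟨s, hs, hm, h40, hr⟩ : ∃ s, arraysCmd.Exec ω W (Store.start n K T) 3 s ∧
      (∀ a, s.mem a = 0) ∧ s.reg 4 = M ∧
      ∀ r < 40, r ≠ 4 → s.reg r = (Store.start n K T).reg r := by
    refine ⟨_, .seq (.basic _ _ ?_) (.seq (.basic _ _ ?_) (.basic _ _ ?_)), fun a => rfl, ?_, ?_⟩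
    · simp only [Basic.value]; omega
    · simp [Basic.value, Basic.run, Store.start, BinOp.eval]; omega
    · simp [Basic.value, Basic.run, Store.start, BinOp.eval]; omega
    · simp [Basic.run, Store.start, BinOp.eval]; omega
    · intro r h1 h2
      simp only [Basic.run]
      rw [Function.update_of_ne h2, Function.update_of_ne (by omega),
        Function.update_of_ne (by omega)]
  refine ⟨s, ⟨s.reg, fun _ _ => 0, fun _ => 0⟩, hs, ⟨fun _ _ => rfl, h40, fun _ _ _ => hm _,
    fun _ _ => hm _, fun r h1 => ?_, fun _ _ _ => Nat.zero_le _⟩, hr 0 (by norm_num) (by norm_num),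
    hr 1 (by norm_num) (by norm_num), hr 2 (by norm_num) (by norm_num), h40, fun _ => rfl⟩
  change s.reg r ≤ Y
  by_cases h4 : r = 4
  · rw [h4, h40]; exact hMY
  rw [hr r h1 h4]
  match r with
  | 0 => exact hn
  | 1 => change K ≤ Y; omega
  | 2 => exact hT
  | r + 3 => exact Nat.zero_le _

/-- The output cells refer to the output of the algorithm in the slot `i`. -/
lemma Sim.outputs {M Y i n : ℕ} {h : HS} {s : Store} {F : FullSlot A} {c : A.Cfg} {o : ℕ → ℕ}
    (hs : Sim M Y h s) (hi : 8 * i + 8 < M) (hF : Stored enc h i F) (ho : h.out = outAfter M i F o)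
    (hc : F.slot.cells = c.cells) {G : SimpleGraph (Fin n)} {S : G.Subgraph}
    (hS : Outputs c.mem 0 S) : Outputs s.mem 0 S := by
  have key : ∀ a, c.cells (2 * a + 1) = c.mem a := fun a => by
    simp [Program.Cfg.cells, Nat.add_mod, show (2 * a + 1) / 2 = a by omega]
  have h0 : s.mem 0 = 2 + M + (8 * i + 8) + c.mem 0 * (2 * M) := by
    rw [hs.out 0 (by norm_num), ho, outAfter, hc, ← key 0]; simp
  have h1 : s.mem 1 = c.mem 1 * (2 * M) := by
    rw [hs.out 1 (by norm_num), ho, outAfter, hc, ← key 1]; simp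
  -- Memory cell `a` of the slot is entry `2 a + 1` of its array, at the address `2 + (2 a + 1) M +
  -- (8 i + 8)`. This is affine in `a`, so the mate array of the slot is an arithmetic progression
  -- of cells and becomes the output by changing only base and stride.
  have h2 : ∀ u, s.mem (s.mem 0 + s.mem 1 * u) = c.mem (c.mem 0 + c.mem 1 * u) := fun u => by
    rw [← key, ← hc, ← hF.cells, ← hs.arr _ hi, h0, h1]
    congr 1
    ring
  intro u
  simp only [Nat.mul_zero, Nat.zero_add, h2]
  exact hS u

lemma Sim.feed {M Y n : ℕ} {h : HS} {s : Store} (hs : Sim M Y h s) (e : Update n × Bool)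
    (hn : n ≤ Y) (hY : 1 ≤ Y) : Sim M Y ⟨(s.feed e).reg, h.arr, h.out⟩ (s.feed e) :=
  ⟨fun _ _ => rfl, (s.feed_reg e le_rfl).trans ((hs.reg 4 (by norm_num)).trans hs.arrays), hs.arr, hs.out,
    fun r hr => s.feed_le e (hs.reg r hr ▸ hs.reg_le r hr) hn hY, hs.arr_le⟩

/-- All numbers that occur in the simulation of `K` slots are at most `Y`. -/
structure Room (A : Program) (Q n b K T R W D N Y : ℕ) : Prop where
  arrays : 8 * K + 8 ≤ Y
  pairs : n * n ≤ Y
  time : T ≤ Y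
  epoch : K * b ^ (K - 1) ≤ Y
  work : R ≤ Y
  pow : b ^ K ≤ Y
  len : 2 * N + 2 ≤ Y
  log : D + 4 ≤ Y
  locs : Q ≤ Y
  word : 2 * W + 1 ≤ Y
  regs : ∀ q, (A.code q).RegsLe Y

/-- The state between two updates. -/
def SimInv (enc : A.Loc ≃ Fin Q) (ω : ℕ → ℕ) {n : ℕ} (b K T R W D C Y : ℕ) (I : List (Update n))
    (t : ℕ) (s : Store) : Prop :=
  ∃ h, Sim (8 * K + 8) Y h s ∧ Env I (8 * K + 8) K R (K * b ^ (K - 1)) t h ∧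
    Slots enc (8 * K + 8) K
      (fun i => leftTicks b K i t = 0 ∧ bnd b K i t (dvOf b K i t + 1) = t)
      (fun i => SlotInv ω b K T R W D (C * T + 4) I i t (leftTicks b K i t)) h

variable {n b K T R W D C Y : ℕ} {I : List (Update n)}

/-- The output belongs to a slot with no work left whose batches extend to time `t`. By uniqueness
its configuration is the final one of the guaranteed run, and the concatenated batches lead to the
current graph. -/
lemma SimInv.holdsMatchings {t : ℕ} {s : Store} (hs : SimInv enc ω b K T R W D C Y I t s)
    (hb : 2 ≤ b) (hK : 1 ≤ K) {C₀ α δ : ℝ} {P : ℕ}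
    (hgood : ∀ i < K, A.GoodOnBatches ω W C₀ n K T P α δ (batches b K I i t)) :
    HoldsMatchings 1 α δ (graphAfter (I.take t)) s.mem := by
  obtain ⟨h, h1, -, h3⟩ := hs
  obtain ⟨i, hi, ⟨hl, hbnd⟩, F, hF, hst, o, ho⟩ := h3.output
  rw [hl] at hF
  obtain ⟨-, -, ⟨c, hc, hcells⟩, -⟩ := hF.idle
  obtain ⟨c', hc', hm⟩ := (hgood i hi).final
  obtain rfl := hc.unique hc'
  rw [graphAfter_batches hb hK, hbnd] at hm
  have key : ∀ {S : (graphAfter (I.take t)).Subgraph}, Outputs c.mem 0 S → Outputs s.mem 0 S :=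
    fun hS => h1.outputs (by omega) hst ho hcells hS
  obtain ⟨m1, j, hj, S, m2, m3, m4⟩ := hm
  refine ⟨fun j' hj' => ?_, j, hj, S, m2, ?_, m4⟩
  · obtain ⟨S', k1, k2⟩ := m1 j' hj'
    obtain rfl : j' = 0 := by omega
    exact ⟨S', k1, key k2⟩
  · obtain rfl : j = 0 := by omega
    exact key m3

lemma SimInv.init {ρ P W' t : ℕ} {c : A.Cfg} (hrun : A.RunsTo ω W (A.start n K T) t c)
    (ht : t ≤ C * P) (hD : C * P ≤ D) (hb : 2 ≤ b) (hK : 1 ≤ K)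
    (hY : Room A Q n b K T (ρ * T * K) W D I.length Y)
    (hW : (Y + 2) ^ ((initStm enc b ρ).size + (updateStm enc b).size + 1) ≤ W') :
    ∃ t' s, (Cmd.seq arraysCmd (initStm enc b ρ).cmd).Exec ω W' (Store.start n K T) t' s ∧
      t' ≤ 3 + (K + 1) * ((C * P + 2) * ((microStm enc).cost + 3) + 2000) ∧
      SimInv enc ω b K T (ρ * T * K) W D C Y I 0 s := by
  have hYW : Y ≤ W' := by
    have := pow_le_of_le (Z := Y + 2) (a := 1) (by omega) hW (by omega)
    rw [pow_one] at this
    omega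
  obtain ⟨s, h, e1, e2, e3, e4, e5, e6, e7⟩ := exec_arraysCmd (ω := ω) (n := n) (K := K) rfl
    hY.arrays ((Nat.le_mul_self n).trans hY.pairs) hY.time hYW
  obtain ⟨t', ht', h', f1, f2, f3⟩ := tr_initStm (enc := enc) (ρ := ρ) I hrun hb e3 e4 e5 e6 e7 hK rfl
    hY.arrays hY.pairs hY.time hY.epoch hY.work hY.regs hY.log hY.locs hY.word (ht.trans hD)
  obtain ⟨s', g1, g2⟩ := f1.exec e2 (pow_le_of_le (by omega) hW (by omega))
  refine ⟨3 + t', s', e1.seq g1, ?_, h', g2, f2, ⟨fun i hi => ?_, ?_⟩⟩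
  · refine Nat.add_le_add_left (ht'.trans ?_) 3
    gcongr
  · obtain ⟨F, k1, k2⟩ := f3.stored i hi
    exact ⟨F, SlotInv.of_fresh hrun k1 _, k2⟩
  · obtain ⟨i, hi, -, F, k1, k2⟩ := f3.output
    exact ⟨i, hi, ⟨rfl, bnd_zero _⟩, F, SlotInv.of_fresh hrun k1 _, k2⟩

/-- Behaviour on the batches at time `t + 1` is what is needed: the batch of the task active in this
tick is the last one of that list. -/
lemma SimInv.step {ρ P W' t : ℕ} {C₀ α δ : ℝ} {s : Store}
    (hs : SimInv enc ω b K T (ρ * T * K) W D C Y I t s)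
    (hI : LegalSeq I) (ht : t < I.length) (hb : 2 ≤ b) (hK : 2 ≤ K)
    (hbud : Budget n b K T (ρ * T * K) D C) (hC : C₀ ≤ C)
    (hY : Room A Q n b K T (ρ * T * K) W D I.length Y)
    (hW : (Y + 2) ^ ((initStm enc b ρ).size + (updateStm enc b).size + 1) ≤ W')
    (hgood : ∀ i < K, A.GoodOnBatches ω W C₀ n K T P α δ (batches b K I i (t + 1))) (f : Bool) :
    ∃ t' s', (updateStm enc b).cmd.Exec ω W' (s.feed (I[t]'ht, f)) t' s' ∧
      t' ≤ (K + 1) * (K + ρ * T * K + 2) * ((microStm enc).cost + 2000) ∧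
      SimInv enc ω b K T (ρ * T * K) W D C Y I (t + 1) s' := by
  obtain ⟨h, h1, h2, h3⟩ := hs
  have hsim := h1.feed (I[t]'ht, f) ((Nat.le_mul_self n).trans hY.pairs)
    (by have := hY.arrays; omega)
  set h' : HS := ⟨(s.feed (I[t]'ht, f)).reg, h.arr, h.out⟩ with hh'
  have hst : ∀ {i F}, Stored enc h i F → Stored enc h' i F := fun hF => hF.congr fun _ _ _ => rfl
  have henv : Env I (8 * K + 8) K (ρ * T * K) (K * b ^ (K - 1)) t h' := by
    refine ⟨h2.params.congr fun r r1 r2 => ?_, h2.hist, h2.cur, h2.nxt⟩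
    change (s.feed (I[t]'ht, f)).reg r = _
    rw [Store.feed_reg _ _ r1, h1.reg r (by omega)]
  have hE : 1 ≤ K * b ^ (K - 1) := Nat.mul_pos (by omega) (Nat.pow_pos (by omega))
  have hslots : Slots enc (8 * K + 8) K (fun i => leftTicks b K i t = 0 ∧ bnd b K i t (dvOf b K i t + 1) = t)
      (fun i => SlotInv ω b K T (ρ * T * K) W D (C * T + 4) I i t (leftTicks b K i t)) h' := by
    refine ⟨fun i hi => ?_, ?_⟩
    · obtain ⟨F, k1, k2⟩ := h3.stored i hi
      exact ⟨F, k1, hst k2⟩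
    · obtain ⟨i, hi, k0, F, k1, k2, k3⟩ := h3.output
      exact ⟨i, hi, k0, F, k1, hst k2, k3⟩
  have hlen := hY.len
  obtain ⟨t', ht', h'', f1, f2, f3⟩ := tr_updateStm (ω := ω) (b := b) (W := W) (D := D)
    (J' := fun i => SlotInv ω b K T (ρ * T * K) W D (C * T + 4) I i (t + 1)
      (leftTicks b K i (t + 1))) hI henv hslots hE ht rfl rfl rfl hb (by omega) rfl hY.arrays
    hY.pairs (by omega) hY.pow hY.regs hY.log hY.locs hY.word hY.work
    (fun i hi F hm hmid hF => SlotInv.tick hb hK hi hbud hmid ht (by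
      have hd : dvOf b K i (t + 1) < (batches b K I i (t + 1)).length := by
        rw [batches_length]; omega
      obtain ⟨c, c', x, k1, k2, k3, -⟩ := (hgood i hi).step hC hd
      rw [take_batches I (by omega)] at k1
      rw [getElem_batches] at k2 k3
      exact ⟨c, c', x, k1, k2, k3⟩) hF)
  obtain ⟨s', g1, g2⟩ := f1.exec hsim (pow_le_of_le (by omega) hW (by omega))
  refine ⟨t', s', g1, ht', h'', g2, f2, f3.stored, ?_⟩
  obtain ⟨i, hi, k0, k1⟩ := f3.output
  exact ⟨i, hi, ⟨leftTicks_of_free k0, bnd_of_free hb (by omega) k0⟩, k1⟩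

/-- If the algorithm behaves well on all batches that the slots process, then the simulation behaves
well. -/
theorem goodWorstCase_simProgram {ρ P W' : ℕ} {C₀ α δ U V : ℝ}
    (hI : LegalSeq I) (hb : 2 ≤ b) (hK : 2 ≤ K) (hbud : Budget n b K T (ρ * T * K) D C)
    (hC : C₀ ≤ C) (hD : C * P ≤ D) (hY : Room A Q n b K T (ρ * T * K) W D I.length Y)
    (hW : (Y + 2) ^ ((initStm enc b ρ).size + (updateStm enc b).size + 1) ≤ W')
    (hgood : ∀ i < K, ∀ t ≤ I.length, A.GoodOnBatches ω W C₀ n K T P α δ (batches b K I i t))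
    (hU : (((K + 1) * (K + ρ * T * K + 2) * ((microStm enc).cost + 2000) : ℕ) : ℝ) ≤ U)
    (hV : ((3 + (K + 1) * ((C * P + 2) * ((microStm enc).cost + 3) + 2000) : ℕ) : ℝ) ≤ V) :
    (simProgram enc b ρ).GoodWorstCase ω W' n K T 1 U V α δ I := by
  have hYW : Y ≤ W' := by
    have := pow_le_of_le (Z := Y + 2) (a := 1) (by omega) hW (by omega)
    rw [pow_one] at this
    omega
  have hY1 := hY.arrays
  obtain ⟨t₀, c, hrun, ht₀⟩ := (hgood 0 (by omega) 0 (Nat.zero_le _)).preprocess hC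
  obtain ⟨st, time, h1, h2, h3, h4⟩ := Cmd.exists_isExecution
    (evs := I.map fun e => (e, false)) (((Nat.le_mul_self n).trans hY.pairs).trans hYW)
    (by omega) (hY.time.trans hYW) (by omega)
    (SimInv.init hrun ht₀ hD hb (by omega) hY hW)
    (fun i hi s hs => by
      have hi' : i < I.length := by simpa using hi
      rw [List.getElem_map]
      exact hs.step hI hi' hb hK hbud hC hY hW (fun j hj => hgood j hj _ hi') false)
  rw [List.length_map] at h3 h4
  refine ⟨_, time, h1, le_trans (by exact_mod_cast h2) hV, fun i hi => ?_, fun i hi =>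
    le_trans (by exact_mod_cast h4 i hi) hU⟩
  exact (h3 i hi).holdsMatchings hb (by omega) fun j hj => hgood j hj i hi

end

end DynMatching

namespace DynMatching

section

variable {A : Program} {Q : ℕ}

/-! ### Determinism -/

lemma Instr.noRand_instrStm {τ : Type} (enc : τ → ℕ) {i : Instr τ} (h : ∀ r s q, i ≠ .rand r s q) :
    (instrStm enc i).NoRand := by
  cases i with
  | rand r s q => exact absurd rfl (h r s q)
  | _ => simp [instrStm, logWrite, Stm.NoRand]

lemma noRand_dispatch : ∀ (q : ℕ) {l : List Stm}, (∀ c ∈ l, c.NoRand) → (dispatch q l).NoRand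
  | _, [], _ => trivial
  | q, c :: cs, h => ⟨h c (by simp), noRand_dispatch (q + 1) fun c' hc' => h c' (by simp [hc'])⟩

lemma noRand_microStm (enc : A.Loc ≃ Fin Q) (hA : A.Deterministic) : (microStm enc).NoRand := by
  have h := noRand_dispatch 0 (l := List.ofFn fun j =>
    instrStm (fun q => (enc q : ℕ)) (A.code (enc.symm j))) (by
      intro c hc
      obtain ⟨j, rfl⟩ := (List.mem_ofFn' _ _).1 hc
      exact Instr.noRand_instrStm _ fun r s q => hA _ r s q)
  simp [microStm, Stm.NoRand, h, fetchStm, feedStm, logWrite, undoStm, skipStm]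

lemma simProgram_deterministic (enc : A.Loc ≃ Fin Q) (b ρ : ℕ) (hA : A.Deterministic) :
    (simProgram enc b ρ).Deterministic := by
  have h := noRand_microStm enc hA
  refine Cmd.program_deterministic ⟨?_, Stm.noRand_cmd ?_⟩ (Stm.noRand_cmd ?_)
  · simp [arraysCmd, Cmd.NoRand]
  · simp [initStm, setupStm, clearStm, saveStm, outStm, Stm.NoRand, h]
  · simp [updateStm, recordStm, tableStm, tickStm, loadStm, schedStm, startStm, workStm, saveStm,
      outStm, skipStm, Stm.NoRand, h]

/-! ### Choice of the parameters -/

lemma Instr.RegsLe.mono {τ : Type} {i : Instr τ} {Y Y' : ℕ} (h : i.RegsLe Y) (hY : Y ≤ Y') :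
    i.RegsLe Y' := by
  cases i <;> first
    | exact trivial
    | exact le_trans h hY

lemma Instr.exists_regsLe {τ : Type} (i : Instr τ) : ∃ Y, i.RegsLe Y := by
  cases i <;> first
    | exact ⟨0, trivial⟩
    | exact ⟨_, le_rfl⟩

lemma Program.exists_regsLe (A : Program) : ∃ Y, ∀ q, (A.code q).RegsLe Y := by
  have := A.finite_loc
  choose f hf using fun q => (A.code q).exists_regsLe
  obtain ⟨Y, hY⟩ := (Set.finite_range f).bddAbove
  exact ⟨Y, fun q => (hf q).mono (hY ⟨q, rfl⟩)⟩

/-- As `b ≥ 2`, the deeper tasks of a window take at most half of its time. -/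
lemma pow_le_two_mul_sub {b : ℕ} (hb : 2 ≤ b) (l : ℕ) :
    b ^ l ≤ 2 * (b ^ l - if l = 0 then 0 else b ^ (l - 1)) := by
  rcases l with _ | l
  · simp
  · rw [if_neg (by omega), Nat.add_sub_cancel, pow_succ]
    have : b ^ l * 2 ≤ b ^ l * b := Nat.mul_le_mul_left _ hb
    omega

/-- With `x` ticks for a task of level `l` one has `b ^ l ≤ 2 x`, so the batch size `K b^(l+1)`
needs a factor `2 b`. At the top `n² + 2 K b^(K-1) ≤ 3 K b^(K-1) ≤ 6 K x`. The factor `6 b` covers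
both cases. -/
lemma Budget.of_le {n b K T D C : ℕ} (hb : 2 ≤ b) (hK : 1 ≤ K) (hT : 1 ≤ T)
    (hn : n * n ≤ b ^ (K - 1)) (hD : (C * T + 4) * (n * n + 2 * (K * b ^ (K - 1))) ≤ D) :
    Budget n b K T (6 * b * (2 * C + 7) * T * K) D C := by
  have h7 : 2 * (C * T) + 7 ≤ (2 * C + 7) * T := by nlinarith
  refine ⟨fun l _ => ?_, ?_, hD⟩
  · have h := pow_le_two_mul_sub hb l
    set x := b ^ l - if l = 0 then 0 else b ^ (l - 1)
    calc (2 * (C * T) + 7) * (K * b ^ (l + 1)) ≤ ((2 * C + 7) * T) * (K * (2 * x * b)) := by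
          rw [pow_succ]; gcongr
      _ = 2 * (b * (2 * C + 7) * T * K * x) := by ring
      _ ≤ 6 * (b * (2 * C + 7) * T * K * x) := by omega
      _ = _ := by ring
  · have h := pow_le_two_mul_sub hb (K - 1)
    set x := b ^ (K - 1) - if K - 1 = 0 then 0 else b ^ (K - 1 - 1)
    have h1 : n * n + 2 * (K * b ^ (K - 1)) ≤ 6 * (K * x) := by nlinarith
    calc (2 * (C * T) + 7) * (n * n + 2 * (K * b ^ (K - 1)))
        ≤ ((2 * C + 7) * T) * (6 * (K * x)) := by gcongr
      _ = 1 * ((2 * C + 7) * T * (6 * (K * x))) := by ring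
      _ ≤ b * ((2 * C + 7) * T * (6 * (K * x))) := Nat.mul_le_mul_right _ (by omega)
      _ = _ := by ring

/-- Every quantity is a bounded number of sums and products of things polynomial in `Z`, so
collecting exponents suffices; `20` leaves generous room. -/
lemma Room.of_le {n b K T P ρ c d e C N Z Y₀ : ℕ} (hZ : 2 ≤ Z) (hn : n ≤ Z) (hT : T ≤ Z) (hP : P ≤ Z)
    (hQ : Q ≤ Z) (hρ : ρ ≤ Z) (hC : C ≤ Z) (hY : Y₀ ≤ Z) (hregs : ∀ q, (A.code q).RegsLe Y₀)
    (hb : 2 ≤ b) (he : 1 ≤ e) (hbe : b ^ K ≤ Z ^ e) (hN : N ≤ Z ^ d) :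
    Room A Q n b K T (ρ * T * K) (Z ^ c)
      (C * P + (C * T + 4) * (n * n + 2 * (K * b ^ (K - 1)))) N (Z ^ (2 * e + d + c + 20)) := by
  have h1 : ∀ {x}, x ≤ Z → x ≤ Z ^ 1 := fun h => by rwa [pow_one]
  have hmul : ∀ {x y i j}, x ≤ Z ^ i → y ≤ Z ^ j → x * y ≤ Z ^ (i + j) := fun hx hy => by
    rw [pow_add]; exact Nat.mul_le_mul hx hy
  have hfin : ∀ {x i}, x ≤ Z ^ i → i ≤ 2 * e + d + c + 20 → x ≤ Z ^ (2 * e + d + c + 20) :=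
    fun hx hi => hx.trans (Nat.pow_le_pow_right (by omega) hi)
  have hK : K ≤ Z ^ e := (Nat.lt_pow_self (by omega)).le.trans hbe
  have hb' : b ^ (K - 1) ≤ Z ^ e := (Nat.pow_le_pow_right (by omega) (Nat.sub_le _ _)).trans hbe
  have h2 : 2 ≤ Z ^ 1 := h1 hZ
  have h4 : 4 ≤ Z ^ (1 + 1) := hmul h2 h2
  have h8 : 8 ≤ Z ^ (1 + 1 + 1) := hmul h4 h2
  have hE : K * b ^ (K - 1) ≤ Z ^ (e + e) := hmul hK hb'
  refine ⟨hfin (add_le_pow hZ (by omega) (by omega) (hmul h8 hK) h8) (by omega),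
    hfin (hmul (h1 hn) (h1 hn)) (by omega), hfin (h1 hT) (by omega), hfin hE (by omega),
    hfin (hmul (hmul (h1 hρ) (h1 hT)) hK) (by omega), hfin hbe (by omega),
    hfin (add_le_pow hZ (by omega) (by omega) (hmul h2 hN) h2) (by omega), ?_,
    hfin (h1 hQ) (by omega),
    hfin (add_le_pow hZ (by omega) le_rfl (hmul h2 le_rfl) (h1 (by omega))) (by omega),
    fun q => (hregs q).mono (hfin (h1 hY) (by omega))⟩
  have hCT := add_le_pow hZ (by omega) (by omega) (hmul (h1 hC) (h1 hT)) h4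
  have hnn := add_le_pow hZ (by omega) (by omega) (hmul (h1 hn) (h1 hn)) (hmul h2 hE)
  exact hfin (add_le_pow hZ (by omega) (by omega) (add_le_pow hZ (by omega) (by omega)
    (hmul (h1 hC) (h1 hP)) (hmul hCT hnn)) h4) (by omega)

end

/-! ### Asymptotic estimates -/

/-- `n² = exp (2 log n) ≤ exp (2 c k) ≤ exp (4 c (k-1)) ≤ 3^(4 c (k-1))`, using `k ≤ 2 (k-1)` for `k
≥ 2`. -/
lemma sq_le_pow_of_log_le {n k c : ℕ} (hn : 1 ≤ n) (hk : 2 ≤ k) (h : Real.log n ≤ c * k) :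
    n * n ≤ (3 ^ (4 * c)) ^ (k - 1) := by
  have hn' : (0 : ℝ) < n := by exact_mod_cast hn
  have h1 : (k : ℝ) ≤ 2 * ((k - 1 : ℕ) : ℝ) := by
    have : k ≤ 2 * (k - 1) := by omega
    exact_mod_cast this
  have h2 : ((n * n : ℕ) : ℝ) ≤ (((3 ^ (4 * c)) ^ (k - 1) : ℕ) : ℝ) := by
    calc ((n * n : ℕ) : ℝ) = Real.exp (Real.log n + Real.log n) := by
          rw [Real.exp_add, Real.exp_log hn']; push_cast; ring
      _ ≤ Real.exp (((4 * c * (k - 1) : ℕ) : ℝ) * 1) := by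
          refine Real.exp_le_exp.2 ?_
          push_cast
          have : (c : ℝ) * k ≤ c * (2 * ((k - 1 : ℕ) : ℝ)) := by gcongr
          linarith
      _ ≤ 3 ^ (4 * c * (k - 1)) := by
          rw [Real.exp_nat_mul]
          gcongr
          exact Real.exp_one_lt_three.le
      _ = _ := by push_cast; rw [pow_mul]
  exact_mod_cast h2

/-- `b^k ≤ exp (b k) ≤ exp (b c log n)`: the epochs have polynomial length, so words of logarithmic
size suffice. -/
lemma pow_le_pow_of_le_log {n k c b : ℕ} (hn : 1 ≤ n) (h : (k : ℝ) ≤ c * Real.log n) :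
    b ^ k ≤ n ^ (b * c) := by
  have hn' : (0 : ℝ) < n := by exact_mod_cast hn
  have h2 : ((b ^ k : ℕ) : ℝ) ≤ ((n ^ (b * c) : ℕ) : ℝ) := by
    calc ((b ^ k : ℕ) : ℝ) ≤ Real.exp b ^ k := by
          push_cast
          gcongr
          linarith [Real.add_one_le_exp (b : ℝ)]
      _ = Real.exp (k * b) := by rw [Real.exp_nat_mul]
      _ ≤ Real.exp (((b * c : ℕ) : ℝ) * Real.log n) := by
          refine Real.exp_le_exp.2 ?_
          push_cast
          calc (k : ℝ) * b ≤ c * Real.log n * b := by gcongr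
            _ = _ := by ring
      _ = _ := by rw [Real.exp_nat_mul, Real.exp_log hn']; push_cast; rfl
  exact_mod_cast h2

lemma exists_log_bounds {k : ℕ → ℕ}
    (hk : (fun n : ℕ => (k n : ℝ)) =Θ[atTop] fun n : ℕ => Real.log n) :
    ∃ c : ℕ, 1 ≤ c ∧ ∀ᶠ n : ℕ in atTop,
      1 ≤ Real.log n ∧ (k n : ℝ) ≤ c * Real.log n ∧ Real.log n ≤ c * k n ∧ 2 ≤ k n := by
  obtain ⟨c₁, h₁⟩ := hk.1.bound
  obtain ⟨c₂, h₂⟩ := hk.2.bound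
  obtain ⟨c, hc⟩ := exists_nat_ge (max 1 (max c₁ c₂))
  have hc1 : (1 : ℝ) ≤ c := (le_max_left _ _).trans hc
  have hc2 : c₁ ≤ c := ((le_max_left _ _).trans (le_max_right _ _)).trans hc
  have hc3 : c₂ ≤ c := ((le_max_right _ _).trans (le_max_right _ _)).trans hc
  refine ⟨c, by exact_mod_cast hc1, ?_⟩
  have hlog := (Real.tendsto_log_atTop.comp tendsto_natCast_atTop_atTop).eventually_ge_atTop
    (2 * c : ℝ)
  filter_upwards [h₁, h₂, hlog] with n a1 a2 a3
  simp only [Function.comp_apply] at a3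
  have hL : 1 ≤ Real.log n := by linarith
  rw [Real.norm_natCast, Real.norm_of_nonneg (by linarith)] at a1 a2
  have a4 : Real.log n ≤ c * k n := a2.trans (by gcongr)
  refine ⟨hL, a1.trans (by gcongr), a4, ?_⟩
  have : (2 : ℝ) ≤ k n := by
    by_contra hlt
    rw [not_le] at hlt
    nlinarith
  exact_mod_cast this

/-- `K` slots with `O(T K)` work each give only the second power of the logarithm; the third one is
slack. -/
lemma update_time_le {L : ℝ} {K T ρ c x : ℕ} (hL : 1 ≤ L) (hK : (K : ℝ) ≤ c * L) (hT : 1 ≤ T) :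
    (((K + 1) * (K + ρ * T * K + 2) * x : ℕ) : ℝ) ≤
      (((c + 1) * (c + ρ * c + 2) * x : ℕ) : ℝ) * (T * L ^ 3) := by
  have hT' : (1 : ℝ) ≤ T := by exact_mod_cast hT
  have h0 : (0 : ℝ) ≤ c * L := by positivity
  have hTL : (1 : ℝ) ≤ T * L := by nlinarith
  have h1 : (K : ℝ) + 1 ≤ (c + 1) * L := by linarith
  have h2 : (K : ℝ) + ρ * T * K + 2 ≤ (c + ρ * c + 2) * (T * L) := by
    have a1 : (K : ℝ) ≤ c * (T * L) := by nlinarith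
    have a2 : (ρ : ℝ) * T * K ≤ ρ * T * (c * L) := by gcongr
    nlinarith
  push_cast
  calc ((K : ℝ) + 1) * (K + ρ * T * K + 2) * x
      ≤ ((c + 1) * L) * ((c + ρ * c + 2) * (T * L)) * x := by gcongr
    _ = ((c + 1) * (c + ρ * c + 2) * x) * (T * L ^ 2) := by ring
    _ ≤ ((c + 1) * (c + ρ * c + 2) * x) * (T * L ^ 3) := by
        gcongr
        norm_num

lemma preprocessing_time_le {L : ℝ} {K P C c x : ℕ} (hL : 1 ≤ L) (hK : (K : ℝ) ≤ c * L)
    (hP : 1 ≤ P) : ((3 + (K + 1) * ((C * P + 2) * x + 2000) : ℕ) : ℝ) ≤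
      ((3 + (c + 1) * ((C + 2) * x + 2000) : ℕ) : ℝ) * (P * L ^ 3) := by
  have hP' : (1 : ℝ) ≤ P := by exact_mod_cast hP
  have hPL : (1 : ℝ) ≤ P * L := by nlinarith
  have h1 : (K : ℝ) + 1 ≤ (c + 1) * L := by linarith
  have h2 : ((C : ℝ) * P + 2) * x + 2000 ≤ ((C + 2) * x + 2000) * P := by
    have : (0 : ℝ) ≤ x := Nat.cast_nonneg x
    nlinarith
  push_cast
  calc (3 : ℝ) + (K + 1) * ((C * P + 2) * x + 2000)
      ≤ 3 * (P * L) + ((c + 1) * L) * (((C + 2) * x + 2000) * P) := by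
        gcongr
        linarith
    _ = (3 + (c + 1) * ((C + 2) * x + 2000)) * (P * L ^ 1) := by ring
    _ ≤ (3 + (c + 1) * ((C + 2) * x + 2000)) * (P * L ^ 3) := by
        gcongr
        norm_num

/-! ### The failure probability -/

/-- A union bound over pairs of a slot and a time. It needs neither independence, since all slots
share one tape, nor measurability, since it holds for the outer measure. The lists of batches do not
depend on the tape, so the guarantee for fixed lists applies to each. -/
lemma measure_not_good_le {A A' : Program} {n k T P b K W W' : ℕ} {C U V α δ : ℝ} {p : ℝ≥0∞}
    {I : List (Update n)}
    (h : ∀ ω : ℕ → ℕ,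
      (∀ i < k, ∀ t ≤ I.length, A.GoodOnBatches ω W C n k T P α δ (batches b k I i t)) →
      A'.GoodWorstCase ω W' n k T K U V α δ I)
    (hp : ∀ i < k, ∀ t ≤ I.length, tapeLaw n {ω | ¬ A.GoodOnBatches (fun i => (ω i : ℕ)) W C n k T P
      α δ (batches b k I i t)} ≤ p) :
    tapeLaw n {ω | ¬ A'.GoodWorstCase (fun i => (ω i : ℕ)) W' n k T K U V α δ I} ≤
      k * (I.length + 1) * p := by
  have hsub : {ω : ℕ → RandomWord n | ¬ A'.GoodWorstCase (fun i => (ω i : ℕ)) W' n k T K U V α δ I} ⊆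
      ⋃ x ∈ Finset.range k ×ˢ Finset.range (I.length + 1),
        {ω | ¬ A.GoodOnBatches (fun i => (ω i : ℕ)) W C n k T P α δ (batches b k I x.1 x.2)} := by
    intro ω hω
    by_contra hno
    refine hω (h _ fun i hi t ht => ?_)
    by_contra hbad
    refine hno (Set.mem_iUnion₂.2 ⟨(i, t), ?_, hbad⟩)
    simp only [Finset.mem_product, Finset.mem_range]
    exact ⟨hi, by omega⟩
  refine (measure_mono hsub).trans ((measure_biUnion_finset_le _ _).trans ?_)
  refine (Finset.sum_le_card_nsmul _ _ p fun x hx => ?_).trans (le_of_eq ?_)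
  · simp only [Finset.mem_product, Finset.mem_range] at hx
    exact hp _ hx.1 _ (by omega)
  · rw [Finset.card_product, Finset.card_range, Finset.card_range, nsmul_eq_mul]
    push_cast
    rfl

end DynMatching

/-- Let `A` be an `(α, δ)`-approximate dynamic matching algorithm (`δ = 0` being the purely
multiplicative case) that is `Θ(log n)` batch-dynamic with update time `O(T(n))`. Then some `A'`
maintains `O(log n)` matchings, at all times one of them `(α, δ)`-approximate, with worst-case
update time `O(T(n) log³ n)`; and `A'` is deterministic if `A` is. -/
theorem mainTheorem4 (A : DynMatching.Program) (k T P : ℕ → ℕ) (α δ : ℕ → ℝ) (p : ℕ → ℝ≥0∞)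
    (hT : ∀ n, 1 ≤ T n) (hP : ∀ n, 1 ≤ P n)
    (hk : (fun n : ℕ => (k n : ℝ)) =Θ[atTop] fun n : ℕ => Real.log n)
    (hA : A.IsBatchDynamic k T P α δ p) :
    ∃ (A' : DynMatching.Program) (K : ℕ → ℕ) (c : ℝ≥0),
      ((fun n : ℕ => (K n : ℝ)) =O[atTop] fun n : ℕ => Real.log n) ∧
      A'.IsWorstCaseDynamic k T P K
        (fun n => (T n : ℝ) * Real.log n ^ 3) (fun n => (P n : ℝ) * Real.log n ^ 3) α δ
        (fun n N => c * ENNReal.ofReal (Real.log n) * (N + 1) * p n) ∧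
      (A.Deterministic → A'.Deterministic) := by
  obtain ⟨C₀, hA⟩ := hA
  obtain ⟨C, hC⟩ := exists_nat_ge C₀
  obtain ⟨c₁, hc₁, hlog⟩ := DynMatching.exists_log_bounds hk
  obtain ⟨Y₀, hY₀⟩ := A.exists_regsLe
  obtain ⟨Q, ⟨enc⟩⟩ := @Finite.exists_equiv_fin A.Loc A.finite_loc
  -- This base makes `b ^ (k n - 1)` at least `n²`, so that the top level has time to rebuild the
  -- graph.
  obtain ⟨b, hb⟩ : ∃ b, b = 3 ^ (4 * c₁) := ⟨_, rfl⟩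
  have hb2 : 2 ≤ b := hb ▸ (by norm_num : 2 ≤ 3 ^ 1).trans (Nat.pow_le_pow_right (by norm_num) (by omega))
  obtain ⟨ρ, hρ⟩ : ∃ ρ, ρ = 6 * b * (2 * C + 7) := ⟨_, rfl⟩
  have hone : (fun _ : ℕ => ((1 : ℕ) : ℝ)) =O[atTop] fun n : ℕ => Real.log n := by
    refine IsBigO.of_bound 1 (hlog.mono fun n hn => ?_)
    rw [Real.norm_of_nonneg (by linarith [hn.1] : 0 ≤ Real.log n)]
    simpa using hn.1
  -- One matching suffices, because the output is redirected to an up-to-date slot after every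
  -- update.
  refine ⟨DynMatching.simProgram enc b ρ, fun _ => 1, c₁, hone, ?_,
    DynMatching.simProgram_deterministic enc b ρ⟩
  obtain ⟨u, hu⟩ : ∃ u, u = (c₁ + 1) * (c₁ + ρ * c₁ + 2) *
      ((DynMatching.microStm enc).cost + 2000) := ⟨_, rfl⟩
  obtain ⟨v, hv⟩ : ∃ v, v = 3 + (c₁ + 1) *
      ((C + 2) * ((DynMatching.microStm enc).cost + 3) + 2000) := ⟨_, rfl⟩
  -- The constant of the time bounds, like the program, is fixed before `d`; only the word size may
  -- depend on `d`.
  refine ⟨((u + v : ℕ) : ℝ), fun d => ?_⟩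
  -- The sequences given to the slots have length up to `n² + n^d`, which is at most `n^(d+3)` for
  -- large `n`.
  obtain ⟨c, hc⟩ := hA (d + 3)
  obtain ⟨S, hS⟩ : ∃ S, S = (DynMatching.initStm enc b ρ).size +
      (DynMatching.updateStm enc b).size + 1 := ⟨_, rfl⟩
  obtain ⟨e, he⟩ : ∃ e, e = b * c₁ := ⟨_, rfl⟩
  refine ⟨(2 * e + d + c + 20 + 1) * S, ?_⟩
  -- For such `n` the fixed constants, among them the number of locations and the register numbers
  -- of the given program, are below `Z`.
  filter_upwards [hc, hlog, eventually_ge_atTop (2 + Q + ρ + C + Y₀)] with n hn hL hlarge I hI hlen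
  obtain ⟨hL1, hkL, hLk, hk2⟩ := hL
  have he1 : 1 ≤ e := he ▸ Nat.mul_pos (by omega) (by omega)
  have hk1 : 1 ≤ k n := by omega
  obtain ⟨Z, hZ⟩ : ∃ Z, Z = n + T n + P n + 2 := ⟨_, rfl⟩
  rw [← hZ] at hn ⊢
  have hbud := DynMatching.Budget.of_le (C := C) hb2 hk1 (hT n)
    (hb ▸ DynMatching.sq_le_pow_of_log_le (by omega) hk2 hLk) (Nat.le_add_left _ (C * P n))
  rw [← hρ] at hbud
  have hroom := DynMatching.Room.of_le (A := A) (Q := Q) (n := n) (T := T n) (P := P n) (ρ := ρ)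
    (c := c) (d := d) (C := C) (N := I.length) (Z := Z) (by omega) (by omega) (by omega) (by omega)
    (by omega) (by omega) (by omega) (by omega) hY₀ hb2 he1
    ((he ▸ DynMatching.pow_le_pow_of_le_log (by omega) hkL).trans (Nat.pow_le_pow_left (by omega) _))
    (hlen.trans (Nat.pow_le_pow_left (by omega) _))
  have hW : (Z ^ (2 * e + d + c + 20) + 2) ^ S ≤ Z ^ ((2 * e + d + c + 20 + 1) * S) := by
    rw [pow_mul]
    exact Nat.pow_le_pow_left (DynMatching.add_le_pow (by omega) (by omega) le_rfl le_rfl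
      (by rw [pow_one]; omega)) _
  have hbatch : ∀ i t, (DynMatching.batches b (k n) I i t).flatten.length ≤ n ^ (d + 3) := by
    intro i t
    refine (DynMatching.length_flatten_batches hb2 hk1 I t).trans ?_
    calc n * n + I.length ≤ n ^ (d + 2) + n ^ (d + 2) := by
          refine Nat.add_le_add ?_ (hlen.trans (Nat.pow_le_pow_right (by omega) (by omega)))
          rw [← sq]
          exact Nat.pow_le_pow_right (by omega) (by omega)
      _ = n ^ (d + 2) * 2 := by ring
      _ ≤ n ^ (d + 3) := by
          rw [pow_succ n (d + 2)]
          exact Nat.mul_le_mul_left _ (by omega)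
  have hT0 : (0 : ℝ) ≤ T n * Real.log n ^ 3 := by positivity
  have hP0 : (0 : ℝ) ≤ P n * Real.log n ^ 3 := by positivity
  refine (DynMatching.measure_not_good_le (A := A) (b := b) (P := P n) (C := C₀) (W := Z ^ c)
    (p := p n) (fun ω hω => DynMatching.goodWorstCase_simProgram hI hb2 hk2 hbud hC
      (Nat.le_add_right _ _) hroom (hS ▸ hW) hω ?_ ?_) fun i hi t ht => hn _ ?_
      (DynMatching.legalSeq_batches hb2 hk1 hI t) (hbatch i t)).trans ?_
  · refine (DynMatching.update_time_le hL1 hkL (hT n)).trans (mul_le_mul_of_nonneg_right ?_ hT0)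
    rw [← hu]
    exact_mod_cast Nat.le_add_right u v
  · refine (DynMatching.preprocessing_time_le hL1 hkL (hP n)).trans
      (mul_le_mul_of_nonneg_right ?_ hP0)
    rw [← hv]
    exact_mod_cast Nat.le_add_left v u
  · rw [DynMatching.batches_length]
    exact DynMatching.dvOf_lt hk1 t
  · gcongr
    rw [← ENNReal.ofReal_natCast (k n)]
    refine (ENNReal.ofReal_le_ofReal hkL).trans (le_of_eq ?_)
    rw [ENNReal.ofReal_mul (by positivity), ENNReal.ofReal_natCast]
    simp
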